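/- **Setting.** Let $\Gamma$ be a finite bipartite ribbon graph: a graph with $\circ$- and $\bullet$-vertices, every edge having one end of each type, with a (counterclockwise) cyclic order of the edges at each vertex. Let $L_\Gamma$ be the set of oriented loops on $\Gamma$ modulo free homotopy. For edges at a vertex $v$, oriented out of $v$, let $\delta_v$ be the skew-symmetric bilinear form on combinations $\sum n_i\vec E_i$, $\sum n_i=0$, with $\delta_v(\vec E_1-\vec E_0,\vec E_2-\vec E_0)=\tfrac12$ for distinct $E_0,E_1,E_2$ in counterclockwise order. A passage of a loop $\alpha$ through $v$, coming in along $E$ and going out along $E'$, defines $\alpha_v=\vec E'-\vec E$. The Goldman bracket of a ribbon graph is $\{\alpha,\beta\}_G=\sum\delta_v(\alpha_v,\beta_v)\,\alpha\circ_v\beta$, the sum over pairs of passages of $\alpha$ and of $\beta$ through the same vertex $v$, where $\alpha\circ_v\beta$ goes from $v$ around $\beta$ and then around $\alpha$. The bracket $\{\,,\}$ on $\mathbb Q[L_\Gamma]$ is the Goldman bracket of the conjugate graph $\Gamma^*$, which is $\Gamma$ with the cyclic orders at all $\bullet$-vertices reversed. It extends by the Leibniz rule to $\mathcal O_\Gamma=S^*(\mathbb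 Q[L_\Gamma])$. **Two by two move.** Suppose that $\Gamma$ contains the graph $\alpha$ with $\circ$-vertices $a,b,c,d$ and trivalent $\bullet$-vertices $p$ (joined to $a,b,d$, in the counterclockwise order $b,a,d$) and $q$ (joined to $b,c,d$, in the counterclockwise order $b,d,c$), where the edge $bq$ immediately follows $bp$ at $b$, and $dp$ immediately follows $dq$ at $d$. The move $\Gamma\to\Gamma'$ replaces $\alpha$ by the graph $\alpha'$ with the same $\circ$-vertices and trivalent $\bullet$-vertices $p'$ (joined to $a,b,c$, in the counterclockwise order $a,c,b$) and $q'$ (joined to $a,c,d$, in the counterclockwise order $a,d,c$): in the cyclic orders at the $\circ$-vertices, $ap$ is replaced by $aq',ap'$; $bp,bq$ by $bp'$; $cq$ by $cp',cq'$; and $dq,dp$ by $dq'$. Everything else is unchanged. Write $t_{b\bullet a}$ for the parallel transport of a flat line bundle from $a$ to $b$ through one $\bullet$-vertex of $\alpha$ ($p$ for $t_{b\bullet a},t_{a\bullet d}$, and $q$ for $t_{c\bullet b},t_{d\bullet c}$), similarly on $\alpha'$, and let $M_v$ be minus the counterclockwise monodromy around the square $p\,d\,q\,b$ of $\alpha$,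 starting at $v$. A flat line bundle on $\Gamma$ defines one on $\Gamma'$, with the same transports outside $\alpha'$ and $$t_{b'\bullet a'}=(1+M_b)\,t_{b\bullet a},\quad t_{c'\bullet b'}=t_{c\bullet b}(1+M_b^{-1})^{-1},\quad t_{d'\bullet c'}=(1+M_d)\,t_{d\bullet c},\quad t_{a'\bullet d'}=t_{a\bullet d}(1+M_d^{-1})^{-1}.$$ **Completions.** Let $w\in H^1(\Gamma,\mathbb Z)$ be a class with $w(\text{counterclockwise square loop})=m>0$. Let $w'\in H^1(\Gamma',\mathbb Z)$ be the corresponding class: it agrees with $w$ outside $\alpha'$ and on the arcs $b'\bullet a'$, $d'\bullet c'$, while $w'(c'\bullet b')=w(c\bullet b)+m$ and $w'(a'\bullet d')=w(a\bullet d)+m$. Let $\widehat L(\Gamma)$ be the space of formal sums, with coefficients in $\mathbb Q$, of loops on $\Gamma$ which have finitely many terms of weight $w\le N$ for every $N$; similarly let $\widehat{\mathcal O}(\Gamma)$ be the algebra of formal sums of monomials in loops with finitely many terms of total weight $\le N$ for every $N$. The brackets extend to them. Define $\widehat L(\Gamma'),\widehat{\mathcal O}(\Gamma')$ in the same way using $w'$.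 Expanding $(1+M)^{-1}=\sum_{n\ge0}(-M)^n$ and $(1+M^{-1})^{-1}=M(1+M)^{-1}$, the monodromy of the new line bundle along a loop $\gamma'$ on $\Gamma'$ becomes a formal sum of loops $\mu^*(\gamma')\in\widehat L(\Gamma)$. **Theorem.** The brackets make $\widehat L(\Gamma),\widehat L(\Gamma')$ Lie algebras and $\widehat{\mathcal O}(\Gamma),\widehat{\mathcal O}(\Gamma')$ Poisson algebras, and elements of $\widehat L(\Gamma)$ (respectively $\widehat L(\Gamma')$) with integral coefficients are closed under the bracket. There is an isomorphism of Lie algebras $$\mu_{\Gamma\to\Gamma'}:\widehat L(\Gamma)\longrightarrow\widehat L(\Gamma')$$ whose inverse sends every loop $\gamma'$ on $\Gamma'$ to $\mu^*(\gamma')$; in both directions it preserves the weight filtrations (so it is bicontinuous) and the integrality of coefficients. It extends to an isomorphism of Poisson algebras $\widehat{\mathcal O}(\Gamma)\to\widehat{\mathcal O}(\Gamma')$, which again preserves, in both directions, the weight filtrations and the integrality of coefficients. -/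

import Mathlib

noncomputable section

/-! ### Bipartite graphs, walks and free homotopy classes of loops -/

/-- A bipartite graph with `∘`-vertices `W`, `•`-vertices `B` and edges `E` (multiple edges are
allowed); every edge has one end of each colour. -/
structure BipartiteGraph (W B E : Type*) where
  white : E → W
  black : E → B

/-- An oriented edge: `(e, true)` runs from the `∘`-end of `e` to its `•`-end, `(e, false)` runs
from the `•`-end to the `∘`-end. -/
abbrev Dart (E : Type*) := E × Bool

/-- The same edge with the opposite orientation. -/
def Dart.rev {E : Type*} (d : Dart E) : Dart E := (d.1, !d.2)

namespace BipartiteGraph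

variable {W B E : Type*} (G : BipartiteGraph W B E)

/-- The vertex at which an oriented edge starts. -/
def src (d : Dart E) : W ⊕ B :=
  if d.2 then Sum.inl (G.white d.1) else Sum.inr (G.black d.1)

/-- The vertex at which an oriented edge ends. -/
def tgt (d : Dart E) : W ⊕ B := G.src d.rev

/-- `G.IsWalk u v l`: the consecutive oriented edges in `l` form a path from `u` to `v`. -/
def IsWalk : W ⊕ B → W ⊕ B → List (Dart E) → Prop
  | u, v, [] => u = v
  | u, v, d :: l => G.src d = u ∧ IsWalk (G.tgt d) v l

/-- A non-empty list of oriented edges which is a closed path. (A constant loop is represented by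
running along an edge and back.) -/
def IsClosedWalk (l : List (Dart E)) : Prop := l ≠ [] ∧ ∃ v, G.IsWalk v v l

/-- Combinatorial oriented loops with a starting point. -/
def ClosedWalk := {l : List (Dart E) // G.IsClosedWalk l}

/-- Elementary free homotopies: moving the starting point along the loop, and inserting a piece that
runs along an edge and immediately back. -/
inductive ElemHomotopy : G.ClosedWalk → G.ClosedWalk → Prop
  | rotate (l₁ l₂ : List (Dart E)) (h : G.IsClosedWalk (l₁ ++ l₂)) (h' : G.IsClosedWalk (l₂ ++ l₁)) :
      ElemHomotopy ⟨l₁ ++ l₂, h⟩ ⟨l₂ ++ l₁, h'⟩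
  | spike (l : List (Dart E)) (d : Dart E) (h : G.IsClosedWalk l)
      (h' : G.IsClosedWalk (l ++ [d, d.rev])) : ElemHomotopy ⟨l, h⟩ ⟨l ++ [d, d.rev], h'⟩

/-- The set of oriented loops on the graph modulo (free) homotopy: the quotient by the equivalence
relation generated by the elementary homotopies. -/
def Loops := Quot G.ElemHomotopy

variable {G}

/-- The homotopy class of a closed walk. -/
def ClosedWalk.toLoop (γ : G.ClosedWalk) : G.Loops := Quot.mk _ γ

variable (G)

open Classical in
/-- The generator of `ℚ[Loops]` given by a list of oriented edges, if it is a closed walk; zero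
if the list does not close up. -/
def loopTerm (l : List (Dart E)) : G.Loops →₀ ℚ :=
  if h : G.IsClosedWalk l then Finsupp.single (ClosedWalk.toLoop ⟨l, h⟩) 1 else 0

variable {G}

theorem src_rev (d : Dart E) : G.src d.rev = G.tgt d := rfl

theorem rev_rev (d : Dart E) : d.rev.rev = d := by
  cases d; simp [Dart.rev]

theorem tgt_rev (d : Dart E) : G.tgt d.rev = G.src d := by
  simp [tgt, rev_rev]

theorem isWalk_append {u v : W ⊕ B} {l₁ l₂ : List (Dart E)} :
    G.IsWalk u v (l₁ ++ l₂) ↔ ∃ x, G.IsWalk u x l₁ ∧ G.IsWalk x v l₂ := by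
  induction l₁ generalizing u with
  | nil => simp [IsWalk]
  | cons d l ih =>
    simp only [List.cons_append, IsWalk, ih]
    constructor
    · rintro ⟨h, x, h1, h2⟩; exact ⟨x, ⟨h, h1⟩, h2⟩
    · rintro ⟨x, ⟨h, h1⟩, h2⟩; exact ⟨h, x, h1, h2⟩

theorem isWalk_spike {u v : W ⊕ B} {d : Dart E} :
    G.IsWalk u v [d, d.rev] ↔ G.src d = u ∧ u = v := by
  simp only [IsWalk, src_rev, tgt_rev, true_and]
  constructor
  · rintro ⟨rfl, h⟩; exact ⟨rfl, h⟩
  · rintro ⟨rfl, h⟩; exact ⟨rfl, h⟩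

theorem IsWalk.start_unique {u u' v v' : W ⊕ B} {l : List (Dart E)} (hl : l ≠ [])
    (h : G.IsWalk u v l) (h' : G.IsWalk u' v' l) : u = u' := by
  cases l with
  | nil => exact absurd rfl hl
  | cons d l => exact h.1.symm.trans h'.1

theorem IsWalk.end_unique {u v v' : W ⊕ B} {l : List (Dart E)}
    (h : G.IsWalk u v l) (h' : G.IsWalk u v' l) : v = v' := by
  induction l generalizing u with
  | nil => exact Eq.trans (Eq.symm h) h'
  | cons d l ih => exact ih h.2 h'.2

theorem IsClosedWalk.comm {l₁ l₂ : List (Dart E)} (h : G.IsClosedWalk (l₁ ++ l₂)) :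
    G.IsClosedWalk (l₂ ++ l₁) := by
  obtain ⟨hne, v, hv⟩ := h
  obtain ⟨x, h1, h2⟩ := isWalk_append.1 hv
  refine ⟨?_, x, isWalk_append.2 ⟨v, h2, h1⟩⟩
  simp only [ne_eq, List.append_eq_nil_iff, not_and] at hne ⊢
  exact fun a b => hne b a

theorem loopTerm_comm (l₁ l₂ : List (Dart E)) :
    G.loopTerm (l₁ ++ l₂) = G.loopTerm (l₂ ++ l₁) := by
  unfold loopTerm
  by_cases h : G.IsClosedWalk (l₁ ++ l₂)
  · rw [dif_pos h, dif_pos h.comm]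
    congr 1
    exact Quot.sound (ElemHomotopy.rotate _ _ h h.comm)
  · rw [dif_neg h, dif_neg (fun h' => h h'.comm)]

theorem isClosedWalk_append {u v : W ⊕ B} {r s : List (Dart E)} (hs : s ≠ []) (hr : r ≠ [])
    (hus : G.IsWalk u u s) (hvr : G.IsWalk v v r) : G.IsClosedWalk (s ++ r) ↔ u = v := by
  constructor
  · rintro ⟨-, z, hz⟩
    obtain ⟨x, h1, h2⟩ := isWalk_append.1 hz
    have e1 := IsWalk.start_unique hs hus h1
    have e2 := IsWalk.start_unique hr hvr h2
    subst e1; subst e2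
    exact IsWalk.end_unique hus h1
  · rintro rfl
    exact ⟨by simp [hs], u, isWalk_append.2 ⟨u, hus, hvr⟩⟩

/-- Removing a spike from a closed walk does not change its class. -/
theorem loopTerm_spike (a b : List (Dart E)) (d : Dart E) (hab : G.IsClosedWalk (b ++ a))
    (h : G.IsClosedWalk (a ++ [d, d.rev] ++ b)) :
    G.loopTerm (a ++ [d, d.rev] ++ b) = G.loopTerm (a ++ b) := by
  rw [loopTerm_comm (a ++ [d, d.rev]) b, loopTerm_comm a b, ← List.append_assoc]
  have h' : G.IsClosedWalk ((b ++ a) ++ [d, d.rev]) := by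
    have := h.comm
    rwa [← List.append_assoc] at this
  unfold loopTerm
  rw [dif_pos h', dif_pos hab]
  congr 1
  exact (Quot.sound (ElemHomotopy.spike _ d hab h')).symm

end BipartiteGraph

/-! ### Ribbon graphs and the local pairing at a vertex -/

/-- A bipartite ribbon graph. The permutation `rotW` (resp. `rotB`) sends an edge to the next edge,
in the counterclockwise order, at its `∘`-end (resp. `•`-end); so its cycles are exactly the sets
of edges at a `∘`-vertex (resp. `•`-vertex), with their cyclic orders. -/
structure BipartiteRibbonGraph (W B E : Type*) extends BipartiteGraph W B E where
  rotW : Equiv.Perm E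
  rotB : Equiv.Perm E
  sameCycle_rotW : ∀ e f, rotW.SameCycle e f ↔ white e = white f
  sameCycle_rotB : ∀ e f, rotB.SameCycle e f ↔ black e = black f

/-- The conjugate ribbon graph: the same graph, with the cyclic orders at all `•`-vertices
reversed. -/
def BipartiteRibbonGraph.conj {W B E : Type*} (Γ : BipartiteRibbonGraph W B E) :
    BipartiteRibbonGraph W B E where
  toBipartiteGraph := Γ.toBipartiteGraph
  rotW := Γ.rotW
  rotB := Γ.rotB⁻¹
  sameCycle_rotW := Γ.sameCycle_rotW
  sameCycle_rotB e f := by rw [Equiv.Perm.sameCycle_inv]; exact Γ.sameCycle_rotB e f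

section CyclicOrder

variable {E : Type*}

/-- The number of steps which `σ` needs to move `e` to `f`. -/
def rotSteps (σ : Equiv.Perm E) (e f : E) : ℕ := sInf {k | (σ ^ k) e = f}

open Classical in
/-- For `e, f, g` in the same cycle of `σ`: `1` if they are distinct and met in this cyclic order,
`-1` if they are distinct and met in the opposite cyclic order, `0` if two of them coincide. -/
def cyclicSign (σ : Equiv.Perm E) (e f g : E) : ℤ :=
  if e = f ∨ f = g ∨ e = g then 0 else if rotSteps σ e f < rotSteps σ e g then 1 else -1

/-- The skew-symmetric bilinear form `δ_v` at a vertex, evaluated at `E₂ - E₁` and `F₂ - F₁`, where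
`E₁, E₂, F₁, F₂` are edges at the vertex, oriented out of it. It is determined by bilinearity,
skew-symmetry and `δ_v(E₁ - E₀, E₂ - E₀) = 1/2` for distinct `E₀, E₁, E₂` in counterclockwise
order. -/
def vertexForm (σ : Equiv.Perm E) (e₁ e₂ f₁ f₂ : E) : ℚ :=
  ((cyclicSign σ e₁ e₂ f₂ - cyclicSign σ e₁ e₂ f₁ : ℤ) : ℚ) / 2

theorem exists_index [Finite E] (σ : Equiv.Perm E) (x : E) : ∃ N : ℕ, 0 < N ∧
    ∀ e, σ.SameCycle x e → ∃ i < N, (σ ^ i) x = e ∧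
      ∀ f j, j < N → (σ ^ j) x = f →
        rotSteps σ e f = if i ≤ j then j - i else j + N - i := by
  have hper : ∀ y, y ∈ Function.periodicPts σ := fun y => by
    have h := isOfFinOrder_of_finite σ
    refine ⟨orderOf σ, h.orderOf_pos, ?_⟩
    rw [Function.IsPeriodicPt, Function.IsFixedPt, Equiv.Perm.iterate_eq_pow, pow_orderOf_eq_one]
    rfl
  set N := Function.minimalPeriod σ x with hN
  have hNpos : 0 < N := Function.minimalPeriod_pos_of_mem_periodicPts (hper x)
  have hpN : ∀ s, (σ ^ (s + N)) x = (σ ^ s) x := fun s => by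
    rw [← Equiv.Perm.iterate_eq_pow, ← Equiv.Perm.iterate_eq_pow]
    exact Function.iterate_add_minimalPeriod_eq
  have hmod : ∀ s, (σ ^ (s % N)) x = (σ ^ s) x := fun s => by
    rw [← Equiv.Perm.iterate_eq_pow, ← Equiv.Perm.iterate_eq_pow]
    exact Function.iterate_mod_minimalPeriod_eq
  have hinj : ∀ s t, s < N → t < N → (σ ^ s) x = (σ ^ t) x → s = t := fun s t hs ht h => by
    rw [← Equiv.Perm.iterate_eq_pow, ← Equiv.Perm.iterate_eq_pow] at h
    exact (Function.iterate_eq_iterate_iff_of_lt_minimalPeriod hs ht).1 h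
  refine ⟨N, hNpos, fun e he => ?_⟩
  obtain ⟨i0, hi0⟩ := he.exists_nat_pow_eq
  refine ⟨i0 % N, Nat.mod_lt _ hNpos, by rw [hmod, hi0], ?_⟩
  have hiN : i0 % N < N := Nat.mod_lt _ hNpos
  have hie : (σ ^ (i0 % N)) x = e := by rw [hmod, hi0]
  generalize i0 % N = i at hiN hie
  intro f j hj hjf
  have hadd : ∀ k, (σ ^ k) e = (σ ^ (k + i)) x := fun k => by
    rw [pow_add, Equiv.Perm.mul_apply, hie]
  have key : ∀ k, k < N → (σ ^ k) e = f → k = if i ≤ j then j - i else j + N - i := by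
    intro k hk h
    rw [hadd, ← hjf] at h
    by_cases hki : k + i < N
    · have := hinj _ _ hki hj h
      split_ifs <;> omega
    · have h2 : (σ ^ (k + i - N)) x = (σ ^ j) x := by
        rw [← hpN (k + i - N), ← h]; congr 2; omega
      have := hinj _ _ (by omega) hj h2
      split_ifs <;> omega
  have hmem : (if i ≤ j then j - i else j + N - i) ∈ {k | (σ ^ k) e = f} := by
    simp only [Set.mem_ofPred_eq, hadd]
    split_ifs with h
    · rw [Nat.sub_add_cancel h, hjf]
    · rw [Nat.sub_add_cancel (by omega), hpN, hjf]
  have hle : rotSteps σ e f ≤ _ := Nat.sInf_le hmem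
  have hin : rotSteps σ e f ∈ {k | (σ ^ k) e = f} := Nat.sInf_mem ⟨_, hmem⟩
  refine key _ (lt_of_le_of_lt hle ?_) hin
  split_ifs <;> omega

/-- The sign of a triple is expressed through the positions in the cycle. -/
theorem exists_position [Finite E] (σ : Equiv.Perm E) (x : E) : ∃ p : E → ℤ,
    ∀ e f g, σ.SameCycle x e → σ.SameCycle x f → σ.SameCycle x g →
      cyclicSign σ e f g =
        if p e = p f ∨ p f = p g ∨ p e = p g then 0
        else if (p e < p f ∧ p f < p g) ∨ (p f < p g ∧ p g < p e) ∨ (p g < p e ∧ p e < p f)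
          then 1 else -1 := by
  classical
  obtain ⟨N, hN, h⟩ := exists_index σ x
  choose! i hi using h
  refine ⟨fun e => (i e : ℤ), fun e f g he hf hg => ?_⟩
  have heq : ∀ e f, σ.SameCycle x e → σ.SameCycle x f → (e = f ↔ (i e : ℤ) = i f) := by
    intro e f he hf
    refine ⟨fun h => by rw [h], fun h => ?_⟩
    rw [← (hi e he).2.1, ← (hi f hf).2.1, Nat.cast_injective h]
  have s1 := (hi e he).2.2 f (i f) (hi f hf).1 (hi f hf).2.1
  have s2 := (hi e he).2.2 g (i g) (hi g hg).1 (hi g hg).2.1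
  have b1 := (hi e he).1
  have b2 := (hi f hf).1
  have b3 := (hi g hg).1
  unfold cyclicSign
  rw [heq e f he hf, heq f g hf hg, heq e g he hg, s1, s2]
  dsimp only
  split_ifs <;> first | rfl | (exfalso; omega)

theorem cyclicSign_cocycle [Finite E] (σ : Equiv.Perm E) {e f g h : E} (hf : σ.SameCycle e f)
    (hg : σ.SameCycle e g) (hh : σ.SameCycle e h) :
    cyclicSign σ e f h + cyclicSign σ f g h = cyclicSign σ e g h + cyclicSign σ e f g := by
  obtain ⟨p, hp⟩ := exists_position σ e
  have he : σ.SameCycle e e := Equiv.Perm.SameCycle.refl _ _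
  rw [hp e f h he hf hh, hp f g h hf hg hh, hp e g h he hg hh, hp e f g he hf hg]
  split_ifs <;> omega

theorem cyclicSign_rotate [Finite E] (σ : Equiv.Perm E) {e f g : E} (hf : σ.SameCycle e f)
    (hg : σ.SameCycle e g) : cyclicSign σ f g e = cyclicSign σ e f g := by
  obtain ⟨p, hp⟩ := exists_position σ e
  have he : σ.SameCycle e e := Equiv.Perm.SameCycle.refl _ _
  rw [hp f g e hf hg he, hp e f g he hf hg]
  split_ifs <;> omega

theorem vertexForm_eq_half (σ : Equiv.Perm E) (e₀ e₁ e₂ : E) (h : cyclicSign σ e₀ e₁ e₂ = 1) :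
    vertexForm σ e₀ e₁ e₀ e₂ = 1 / 2 := by
  have : cyclicSign σ e₀ e₁ e₀ = 0 := by simp [cyclicSign]
  simp [vertexForm, h, this]

theorem vertexForm_self (σ : Equiv.Perm E) (e f₁ f₂ : E) : vertexForm σ e e f₁ f₂ = 0 := by
  simp [vertexForm, cyclicSign]

theorem vertexForm_add [Finite E] (σ : Equiv.Perm E) {e₁ e₂ e₃ f₁ f₂ : E}
    (h2 : σ.SameCycle e₁ e₂) (h3 : σ.SameCycle e₁ e₃) (h4 : σ.SameCycle e₁ f₁)
    (h5 : σ.SameCycle e₁ f₂) :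
    vertexForm σ e₁ e₂ f₁ f₂ + vertexForm σ e₂ e₃ f₁ f₂ = vertexForm σ e₁ e₃ f₁ f₂ := by
  have a := cyclicSign_cocycle σ h2 h3 h4
  have b := cyclicSign_cocycle σ h2 h3 h5
  unfold vertexForm
  rw [← add_div, ← Int.cast_add]
  congr 2
  omega

theorem vertexForm_skew [Finite E] (σ : Equiv.Perm E) {e₁ e₂ f₁ f₂ : E}
    (h2 : σ.SameCycle e₁ e₂) (h4 : σ.SameCycle e₁ f₁) (h5 : σ.SameCycle e₁ f₂) :
    vertexForm σ f₁ f₂ e₁ e₂ = - vertexForm σ e₁ e₂ f₁ f₂ := by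
  have a := cyclicSign_cocycle σ h2 h4 h5
  have b := cyclicSign_rotate σ h4 h5
  have c := cyclicSign_rotate σ (e := e₂) (h2.symm.trans h4) (h2.symm.trans h5)
  unfold vertexForm
  rw [← neg_div, ← Int.cast_neg]
  congr 2
  omega

end CyclicOrder

/-! ### The Goldman bracket of a ribbon graph -/

namespace BipartiteRibbonGraph

variable {W B E : Type*} (Γ : BipartiteRibbonGraph W B E)

/-- The homotopy classes of loops (they do not depend on the ribbon structure). -/
abbrev L := Γ.toBipartiteGraph.Loops

/-- The rotation at the vertex where `d` starts. -/
def rotAt (d : Dart E) : Equiv.Perm E := if d.2 then Γ.rotW else Γ.rotB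

/-- `δ_v` of the passages of two closed walks through their common starting vertex `v`: a closed walk
that comes in along `E₁` and goes out along `E₂` has passage `E₂ - E₁`. -/
def passageForm (r s : List (Dart E)) : ℚ :=
  match r.getLast?, r.head?, s.getLast?, s.head? with
  | some x, some y, some z, some t => vertexForm (Γ.rotAt y) x.1 y.1 z.1 t.1
  | _, _, _, _ => 0

/-- The contribution to the bracket of two closed walks with chosen starting points: it is nonzero
only if `s ++ r`, that is `s` followed by `r`, is a closed walk, i.e. if the starting points map to the
same vertex. -/
def bracketTerm (r s : List (Dart E)) : Γ.L →₀ ℚ :=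
  Γ.passageForm r s • Γ.toBipartiteGraph.loopTerm (s ++ r)

/-- The bracket of two closed walks: the sum over all pairs consisting of a vertex of the first and a
vertex of the second one. -/
def walkBracket (x y : List (Dart E)) : Γ.L →₀ ℚ :=
  ∑ i ∈ Finset.range x.length, ∑ j ∈ Finset.range y.length,
    Γ.bracketTerm (x.rotate i) (y.rotate j)

variable {Γ}

open BipartiteGraph

theorem sum_rotate {M : Type*} [AddCommGroup M] (F : List (Dart E) → M) (l : List (Dart E)) (k : ℕ) :
    ∑ i ∈ Finset.range (l.rotate k).length, F ((l.rotate k).rotate i) =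
      ∑ i ∈ Finset.range l.length, F (l.rotate i) := by
  induction k with
  | zero => simp
  | succ k ih =>
    rw [← ih]
    have h : l.rotate (k + 1) = (l.rotate k).rotate 1 := by rw [List.rotate_rotate]
    rw [h]
    generalize l.rotate k = m
    simp only [List.rotate_rotate, List.length_rotate]
    have := (Finset.sum_range_succ' (fun i => F (m.rotate i)) m.length).symm.trans
      (Finset.sum_range_succ (fun i => F (m.rotate i)) m.length)
    rw [List.rotate_length, List.rotate_zero] at this
    simpa [add_comm 1] using add_right_cancel this

theorem walkBracket_rotate (l₁ l₂ y : List (Dart E)) :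
    Γ.walkBracket (l₁ ++ l₂) y = Γ.walkBracket (l₂ ++ l₁) y := by
  rw [← List.rotate_append_length_eq l₁ l₂]
  exact (sum_rotate (fun r => ∑ j ∈ Finset.range y.length, Γ.bracketTerm r (y.rotate j)) _ _).symm

theorem isClosedWalk_rotate {l : List (Dart E)} (h : Γ.toBipartiteGraph.IsClosedWalk l) (i : ℕ) :
    Γ.toBipartiteGraph.IsClosedWalk (l.rotate i) := by
  rw [← List.rotate_mod]
  rcases Nat.lt_or_ge (i % l.length) l.length with h1 | h1
  · rw [List.rotate_eq_drop_append_take h1.le]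
    apply IsClosedWalk.comm
    rwa [List.take_append_drop]
  · have := Nat.mod_lt i (List.length_pos_of_ne_nil h.1)
    omega

/-- Edges with a common end are in the same cycle of the rotation. -/
theorem sameCycle_of_src {d d' : Dart E}
    (h : Γ.toBipartiteGraph.src d = Γ.toBipartiteGraph.src d') :
    Γ.rotAt d = Γ.rotAt d' ∧ (Γ.rotAt d).SameCycle d.1 d'.1 := by
  obtain ⟨e, b⟩ := d
  obtain ⟨e', b'⟩ := d'
  cases b <;> cases b' <;> simp [BipartiteGraph.src, rotAt] at h ⊢
  · exact (Γ.sameCycle_rotB _ _).2 h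
  · exact (Γ.sameCycle_rotW _ _).2 h

theorem closedWalk_ends {v : W ⊕ B} {l : List (Dart E)} (hl : l ≠ [])
    (h : Γ.toBipartiteGraph.IsWalk v v l) :
    ∃ x y, l.getLast? = some x ∧ l.head? = some y ∧ Γ.toBipartiteGraph.src y = v ∧
      Γ.toBipartiteGraph.src x.rev = v := by
  refine ⟨l.getLast hl, l.head hl, List.getLast?_eq_some_getLast hl, List.head?_eq_some_head hl,
    ?_, ?_⟩
  · cases l with
    | nil => exact absurd rfl hl
    | cons d l => exact h.1
  · rw [← List.dropLast_append_getLast hl] at h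
    obtain ⟨x, -, h2⟩ := isWalk_append.1 h
    exact h2.2

/-- `δ_v` is computed by one permutation for the edges at one vertex. -/
theorem exists_rot (v : W ⊕ B) : ∃ σ : Equiv.Perm E,
    (∀ d : Dart E, Γ.toBipartiteGraph.src d = v → Γ.rotAt d = σ) ∧
    ∀ d d' : Dart E, Γ.toBipartiteGraph.src d = v → Γ.toBipartiteGraph.src d' = v →
      σ.SameCycle d.1 d'.1 := by
  by_cases h : ∃ d : Dart E, Γ.toBipartiteGraph.src d = v
  · obtain ⟨d, hd⟩ := h
    refine ⟨Γ.rotAt d, fun d' hd' => (sameCycle_of_src (hd'.trans hd.symm)).1, ?_⟩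
    intro d1 d2 h1 h2
    rw [(sameCycle_of_src (hd.trans h1.symm)).1]
    exact (sameCycle_of_src (h1.trans h2.symm)).2
  · push Not at h
    exact ⟨1, fun d hd => absurd hd (h d), fun d _ hd => absurd hd (h d)⟩

theorem bracketTerm_skew [Finite E] {r s : List (Dart E)}
    (hr : Γ.toBipartiteGraph.IsClosedWalk r) (hs : Γ.toBipartiteGraph.IsClosedWalk s) :
    Γ.bracketTerm s r = - Γ.bracketTerm r s := by
  unfold bracketTerm
  rw [loopTerm_comm s r]
  obtain ⟨hr0, u, hu⟩ := hr
  obtain ⟨hs0, v, hv⟩ := hs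
  by_cases huv : u = v
  · subst huv
    obtain ⟨x, y, h1, h2, h3, h4⟩ := closedWalk_ends hr0 hu
    obtain ⟨z, t, k1, k2, k3, k4⟩ := closedWalk_ends hs0 hv
    obtain ⟨σ, hσ, hc⟩ := exists_rot (Γ := Γ) u
    have : Γ.passageForm s r = - Γ.passageForm r s := by
      simp only [passageForm, h1, h2, k1, k2, hσ _ h3, hσ _ k3]
      exact vertexForm_skew σ (hc x.rev y h4 h3) (hc x.rev z.rev h4 k4) (hc x.rev t h4 k3)
    rw [this, neg_smul]
  · have : ¬ Γ.toBipartiteGraph.IsClosedWalk (r ++ s) := by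
      rw [isClosedWalk_append hr0 hs0 hu hv]; exact huv
    simp [loopTerm, this]

theorem walkBracket_skew [Finite E] {x y : List (Dart E)}
    (hx : Γ.toBipartiteGraph.IsClosedWalk x) (hy : Γ.toBipartiteGraph.IsClosedWalk y) :
    Γ.walkBracket y x = - Γ.walkBracket x y := by
  unfold walkBracket
  rw [Finset.sum_comm, ← Finset.sum_neg_distrib]
  refine Finset.sum_congr rfl fun i _ => ?_
  rw [← Finset.sum_neg_distrib]
  exact Finset.sum_congr rfl fun j _ =>
    bracketTerm_skew (isClosedWalk_rotate hx i) (isClosedWalk_rotate hy j)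

theorem bracketTerm_eq_zero {u v : W ⊕ B} {r s : List (Dart E)} (hr : r ≠ []) (hs : s ≠ [])
    (hu : Γ.toBipartiteGraph.IsWalk u u s) (hv : Γ.toBipartiteGraph.IsWalk v v r) (h : u ≠ v) :
    Γ.bracketTerm r s = 0 := by
  have : ¬ Γ.toBipartiteGraph.IsClosedWalk (s ++ r) := by
    rw [isClosedWalk_append hs hr hu hv]; exact h
  simp [bracketTerm, loopTerm, this]

/-- A spike in the interior of the first walk does not change its contribution. -/
theorem bracketTerm_spike_mid {a b s : List (Dart E)} {d : Dart E} (ha : a ≠ []) (hb : b ≠ [])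
    (h : Γ.toBipartiteGraph.IsClosedWalk (a ++ [d, d.rev] ++ b))
    (hs : Γ.toBipartiteGraph.IsClosedWalk s) :
    Γ.bracketTerm (a ++ [d, d.rev] ++ b) s = Γ.bracketTerm (a ++ b) s := by
  obtain ⟨h0, v, hv⟩ := h
  obtain ⟨hs0, u, hu⟩ := hs
  have hv' : Γ.toBipartiteGraph.IsWalk v v (a ++ b) := by
    obtain ⟨x, h1, h2⟩ := isWalk_append.1 hv
    obtain ⟨y, h3, h4⟩ := isWalk_append.1 h1
    obtain ⟨-, rfl⟩ := isWalk_spike.1 h4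
    exact isWalk_append.2 ⟨_, h3, h2⟩
  have hab : a ++ b ≠ [] := by simp [ha]
  by_cases huv : u = v
  · subst huv
    have hp : Γ.passageForm (a ++ [d, d.rev] ++ b) s = Γ.passageForm (a ++ b) s := by
      have e1 : (a ++ [d, d.rev] ++ b).getLast? = (a ++ b).getLast? := by
        rw [List.getLast?_append_of_ne_nil _ hb, List.getLast?_append_of_ne_nil _ hb]
      have e2 : (a ++ [d, d.rev] ++ b).head? = (a ++ b).head? := by
        rw [List.append_assoc, List.head?_append_of_ne_nil _ ha, List.head?_append_of_ne_nil _ ha]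
      simp only [passageForm, e1, e2]
    unfold bracketTerm
    rw [hp]
    congr 1
    have := loopTerm_spike (G := Γ.toBipartiteGraph) (s ++ a) b d
      (by
        have : Γ.toBipartiteGraph.IsClosedWalk (s ++ (a ++ b)) :=
          (isClosedWalk_append hs0 hab hu hv').2 rfl
        rw [← List.append_assoc] at this
        exact this.comm)
      (by
        have : Γ.toBipartiteGraph.IsClosedWalk (s ++ (a ++ [d, d.rev] ++ b)) :=
          (isClosedWalk_append hs0 h0 hu hv).2 rfl
        simpa using this)
    simpa using this
  · rw [bracketTerm_eq_zero h0 hs0 hu hv huv, bracketTerm_eq_zero hab hs0 hu hv' huv]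

/-- The two contributions of the vertex at which a spike is attached add up to the contribution
without the spike. -/
theorem bracketTerm_spike_ends [Finite E] {l s : List (Dart E)} {d : Dart E} (hl : l ≠ [])
    (h : Γ.toBipartiteGraph.IsClosedWalk (l ++ [d, d.rev]))
    (hs : Γ.toBipartiteGraph.IsClosedWalk s) :
    Γ.bracketTerm (l ++ [d, d.rev]) s + Γ.bracketTerm ([d, d.rev] ++ l) s =
      Γ.bracketTerm l s := by
  obtain ⟨h0, v, hv⟩ := h
  obtain ⟨hs0, u, hu⟩ := hs
  obtain ⟨y, h3, h4⟩ := isWalk_append.1 hv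
  obtain ⟨hd, rfl⟩ := isWalk_spike.1 h4
  have h4' : Γ.toBipartiteGraph.IsWalk y y ([d, d.rev] ++ l) := isWalk_append.2 ⟨y, h4, h3⟩
  have h0' : [d, d.rev] ++ l ≠ [] := by simp
  by_cases huv : u = y
  · subst huv
    obtain ⟨x, t, k1, k2, k3, k4⟩ := closedWalk_ends hl h3
    obtain ⟨z, t', m1, m2, m3, m4⟩ := closedWalk_ends hs0 hu
    obtain ⟨σ, hσ, hc⟩ := exists_rot (Γ := Γ) u
    have c1 : Γ.toBipartiteGraph.loopTerm (s ++ (l ++ [d, d.rev])) = Γ.toBipartiteGraph.loopTerm (s ++ l) := by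
      have := loopTerm_spike (G := Γ.toBipartiteGraph) (s ++ l) [] d
        (by simpa using (isClosedWalk_append hs0 hl hu h3).2 rfl)
        (by simpa using (isClosedWalk_append hs0 h0 hu hv).2 rfl)
      simpa using this
    have c2 : Γ.toBipartiteGraph.loopTerm (s ++ ([d, d.rev] ++ l)) = Γ.toBipartiteGraph.loopTerm (s ++ l) := by
      have := loopTerm_spike (G := Γ.toBipartiteGraph) s l d
        ((isClosedWalk_append hl hs0 h3 hu).2 rfl)
        (by simpa using (isClosedWalk_append hs0 h0' hu h4').2 rfl)
      simpa using this
    have p : Γ.passageForm (l ++ [d, d.rev]) s + Γ.passageForm ([d, d.rev] ++ l) s =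
        Γ.passageForm l s := by
      have e1 : (l ++ [d, d.rev]).getLast? = some d.rev := by simp
      have e2 : (l ++ [d, d.rev]).head? = some t := by
        rw [List.head?_append_of_ne_nil _ hl, k2]
      have e3 : ([d, d.rev] ++ l).getLast? = some x := by
        rw [List.getLast?_append_of_ne_nil _ hl, k1]
      have e4 : ([d, d.rev] ++ l).head? = some d := by simp
      simp only [passageForm, e1, e2, e3, e4, k1, k2, m1, m2, hσ _ k3, hσ _ hd]
      rw [add_comm]
      exact vertexForm_add σ (hc x.rev d k4 hd) (hc x.rev t k4 k3) (hc x.rev z.rev k4 m4)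
        (hc x.rev t' k4 m3)
    unfold bracketTerm
    rw [c1, c2, ← add_smul, p]
  · rw [bracketTerm_eq_zero h0 hs0 hu hv huv, bracketTerm_eq_zero hl hs0 hu h3 huv,
      bracketTerm_eq_zero h0' hs0 hu h4' huv, add_zero]

theorem walkBracket_spike [Finite E] {l y : List (Dart E)} {d : Dart E}
    (hl : Γ.toBipartiteGraph.IsClosedWalk l)
    (h : Γ.toBipartiteGraph.IsClosedWalk (l ++ [d, d.rev]))
    (hy : Γ.toBipartiteGraph.IsClosedWalk y) :
    Γ.walkBracket (l ++ [d, d.rev]) y = Γ.walkBracket l y := by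
  unfold walkBracket
  rw [Finset.sum_comm, Finset.sum_comm (s := Finset.range l.length)]
  refine Finset.sum_congr rfl fun j _ => ?_
  have hs := isClosedWalk_rotate hy j
  generalize y.rotate j = s at hs
  obtain ⟨m, hm⟩ : ∃ m, l.length = m + 1 :=
    ⟨l.length - 1, (Nat.succ_pred_eq_of_pos (List.length_pos_of_ne_nil hl.1)).symm⟩
  have hlen : (l ++ [d, d.rev]).length = m + 1 + 1 + 1 := by simp [hm]
  have key : ∀ i, i ≤ m + 1 →
      (l ++ [d, d.rev]).rotate i = l.drop i ++ [d, d.rev] ++ l.take i := by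
    intro i hi
    rw [List.rotate_eq_drop_append_take (by simp; omega), List.drop_append_of_le_length (by omega),
      List.take_append_of_le_length (by omega)]
  have last : (l ++ [d, d.rev]).rotate (m + 1 + 1) = [d.rev] ++ l ++ [d] := by
    have e : l ++ [d, d.rev] = (l ++ [d]) ++ [d.rev] := by simp
    have e' : m + 1 + 1 = (l ++ [d]).length := by simp [hm]
    rw [e, e', List.rotate_append_length_eq, List.append_assoc]
  rw [hlen, hm, Finset.sum_range_succ, Finset.sum_range_succ, Finset.sum_range_succ', last,
    key (m + 1) le_rfl, key 0 (by omega), Finset.sum_range_succ']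
  have z : Γ.bracketTerm ([d.rev] ++ l ++ [d]) s = 0 := by
    have : Γ.passageForm ([d.rev] ++ l ++ [d]) s = 0 := by
      have e1 : ([d.rev] ++ l ++ [d]).getLast? = some d := by
        rw [List.getLast?_append_of_ne_nil _ (by simp)]; rfl
      have e2 : ([d.rev] ++ l ++ [d]).head? = some d.rev := by simp
      obtain ⟨hs0, u, hu⟩ := hs
      obtain ⟨z, t', m1, m2, m3, m4⟩ := closedWalk_ends hs0 hu
      simp only [passageForm, e1, e2, m1, m2]
      exact vertexForm_self _ _ _ _
    rw [bracketTerm, this, zero_smul]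
  rw [z, add_zero, add_assoc]
  congr 1
  · refine Finset.sum_congr rfl fun i hi => ?_
    have hi' := Finset.mem_range.1 hi
    rw [key (i + 1) (by omega), List.rotate_eq_drop_append_take (by omega)]
    refine bracketTerm_spike_mid ?_ ?_ ?_ hs
    · intro h0
      have := congrArg List.length h0
      simp at this
      omega
    · intro h0
      simp at h0
      exact hl.1 h0
    · rw [← key (i + 1) (by omega)]
      exact isClosedWalk_rotate h _
  · have := bracketTerm_spike_ends hl.1 h hs
    simpa [← hm] using this

theorem walkBracket_left [Finite E] {x x' y : Γ.toBipartiteGraph.ClosedWalk}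
    (h : Γ.toBipartiteGraph.ElemHomotopy x x') :
    Γ.walkBracket x.1 y.1 = Γ.walkBracket x'.1 y.1 := by
  cases h with
  | rotate l₁ l₂ h h' => exact walkBracket_rotate _ _ _
  | spike l d h h' => exact (walkBracket_spike h h' y.2).symm

variable (Γ)

/-- The Goldman bracket of the ribbon graph `Γ` on (homotopy classes of) loops. -/
def goldman [Finite E] : Γ.L → Γ.L → (Γ.L →₀ ℚ) :=
  Quot.lift (fun x => Quot.lift (fun y => Γ.walkBracket x.1 y.1)
      (fun y y' h => by
        rw [walkBracket_skew y.2 x.2, walkBracket_skew y'.2 x.2, walkBracket_left h]))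
    (fun x x' h => by
      funext y
      induction y using Quot.ind
      exact walkBracket_left h)

/-- The bracket on loops on a bipartite ribbon graph `Γ`: the Goldman bracket of the conjugate ribbon
graph `Γ*`. -/
def bracket [Finite E] (ℓ₁ ℓ₂ : Γ.L) : Γ.L →₀ ℚ := Γ.conj.goldman ℓ₁ ℓ₂

end BipartiteRibbonGraph

/-! ### Weights of loops

An integer-valued function `w` on the edges defines a class in `H¹(Γ, ℤ)`. -/

namespace BipartiteGraph

variable {W B E : Type*} (G : BipartiteGraph W B E) (w : E → ℤ)

/-- The value of the cochain `w` on a path. -/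
def walkWeight (l : List (Dart E)) : ℤ := (l.map fun d => if d.2 then w d.1 else - w d.1).sum

theorem walkWeight_append (l₁ l₂ : List (Dart E)) :
    walkWeight w (l₁ ++ l₂) = walkWeight w l₁ + walkWeight w l₂ := by
  simp [walkWeight]

theorem walkWeight_spike (d : Dart E) : walkWeight w [d, d.rev] = 0 := by
  obtain ⟨e, b⟩ := d
  cases b <;> simp [walkWeight, Dart.rev]

theorem walkWeight_rotate (l : List (Dart E)) (i : ℕ) :
    walkWeight w (l.rotate i) = walkWeight w l :=
  List.Perm.sum_eq ((List.rotate_perm l i).map _)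

/-- The value of the class of `w` on a loop. -/
def loopWeight : G.Loops → ℤ :=
  Quot.lift (fun x => walkWeight w x.1) (by
    intro x y h
    cases h with
    | rotate l₁ l₂ h h' => simp only [walkWeight_append]; ring
    | spike l d h h' => simp only [walkWeight_append, walkWeight_spike, add_zero])

/-- The weight of a monomial in the loops. -/
def monWeight (m : G.Loops →₀ ℕ) : ℤ := m.sum fun ℓ k => (k : ℤ) * G.loopWeight w ℓ

theorem monWeight_add (m n : G.Loops →₀ ℕ) :
    G.monWeight w (m + n) = G.monWeight w m + G.monWeight w n :=
  Finsupp.sum_add_index' (by simp) (by intros; push_cast; ring)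

theorem monWeight_single (ℓ : G.Loops) :
    G.monWeight w (Finsupp.single ℓ 1) = G.loopWeight w ℓ := by
  simp [monWeight]

end BipartiteGraph

/-! ### Completions -/

section Novikov

variable {X : Type*} (ω : X → ℤ)

/-- The formal sum `∑ f(x) x` has finitely many terms of weight at most `N`, for every `N`. -/
def IsNovikov (f : X → ℚ) : Prop := ∀ N : ℤ, {x | f x ≠ 0 ∧ ω x ≤ N}.Finite

/-- The formal sum `∑ f(x) x` contains only terms of weight at least `N`. -/
def SupportedFrom (N : ℤ) (f : X → ℚ) : Prop := ∀ x, f x ≠ 0 → N ≤ ω x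

/-- The formal sum `∑ f(x) x` has integral coefficients. -/
def HasIntegralCoeffs (f : X → ℚ) : Prop := ∀ x, ∃ n : ℤ, f x = n

/-- The bilinear extension to formal sums of an operation `c` on `X` with values in `ℚ[X]`. For the
operations below and Novikov sums, the sums of coefficients are finite. -/
def formalExtend (c : X → X → (X →₀ ℚ)) (f g : X → ℚ) : X → ℚ :=
  fun z => ∑ᶠ p : X × X, f p.1 * g p.2 * c p.1 p.2 z

variable {ω}

theorem IsNovikov.exists_le {f : X → ℚ} (hf : IsNovikov ω f) : ∃ A, SupportedFrom ω A f := by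
  obtain ⟨A, hA⟩ := ((hf 0).image ω).bddBelow
  refine ⟨min A 0, fun x hx => ?_⟩
  rcases le_or_gt (ω x) 0 with h | h
  · exact (min_le_left _ _).trans (hA ⟨x, ⟨hx, h⟩, rfl⟩)
  · exact (min_le_right _ _).trans h.le

theorem IsNovikov.add {f g : X → ℚ} (hf : IsNovikov ω f) (hg : IsNovikov ω g) :
    IsNovikov ω (f + g) := fun N => by
  refine ((hf N).union (hg N)).subset ?_
  rintro x ⟨h, hx⟩
  by_cases h1 : f x = 0
  · exact Or.inr ⟨fun h2 => h (by simp [h1, h2]), hx⟩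
  · exact Or.inl ⟨h1, hx⟩

theorem IsNovikov.of_finite {f : X → ℚ} (hf : {x | f x ≠ 0}.Finite) : IsNovikov ω f :=
  fun _ => hf.subset fun _ h => h.1

theorem IsNovikov.smul {f : X → ℚ} (hf : IsNovikov ω f) (c : ℚ) : IsNovikov ω (c • f) :=
  fun N => (hf N).subset fun x ⟨h, hx⟩ => ⟨fun h0 => h (by simp [h0]), hx⟩

/-- The general finiteness argument for bilinear operations that are additive on weights. -/
theorem IsNovikov.of_bilinear {f g h : X → ℚ} (hf : IsNovikov ω f) (hg : IsNovikov ω g)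
    (S : X → X → Set X) (hS : ∀ a b, (S a b).Finite) (hω : ∀ a b, ∀ z ∈ S a b, ω z = ω a + ω b)
    (hh : ∀ z, h z ≠ 0 → ∃ a b, f a ≠ 0 ∧ g b ≠ 0 ∧ z ∈ S a b) : IsNovikov ω h := by
  intro N
  obtain ⟨A, hA⟩ := hf.exists_le
  obtain ⟨C, hC⟩ := hg.exists_le
  refine (((hf (N - C)).biUnion fun a _ => (hg (N - A)).biUnion fun b _ => hS a b)).subset ?_
  rintro z ⟨hz, hzN⟩
  obtain ⟨a, b, ha, hb, hab⟩ := hh z hz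
  have h1 := hω a b z hab
  have h2 := hA a ha
  have h3 := hC b hb
  simp only [Set.mem_iUnion]
  exact ⟨a, ⟨ha, by omega⟩, b, ⟨hb, by omega⟩, hab⟩

theorem IsNovikov.formalExtend {c : X → X → (X →₀ ℚ)}
    (hc : ∀ a b, c a b ∈ Finsupp.supported ℚ ℚ {z | ω z = ω a + ω b})
    {f g : X → ℚ} (hf : IsNovikov ω f) (hg : IsNovikov ω g) :
    IsNovikov ω (formalExtend c f g) := by
  refine hf.of_bilinear hg (fun a b => ((c a b).support : Set X))
    (fun a b => (c a b).support.finite_toSet) (fun a b z hz => hc a b hz) ?_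
  intro z hz
  obtain ⟨⟨a, b⟩, hp⟩ := (by
    by_contra h
    push Not at h
    exact hz (by rw [_root_.formalExtend, ← finsum_zero (α := X × X)]; exact finsum_congr h) :
    ∃ p : X × X, f p.1 * g p.2 * c p.1 p.2 z ≠ 0)
  have h1 := left_ne_zero_of_mul hp
  exact ⟨a, b, left_ne_zero_of_mul h1, right_ne_zero_of_mul h1, by
    simpa using right_ne_zero_of_mul hp⟩

end Novikov

/-- The axioms of a Lie bracket on a vector space. -/
structure IsLieBracket {V : Type*} [AddCommGroup V] [Module ℚ V] (β : V → V → V) : Prop where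
  add_left : ∀ x y z, β (x + y) z = β x z + β y z
  smul_left : ∀ (c : ℚ) x y, β (c • x) y = c • β x y
  add_right : ∀ x y z, β x (y + z) = β x y + β x z
  smul_right : ∀ (c : ℚ) x y, β x (c • y) = c • β x y
  self : ∀ x, β x x = 0
  jacobi : ∀ x y z, β x (β y z) + β y (β z x) + β z (β x y) = 0

/-- The axioms of a Poisson bracket on a commutative algebra. -/
structure IsPoissonBracket {A : Type*} [CommRing A] [Algebra ℚ A] (β : A → A → A) : Prop
    extends IsLieBracket β where
  leibniz : ∀ f g h, β f (g * h) = β f g * h + g * β f h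

namespace BipartiteRibbonGraph

open BipartiteGraph

variable {W B E : Type*} (Γ : BipartiteRibbonGraph W B E) (w : E → ℤ)

/-- The weight of a loop. -/
abbrev wt : Γ.L → ℤ := Γ.toBipartiteGraph.loopWeight w

/-- The weight of a monomial in loops. -/
abbrev mwt : (Γ.L →₀ ℕ) → ℤ := Γ.toBipartiteGraph.monWeight w

theorem goldman_supported [Finite E] (a b : Γ.L) :
    Γ.goldman a b ∈ Finsupp.supported ℚ ℚ {z | Γ.wt w z = Γ.wt w a + Γ.wt w b} := by
  induction a using Quot.ind with | _ x
  induction b using Quot.ind with | _ y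
  change Γ.walkBracket x.1 y.1 ∈ _
  refine Submodule.sum_mem _ fun i _ => Submodule.sum_mem _ fun j _ => Submodule.smul_mem _ _ ?_
  unfold loopTerm
  split_ifs with h
  · refine Finsupp.single_mem_supported ℚ _ ?_
    change walkWeight w (y.1.rotate j ++ x.1.rotate i) = walkWeight w x.1 + walkWeight w y.1
    rw [walkWeight_append, walkWeight_rotate, walkWeight_rotate, add_comm]
  · exact Submodule.zero_mem _

/-- The completion `L̂(Γ)` of the free module on loops, with respect to `w`: formal sums of
loops with finitely many terms of weight at most `N`, for every `N`. -/
def LHat : Submodule ℚ (Γ.L → ℚ) where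
  carrier := {x | IsNovikov (Γ.wt w) x}
  add_mem' := IsNovikov.add
  zero_mem' := IsNovikov.of_finite (by simp)
  smul_mem' c _ h := h.smul c

open Classical in
/-- A loop as an element of the completion. -/
def ofLoop (ℓ : Γ.L) : Γ.LHat w :=
  ⟨Pi.single ℓ 1, IsNovikov.of_finite ((Set.finite_singleton ℓ).subset fun x hx => by
    by_contra h
    exact hx (Pi.single_eq_of_ne h 1))⟩

/-- The bracket on `L̂(Γ)`. -/
def hatBracket [Finite E] (x y : Γ.LHat w) : Γ.LHat w :=
  ⟨formalExtend Γ.bracket x.1 y.1, x.2.formalExtend (Γ.conj.goldman_supported w) y.2⟩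

/-- The completion `Ô(Γ)` of the polynomial algebra on the set of loops, that is of the symmetric
algebra of the free module on loops: formal sums of monomials in loops with finitely many terms of
weight at most `N`, for every `N`. -/
def OHat : Subalgebra ℚ (MvPowerSeries Γ.L ℚ) where
  carrier := {f | IsNovikov (Γ.mwt w) fun m => MvPowerSeries.coeff m f}
  add_mem' {f g} hf hg := by
    have := IsNovikov.add hf hg
    simpa [Pi.add_def] using this
  mul_mem' {f g} hf hg := by
    classical
    refine IsNovikov.of_bilinear hf hg (fun a b => ({a + b} : Set (Γ.L →₀ ℕ))) (fun a b => Set.finite_singleton _)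
      (fun a b z hz => ?_) (fun z hz => ?_)
    · rw [Set.mem_singleton_iff.1 hz, mwt, monWeight_add]
    · rw [MvPowerSeries.coeff_mul] at hz
      obtain ⟨p, hp, h⟩ := Finset.exists_ne_zero_of_sum_ne_zero hz
      exact ⟨p.1, p.2, left_ne_zero_of_mul h, right_ne_zero_of_mul h,
        (Finset.HasAntidiagonal.mem_antidiagonal.1 hp).symm⟩
  algebraMap_mem' c := by
    classical
    refine IsNovikov.of_finite ((Set.finite_singleton (0 : Γ.L →₀ ℕ)).subset fun m hm => ?_)
    by_contra h
    apply hm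
    rw [MvPowerSeries.algebraMap_apply, MvPowerSeries.coeff_C, if_neg (fun h' => h (Set.mem_singleton_iff.2 h'))]

open Classical in
/-- The inclusion of `L̂(Γ)` into `Ô(Γ)` as the linear part. -/
def linearPart (x : Γ.LHat w) : Γ.OHat w :=
  ⟨fun m => ∑ ℓ ∈ m.support, if m = Finsupp.single ℓ 1 then x.1 ℓ else 0, by
    intro N
    refine ((x.2 N).image fun ℓ => Finsupp.single ℓ 1).subset ?_
    rintro m ⟨hm, hN⟩
    obtain ⟨ℓ, -, h⟩ := Finset.exists_ne_zero_of_sum_ne_zero hm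
    split_ifs at h with hml
    · subst hml
      refine ⟨ℓ, ⟨h, ?_⟩, rfl⟩
      rwa [mwt, monWeight_single] at hN
    · exact absurd rfl h⟩

/-- The bracket of two monomials in loops, given by the Leibniz rule. -/
def monBracket [Finite E] (m n : Γ.L →₀ ℕ) : (Γ.L →₀ ℕ) →₀ ℚ :=
  ∑ a ∈ m.support, ∑ b ∈ n.support, ((m a : ℚ) * (n b : ℚ)) •
    (Γ.bracket a b).mapDomain fun ℓ =>
      (m - Finsupp.single a 1) + (n - Finsupp.single b 1) + Finsupp.single ℓ 1

theorem monBracket_supported [Finite E] (m n : Γ.L →₀ ℕ) :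
    Γ.monBracket m n ∈ Finsupp.supported ℚ ℚ {z | Γ.mwt w z = Γ.mwt w m + Γ.mwt w n} := by
  classical
  refine Submodule.sum_mem _ fun a ha => Submodule.sum_mem _ fun b hb => Submodule.smul_mem _ _ ?_
  rw [Finsupp.mem_supported]
  intro z hz
  obtain ⟨ℓ, hℓ, rfl⟩ := Finset.mem_image.1 (Finsupp.mapDomain_support hz)
  have h := Γ.conj.goldman_supported w a b hℓ
  have sub : ∀ (m : Γ.L →₀ ℕ) (a : Γ.L), a ∈ m.support →
      Γ.mwt w m = Γ.mwt w (m - Finsupp.single a 1) + Γ.wt w a := by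
    intro m a ha
    rw [wt, ← monWeight_single, ← monWeight_add, tsub_add_cancel_of_le]
    rw [Finsupp.single_le_iff]
    exact Nat.one_le_iff_ne_zero.2 (Finsupp.mem_support_iff.1 ha)
  change Γ.mwt w _ = _
  rw [sub m a ha, sub n b hb, mwt, monWeight_add, monWeight_add, monWeight_single]
  change Γ.toBipartiteGraph.loopWeight w ℓ = _ at h
  rw [h]
  change _ + (Γ.toBipartiteGraph.loopWeight w a + Γ.toBipartiteGraph.loopWeight w b) = _
  ring

/-- The Poisson bracket on `Ô(Γ)`: the extension of the bracket on loops by the Leibniz rule. -/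
def poisson [Finite E] (f g : Γ.OHat w) : Γ.OHat w :=
  ⟨formalExtend Γ.monBracket (fun m => MvPowerSeries.coeff m f.1)
      (fun m => MvPowerSeries.coeff m g.1),
    IsNovikov.formalExtend (Γ.monBracket_supported w) f.2 g.2⟩

end BipartiteRibbonGraph

/-! ### Two by two moves -/

/-- The corners of the square: the `∘`-vertices `a, b, c, d`, in clockwise order. -/
inductive Corner | a | b | c | d

/-- The edges of the graph `α`: the `∘`-vertices `a, b, c, d` and two trivalent `•`-vertices, `p` joined
to `a, b, d`, and `q` joined to `b, c, d`. The square is `p b q d`. -/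
inductive AlphaEdge | ap | bp | dp | bq | cq | dq

/-- The edges of the graph `α'`: the `∘`-vertices `a, b, c, d` and two trivalent `•`-vertices, `p'`
joined to `a, b, c`, and `q'` joined to `a, c, d`. The square is `a p' c q'`. -/
inductive AlphaEdge' | ap | bp | cp | aq | cq | dq

/-- The edges of `α` at the corner, in the counterclockwise order, form a segment of the cyclic order
at the corresponding `∘`-vertex. This is the first edge of the segment. -/
def Corner.first : Corner → AlphaEdge
  | .a => .ap | .b => .bp | .c => .cq | .d => .dq

/-- The last edge of `α` at the corner. -/
def Corner.last : Corner → AlphaEdge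
  | .a => .ap | .b => .bq | .c => .cq | .d => .dp

/-- The first edge of `α'` at the corner. -/
def Corner.first' : Corner → AlphaEdge'
  | .a => .aq | .b => .bp | .c => .cp | .d => .dq

/-- The last edge of `α'` at the corner. -/
def Corner.last' : Corner → AlphaEdge'
  | .a => .ap | .b => .bp | .c => .cq | .d => .dq

/-- The data of a two by two move `Γ → Γ'`: the ribbon graph `Γ` contains `α`, and `Γ'` is obtained
from it by replacing `α` by `α'`. The set `R` labels the edges outside of `α`, which are common to
the two graphs. The two graphs have the same `∘`-vertices. -/
structure TwoByTwoMove {W B B' E E' : Type*} (R : Type*) (Γ : BipartiteRibbonGraph W B E)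
    (Γ' : BipartiteRibbonGraph W B' E') where
  edge : R ⊕ AlphaEdge ≃ E
  edge' : R ⊕ AlphaEdge' ≃ E'
  /-- The cyclic orders `b, a, d` at `p` and `b, d, c` at `q`. -/
  bp_ap : Γ.rotB (edge (.inr .bp)) = edge (.inr .ap)
  ap_dp : Γ.rotB (edge (.inr .ap)) = edge (.inr .dp)
  dp_bp : Γ.rotB (edge (.inr .dp)) = edge (.inr .bp)
  bq_dq : Γ.rotB (edge (.inr .bq)) = edge (.inr .dq)
  dq_cq : Γ.rotB (edge (.inr .dq)) = edge (.inr .cq)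
  cq_bq : Γ.rotB (edge (.inr .cq)) = edge (.inr .bq)
  /-- The two edges of the square at `b` are adjacent, and so are the ones at `d`. -/
  bp_bq : Γ.rotW (edge (.inr .bp)) = edge (.inr .bq)
  dq_dp : Γ.rotW (edge (.inr .dq)) = edge (.inr .dp)
  /-- The cyclic orders `a, c, b` at `p'` and `a, d, c` at `q'`. -/
  ap_cp' : Γ'.rotB (edge' (.inr .ap)) = edge' (.inr .cp)
  cp_bp' : Γ'.rotB (edge' (.inr .cp)) = edge' (.inr .bp)
  bp_ap' : Γ'.rotB (edge' (.inr .bp)) = edge' (.inr .ap)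
  aq_dq' : Γ'.rotB (edge' (.inr .aq)) = edge' (.inr .dq)
  dq_cq' : Γ'.rotB (edge' (.inr .dq)) = edge' (.inr .cq)
  cq_aq' : Γ'.rotB (edge' (.inr .cq)) = edge' (.inr .aq)
  /-- The two edges of the square at `a` are adjacent, and so are the ones at `c`. -/
  aq_ap' : Γ'.rotW (edge' (.inr .aq)) = edge' (.inr .ap)
  cp_cq' : Γ'.rotW (edge' (.inr .cp)) = edge' (.inr .cq)
  /-- The other `•`-vertices of the two graphs are the same, with the same cyclic orders. -/
  rotB_outer : ∀ r s : R,
    Γ.rotB (edge (.inl r)) = edge (.inl s) ↔ Γ'.rotB (edge' (.inl r)) = edge' (.inl s)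
  /-- The cyclic orders at the `∘`-vertices are the same, except that the edges of `α` at each corner
  are replaced by the edges of `α'` at this corner. -/
  rotW_outer : ∀ x y : R ⊕ Corner,
    Γ.rotW (edge (x.map id Corner.last)) = edge (y.map id Corner.first) ↔
      Γ'.rotW (edge' (x.map id Corner.last')) = edge' (y.map id Corner.first')
  /-- The edges of the two graphs have the same `∘`-ends. -/
  white_outer : ∀ x : R ⊕ Corner,
    Γ'.white (edge' (x.map id Corner.first')) = Γ.white (edge (x.map id Corner.first))

/-- A list of paths with integral coefficients, indexed by the natural numbers; it stands for the sum
of its terms. -/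
abbrev PathSeries (E : Type*) := ℕ → ℤ × List (Dart E)

namespace PathSeries

variable {E : Type*}

/-- The single path `l`. -/
def ofPath (l : List (Dart E)) : PathSeries E
  | 0 => (1, l)
  | _ => (0, [])

/-- `1 + M`, where `M` is minus the closed path `l`. -/
def onePlus (l : List (Dart E)) : PathSeries E
  | 0 => (1, [])
  | 1 => (-1, l)
  | _ => (0, [])

/-- `(1 + M)⁻¹ = ∑ (-M)ⁿ`, where `M` is minus the closed path `l`. -/
def onePlusInv (l : List (Dart E)) : PathSeries E :=
  fun n => (1, (List.replicate n l).flatten)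

/-- `(1 + M⁻¹)⁻¹ = M (1 + M)⁻¹ = - ∑ (-M)ⁿ⁺¹`, where `M` is minus the closed path `l`. -/
def onePlusInvInv (l : List (Dart E)) : PathSeries E :=
  fun n => (-1, (List.replicate (n + 1) l).flatten)

/-- Prepend the path `l` to all terms. -/
def prepend (l : List (Dart E)) (s : PathSeries E) : PathSeries E :=
  fun n => ((s n).1, l ++ (s n).2)

/-- Append the path `l` to all terms. -/
def append (s : PathSeries E) (l : List (Dart E)) : PathSeries E :=
  fun n => ((s n).1, (s n).2 ++ l)

end PathSeries

/-- The reversed path. -/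
def reversePath {E : Type*} (l : List (Dart E)) : List (Dart E) := (l.map Dart.rev).reverse

namespace TwoByTwoMove

variable {W B B' E E' R : Type*} {Γ : BipartiteRibbonGraph W B E}
  {Γ' : BipartiteRibbonGraph W B' E'} (m : TwoByTwoMove R Γ Γ')

/-- The edge of `α`, oriented from `∘` to `•`. -/
def fwd (x : AlphaEdge) : Dart E := (m.edge (.inr x), true)

/-- The edge of `α`, oriented from `•` to `∘`. -/
def bwd (x : AlphaEdge) : Dart E := (m.edge (.inr x), false)

/-- The counterclockwise simple loop around `α`, starting at `p`. -/
def squareP : List (Dart E) := [m.bwd .dp, m.fwd .dq, m.bwd .bq, m.fwd .bp]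

/-- The counterclockwise simple loop around `α`, starting at `q`. -/
def squareQ : List (Dart E) := [m.bwd .bq, m.fwd .bp, m.bwd .dp, m.fwd .dq]

open PathSeries in
/-- The parallel transports of the flat line bundle `L'` on `Γ'` along oriented edges, in terms of
the parallel transports of `L`. Paths are read from left to right. With `M_v` minus the
counterclockwise monodromy around `α` at `v`, the fibres of `L'` at `p'` and `q'` are identified with
the fibres of `L` at `p` and `q` so that the transports `b' → p'` and `d' → q'` are the transports
`b → p` and `d → q`; then `L'` is given by
`t_{b'•a'} = (1 + M_b) t_{b•a}`, `t_{c'•b'} = t_{c•b} (1 + M_b⁻¹)⁻¹`,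
`t_{d'•c'} = (1 + M_d) t_{d•c}`, `t_{a'•d'} = t_{a•d} (1 + M_d⁻¹)⁻¹`. -/
def transport : (R ⊕ AlphaEdge') → Bool → PathSeries E
  | .inl r, o => ofPath [(m.edge (.inl r), o)]
  | .inr .bp, true => ofPath [m.fwd .bp]
  | .inr .bp, false => ofPath [m.bwd .bp]
  | .inr .dq, true => ofPath [m.fwd .dq]
  | .inr .dq, false => ofPath [m.bwd .dq]
  | .inr .ap, true => prepend [m.fwd .ap] (onePlus m.squareP)
  | .inr .ap, false => append (onePlusInv m.squareP) [m.bwd .ap]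
  | .inr .cq, true => prepend [m.fwd .cq] (onePlus m.squareQ)
  | .inr .cq, false => append (onePlusInv m.squareQ) [m.bwd .cq]
  | .inr .cp, true =>
      prepend [m.fwd .cq, m.bwd .bq, m.fwd .bp] (onePlus (reversePath m.squareP))
  | .inr .cp, false =>
      append (onePlusInvInv m.squareP) [m.bwd .bp, m.fwd .bq, m.bwd .cq]
  | .inr .aq, true =>
      prepend [m.fwd .ap, m.bwd .dp, m.fwd .dq] (onePlus (reversePath m.squareQ))
  | .inr .aq, false =>
      append (onePlusInvInv m.squareQ) [m.bwd .dq, m.fwd .dp, m.bwd .ap]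

/-- The monodromy of `L'` along a closed walk on `Γ'`, as a formal sum of loops on `Γ`: choose a term
of the transport along each of the oriented edges, compose the chosen paths, and sum over all
choices. -/
def pull (γ : List (Dart E')) : Γ.L → ℚ := fun ℓ =>
  ∑ᶠ n : Fin γ.length → ℕ,
    (∏ i, ((m.transport (m.edge'.symm (γ.get i).1) (γ.get i).2 (n i)).1 : ℚ)) *
      Γ.toBipartiteGraph.loopTerm
        (List.ofFn fun i => (m.transport (m.edge'.symm (γ.get i).1) (γ.get i).2 (n i)).2).flatten ℓ

/-- The weight of the counterclockwise simple loop around `α`. -/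
def squareWeight (w : E → ℤ) : ℤ := BipartiteGraph.walkWeight w m.squareP

/-- The class `w'` on `Γ'` corresponds to the class `w` on `Γ`: the weight of a path on `Γ'` between
`∘`-vertices is the weight of the leading term of its transport. -/
structure Compatible (w : E → ℤ) (w' : E' → ℤ) : Prop where
  outer : ∀ r, w' (m.edge' (.inl r)) = w (m.edge (.inl r))
  ba : w' (m.edge' (.inr .ap)) - w' (m.edge' (.inr .bp)) =
    w (m.edge (.inr .ap)) - w (m.edge (.inr .bp))
  cb : w' (m.edge' (.inr .bp)) - w' (m.edge' (.inr .cp)) =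
    w (m.edge (.inr .bq)) - w (m.edge (.inr .cq)) + m.squareWeight w
  dc : w' (m.edge' (.inr .cq)) - w' (m.edge' (.inr .dq)) =
    w (m.edge (.inr .cq)) - w (m.edge (.inr .dq))
  ad : w' (m.edge' (.inr .dq)) - w' (m.edge' (.inr .aq)) =
    w (m.edge (.inr .dp)) - w (m.edge (.inr .ap)) + m.squareWeight w

end TwoByTwoMove

end

/-!
Why a two by two move is an isomorphism of completed Poisson algebras.

*The bracket.* Loops are closed walks up to free homotopy, so the bracket can be computed in the path
algebra `PathAlgebra`, the rational group algebra of the free group on the edges. Cut the cyclic order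
at every vertex into a linear order (`VertexOrder`); then `2 δ_v` is evaluated by the signs
`VertexOrder.form` which compare edges, and the bracket of closed walks `x`, `y` is the trace of
`D_x y`, where `D_x` is the derivation which inserts the gradient of `x`
(`VertexOrder.walkBracket_eq_trace`). The Jacobi identity (`goldman_jacobi`) then compares `D_x D_z`
with `D_z D_x`: all terms cancel except for commutators of gradients. These are governed by the sum of
three products of signs `form_triple`, which is `1` on triples of edges at the same vertex, and `0` if
the three edges coincide. The constant `1` contributes nothing since a closed walk enters a vertex as
often as it leaves it (`sum_cycAt_eq_zero`), and the diagonal contributes nothing since the two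
orientations of an edge cancel (`sum_trace_cycAt_triple`). The coefficients of the bracket are integers
(`goldman_integral`) since the half-integers occur in pairs, at the two ends of each common edge.

*The leading part of the move.* For a fixed loop on `Γ'`, the term of least weight in the monodromy of
the new line bundle is `±` a single loop on `Γ`. On paths this leading part is a relabelling of the
edges followed by two edge slides: `bq` is replaced by a path which begins at `a`, and `dp` by one
which begins at `c`. A slide carries the derivations `D_x` to each other (`IsSlide.der_grad`), so the
leading part is a bijection `leadingEquiv` of the sets of loops which preserves the bracket
(`bracket_leading`), and it preserves weights; the sign is multiplicative for the bracket.

*The rest of the move.* Let `S` be the loop around the square. Up to an inner derivation, which the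
trace does not see, the bracket with a power of `S` is the derivation of the path algebra which
multiplies the edges `ap` and `cq` by a multiple of that power and kills the other edges
(`exists_der_squarePow`). These derivations integrate to the factors `1 - S = 1 + M`, with the geometric
series as their inverses, and comparison with the transports along the edges of `Γ'`
(`wd_orderedTransport`) shows that the monodromy of the new line bundle is the leading part followed by
the flow of the time dependent Hamiltonian `∑ Sᵏ⁺¹ tᵏ / (k + 1)` at time one (`pull_eq`), that is, of the
dilogarithm `∑ Sᵏ / k²`. By the Jacobi identity the flow consists of derivations of the bracket
(`flow_linBracket`), so its exponential respects the bracket (`sum_expFlow`).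

*Completion.* Since the square has positive weight, the flow differs from the identity by terms of
larger weight. Hence it is invertible on formal sums, and the inverse, a geometric series, preserves
the filtration and the integrality of coefficients (`Nov.exists_preimage`). Integrality of the flow itself
is visible from the transports. Identities between finite sums extend to formal sums by density
(`Nov.Bounded.ext`), and a filtered map of formal sums of loops that respects the brackets
induces a homomorphism of the completed Poisson algebras (`completedHom`, `completedHom_poisson`).
-/

noncomputable section

/-! ### The free group algebra and its derivations -/

/-- The group algebra of the free group on the edges. A list of oriented edges defines an element of
it; the class of a path up to homotopy with fixed ends is recorded by this element and the ends. -/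
abbrev PathAlgebra (E : Type*) := MonoidAlgebra ℚ (FreeGroup E)

namespace PathAlgebra

variable {E : Type*}

/-- The linear extension of a function on the free group. -/
def linExt {V : Type*} [AddCommGroup V] [Module ℚ V] (f : FreeGroup E → V) :
    PathAlgebra E →ₗ[ℚ] V :=
  Finsupp.linearCombination ℚ f ∘ₗ (MonoidAlgebra.coeffLinearEquiv ℚ).toLinearMap

/-- The element of the path algebra given by a list of oriented edges. -/
def wd (l : List (Dart E)) : PathAlgebra E := MonoidAlgebra.of ℚ _ (FreeGroup.mk l)

theorem linExt_of {V : Type*} [AddCommGroup V] [Module ℚ V] (f : FreeGroup E → V)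
    (g : FreeGroup E) : linExt f (MonoidAlgebra.of ℚ _ g) = f g := by
  simp [linExt]

theorem linExt_wd {V : Type*} [AddCommGroup V] [Module ℚ V] (f : FreeGroup E → V)
    (l : List (Dart E)) : linExt f (wd l) = f (FreeGroup.mk l) := linExt_of f _

@[simp] theorem wd_nil : wd ([] : List (Dart E)) = 1 := map_one _

theorem wd_append (l₁ l₂ : List (Dart E)) : wd (l₁ ++ l₂) = wd l₁ * wd l₂ := by
  rw [wd, wd, wd, ← map_mul, FreeGroup.mul_mk]

theorem wd_cons (d : Dart E) (l : List (Dart E)) : wd (d :: l) = wd [d] * wd l :=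
  wd_append [d] l

theorem mk_spike (d : Dart E) : FreeGroup.mk [d, d.rev] = 1 := by
  obtain ⟨e, b⟩ := d
  exact Quot.sound FreeGroup.Red.Step.cons_not

theorem wd_mul_rev (d : Dart E) : wd [d] * wd [d.rev] = 1 := by
  rw [← wd_append, wd, List.singleton_append, mk_spike, map_one]

theorem wd_rev_mul (d : Dart E) : wd [d.rev] * wd [d] = 1 := by
  have := wd_mul_rev d.rev
  rwa [BipartiteGraph.rev_rev] at this

theorem wd_rev_eq {l : List (Dart E)} : FreeGroup.mk (reversePath l) = (FreeGroup.mk l)⁻¹ := by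
  induction l with
  | nil => rfl
  | cons d l ih =>
    have h : reversePath (d :: l) = reversePath l ++ [d.rev] := by simp [reversePath]
    have h2 : FreeGroup.mk (d :: l) = FreeGroup.mk [d] * FreeGroup.mk l := rfl
    have h3 : FreeGroup.mk [d.rev] = (FreeGroup.mk [d])⁻¹ :=
      (inv_eq_of_mul_eq_one_right (mk_spike d)).symm
    rw [h, ← FreeGroup.mul_mk, ih, h2, mul_inv_rev, h3]

/-- Two linear maps on the path algebra agree if they agree on paths. -/
theorem hom_ext {V : Type*} [AddCommGroup V] [Module ℚ V] {f g : PathAlgebra E →ₗ[ℚ] V}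
    (h : ∀ l, f (wd l) = g (wd l)) : f = g := by
  refine LinearMap.ext fun x => ?_
  induction x using MonoidAlgebra.induction_linear with
  | zero => simp
  | add x y hx hy => rw [map_add, map_add, hx, hy]
  | single m r =>
    induction m using Quot.ind with | _ l
    have : MonoidAlgebra.single (FreeGroup.mk l) r = r • wd l := by
      simp [wd]
    change f (MonoidAlgebra.single (FreeGroup.mk l) r) = g (MonoidAlgebra.single (FreeGroup.mk l) r)
    rw [this, map_smul, map_smul, h]

/-- The derivation with `d ↦ K(d) d - d K(d⁻¹)` on oriented edges, evaluated on a list. -/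
def listDer (K : Dart E → PathAlgebra E) : List (Dart E) → PathAlgebra E
  | [] => 0
  | d :: l => (K d * wd [d] - wd [d] * K d.rev) * wd l + wd [d] * listDer K l

theorem listDer_append (K : Dart E → PathAlgebra E) (l₁ l₂ : List (Dart E)) :
    listDer K (l₁ ++ l₂) = listDer K l₁ * wd l₂ + wd l₁ * listDer K l₂ := by
  induction l₁ with
  | nil => simp [listDer]
  | cons d l ih =>
    rw [List.cons_append, listDer, listDer, ih, wd_append, wd_cons d l]
    noncomm_ring

theorem listDer_spike (K : Dart E → PathAlgebra E) (d : Dart E) : listDer K [d, d.rev] = 0 := by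
  simp only [listDer, wd_nil, mul_one, BipartiteGraph.rev_rev, mul_zero, add_zero]
  have h1 := wd_mul_rev d
  rw [sub_mul, mul_assoc, h1, mul_sub, ← mul_assoc (wd [d]) (wd [d.rev]), h1]
  noncomm_ring

/-- The derivation of the path algebra with `d ↦ K(d) d - d K(d⁻¹)` on oriented edges. -/
def der (K : Dart E → PathAlgebra E) : PathAlgebra E →ₗ[ℚ] PathAlgebra E :=
  linExt (Quot.lift (listDer K) (by
    rintro _ _ ⟨⟩
    rename_i l₁ l₂ x b
    have h := listDer_spike K (x, b)
    have h' : wd [(x, b), (x, !b)] = 1 := by rw [wd]; exact (congrArg _ (mk_spike (x, b))).trans (map_one _)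
    have e : l₁ ++ (x, b) :: (x, !b) :: l₂ = l₁ ++ ([(x, b), (x, !b)] ++ l₂) := rfl
    change listDer K [(x, b), (x, !b)] = 0 at h
    rw [e, listDer_append, listDer_append, listDer_append, h, wd_append _ l₂, h']
    simp))

theorem der_wd (K : Dart E → PathAlgebra E) (l : List (Dart E)) : der K (wd l) = listDer K l :=
  linExt_of _ _

theorem der_dart (K : Dart E → PathAlgebra E) (d : Dart E) :
    der K (wd [d]) = K d * wd [d] - wd [d] * K d.rev := by
  simp [der_wd, listDer]

theorem der_mul (K : Dart E → PathAlgebra E) (a b : PathAlgebra E) :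
    der K (a * b) = der K a * b + a * der K b := by
  have h : ∀ l, (der K ∘ₗ LinearMap.mulRight ℚ (wd l)) =
      LinearMap.mulRight ℚ (wd l) ∘ₗ der K + LinearMap.mulRight ℚ (der K (wd l)) := fun l =>
    hom_ext fun l' => by
      simp [← wd_append, der_wd, listDer_append]
  have h2 : (der K ∘ₗ LinearMap.mulLeft ℚ a) =
      LinearMap.mulLeft ℚ (der K a) + LinearMap.mulLeft ℚ a ∘ₗ der K :=
    hom_ext fun l => by simpa using LinearMap.congr_fun (h l) a
  simpa using LinearMap.congr_fun h2 b

theorem der_one (K : Dart E → PathAlgebra E) : der K 1 = 0 := by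
  rw [← wd_nil, der_wd, listDer]

theorem der_add_left (K K' : Dart E → PathAlgebra E) : der (K + K') = der K + der K' :=
  hom_ext fun l => by
    rw [LinearMap.add_apply, der_wd, der_wd, der_wd]
    induction l with
    | nil => simp [listDer]
    | cons d l ih => simp only [listDer, ih, Pi.add_apply]; noncomm_ring

theorem der_smul_left (c : ℚ) (K : Dart E → PathAlgebra E) : der (c • K) = c • der K :=
  hom_ext fun l => by
    rw [LinearMap.smul_apply, der_wd, der_wd]
    induction l with
    | nil => simp [listDer]
    | cons d l ih =>
      simp only [listDer, ih, Pi.smul_apply, smul_mul_assoc, mul_smul_comm, smul_add, smul_sub,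
        sub_mul]

end PathAlgebra

/-! ### Homotopy classes of closed paths -/

namespace BipartiteGraph

open PathAlgebra

variable {W B E : Type*} (G : BipartiteGraph W B E)

/-- The element `g` of the free group is the class of a path from `u` to `v`. -/
def IsPath (u v : W ⊕ B) (g : FreeGroup E) : Prop := ∃ l, G.IsWalk u v l ∧ FreeGroup.mk l = g

variable {G}

theorem IsPath.mul {u v x : W ⊕ B} {g h : FreeGroup E} (hg : G.IsPath u v g) (hh : G.IsPath v x h) :
    G.IsPath u x (g * h) := by
  obtain ⟨l, hl, rfl⟩ := hg
  obtain ⟨l', hl', rfl⟩ := hh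
  exact ⟨l ++ l', isWalk_append.2 ⟨_, hl, hl'⟩, FreeGroup.mul_mk.symm⟩

theorem IsWalk.reverse {u v : W ⊕ B} {l : List (Dart E)} (h : G.IsWalk u v l) :
    G.IsWalk v u (reversePath l) := by
  induction l generalizing u with
  | nil => exact Eq.symm h
  | cons d l ih =>
    have e : reversePath (d :: l) = reversePath l ++ [d.rev] := by simp [reversePath]
    rw [e]
    exact isWalk_append.2 ⟨_, ih h.2, rfl, (tgt_rev d).trans h.1⟩

theorem IsPath.inv {u v : W ⊕ B} {g : FreeGroup E} (hg : G.IsPath u v g) : G.IsPath v u g⁻¹ := by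
  obtain ⟨l, hl, rfl⟩ := hg
  exact ⟨_, hl.reverse, wd_rev_eq⟩

/-- Reducing a word preserves the property of being a walk. A spike at the starting point is
inserted so that the list does not become empty. -/
theorem loopTerm_red {u : W ⊕ B} {d : Dart E} (hd : G.src d = u) {l l' : List (Dart E)}
    (h : FreeGroup.Red l l') (hl : G.IsWalk u u l) :
    G.IsWalk u u l' ∧ G.loopTerm ([d, d.rev] ++ l) = G.loopTerm ([d, d.rev] ++ l') := by
  have hsp : G.IsWalk u u [d, d.rev] := isWalk_spike.2 ⟨hd, rfl⟩
  induction h with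
  | refl => exact ⟨hl, rfl⟩
  | tail _ hs ih =>
    obtain ⟨h1, h2⟩ := ih
    rw [h2]
    obtain ⟨⟩ := hs
    rename_i l₁ l₂ x b _
    obtain ⟨y, h3, h4⟩ := isWalk_append.1 h1
    obtain ⟨z, h5, h6⟩ := (isWalk_append (l₁ := [(x, b), (x, !b)])).1 h4
    obtain ⟨h7, rfl⟩ := (isWalk_spike (d := (x, b))).1 h5
    have h8 : G.IsWalk u u (l₁ ++ l₂) := isWalk_append.2 ⟨_, h3, h6⟩
    refine ⟨h8, ?_⟩
    have := loopTerm_spike (G := G) ([d, d.rev] ++ l₁) l₂ (x, b)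
      (IsClosedWalk.comm ⟨by simp, u, by
        rw [List.append_assoc]; exact isWalk_append.2 ⟨u, hsp, h8⟩⟩)
      ⟨by simp, u, by
        rw [List.append_assoc, List.append_assoc]; exact isWalk_append.2 ⟨u, hsp, h1⟩⟩
    simpa [Dart.rev] using this

theorem loopTerm_add_spike {u : W ⊕ B} {d : Dart E} (hd : G.src d = u) {l : List (Dart E)}
    (hne : l ≠ []) (hl : G.IsWalk u u l) : G.loopTerm ([d, d.rev] ++ l) = G.loopTerm l := by
  have hsp : G.IsWalk u u [d, d.rev] := isWalk_spike.2 ⟨hd, rfl⟩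
  exact loopTerm_spike (G := G) [] l d ⟨by simpa using hne, u, by simpa using hl⟩
    ⟨by simp, u, isWalk_append.2 ⟨u, hsp, hl⟩⟩

/-- The class of a closed walk is determined by the starting point and the element of the free
group. -/
theorem loopTerm_eq_of_mk {u : W ⊕ B} {l l' : List (Dart E)} (hne : l ≠ []) (hne' : l' ≠ [])
    (hl : G.IsWalk u u l) (hl' : G.IsWalk u u l') (h : FreeGroup.mk l = FreeGroup.mk l') :
    G.loopTerm l = G.loopTerm l' := by
  obtain ⟨m, h1, h2⟩ := FreeGroup.Red.exact.1 h
  obtain ⟨d, hd⟩ : ∃ d, G.src d = u := by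
    cases l with
    | nil => exact absurd rfl hne
    | cons d l => exact ⟨d, hl.1⟩
  rw [← loopTerm_add_spike hd hne hl, ← loopTerm_add_spike hd hne' hl',
    (loopTerm_red hd h1 hl).2, (loopTerm_red hd h2 hl').2]

variable (G)

open Classical in
/-- The homotopy class of the closed path based at `u` with class `g` in the free group; zero if there
is no such closed path. -/
def pathLoop (u : W ⊕ B) (g : FreeGroup E) : G.Loops →₀ ℚ :=
  if h : ∃ l, l ≠ [] ∧ G.IsWalk u u l ∧ FreeGroup.mk l = g then G.loopTerm h.choose else 0

variable {G}

theorem pathLoop_mk {u : W ⊕ B} {l : List (Dart E)} (hne : l ≠ []) (hl : G.IsWalk u u l) :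
    G.pathLoop u (FreeGroup.mk l) = G.loopTerm l := by
  have h : ∃ l', l' ≠ [] ∧ G.IsWalk u u l' ∧ FreeGroup.mk l' = FreeGroup.mk l := ⟨l, hne, hl, rfl⟩
  rw [pathLoop, dif_pos h]
  exact loopTerm_eq_of_mk h.choose_spec.1 hne h.choose_spec.2.1 hl h.choose_spec.2.2

theorem pathLoop_eq_zero {u : W ⊕ B} {g : FreeGroup E} (h : ¬ G.IsPath u u g) :
    G.pathLoop u g = 0 := by
  rw [pathLoop, dif_neg]
  rintro ⟨l, -, h1, h2⟩
  exact h ⟨l, h1, h2⟩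

theorem pathLoop_mul_comm {u v : W ⊕ B} {g h : FreeGroup E} (hg : G.IsPath u v g) :
    G.pathLoop u (g * h) = G.pathLoop v (h * g) := by
  by_cases hh : G.IsPath v u h
  · obtain ⟨l, hl, rfl⟩ := hg
    obtain ⟨l', hl', rfl⟩ := hh
    rw [FreeGroup.mul_mk, FreeGroup.mul_mk]
    by_cases hne : l ++ l' = []
    · obtain ⟨rfl, rfl⟩ := List.append_eq_nil_iff.1 hne
      obtain rfl : u = v := hl
      rfl
    · rw [pathLoop_mk hne (isWalk_append.2 ⟨_, hl, hl'⟩), pathLoop_mk (fun h => hne (by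
        obtain ⟨rfl, rfl⟩ := List.append_eq_nil_iff.1 h; rfl)) (isWalk_append.2 ⟨_, hl', hl⟩),
        loopTerm_comm]
  · rw [pathLoop_eq_zero, pathLoop_eq_zero]
    · intro h'
      exact hh (by simpa using h'.mul hg.inv)
    · intro h'
      exact hh (by simpa using hg.inv.mul h')

variable (G)

/-- The linear extension of the map which sends a closed path based at `u` to its free homotopy
class, and all other elements of the free group to zero. -/
def trace (u : W ⊕ B) : PathAlgebra E →ₗ[ℚ] (G.Loops →₀ ℚ) := linExt (G.pathLoop u)

/-- The span of the paths from `u` to `v`. -/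
def pathSpan (u v : W ⊕ B) : Submodule ℚ (PathAlgebra E) :=
  Submodule.span ℚ {x | ∃ l, G.IsWalk u v l ∧ x = wd l}

variable {G}

theorem wd_mem {u v : W ⊕ B} {l : List (Dart E)} (h : G.IsWalk u v l) : wd l ∈ G.pathSpan u v :=
  Submodule.subset_span ⟨l, h, rfl⟩

theorem one_mem_pathSpan (u : W ⊕ B) : (1 : PathAlgebra E) ∈ G.pathSpan u u := by
  rw [← wd_nil]; exact wd_mem rfl

theorem mul_mem_pathSpan {u v x : W ⊕ B} {a b : PathAlgebra E} (ha : a ∈ G.pathSpan u v)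
    (hb : b ∈ G.pathSpan v x) : a * b ∈ G.pathSpan u x := by
  induction ha using Submodule.span_induction with
  | zero => simp
  | add y z _ _ hy hz => rw [add_mul]; exact add_mem hy hz
  | smul c y _ hy => rw [smul_mul_assoc]; exact Submodule.smul_mem _ _ hy
  | mem y hy =>
    obtain ⟨l, hl, rfl⟩ := hy
    induction hb using Submodule.span_induction with
    | zero => simp
    | add y z _ _ hy hz => rw [mul_add]; exact add_mem hy hz
    | smul c y _ hy => rw [mul_smul_comm]; exact Submodule.smul_mem _ _ hy
    | mem y hy =>
      obtain ⟨l', hl', rfl⟩ := hy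
      rw [← wd_append]
      exact wd_mem (isWalk_append.2 ⟨_, hl, hl'⟩)

theorem dart_mem (d : Dart E) : wd [d] ∈ G.pathSpan (G.src d) (G.tgt d) := wd_mem ⟨rfl, rfl⟩

theorem trace_wd {u : W ⊕ B} {l : List (Dart E)} (hne : l ≠ []) (hl : G.IsWalk u u l) :
    G.trace u (wd l) = G.loopTerm l := by
  rw [trace, linExt_wd, pathLoop_mk hne hl]

theorem trace_mul_comm {u v : W ⊕ B} {a : PathAlgebra E} (ha : a ∈ G.pathSpan u v)
    (b : PathAlgebra E) : G.trace u (a * b) = G.trace v (b * a) := by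
  induction ha using Submodule.span_induction with
  | zero => simp
  | add y z _ _ hy hz => rw [add_mul, mul_add, map_add, map_add, hy, hz]
  | smul c y _ hy => rw [smul_mul_assoc, mul_smul_comm, map_smul, map_smul, hy]
  | mem y hy =>
    obtain ⟨l, hl, rfl⟩ := hy
    suffices G.trace u ∘ₗ LinearMap.mulLeft ℚ (wd l) = G.trace v ∘ₗ LinearMap.mulRight ℚ (wd l) from
      LinearMap.congr_fun this b
    refine hom_ext fun l' => ?_
    simp only [LinearMap.comp_apply, LinearMap.mulLeft_apply, LinearMap.mulRight_apply, ← wd_append,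
      trace, linExt_wd, ← FreeGroup.mul_mk]
    exact pathLoop_mul_comm ⟨l, hl, rfl⟩

/-- `der K` maps paths from `u` to `v` to combinations of such paths, if `K(d)` is a combination of
loops based at the start of `d`. -/
theorem der_mem {K : Dart E → PathAlgebra E} (hK : ∀ d, K d ∈ G.pathSpan (G.src d) (G.src d))
    {u v : W ⊕ B} {a : PathAlgebra E} (ha : a ∈ G.pathSpan u v) : der K a ∈ G.pathSpan u v := by
  induction ha using Submodule.span_induction with
  | zero => simp
  | add y z _ _ hy hz => rw [map_add]; exact add_mem hy hz
  | smul c y _ hy => rw [map_smul]; exact Submodule.smul_mem _ _ hy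
  | mem y hy =>
    obtain ⟨l, hl, rfl⟩ := hy
    rw [der_wd]
    induction l generalizing u with
    | nil => exact zero_mem _
    | cons d l ih =>
      obtain ⟨rfl, h⟩ := hl
      refine add_mem (mul_mem_pathSpan (sub_mem (mul_mem_pathSpan (hK d) (dart_mem d))
        (mul_mem_pathSpan (dart_mem d) (hK d.rev))) (wd_mem h)) (mul_mem_pathSpan (dart_mem d) (ih h))

end BipartiteGraph

/-! ### Cyclic derivatives -/

namespace PathAlgebra

variable {E : Type*}

/-- The sum over the oriented edges `d` of the first list, of the rotation which starts with `d`
times `a d`, minus the rotation which ends with `d` times `a d⁻¹`; here the element `c` closes up the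
list. -/
def cycAux (a : Dart E → ℚ) : List (Dart E) → PathAlgebra E → PathAlgebra E
  | [], _ => 0
  | d :: l, c => a d • (wd [d] * wd l * c) - a d.rev • (wd l * c * wd [d]) + cycAux a l (c * wd [d])

/-- The cyclic derivative of a closed walk with respect to a function `a` on oriented edges: the sum of
its rotations, where the rotation which comes in along `d₁` and goes out along `d₂` has the
coefficient `a d₂ - a d₁⁻¹`. -/
def cyc (a : Dart E → ℚ) (l : List (Dart E)) : PathAlgebra E := cycAux a l 1

theorem cycAux_add_fun (a b : Dart E → ℚ) (l : List (Dart E)) (c : PathAlgebra E) :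
    cycAux (a + b) l c = cycAux a l c + cycAux b l c := by
  induction l generalizing c with
  | nil => simp [cycAux]
  | cons d l ih => simp only [cycAux, ih, Pi.add_apply, add_smul]; abel

theorem cycAux_smul_fun (r : ℚ) (a : Dart E → ℚ) (l : List (Dart E)) (c : PathAlgebra E) :
    cycAux (r • a) l c = r • cycAux a l c := by
  induction l generalizing c with
  | nil => simp [cycAux]
  | cons d l ih => simp only [cycAux, ih, Pi.smul_apply, smul_add, smul_sub, smul_smul, smul_eq_mul]

/-- The cyclic derivative of `l`, as a linear function of `a`. -/
def cycHom (l : List (Dart E)) : (Dart E → ℚ) →ₗ[ℚ] PathAlgebra E where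
  toFun a := cyc a l
  map_add' a b := cycAux_add_fun a b l 1
  map_smul' r a := cycAux_smul_fun r a l 1

theorem cycAux_append (a : Dart E → ℚ) (l₁ l₂ : List (Dart E)) (c : PathAlgebra E) :
    cycAux a (l₁ ++ l₂) c = cycAux a l₁ (wd l₂ * c) + cycAux a l₂ (c * wd l₁) := by
  induction l₁ generalizing c with
  | nil => simp [cycAux]
  | cons d l ih =>
    rw [List.cons_append, cycAux, cycAux, ih, wd_append, wd_cons d l]
    simp only [mul_assoc, add_assoc]

/-- The sum of `f` over the rotations of the concatenation of the second list and `pre` which start in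
the second list. -/
def rotSum {M : Type*} [AddCommGroup M] (f : List (Dart E) → M) :
    List (Dart E) → List (Dart E) → M
  | _, [] => 0
  | pre, d :: l => f (d :: (l ++ pre)) + rotSum f (pre ++ [d]) l

theorem rotSum_eq_sum {M : Type*} [AddCommGroup M] (f : List (Dart E) → M) (pre l : List (Dart E)) :
    rotSum f pre l = ∑ i ∈ Finset.range l.length, f ((l ++ pre).rotate i) := by
  induction l generalizing pre with
  | nil => simp [rotSum]
  | cons d l ih =>
    rw [rotSum, ih, List.length_cons, Finset.sum_range_succ', add_comm]
    simp

theorem sum_rotate_one {M : Type*} [AddCommGroup M] (f : List (Dart E) → M) (l : List (Dart E)) :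
    ∑ i ∈ Finset.range l.length, f (l.rotate i) =
      ∑ i ∈ Finset.range l.length, f ((l.rotate i).rotate 1) := by
  rw [← BipartiteRibbonGraph.sum_rotate f l 1]
  simp [List.rotate_rotate, add_comm]

/-- The value at the corner between the last and the first edge of a closed walk. -/
def corner {M : Type*} [AddCommGroup M] (a : Dart E → M) (r : List (Dart E)) : M :=
  match r.getLast?, r.head? with
  | some x, some y => a y - a x.rev
  | _, _ => 0

/-- The value of `F` at the first oriented edge of a list. -/
def onHead {M : Type*} [Zero M] (F : Dart E → M) : List (Dart E) → M
  | [] => 0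
  | d :: _ => F d

theorem corner_rotate_one {M : Type*} [AddCommGroup M] (a : Dart E → M) (d : Dart E)
    (l : List (Dart E)) : corner a ((d :: l).rotate 1) = onHead a (l ++ [d]) - a d.rev := by
  have h : (d :: l).rotate 1 = l ++ [d] := by simp
  rw [h, corner, List.getLast?_concat]
  cases l <;> rfl

theorem corner_cons {M : Type*} [AddCommGroup M] (a : Dart E → M) (d : Dart E) (l : List (Dart E)) :
    corner a (d :: l) = a d - a ((d :: l).getLast (by simp)).rev := by
  rw [corner, List.getLast?_eq_some_getLast (by simp)]; rfl

theorem cycAux_eq_rotSum (a : Dart E → ℚ) (pre l : List (Dart E)) :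
    cycAux a l (wd pre) = rotSum (fun r => onHead (fun d => a d • wd r - a d.rev • wd (r.rotate 1)) r) pre l := by
  induction l generalizing pre with
  | nil => rfl
  | cons d l ih =>
    rw [cycAux, rotSum, ← ih, wd_append]
    simp [onHead, wd_append, wd_cons d (l ++ pre), mul_assoc]

theorem cyc_eq_sum (a : Dart E → ℚ) (l : List (Dart E)) :
    cyc a l = ∑ i ∈ Finset.range l.length, corner a (l.rotate i) • wd (l.rotate i) := by
  rw [cyc, ← wd_nil, cycAux_eq_rotSum, rotSum_eq_sum, List.append_nil,
    sum_rotate_one (fun r => corner a r • wd r)]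
  have h1 : ∀ r : List (Dart E), onHead (fun d => a d • wd r - a d.rev • wd (r.rotate 1)) r =
      onHead (fun d => a d • wd r) r - onHead (fun d => a d.rev • wd (r.rotate 1)) r := by
    rintro (_ | ⟨d, l⟩) <;> simp [onHead]
  simp only [h1, Finset.sum_sub_distrib]
  rw [sum_rotate_one (fun r => onHead (fun d => a d • wd r) r), ← Finset.sum_sub_distrib]
  refine Finset.sum_congr rfl fun i _ => ?_
  generalize l.rotate i = r
  cases r with
  | nil => simp [onHead, corner]
  | cons d l =>
    rw [corner_rotate_one, sub_smul]
    cases l <;> simp [onHead]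

/-- The cyclic derivative of a closed walk which pairs with the oriented edge `d` through the form
`s`. -/
def grad (s : Dart E → Dart E → ℚ) (l : List (Dart E)) (d : Dart E) : PathAlgebra E :=
  (1 / 2 : ℚ) • cyc (fun d' => s d' d) l

end PathAlgebra

namespace BipartiteGraph

open PathAlgebra

variable {W B E : Type*} {G : BipartiteGraph W B E}

theorem isWalk_rotate {u : W ⊕ B} {l : List (Dart E)} (hl : G.IsWalk u u l) (i : ℕ) :
    ∃ v, G.IsWalk v v (l.rotate i) := by
  by_cases h0 : l = []
  · subst h0; exact ⟨u, by simpa using hl⟩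
  rw [← List.rotate_mod]
  have hi : i % l.length ≤ l.length := (Nat.mod_lt _ (List.length_pos_of_ne_nil h0)).le
  rw [List.rotate_eq_drop_append_take hi]
  rw [← List.take_append_drop (i % l.length) l] at hl
  obtain ⟨v, h1, h2⟩ := isWalk_append.1 hl
  exact ⟨v, isWalk_append.2 ⟨u, h2, h1⟩⟩

/-- The trace of a derivation, applied to a path which is closed up by a second path. -/
theorem trace_listDer_mul {K : Dart E → PathAlgebra E} {u v : W ⊕ B} {l pre : List (Dart E)}
    (hl : G.IsWalk u v l) (hpre : G.IsWalk v u pre) :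
    G.trace u (listDer K l * wd pre) = rotSum (fun r => onHead (fun d =>
      G.trace (G.src d) (K d * wd r) - G.trace (G.tgt d) (K d.rev * wd (r.rotate 1))) r) pre l := by
  induction l generalizing u pre with
  | nil => simp [listDer, rotSum]
  | cons d l ih =>
    obtain ⟨rfl, hl⟩ := hl
    have h := ih hl (pre := pre ++ [d]) (isWalk_append.2 ⟨_, hpre, rfl, rfl⟩)
    rw [rotSum, ← h, listDer, add_mul, map_add]
    congr 1
    · rw [sub_mul, sub_mul, map_sub]
      congr 1
      · rw [wd_cons d (l ++ pre), wd_append]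
        simp only [mul_assoc]
      · rw [mul_assoc, mul_assoc, trace_mul_comm (dart_mem d)]
        simp [wd_append, mul_assoc]
    · rw [mul_assoc, trace_mul_comm (dart_mem d), wd_append]
      simp only [mul_assoc]

/-- The trace of a derivation, applied to a closed walk, is a sum over the corners of the walk. -/
theorem trace_der {K : Dart E → PathAlgebra E} {u : W ⊕ B} {l : List (Dart E)}
    (hl : G.IsWalk u u l) :
    G.trace u (der K (wd l)) = ∑ i ∈ Finset.range l.length, onHead (fun d =>
      G.trace (G.src d) (corner K (l.rotate i) * wd (l.rotate i))) (l.rotate i) := by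
  have h0 := trace_listDer_mul (K := K) hl (show G.IsWalk u u [] from rfl)
  rw [wd_nil, mul_one, ← der_wd, rotSum_eq_sum, List.append_nil] at h0
  have h1 : ∀ r : List (Dart E), onHead (fun d => G.trace (G.src d) (K d * wd r) -
      G.trace (G.tgt d) (K d.rev * wd (r.rotate 1))) r =
      onHead (fun d => G.trace (G.src d) (K d * wd r)) r -
      onHead (fun d => G.trace (G.tgt d) (K d.rev * wd (r.rotate 1))) r := by
    rintro (_ | ⟨d, l⟩) <;> simp [onHead]
  rw [h0, sum_rotate_one (fun r => onHead (fun d => G.trace (G.src d) (corner K r * wd r)) r)]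
  simp only [h1, Finset.sum_sub_distrib]
  rw [sum_rotate_one (fun r => onHead (fun d => G.trace (G.src d) (K d * wd r)) r),
    ← Finset.sum_sub_distrib]
  refine Finset.sum_congr rfl fun i _ => ?_
  obtain ⟨v, hv⟩ := isWalk_rotate hl i
  generalize l.rotate i = r at hv
  cases r with
  | nil => simp [onHead]
  | cons d l =>
    rw [corner_rotate_one]
    cases l with
    | nil =>
      have : G.src d = G.tgt d := hv.1.trans hv.2.symm
      simp [onHead, sub_mul, this]
    | cons d' l =>
      have : G.src d' = G.tgt d := hv.2.1
      simp [onHead, sub_mul, this]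

theorem cyc_mem {a : Dart E → ℚ} {v : W ⊕ B} (ha : ∀ d, G.src d ≠ v → a d = 0) {u : W ⊕ B}
    {l : List (Dart E)} (hl : G.IsWalk u u l) : cyc a l ∈ G.pathSpan v v := by
  rw [cyc_eq_sum]
  refine Submodule.sum_mem _ fun i _ => ?_
  obtain ⟨x, hx⟩ := isWalk_rotate hl i
  generalize l.rotate i = r at hx
  by_cases hr : r = []
  · subst hr; simp [corner]
  · obtain ⟨y, z, h1, h2, h3, h4⟩ : ∃ y z, r.getLast? = some y ∧ r.head? = some z ∧
        G.src z = x ∧ G.src y.rev = x := by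
      refine ⟨r.getLast hr, r.head hr, List.getLast?_eq_some_getLast hr, List.head?_eq_some_head hr,
        ?_, ?_⟩
      · cases r with
        | nil => exact absurd rfl hr
        | cons d l => exact hx.1
      · rw [← List.dropLast_append_getLast hr] at hx
        obtain ⟨x, -, h2⟩ := isWalk_append.1 hx
        exact h2.2
    by_cases hxv : x = v
    · subst hxv
      exact Submodule.smul_mem _ _ (wd_mem hx)
    · have : corner a r = 0 := by
        simp only [corner, h1, h2]
        rw [ha z (by rwa [h3]), ha y.rev (by rwa [h4]), sub_self]
      rw [this, zero_smul]
      exact zero_mem _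

end BipartiteGraph

/-! ### Linear orders at the vertices and the bracket of two loops -/

/-- Linear orders of the edges at each vertex of a ribbon graph, which induce the cyclic orders. -/
structure VertexOrder {W B E : Type*} (Γ : BipartiteRibbonGraph W B E) where
  pos : Dart E → ℤ
  inj : ∀ d d', Γ.toBipartiteGraph.src d = Γ.toBipartiteGraph.src d' → pos d = pos d' → d = d'
  sign : ∀ d e f, Γ.toBipartiteGraph.src d = Γ.toBipartiteGraph.src e →
    Γ.toBipartiteGraph.src d = Γ.toBipartiteGraph.src f →
    cyclicSign (Γ.rotAt d) d.1 e.1 f.1 =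
      (pos e - pos d).sign + (pos f - pos e).sign + (pos d - pos f).sign

namespace VertexOrder

open PathAlgebra BipartiteGraph BipartiteRibbonGraph

variable {W B E : Type*} {Γ : BipartiteRibbonGraph W B E} (o : VertexOrder Γ)

open Classical in
/-- The sign which compares two edges at a vertex; zero for edges at different vertices. -/
def form (d d' : Dart E) : ℚ :=
  if Γ.toBipartiteGraph.src d = Γ.toBipartiteGraph.src d' then ((o.pos d' - o.pos d).sign : ℚ) else 0

theorem form_of_ne {d d' : Dart E} (h : Γ.toBipartiteGraph.src d ≠ Γ.toBipartiteGraph.src d') :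
    o.form d d' = 0 := if_neg h

theorem form_of_eq {d d' : Dart E} (h : Γ.toBipartiteGraph.src d = Γ.toBipartiteGraph.src d') :
    o.form d d' = ((o.pos d' - o.pos d).sign : ℚ) := if_pos h

theorem form_skew (d d' : Dart E) : o.form d' d = - o.form d d' := by
  unfold form
  by_cases h : Γ.toBipartiteGraph.src d = Γ.toBipartiteGraph.src d'
  · rw [if_pos h, if_pos h.symm, ← Int.cast_neg, ← Int.sign_neg, neg_sub]
  · rw [if_neg h, if_neg (Ne.symm h), neg_zero]

theorem form_corner {x y z t : Dart E}
    (hx : Γ.toBipartiteGraph.src x.rev = Γ.toBipartiteGraph.src y)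
    (hz : Γ.toBipartiteGraph.src z.rev = Γ.toBipartiteGraph.src y)
    (ht : Γ.toBipartiteGraph.src t = Γ.toBipartiteGraph.src y) :
    vertexForm (Γ.rotAt y) x.1 y.1 z.1 t.1 =
      (1 / 2 : ℚ) * ((o.form y t - o.form x.rev t) - (o.form y z.rev - o.form x.rev z.rev)) := by
  have h1 := o.sign x.rev y t hx (hx.trans ht.symm)
  have h2 := o.sign x.rev y z.rev hx (hx.trans hz.symm)
  rw [(sameCycle_of_src hx).1] at h1 h2
  simp only [Dart.rev] at h1 h2 hx hz
  simp only [Dart.rev]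
  rw [vertexForm, h1, h2, o.form_of_eq ht.symm, o.form_of_eq (hx.trans ht.symm),
    o.form_of_eq hz.symm, o.form_of_eq (hx.trans hz.symm)]
  have e1 : (o.pos (x.1, !x.2) - o.pos t).sign = - (o.pos t - o.pos (x.1, !x.2)).sign := by
    rw [← Int.sign_neg, neg_sub]
  have e2 : (o.pos (x.1, !x.2) - o.pos (z.1, !z.2)).sign =
      - (o.pos (z.1, !z.2) - o.pos (x.1, !x.2)).sign := by
    rw [← Int.sign_neg, neg_sub]
  rw [e1, e2]
  push_cast
  ring

theorem corner_bracketTerm {u v : W ⊕ B} {r s : List (Dart E)} (hr0 : r ≠ []) (hs0 : s ≠ [])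
    (hr : Γ.toBipartiteGraph.IsWalk u u r) (hs : Γ.toBipartiteGraph.IsWalk v v s) :
    Γ.bracketTerm r s = (1 / 2 : ℚ) • Γ.toBipartiteGraph.trace v
      (corner (fun d => corner (fun d' => o.form d' d) r • wd r) s * wd s) := by
  obtain ⟨x, y, h1, h2, h3, h4⟩ := closedWalk_ends hr0 hr
  obtain ⟨z, t, k1, k2, k3, k4⟩ := closedWalk_ends hs0 hs
  by_cases huv : u = v
  · subst huv
    rw [bracketTerm, passageForm]
    simp only [h1, h2, k1, k2, corner]
    rw [o.form_corner (h4.trans h3.symm) (k4.trans h3.symm) (k3.trans h3.symm), ← sub_smul,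
      smul_mul_assoc, map_smul, smul_smul, ← wd_append, loopTerm_comm s r,
      trace_wd (by simp [hr0]) (isWalk_append.2 ⟨_, hr, hs⟩)]
  · rw [bracketTerm_eq_zero hr0 hs0 hs hr (Ne.symm huv)]
    simp only [h1, h2, k1, k2, corner]
    rw [o.form_of_ne (by rwa [h3, k3]), o.form_of_ne (by rwa [h4, k3]),
      o.form_of_ne (by rwa [h3, k4]), o.form_of_ne (by rwa [h4, k4])]
    simp

/-- The bracket of two closed walks is the trace of the derivation which is defined by the gradient of
the first one, applied to the second one. -/
theorem walkBracket_eq_trace {u v : W ⊕ B} {x y : List (Dart E)}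
    (hx : Γ.toBipartiteGraph.IsWalk u u x) (hy : Γ.toBipartiteGraph.IsWalk v v y) :
    Γ.walkBracket x y = Γ.toBipartiteGraph.trace v (der (grad o.form x) (wd y)) := by
  rw [trace_der hy, walkBracket, Finset.sum_comm]
  refine Finset.sum_congr rfl fun j hj => ?_
  obtain ⟨v', hv'⟩ := isWalk_rotate hy j
  have hne : y.rotate j ≠ [] := by
    intro h
    rw [List.rotate_eq_nil_iff] at h
    subst h
    simp at hj
  generalize y.rotate j = s at hv' hne
  have hsrc : ∀ F : W ⊕ B → Γ.L →₀ ℚ, onHead (fun d => F (Γ.toBipartiteGraph.src d)) s = F v' := by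
    intro F
    cases s with
    | nil => exact absurd rfl hne
    | cons d l => exact congrArg F hv'.1
  rw [hsrc fun v => Γ.toBipartiteGraph.trace v (corner (grad o.form x) s * wd s)]
  have h1 : corner (grad o.form x) s = ∑ i ∈ Finset.range x.length, (1 / 2 : ℚ) •
      corner (fun d => corner (fun d' => o.form d' d) (x.rotate i) • wd (x.rotate i)) s := by
    cases s with
    | nil => exact absurd rfl hne
    | cons d l =>
      simp only [corner_cons, grad, cyc_eq_sum, smul_sub, Finset.sum_sub_distrib, Finset.smul_sum]
  rw [h1, Finset.sum_mul, map_sum]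
  refine Finset.sum_congr rfl fun i hi => ?_
  obtain ⟨u', hu'⟩ := isWalk_rotate hx i
  rw [o.corner_bracketTerm (fun h => ?_) hne hu' hv', smul_mul_assoc, map_smul]
  rw [List.rotate_eq_nil_iff] at h
  subst h
  simp at hi

theorem grad_mem {u : W ⊕ B} {x : List (Dart E)} (hx : Γ.toBipartiteGraph.IsWalk u u x)
    (d : Dart E) : grad o.form x d ∈
      Γ.toBipartiteGraph.pathSpan (Γ.toBipartiteGraph.src d) (Γ.toBipartiteGraph.src d) :=
  Submodule.smul_mem _ _ (cyc_mem (fun _ h => o.form_of_ne h) hx)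

end VertexOrder

/-! ### Existence of vertex orders -/

section Positions

variable {E : Type*} [Finite E]

theorem rotSteps_rotate (σ : Equiv.Perm E) {o e : E} (he : σ.SameCycle o e) :
    σ e = o ∨ rotSteps σ o (σ e) = rotSteps σ o e + 1 := by
  obtain ⟨N, hN, h⟩ := exists_index σ o
  have h0 : ∀ f j, j < N → (σ ^ j) o = f → rotSteps σ o f = j := by
    intro f j hj hf
    obtain ⟨i, hi, -, h3⟩ := h o (Equiv.Perm.SameCycle.refl _ _)
    have h4 : rotSteps σ o o = 0 := Nat.le_zero.1 (Nat.sInf_le (by simp))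
    have h5 := h3 o 0 hN rfl
    have h6 := h3 f j hj hf
    rw [h4] at h5
    split_ifs at h5 h6 <;> omega
  have he' : σ.SameCycle o (σ e) := he.trans ⟨1, by simp⟩
  obtain ⟨i', hi', h2, -⟩ := h (σ e) he'
  cases i' with
  | zero => left; rw [← h2]; simp
  | succ k =>
    right
    have h3 : (σ ^ k) o = e := by
      rw [pow_succ', Equiv.Perm.mul_apply] at h2
      exact σ.injective h2
    rw [h0 _ _ hi' h2, h0 _ _ (by omega) h3]

/-- A function that increases along a cycle of a permutation, until the cycle returns to its starting
point, computes the signs of triples in the cycle. -/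
theorem cyclicSign_of_pos (σ : Equiv.Perm E) {o : E} {pos : E → ℤ}
    (h : ∀ e, σ.SameCycle o e → σ e = o ∨ pos e < pos (σ e)) :
    (∀ e f, σ.SameCycle o e → σ.SameCycle o f → pos e = pos f → e = f) ∧
    ∀ e f g, σ.SameCycle o e → σ.SameCycle o f → σ.SameCycle o g →
      cyclicSign σ e f g = (pos f - pos e).sign + (pos g - pos f).sign + (pos e - pos g).sign := by
  obtain ⟨N, hN, hi⟩ := exists_index σ o
  have h0 : ∀ j, j < N → (σ ^ j) o = o → j = 0 := by
    intro j hj hf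
    obtain ⟨i, hi, -, h3⟩ := hi o (Equiv.Perm.SameCycle.refl _ _)
    have h4 : rotSteps σ o o = 0 := Nat.le_zero.1 (Nat.sInf_le (by simp))
    have h5 := h3 o 0 hN rfl
    have h6 := h3 o j hj hf
    rw [h4] at h5 h6
    split_ifs at h5 h6 <;> omega
  have hmono : ∀ i k, i + k + 1 < N → pos ((σ ^ i) o) < pos ((σ ^ (i + k + 1)) o) := by
    intro i k
    have step : ∀ i, i + 1 < N → pos ((σ ^ i) o) < pos ((σ ^ (i + 1)) o) := by
      intro i hi
      rcases h ((σ ^ i) o) ⟨i, by simp⟩ with h1 | h1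
      · rw [← Equiv.Perm.mul_apply, ← pow_succ'] at h1
        have := h0 _ hi h1
        omega
      · rwa [pow_succ', Equiv.Perm.mul_apply]
    induction k with
    | zero => exact step i
    | succ k ih => exact fun hk => (ih (by omega)).trans (step _ hk)
  have hlt : ∀ i j, i < j → j < N → pos ((σ ^ i) o) < pos ((σ ^ j) o) := by
    intro i j hij hj
    obtain ⟨k, rfl⟩ := Nat.exists_eq_add_of_lt hij
    exact hmono i k hj
  choose! i hi using hi
  have key : ∀ e f, σ.SameCycle o e → σ.SameCycle o f →
      (i e < i f ∧ (pos f - pos e).sign = 1) ∨ (i e = i f ∧ (pos f - pos e).sign = 0) ∨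
      (i f < i e ∧ (pos f - pos e).sign = -1) := by
    intro e f he hf
    have e1 := (hi e he).2.1
    have e2 := (hi f hf).2.1
    rcases lt_trichotomy (i e) (i f) with hl | hl | hl
    · have := hlt _ _ hl (hi f hf).1
      rw [e1, e2] at this
      exact Or.inl ⟨hl, Int.sign_eq_one_of_pos (by omega)⟩
    · have : e = f := by rw [← e1, ← e2, hl]
      subst this
      simp
    · have := hlt _ _ hl (hi e he).1
      rw [e1, e2] at this
      exact Or.inr (Or.inr ⟨hl, Int.sign_eq_neg_one_of_neg (by omega)⟩)
  refine ⟨fun e f he hf hef => ?_, fun e f g he hf hg => ?_⟩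
  · rw [← (hi e he).2.1, ← (hi f hf).2.1]
    have := key e f he hf
    rw [hef, sub_self, Int.sign_zero] at this
    congr 2
    omega
  · have s1 := (hi e he).2.2 f (i f) (hi f hf).1 (hi f hf).2.1
    have s2 := (hi e he).2.2 g (i g) (hi g hg).1 (hi g hg).2.1
    have b1 := (hi e he).1
    have b2 := (hi f hf).1
    have b3 := (hi g hg).1
    have heq : ∀ e f, σ.SameCycle o e → σ.SameCycle o f → (e = f ↔ i e = i f) := by
      intro e f he hf
      refine ⟨fun h => by rw [h], fun h => ?_⟩
      rw [← (hi e he).2.1, ← (hi f hf).2.1, h]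
    unfold cyclicSign
    rw [heq e f he hf, heq f g hf hg, heq e g he hg, s1, s2]
    clear s1 s2
    have k1 := key e f he hf
    have k2 := key f g hf hg
    have k3 := key g e hg he
    clear hi h hmono hlt key heq h0
    split_ifs <;> omega

end Positions

namespace VertexOrder

theorem exists_first {E V : Type*} (f : E → V) : ∃ first : E → E, (∀ e, f (first e) = f e) ∧
    ∀ e e', f e = f e' → first e = first e' := by
  classical
  refine ⟨fun e => (⟨e, rfl⟩ : ∃ e', f e' = f e).choose, fun e =>
    (⟨e, rfl⟩ : ∃ e', f e' = f e).choose_spec, fun e e' h => ?_⟩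
  dsimp only
  simp only [h]

open BipartiteGraph BipartiteRibbonGraph

variable {W B E : Type*} [Finite E] (Γ : BipartiteRibbonGraph W B E)

/-- The linear orders given by functions which increase along the cyclic orders except at chosen
first edges. -/
def ofPos (posW posB : E → ℤ) (firstW firstB : E → E)
    (hW : ∀ e, Γ.white (firstW e) = Γ.white e) (hW' : ∀ e f, Γ.white e = Γ.white f → firstW e = firstW f)
    (hB : ∀ e, Γ.black (firstB e) = Γ.black e) (hB' : ∀ e f, Γ.black e = Γ.black f → firstB e = firstB f)
    (hposW : ∀ e, Γ.rotW e = firstW e ∨ posW e < posW (Γ.rotW e))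
    (hposB : ∀ e, Γ.rotB e = firstB e ∨ posB e < posB (Γ.rotB e)) : VertexOrder Γ where
  pos d := if d.2 then posW d.1 else posB d.1
  inj := by
    rintro ⟨e, b⟩ ⟨f, c⟩ h1 h2
    cases b <;> cases c <;> simp [src] at h1 h2 ⊢
    · refine (cyclicSign_of_pos Γ.rotB (o := firstB e) (pos := posB) fun g hg => ?_).1 e f
        ((Γ.sameCycle_rotB _ _).2 (hB e)) ((Γ.sameCycle_rotB _ _).2 ((hB e).trans h1)) h2
      rw [hB' e g ((hB e).symm.trans ((Γ.sameCycle_rotB _ _).1 hg))]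
      exact hposB g
    · refine (cyclicSign_of_pos Γ.rotW (o := firstW e) (pos := posW) fun g hg => ?_).1 e f
        ((Γ.sameCycle_rotW _ _).2 (hW e)) ((Γ.sameCycle_rotW _ _).2 ((hW e).trans h1)) h2
      rw [hW' e g ((hW e).symm.trans ((Γ.sameCycle_rotW _ _).1 hg))]
      exact hposW g
  sign := by
    rintro ⟨e, b⟩ ⟨f, c⟩ ⟨g, d⟩ h1 h2
    cases b <;> cases c <;> cases d <;> simp [src, rotAt] at h1 h2 ⊢
    · refine (cyclicSign_of_pos Γ.rotB (o := firstB e) (pos := posB) fun g hg => ?_).2 e f g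
        ((Γ.sameCycle_rotB _ _).2 (hB e)) ((Γ.sameCycle_rotB _ _).2 ((hB e).trans h1))
        ((Γ.sameCycle_rotB _ _).2 ((hB e).trans h2))
      rw [hB' e g ((hB e).symm.trans ((Γ.sameCycle_rotB _ _).1 hg))]
      exact hposB g
    · refine (cyclicSign_of_pos Γ.rotW (o := firstW e) (pos := posW) fun g hg => ?_).2 e f g
        ((Γ.sameCycle_rotW _ _).2 (hW e)) ((Γ.sameCycle_rotW _ _).2 ((hW e).trans h1))
        ((Γ.sameCycle_rotW _ _).2 ((hW e).trans h2))
      rw [hW' e g ((hW e).symm.trans ((Γ.sameCycle_rotW _ _).1 hg))]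
      exact hposW g

theorem nonempty : Nonempty (VertexOrder Γ) := by
  obtain ⟨fW, h1, h2⟩ := exists_first Γ.white
  obtain ⟨fB, h3, h4⟩ := exists_first Γ.black
  refine ⟨ofPos Γ (fun e => rotSteps Γ.rotW (fW e) e) (fun e => rotSteps Γ.rotB (fB e) e) fW fB
    h1 h2 h3 h4 (fun e => ?_) (fun e => ?_)⟩
  · have h : fW (Γ.rotW e) = fW e := h2 _ _ ((Γ.sameCycle_rotW _ _).1 ⟨-1, by simp⟩)
    refine (rotSteps_rotate Γ.rotW ((Γ.sameCycle_rotW _ _).2 (h1 e))).imp_right fun h' => ?_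
    rw [h, h']; push_cast; omega
  · have h : fB (Γ.rotB e) = fB e := h4 _ _ ((Γ.sameCycle_rotB _ _).1 ⟨-1, by simp⟩)
    refine (rotSteps_rotate Γ.rotB ((Γ.sameCycle_rotB _ _).2 (h3 e))).imp_right fun h' => ?_
    rw [h, h']; push_cast; omega

end VertexOrder

/-! ### The Jacobi identity -/

/-- The bilinear extension of an operation on `X` with values in the free vector space on `X`. -/
def bilinearExt {X : Type*} (c : X → X → (X →₀ ℚ)) : (X →₀ ℚ) →ₗ[ℚ] (X →₀ ℚ) →ₗ[ℚ] (X →₀ ℚ) :=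
  Finsupp.linearCombination ℚ fun a => Finsupp.linearCombination ℚ (c a)

theorem bilinearExt_single {X : Type*} (c : X → X → (X →₀ ℚ)) (a b : X) :
    bilinearExt c (Finsupp.single a 1) (Finsupp.single b 1) = c a b := by
  simp [bilinearExt]

namespace PathAlgebra

variable {E : Type*}

/-- The commutator of two derivations. -/
theorem der_comm (K K' : Dart E → PathAlgebra E) (a : PathAlgebra E) :
    der K (der K' a) - der K' (der K a) =
      der (fun d => der K (K' d) - der K' (K d) + (K' d * K d - K d * K' d)) a := by
  suffices der K ∘ₗ der K' - der K' ∘ₗ der K =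
      der (fun d => der K (K' d) - der K' (K d) + (K' d * K d - K d * K' d)) from
    LinearMap.congr_fun this a
  refine hom_ext fun l => ?_
  simp only [LinearMap.sub_apply, LinearMap.comp_apply]
  induction l with
  | nil => simp [der_one]
  | cons d l ih =>
    rw [wd_cons]
    simp only [der_mul, map_add, ← ih, der_dart, map_sub]
    noncomm_ring

theorem corner_zero {M : Type*} [AddCommGroup M] (r : List (Dart E)) :
    corner (fun _ => (0 : M)) r = 0 := by
  cases r with
  | nil => rfl
  | cons d l => rw [corner_cons, sub_zero]

theorem corner_nil {M : Type*} [AddCommGroup M] (a : Dart E → M) : corner a [] = 0 := rfl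

theorem corner_sum {ι M : Type*} [AddCommGroup M] (s : Finset ι) (K : ι → Dart E → M)
    (r : List (Dart E)) : corner (fun d => ∑ i ∈ s, K i d) r = ∑ i ∈ s, corner (K i) r := by
  cases r with
  | nil => simp [corner]
  | cons d l => simp only [corner_cons, Finset.sum_sub_distrib]

theorem corner_map {M N : Type*} [AddCommGroup M] [AddCommGroup N] (f : M →+ N) (K : Dart E → M)
    (r : List (Dart E)) : corner (fun d => f (K d)) r = f (corner K r) := by
  cases r with
  | nil => simp [corner]
  | cons d l => simp only [corner_cons, map_sub]

theorem corner_add {M : Type*} [AddCommGroup M] (K K' : Dart E → M)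
    (r : List (Dart E)) : corner (fun d => K d + K' d) r = corner K r + corner K' r := by
  cases r with
  | nil => simp [corner]
  | cons d l => simp only [corner_cons]; abel

theorem corner_sub {M : Type*} [AddCommGroup M] (K K' : Dart E → M)
    (r : List (Dart E)) : corner (fun d => K d - K' d) r = corner K r - corner K' r := by
  cases r with
  | nil => simp [corner]
  | cons d l => simp only [corner_cons]; abel

open Classical in
/-- The sum of the rotations of a closed walk which start with the oriented edge `d`, minus the ones
that end with its inverse. -/
def cycAt (l : List (Dart E)) (d : Dart E) : PathAlgebra E := cyc (Pi.single d 1) l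

theorem cycAt_rev (l : List (Dart E)) (d : Dart E) :
    cycAt l d.rev = - (wd [d.rev] * cycAt l d * wd [d]) := by
  classical
  have key : ∀ (l : List (Dart E)) (c : PathAlgebra E), cycAux (Pi.single d.rev 1) l c =
      - (wd [d.rev] * cycAux (Pi.single d 1) l c * wd [d]) := by
    intro l
    induction l with
    | nil => simp [cycAux]
    | cons x l ih =>
      intro c
      have h1 := wd_rev_mul d
      have h2 : ∀ a, wd [d.rev] * (wd [d] * a) = a := fun a => by rw [← mul_assoc, h1, one_mul]
      have hne : d.rev ≠ d := fun h => by
        have := congrArg Prod.snd h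
        simp [Dart.rev] at this
      rw [cycAux, cycAux, ih]
      by_cases hd : x = d
      · subst hd
        simp [hne, hne.symm, mul_add, add_mul, mul_assoc, h2, add_comm]
      · by_cases hd' : x = d.rev
        · subst hd'
          simp only [Pi.single_apply, if_true, BipartiteGraph.rev_rev, hne, hne.symm, if_false, one_smul,
            zero_smul, mul_add, add_mul, mul_sub, sub_mul, mul_zero, zero_mul, mul_assoc, h1, mul_one]
          abel
        · have hd2 : x.rev ≠ d := fun h => hd' (by rw [← h, BipartiteGraph.rev_rev])
          have hd3 : x.rev ≠ d.rev := fun h => hd (by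
            rw [← BipartiteGraph.rev_rev x, h, BipartiteGraph.rev_rev])
          simp [hd, hd', hd2, hd3]
  exact key l 1

theorem cyc_eq_sum_cycAt [Fintype (Dart E)] (a : Dart E → ℚ) (l : List (Dart E)) :
    cyc a l = ∑ d, a d • cycAt l d := by
  classical
  change cycHom l a = _
  have : a = ∑ d, a d • Pi.single d (1 : ℚ) := by
    funext x
    simp [Finset.sum_apply, Pi.single_apply]
  conv_lhs => rw [this, map_sum]
  refine Finset.sum_congr rfl fun d _ => ?_
  rw [map_smul, cycAt]
  congr!

end PathAlgebra

namespace BipartiteGraph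

open PathAlgebra

variable {W B E : Type*} (G : BipartiteGraph W B E)

/-- The trace at the starting point of the list. -/
def headTrace : List (Dart E) → PathAlgebra E →ₗ[ℚ] (G.Loops →₀ ℚ)
  | [] => 0
  | d :: _ => G.trace (G.src d)

variable {G}

theorem headTrace_eq {v : W ⊕ B} {r : List (Dart E)} (hne : r ≠ []) (hr : G.IsWalk v v r) :
    G.headTrace r = G.trace v := by
  cases r with
  | nil => exact absurd rfl hne
  | cons d l => exact congrArg G.trace hr.1

theorem trace_der' {K : Dart E → PathAlgebra E} {u : W ⊕ B} {l : List (Dart E)}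
    (hl : G.IsWalk u u l) :
    G.trace u (der K (wd l)) = ∑ i ∈ Finset.range l.length,
      G.headTrace (l.rotate i) (corner K (l.rotate i) * wd (l.rotate i)) := by
  rw [trace_der hl]
  refine Finset.sum_congr rfl fun i _ => ?_
  cases l.rotate i <;> rfl

theorem corner_mem {K : Dart E → PathAlgebra E} (hK : ∀ d, K d ∈ G.pathSpan (G.src d) (G.src d))
    {v : W ⊕ B} {r : List (Dart E)} (hr : G.IsWalk v v r) : corner K r ∈ G.pathSpan v v := by
  cases r with
  | nil => simp [corner]
  | cons d l =>
    rw [corner_cons]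
    have h1 := hK d
    rw [hr.1] at h1
    refine sub_mem h1 ?_
    have h2 : G.src ((d :: l).getLast (by simp)).rev = v := by
      rw [← List.dropLast_append_getLast (l := d :: l) (by simp)] at hr
      obtain ⟨x, -, h2⟩ := isWalk_append.1 hr
      exact h2.2
    have h3 := hK ((d :: l).getLast (by simp)).rev
    rwa [h2] at h3

theorem corner_eq_zero {M : Type*} [AddCommGroup M] {v : W ⊕ B} {a : Dart E → M}
    {c : M} (ha : ∀ d, G.src d = v → a d = c) {r : List (Dart E)} (hr : G.IsWalk v v r) :
    corner a r = 0 := by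
  cases r with
  | nil => simp [corner]
  | cons d l =>
    have h2 : G.src ((d :: l).getLast (by simp)).rev = v := by
      rw [← List.dropLast_append_getLast (l := d :: l) (by simp)] at hr
      obtain ⟨x, -, h2⟩ := isWalk_append.1 hr
      exact h2.2
    rw [corner_cons, ha d hr.1, ha _ h2, sub_self]

/-- A closed walk comes into each vertex as often as it goes out. -/
theorem cyc_const {a : Dart E → ℚ} (ha : ∀ d d', G.src d = G.src d' → a d = a d') {u : W ⊕ B}
    {l : List (Dart E)} (hl : G.IsWalk u u l) : cyc a l = 0 := by
  rw [cyc_eq_sum]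
  refine Finset.sum_eq_zero fun i _ => ?_
  obtain ⟨v, hv⟩ := isWalk_rotate hl i
  generalize l.rotate i = r at hv
  cases r with
  | nil => simp [corner]
  | cons d l =>
    rw [corner_eq_zero (c := a d) (fun d' h => ha d' d (h.trans hv.1.symm)) hv, zero_smul]

theorem cycAt_mem {u : W ⊕ B} {l : List (Dart E)} (hl : G.IsWalk u u l) (d : Dart E) :
    cycAt l d ∈ G.pathSpan (G.src d) (G.src d) := by
  classical
  refine cyc_mem (fun x hx => ?_) hl
  rw [Pi.single_apply, if_neg]
  rintro rfl
  exact hx rfl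

theorem exists_isWalk_wd (v : W ⊕ B) {l : List (Dart E)} (hl : G.IsWalk v v l)
    (h : ∃ d, G.src d = v) : ∃ l', l' ≠ [] ∧ G.IsWalk v v l' ∧ (wd l' : PathAlgebra E) = wd l := by
  by_cases hne : l = []
  · obtain ⟨d, hd⟩ := h
    subst hne
    exact ⟨[d, d.rev], by simp, isWalk_spike.2 ⟨hd, rfl⟩, by rw [wd_cons, wd_mul_rev, wd_nil]⟩
  · exact ⟨l, hne, hl, rfl⟩

theorem trace_eq_zero_of_isolated {v : W ⊕ B} (h : ¬ ∃ d, G.src d = v) : G.trace v = 0 := by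
  refine hom_ext fun l => ?_
  rw [trace, linExt_wd, pathLoop, dif_neg]
  · rfl
  · rintro ⟨l', h1, h2, -⟩
    cases l' with
    | nil => exact h1 rfl
    | cons d l' => exact h ⟨d, h2.1⟩

theorem exists_pathLoop (ℓ : G.Loops) : ∃ (u : W ⊕ B) (l : List (Dart E)), l ≠ [] ∧ G.IsWalk u u l ∧
    G.trace u (wd l) = Finsupp.single ℓ 1 := by
  induction ℓ using Quot.ind with | _ x
  obtain ⟨l, hne, u, hu⟩ := x
  refine ⟨u, l, hne, hu, ?_⟩
  rw [trace_wd hne hu, loopTerm, dif_pos ⟨hne, u, hu⟩]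
  rfl

end BipartiteGraph

namespace VertexOrder

open PathAlgebra BipartiteGraph BipartiteRibbonGraph

variable {W B E : Type*} {Γ : BipartiteRibbonGraph W B E} (o : VertexOrder Γ)

/-- The coefficient of the composition of two closed walks in their bracket. -/
def pairing (r s : List (Dart E)) : ℚ :=
  (1 / 2 : ℚ) * corner (fun d => corner (fun d' => o.form d' d) r) s

theorem corner_grad (x s : List (Dart E)) : corner (grad o.form x) s =
    ∑ i ∈ Finset.range x.length, o.pairing (x.rotate i) s • wd (x.rotate i) := by
  have h1 : grad o.form x = fun d => ∑ i ∈ Finset.range x.length,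
      ((1 / 2 : ℚ) * corner (fun d' => o.form d' d) (x.rotate i)) • wd (x.rotate i) := by
    funext d
    simp only [grad, cyc_eq_sum, Finset.smul_sum, smul_smul]
  rw [h1, corner_sum]
  refine Finset.sum_congr rfl fun i _ => ?_
  cases s with
  | nil => simp [pairing, corner]
  | cons d l => simp only [pairing, corner_cons, ← sub_smul, ← mul_sub]

theorem pairing_skew (r s : List (Dart E)) : o.pairing s r = - o.pairing r s := by
  cases r with
  | nil => simp [pairing, corner_nil, corner_zero]
  | cons d l =>
    cases s with
    | nil => simp [pairing, corner_nil, corner_zero]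
    | cons d' l' =>
      simp only [pairing, corner_cons]
      generalize ((d :: l).getLast (by simp)).rev = x
      generalize ((d' :: l').getLast (by simp)).rev = y
      rw [o.form_skew d d', o.form_skew x d', o.form_skew d y, o.form_skew x y]
      ring

theorem pairing_eq_zero {u v : W ⊕ B} {r s : List (Dart E)} (hr : Γ.toBipartiteGraph.IsWalk u u r)
    (hs : Γ.toBipartiteGraph.IsWalk v v s) (huv : u ≠ v) : o.pairing r s = 0 := by
  have : corner (fun d => corner (fun d' => o.form d' d) r) s = 0 :=
    corner_eq_zero (v := v) (c := 0) (fun d hd => corner_eq_zero (v := u) (c := 0) (fun d' hd' =>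
      o.form_of_ne (by rwa [hd, hd'])) hr) hs
  rw [pairing, this, mul_zero]

theorem corner_grad_mem {u v : W ⊕ B} {x r : List (Dart E)} (hx : Γ.toBipartiteGraph.IsWalk u u x)
    (hr : Γ.toBipartiteGraph.IsWalk v v r) :
    corner (grad o.form x) r ∈ Γ.toBipartiteGraph.pathSpan v v :=
  corner_mem (o.grad_mem hx) hr

theorem bilinearExt_trace [Finite E] {u v : W ⊕ B} {x : List (Dart E)} (hne : x ≠ [])
    (hx : Γ.toBipartiteGraph.IsWalk u u x) {a : PathAlgebra E}
    (ha : a ∈ Γ.toBipartiteGraph.pathSpan v v) :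
    bilinearExt Γ.goldman (Γ.toBipartiteGraph.trace u (wd x)) (Γ.toBipartiteGraph.trace v a) =
      Γ.toBipartiteGraph.trace v (der (grad o.form x) a) := by
  by_cases hv : ∃ d, Γ.toBipartiteGraph.src d = v
  · induction ha using Submodule.span_induction with
    | zero => simp
    | add y z _ _ hy hz => simp only [map_add, hy, hz]
    | smul c y _ hy => simp only [map_smul, hy]
    | mem y hy =>
      obtain ⟨l, hl, rfl⟩ := hy
      obtain ⟨l', h1, h2, h3⟩ := exists_isWalk_wd v hl hv
      rw [← h3, trace_wd hne hx, trace_wd h1 h2, loopTerm, loopTerm, dif_pos ⟨hne, u, hx⟩,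
        dif_pos ⟨h1, v, h2⟩, bilinearExt_single]
      exact o.walkBracket_eq_trace hx h2
  · rw [trace_eq_zero_of_isolated hv]
    simp

/-- The sum over the corners of `y` of the part of the double bracket in which `z` is attached at the
corner and `x` anywhere on `y`. -/
def attach (x y z : List (Dart E)) : Γ.L →₀ ℚ :=
  ∑ j ∈ Finset.range y.length, Γ.toBipartiteGraph.headTrace (y.rotate j)
    (corner (grad o.form z) (y.rotate j) * der (grad o.form x) (wd (y.rotate j)))

theorem trace_der_der [Finite E] {ux uy uz : W ⊕ B} {x y z : List (Dart E)} (hne : z ≠ [])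
    (hx : Γ.toBipartiteGraph.IsWalk ux ux x)
    (hy : Γ.toBipartiteGraph.IsWalk uy uy y) (hz : Γ.toBipartiteGraph.IsWalk uz uz z) :
    Γ.toBipartiteGraph.trace uy (der (grad o.form z) (der (grad o.form x) (wd y))) =
      ∑ j ∈ Finset.range y.length, Γ.toBipartiteGraph.headTrace (y.rotate j)
        (der (grad o.form z) (corner (grad o.form x) (y.rotate j)) * wd (y.rotate j)) +
      o.attach z y x := by
  rw [← o.bilinearExt_trace hne hz (der_mem (o.grad_mem hx) (wd_mem hy)), trace_der' hy, map_sum,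
    attach, ← Finset.sum_add_distrib]
  refine Finset.sum_congr rfl fun j hj => ?_
  obtain ⟨v, hv⟩ := isWalk_rotate hy j
  by_cases hr : y.rotate j = []
  · rw [hr]; simp [headTrace]
  · rw [headTrace_eq hr hv, o.bilinearExt_trace hne hz
      (mul_mem_pathSpan (o.corner_grad_mem hx hv) (wd_mem hv)), der_mul, map_add]

theorem sum_der_corner {ux uy : W ⊕ B} {x y z : List (Dart E)}
    (hx : Γ.toBipartiteGraph.IsWalk ux ux x) (hy : Γ.toBipartiteGraph.IsWalk uy uy y) :
    ∑ j ∈ Finset.range y.length, Γ.toBipartiteGraph.headTrace (y.rotate j)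
        (der (grad o.form z) (corner (grad o.form x) (y.rotate j)) * wd (y.rotate j)) =
      - o.attach z x y := by
  simp only [attach, corner_grad, map_sum, Finset.sum_mul, map_smul, smul_mul_assoc]
  rw [Finset.sum_comm, ← Finset.sum_neg_distrib]
  refine Finset.sum_congr rfl fun i _ => ?_
  rw [← Finset.sum_neg_distrib]
  refine Finset.sum_congr rfl fun j _ => ?_
  obtain ⟨u, hu⟩ := isWalk_rotate hx i
  obtain ⟨v, hv⟩ := isWalk_rotate hy j
  generalize x.rotate i = r at hu
  generalize y.rotate j = s at hv
  rw [o.pairing_skew r s, neg_smul, neg_neg]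
  by_cases huv : u = v
  · subst huv
    by_cases hr : r = []
    · subst hr; simp [pairing, corner_nil, corner_zero]
    by_cases hs : s = []
    · subst hs; simp [pairing, corner_nil]
    rw [headTrace_eq hr hu, headTrace_eq hs hv, trace_mul_comm (wd_mem hv)]
  · rw [o.pairing_eq_zero hu hv huv, zero_smul, zero_smul]

/-- The commutator of the derivations given by `x` and `z` is the derivation given by the difference of their
derivatives plus the commutator of the gradients; in the Jacobi identity only the latter survives. -/
theorem attach_sub_attach [Finite E] {ux uy uz : W ⊕ B} {x y z : List (Dart E)} (hxne : x ≠ []) (hne : z ≠ [])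
    (hx : Γ.toBipartiteGraph.IsWalk ux ux x) (hy : Γ.toBipartiteGraph.IsWalk uy uy y)
    (hz : Γ.toBipartiteGraph.IsWalk uz uz z) :
    o.attach x y z - o.attach z y x = Γ.toBipartiteGraph.trace uy (der (fun d =>
      grad o.form z d * grad o.form x d - grad o.form x d * grad o.form z d) (wd y)) := by
  have h1 := o.trace_der_der hne hx hy hz
  have h2 := o.trace_der_der hxne hz hy hx
  have h3 := congrArg (Γ.toBipartiteGraph.trace uy) (der_comm (grad o.form x) (grad o.form z) (wd y))
  rw [map_sub, h1, h2, trace_der' hy] at h3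
  have h4 : ∀ r : List (Dart E), corner (fun d => der (grad o.form x) (grad o.form z d) -
      der (grad o.form z) (grad o.form x d) +
      (grad o.form z d * grad o.form x d - grad o.form x d * grad o.form z d)) r =
      der (grad o.form x) (corner (grad o.form z) r) - der (grad o.form z) (corner (grad o.form x) r) +
      corner (fun d => grad o.form z d * grad o.form x d - grad o.form x d * grad o.form z d) r := by
    intro r
    rw [corner_add, corner_sub]
    congr 2
    · exact corner_map (der (grad o.form x)).toAddMonoidHom _ r
    · exact corner_map (der (grad o.form z)).toAddMonoidHom _ r
  simp only [h4, add_mul, sub_mul, map_add, map_sub, Finset.sum_add_distrib,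
    Finset.sum_sub_distrib] at h3
  rw [trace_der' hy]
  rw [← sub_eq_zero] at h3 ⊢
  rw [← h3]
  abel

/-- Writes the trace of a derivation, applied to a closed walk, as a sum over oriented edges instead of a sum
over corners. -/
theorem trace_der_eq_sum [Fintype (Dart E)] {K : Dart E → PathAlgebra E} {u : W ⊕ B}
    {y : List (Dart E)} (hy : Γ.toBipartiteGraph.IsWalk u u y) :
    Γ.toBipartiteGraph.trace u (der K (wd y)) =
      ∑ d, Γ.toBipartiteGraph.trace (Γ.toBipartiteGraph.src d) (K d * cycAt y d) := by
  classical
  have h1 : ∀ r : List (Dart E), corner K r = ∑ d, corner (Pi.single d (1 : ℚ)) r • K d := by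
    intro r
    have : K = fun x => ∑ d, (Pi.single d (1 : ℚ) : Dart E → ℚ) x • K d := by
      funext x
      simp [Pi.single_apply]
    conv_lhs => rw [this, corner_sum]
    refine Finset.sum_congr rfl fun d _ => ?_
    cases r with
    | nil => simp [corner]
    | cons d l => simp only [corner_cons, sub_smul]
  rw [trace_der' hy]
  simp only [h1, cycAt, cyc_eq_sum, Finset.sum_mul, Finset.mul_sum, map_sum, smul_mul_assoc,
    mul_smul_comm, map_smul]
  rw [Finset.sum_comm]
  refine Finset.sum_congr rfl fun d _ => Finset.sum_congr rfl fun i _ => ?_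
  obtain ⟨v, hv⟩ := isWalk_rotate hy i
  generalize y.rotate i = r at hv
  by_cases hr : r = []
  · subst hr; simp [corner]
  rw [headTrace_eq hr hv]
  by_cases hd : Γ.toBipartiteGraph.src d = v
  · rw [hd]
  · have h0 : corner (Pi.single d (1 : ℚ)) r = 0 := by
      refine corner_eq_zero (v := v) (c := 0) (fun d' hd' => ?_) hv
      rw [Pi.single_apply, if_neg]
      rintro rfl
      exact hd hd'
    rw [h0, zero_smul]
    convert (zero_smul ℚ _).symm

end VertexOrder

namespace VertexOrder

open PathAlgebra BipartiteGraph BipartiteRibbonGraph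

variable {W B E : Type*} {Γ : BipartiteRibbonGraph W B E} (o : VertexOrder Γ)

/-- The three products of signs at the ends of a triple of oriented edges add up to `1`, unless the
three edges coincide or are not at the same vertex. -/
theorem form_triple [DecidableEq (Dart E)] [DecidableEq (W ⊕ B)] (d₁ d₂ d₃ : Dart E) :
    o.form d₁ d₂ * o.form d₃ d₂ + o.form d₃ d₁ * o.form d₂ d₁ + o.form d₂ d₃ * o.form d₁ d₃ =
      (if Γ.toBipartiteGraph.src d₁ = Γ.toBipartiteGraph.src d₂ ∧
        Γ.toBipartiteGraph.src d₃ = Γ.toBipartiteGraph.src d₂ then 1 else 0) -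
      (if d₁ = d₂ ∧ d₃ = d₂ then 1 else 0) := by
  by_cases h : Γ.toBipartiteGraph.src d₁ = Γ.toBipartiteGraph.src d₂ ∧
        Γ.toBipartiteGraph.src d₃ = Γ.toBipartiteGraph.src d₂
  · obtain ⟨h1, h2⟩ := h
    rw [if_pos ⟨h1, h2⟩, o.form_of_eq h1, o.form_of_eq h2, o.form_of_eq (h2.trans h1.symm),
      o.form_of_eq h1.symm, o.form_of_eq h2.symm, o.form_of_eq (h1.trans h2.symm)]
    have e1 : d₁ = d₂ ↔ o.pos d₁ = o.pos d₂ := ⟨fun h => by rw [h], o.inj _ _ h1⟩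
    have e2 : d₃ = d₂ ↔ o.pos d₃ = o.pos d₂ := ⟨fun h => by rw [h], o.inj _ _ h2⟩
    simp only [e1, e2]
    generalize o.pos d₁ = a
    generalize o.pos d₂ = b
    generalize o.pos d₃ = c
    have hs : ∀ n : ℤ, 0 < n ∧ n.sign = 1 ∨ n = 0 ∧ n.sign = 0 ∨ n < 0 ∧ n.sign = -1 := fun n => by
      rcases lt_trichotomy n 0 with h | h | h
      · exact Or.inr (Or.inr ⟨h, Int.sign_eq_neg_one_of_neg h⟩)
      · exact Or.inr (Or.inl ⟨h, by rw [h]; rfl⟩)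
      · exact Or.inl ⟨h, Int.sign_eq_one_of_pos h⟩
    have n1 : (a - b).sign = - (b - a).sign := by rw [← Int.sign_neg, neg_sub]
    have n2 : (b - c).sign = - (c - b).sign := by rw [← Int.sign_neg, neg_sub]
    have n3 : (c - a).sign = - (a - c).sign := by rw [← Int.sign_neg, neg_sub]
    rw [n1, n2, n3]
    rcases hs (b - a) with ⟨h1, k1⟩ | ⟨h1, k1⟩ | ⟨h1, k1⟩ <;>
      rcases hs (c - b) with ⟨h2, k2⟩ | ⟨h2, k2⟩ | ⟨h2, k2⟩ <;>
      rcases hs (a - c) with ⟨h3, k3⟩ | ⟨h3, k3⟩ | ⟨h3, k3⟩ <;> first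
      | (exfalso; omega)
      | (rw [k1, k2, k3, if_neg (by omega)]; norm_num)
      | (rw [k1, k2, k3, if_pos (by omega)]; norm_num)
  · rw [if_neg h, if_neg (fun h' => h (by rw [h'.1, h'.2]; exact ⟨rfl, rfl⟩))]
    by_cases h1 : Γ.toBipartiteGraph.src d₁ = Γ.toBipartiteGraph.src d₂
    · have h2 : Γ.toBipartiteGraph.src d₃ ≠ Γ.toBipartiteGraph.src d₂ := fun h2 => h ⟨h1, h2⟩
      rw [o.form_of_ne h2, o.form_of_ne (h1 ▸ h2 : Γ.toBipartiteGraph.src d₃ ≠ _),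
        o.form_of_ne h2.symm]
      simp
    · rw [o.form_of_ne h1, o.form_of_ne (Ne.symm h1)]
      by_cases h2 : Γ.toBipartiteGraph.src d₃ = Γ.toBipartiteGraph.src d₂
      · rw [o.form_of_ne (d := d₁) (d' := d₃) (h2 ▸ h1)]
        simp
      · rw [o.form_of_ne (Ne.symm h2)]
        simp

end VertexOrder

theorem map_sum_mul_sum {A M ι : Type*} [Ring A] [Algebra ℚ A] [AddCommGroup M] [Module ℚ M]
    (T : A →ₗ[ℚ] M) (s : Finset ι) (a b : ι → ℚ) (u v : ι → A) (c : A) :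
    T ((∑ i ∈ s, a i • u i) * (∑ j ∈ s, b j • v j) * c) =
      ∑ i ∈ s, ∑ j ∈ s, (a i * b j) • T (u i * v j * c) := by
  rw [Finset.sum_mul_sum]
  simp only [mul_smul_comm, Finset.sum_mul, smul_mul_assoc, map_sum, map_smul, smul_smul, mul_comm (b _)]

namespace BipartiteGraph

open PathAlgebra

variable {W B E : Type*} {G : BipartiteGraph W B E} [Fintype (Dart E)]

/-- A closed walk enters a vertex as often as it leaves it. -/
theorem sum_cycAt_eq_zero [DecidableEq (W ⊕ B)] {u : W ⊕ B} {l : List (Dart E)}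
    (hl : G.IsWalk u u l) (v : W ⊕ B) :
    ∑ d, (if G.src d = v then (1 : ℚ) else 0) • cycAt l d = 0 := by
  rw [← cyc_eq_sum_cycAt, cyc_const (G := G) (fun d d' h => by rw [h]) hl]

/-- The sum over the oriented edges vanishes since the two orientations of an edge cancel. -/
theorem sum_trace_cycAt_triple (x y z : List (Dart E)) :
    ∑ d, G.trace (G.src d) (cycAt x d * cycAt z d * cycAt y d) = 0 := by
  have key : ∑ d, G.trace (G.src d) (cycAt x d * cycAt z d * cycAt y d) =
      - ∑ d, G.trace (G.src d) (cycAt x d * cycAt z d * cycAt y d) := by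
    conv_lhs => rw [← Equiv.sum_comp (⟨Dart.rev, Dart.rev, rev_rev, rev_rev⟩ : Dart E ≃ Dart E)]
    rw [← Finset.sum_neg_distrib]
    refine Finset.sum_congr rfl fun d _ => ?_
    have h1 := wd_mul_rev d
    have h2 : ∀ a, wd [d] * (wd [d.rev] * a) = a := fun a => by rw [← mul_assoc, h1, one_mul]
    simp only [Equiv.coe_fn_mk, cycAt_rev, neg_mul, mul_neg, mul_assoc, h2, neg_neg]
    rw [map_neg, trace_mul_comm (dart_mem d.rev)]
    simp only [mul_assoc, h1, mul_one, tgt_rev]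
  have h2 : (2 : ℚ) • ∑ d, G.trace (G.src d) (cycAt x d * cycAt z d * cycAt y d) = 0 := by
    rw [two_smul]
    nth_rewrite 2 [key]
    exact add_neg_cancel _
  exact (smul_eq_zero.1 h2).resolve_left (by norm_num)

end BipartiteGraph

namespace VertexOrder

open PathAlgebra BipartiteGraph BipartiteRibbonGraph

variable {W B E : Type*} {Γ : BipartiteRibbonGraph W B E} (o : VertexOrder Γ)

theorem trace_der_commutator [Fintype (Dart E)] {uy : W ⊕ B} {x y z : List (Dart E)}
    (hy : Γ.toBipartiteGraph.IsWalk uy uy y) :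
    Γ.toBipartiteGraph.trace uy (der (fun d =>
      grad o.form x d * grad o.form z d - grad o.form z d * grad o.form x d) (wd y)) =
    (1 / 4 : ℚ) • ∑ d₂, ∑ d₁, ∑ d₃, (o.form d₁ d₂ * o.form d₃ d₂) •
      (Γ.toBipartiteGraph.trace (Γ.toBipartiteGraph.src d₂) (cycAt x d₁ * cycAt z d₃ * cycAt y d₂) -
      Γ.toBipartiteGraph.trace (Γ.toBipartiteGraph.src d₂)
        (cycAt z d₃ * cycAt x d₁ * cycAt y d₂)) := by
  rw [trace_der_eq_sum hy, Finset.smul_sum]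
  refine Finset.sum_congr rfl fun d₂ _ => ?_
  simp only [grad, cyc_eq_sum_cycAt, Finset.smul_sum, smul_smul]
  rw [sub_mul, map_sub, map_sum_mul_sum, map_sum_mul_sum, Finset.sum_comm (γ := Dart E),
    ← Finset.sum_sub_distrib]
  rw [Finset.sum_comm]
  refine Finset.sum_congr rfl fun d₁ _ => ?_
  rw [← Finset.sum_sub_distrib]
  refine Finset.sum_congr rfl fun d₃ _ => ?_
  module

/-- The Jacobi identity for closed walks: the double brackets cancel up to commutators of gradients, which
cancel by `form_triple`. -/
theorem jacobi_walk [Finite E] {ux uy uz : W ⊕ B} {x y z : List (Dart E)}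
    (hx0 : x ≠ []) (hy0 : y ≠ []) (hz0 : z ≠ [])
    (hx : Γ.toBipartiteGraph.IsWalk ux ux x)
    (hy : Γ.toBipartiteGraph.IsWalk uy uy y) (hz : Γ.toBipartiteGraph.IsWalk uz uz z) :
    Γ.toBipartiteGraph.trace uz (der (grad o.form x) (der (grad o.form y) (wd z))) +
    Γ.toBipartiteGraph.trace ux (der (grad o.form y) (der (grad o.form z) (wd x))) +
    Γ.toBipartiteGraph.trace uy (der (grad o.form z) (der (grad o.form x) (wd y))) = 0 := by
  classical
  have := Fintype.ofFinite E
  have a1 := o.attach_sub_attach hz0 hx0 hz hy hx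
  have a2 := o.attach_sub_attach hx0 hy0 hx hz hy
  have a3 := o.attach_sub_attach hy0 hz0 hy hx hz
  rw [o.trace_der_commutator hy] at a1
  rw [o.trace_der_commutator hz] at a2
  rw [o.trace_der_commutator hx] at a3
  rw [o.trace_der_der hx0 hy hz hx, o.trace_der_der hy0 hz hx hy, o.trace_der_der hz0 hx hy hz,
    o.sum_der_corner hy hz, o.sum_der_corner hz hx, o.sum_der_corner hx hy]
  set T := Γ.toBipartiteGraph.trace with hT
  set s := Γ.toBipartiteGraph.src with hs
  -- all three commutators are sums of the same two cyclic products
  set F : Dart E → Dart E → Dart E → (Γ.L →₀ ℚ) := fun d₁ d₂ d₃ =>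
    T (s d₂) (cycAt x d₁ * cycAt z d₃ * cycAt y d₂) -
      T (s d₂) (cycAt z d₃ * cycAt x d₁ * cycAt y d₂) with hF
  have b2 : ∀ d₁ d₂ d₃, (o.form d₂ d₃ * o.form d₁ d₃) •
      (T (s d₃) (cycAt y d₂ * cycAt x d₁ * cycAt z d₃) -
        T (s d₃) (cycAt x d₁ * cycAt y d₂ * cycAt z d₃)) =
      (o.form d₂ d₃ * o.form d₁ d₃) • F d₁ d₂ d₃ := by
    intro d₁ d₂ d₃
    by_cases h1 : s d₂ = s d₃
    · have m2 := cycAt_mem hy d₂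
      have m3 := cycAt_mem hz d₃
      rw [← hs, h1] at m2
      simp only [hF, hT]
      rw [h1, mul_assoc, trace_mul_comm m2, mul_assoc (cycAt z d₃) (cycAt x d₁), trace_mul_comm m3]
    · rw [o.form_of_ne h1]; simp
  have b3 : ∀ d₁ d₂ d₃, (o.form d₃ d₁ * o.form d₂ d₁) •
      (T (s d₁) (cycAt z d₃ * cycAt y d₂ * cycAt x d₁) -
        T (s d₁) (cycAt y d₂ * cycAt z d₃ * cycAt x d₁)) =
      (o.form d₃ d₁ * o.form d₂ d₁) • F d₁ d₂ d₃ := by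
    intro d₁ d₂ d₃
    by_cases h1 : s d₂ = s d₁
    · have m1 := cycAt_mem hx d₁
      have m2 := cycAt_mem hy d₂
      rw [← hs, h1] at m2
      simp only [hF, hT]
      rw [h1, mul_assoc (cycAt x d₁), trace_mul_comm m1, mul_assoc (cycAt y d₂), trace_mul_comm m2]
    · rw [o.form_of_ne (Ne.symm h1 : s d₁ ≠ s d₂) |> fun h => (o.form_skew d₁ d₂).trans (by rw [h, neg_zero])]
      simp
  simp only [b2] at a2
  simp only [b3] at a3
  have c2 : ∑ d₃, ∑ d₂, ∑ d₁, (o.form d₂ d₃ * o.form d₁ d₃) • F d₁ d₂ d₃ =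
      ∑ d₂, ∑ d₁, ∑ d₃, (o.form d₂ d₃ * o.form d₁ d₃) • F d₁ d₂ d₃ := by
    rw [Finset.sum_comm]
    refine Finset.sum_congr rfl fun d₂ _ => Finset.sum_comm
  have c3 : ∑ d₁, ∑ d₃, ∑ d₂, (o.form d₃ d₁ * o.form d₂ d₁) • F d₁ d₂ d₃ =
      ∑ d₂, ∑ d₁, ∑ d₃, (o.form d₃ d₁ * o.form d₂ d₁) • F d₁ d₂ d₃ := by
    rw [Finset.sum_comm (s := (Finset.univ : Finset (Dart E))) (t := Finset.univ)
      (f := fun d₂ d₁ => ∑ d₃, (o.form d₃ d₁ * o.form d₂ d₁) • F d₁ d₂ d₃)]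
    exact Finset.sum_congr rfl fun d₁ _ => Finset.sum_comm
  have total : (1 / 4 : ℚ) • ∑ d₂, ∑ d₁, ∑ d₃, (o.form d₁ d₂ * o.form d₃ d₂ +
      o.form d₃ d₁ * o.form d₂ d₁ + o.form d₂ d₃ * o.form d₁ d₃) • F d₁ d₂ d₃ = 0 := by
    rw [smul_eq_zero]
    right
    simp only [o.form_triple, sub_smul, Finset.sum_sub_distrib]
    -- The sum over all edges at a vertex is a product with the factor `∑ d, cycAt x d`, which
    -- vanishes.
    have hsame : ∀ d₂, ∑ d₁, ∑ d₃, (if s d₁ = s d₂ ∧ s d₃ = s d₂ then (1 : ℚ) else 0) • F d₁ d₂ d₃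
        = 0 := by
      intro d₂
      have hxs := sum_cycAt_eq_zero hx (s d₂)
      have hzs := sum_cycAt_eq_zero hz (s d₂)
      have e1 : ∑ d₁, ∑ d₃, (if s d₁ = s d₂ ∧ s d₃ = s d₂ then (1 : ℚ) else 0) • F d₁ d₂ d₃ =
          T (s d₂) ((∑ d, (if s d = s d₂ then (1 : ℚ) else 0) • cycAt x d) *
            (∑ d, (if s d = s d₂ then (1 : ℚ) else 0) • cycAt z d) * cycAt y d₂) -
          T (s d₂) ((∑ d, (if s d = s d₂ then (1 : ℚ) else 0) • cycAt z d) *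
            (∑ d, (if s d = s d₂ then (1 : ℚ) else 0) • cycAt x d) * cycAt y d₂) := by
        rw [map_sum_mul_sum, map_sum_mul_sum, Finset.sum_comm (f := fun i j =>
          ((if s i = s d₂ then (1 : ℚ) else 0) * (if s j = s d₂ then (1 : ℚ) else 0)) •
            T (s d₂) (cycAt z i * cycAt x j * cycAt y d₂)), ← Finset.sum_sub_distrib]
        refine Finset.sum_congr rfl fun d₁ _ => ?_
        rw [← Finset.sum_sub_distrib]
        refine Finset.sum_congr rfl fun d₃ _ => ?_
        simp only [hF, smul_sub]
        congr 2 <;> by_cases h1 : s d₁ = s d₂ <;> by_cases h3 : s d₃ = s d₂ <;> simp [h1, h3]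
      rw [e1, hxs, hzs]
      simp
    -- On the diagonal, the two orientations of an edge cancel.
    have hdiag : ∑ d₂, ∑ d₁, ∑ d₃, (if d₁ = d₂ ∧ d₃ = d₂ then (1 : ℚ) else 0) • F d₁ d₂ d₃ = 0 := by
      have e2 : ∀ d₂, ∑ d₁, ∑ d₃, (if d₁ = d₂ ∧ d₃ = d₂ then (1 : ℚ) else 0) • F d₁ d₂ d₃ =
          F d₂ d₂ d₂ := by
        intro d₂
        simp [ite_and]
      rw [Finset.sum_congr rfl fun d₂ _ => e2 d₂]
      simp only [hF, hT, hs, Finset.sum_sub_distrib]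
      rw [sum_trace_cycAt_triple x y z, sum_trace_cycAt_triple z y x, sub_zero]
    rw [hdiag, sub_zero]
    exact Finset.sum_eq_zero fun d₂ _ => hsame d₂
  rw [c2] at a2
  rw [c3] at a3
  simp only [add_smul, Finset.sum_add_distrib, smul_add] at total
  rw [← total, ← a1, ← a2, ← a3]
  abel

end VertexOrder

namespace BipartiteRibbonGraph

open PathAlgebra BipartiteGraph

variable {W B E : Type*} [Finite E] (Γ : BipartiteRibbonGraph W B E)

theorem goldman_skew (a b : Γ.L) : Γ.goldman b a = - Γ.goldman a b := by
  induction a using Quot.ind with | _ x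
  induction b using Quot.ind with | _ y
  exact walkBracket_skew x.2 y.2

/-- The Jacobi identity for the Goldman bracket of three loops. -/
theorem goldman_jacobi (a b c : Γ.L) :
    bilinearExt Γ.goldman (Finsupp.single a 1) (Γ.goldman b c) +
    bilinearExt Γ.goldman (Finsupp.single b 1) (Γ.goldman c a) +
    bilinearExt Γ.goldman (Finsupp.single c 1) (Γ.goldman a b) = 0 := by
  obtain ⟨o⟩ := VertexOrder.nonempty Γ
  obtain ⟨ux, x, hx0, hx, ex⟩ := exists_pathLoop a
  obtain ⟨uy, y, hy0, hy, ey⟩ := exists_pathLoop b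
  obtain ⟨uz, z, hz0, hz, ez⟩ := exists_pathLoop c
  rw [← bilinearExt_single Γ.goldman b c, ← bilinearExt_single Γ.goldman c a,
    ← bilinearExt_single Γ.goldman a b, ← ex, ← ey, ← ez,
    o.bilinearExt_trace hy0 hy (wd_mem hz), o.bilinearExt_trace hz0 hz (wd_mem hx),
    o.bilinearExt_trace hx0 hx (wd_mem hy),
    o.bilinearExt_trace hx0 hx (der_mem (o.grad_mem hy) (wd_mem hz)),
    o.bilinearExt_trace hy0 hy (der_mem (o.grad_mem hz) (wd_mem hx)),
    o.bilinearExt_trace hz0 hz (der_mem (o.grad_mem hx) (wd_mem hy))]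
  exact o.jacobi_walk hx0 hy0 hz0 hx hy hz

end BipartiteRibbonGraph

/-! ### Integrality of the bracket -/

/-- The finite formal sums with integral coefficients. -/
def integralSums (X : Type*) : AddSubgroup (X →₀ ℚ) where
  carrier := {f | HasIntegralCoeffs f}
  zero_mem' _ := ⟨0, by simp⟩
  add_mem' {f g} hf hg x := by
    obtain ⟨a, ha⟩ := hf x
    obtain ⟨b, hb⟩ := hg x
    exact ⟨a + b, by rw [Finsupp.add_apply, ha, hb, Int.cast_add]⟩
  neg_mem' {f} hf x := by
    obtain ⟨a, ha⟩ := hf x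
    exact ⟨-a, by rw [Finsupp.neg_apply, ha, Int.cast_neg]⟩

theorem int_smul_mem_integralSums {X : Type*} {f : X →₀ ℚ} (hf : f ∈ integralSums X) (k : ℤ) :
    (k : ℚ) • f ∈ integralSums X := by
  rw [Int.cast_smul_eq_zsmul]
  exact zsmul_mem hf k

theorem single_mem_integralSums {X : Type*} (x : X) (k : ℤ) :
    Finsupp.single x (k : ℚ) ∈ integralSums X := fun y => by
  classical
  rw [Finsupp.single_apply]
  split_ifs
  · exact ⟨k, rfl⟩
  · exact ⟨0, by simp⟩

namespace BipartiteGraph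

variable {W B E : Type*} {G : BipartiteGraph W B E}

theorem loopTerm_mem_integralSums (l : List (Dart E)) : G.loopTerm l ∈ integralSums G.Loops := by
  unfold loopTerm
  split_ifs
  · rw [← Int.cast_one (R := ℚ)]
    exact single_mem_integralSums _ 1
  · exact zero_mem _

end BipartiteGraph

namespace VertexOrder

open PathAlgebra BipartiteGraph BipartiteRibbonGraph

variable {W B E : Type*} {Γ : BipartiteRibbonGraph W B E} (o : VertexOrder Γ)

theorem form_parity [DecidableEq (Dart E)] {d d' : Dart E}
    (h : Γ.toBipartiteGraph.src d = Γ.toBipartiteGraph.src d') :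
    ∃ k : ℤ, o.form d d' = (1 - if d = d' then 1 else 0) + 2 * k := by
  rw [o.form_of_eq h]
  split_ifs with hd
  · exact ⟨0, by simp [hd]⟩
  · rcases lt_trichotomy (o.pos d' - o.pos d) 0 with h1 | h1 | h1
    · exact ⟨-1, by rw [Int.sign_eq_neg_one_of_neg h1]; norm_num⟩
    · exact absurd (o.inj _ _ h (by omega)) hd
    · exact ⟨0, by rw [Int.sign_eq_one_of_pos h1]; norm_num⟩

end VertexOrder

namespace BipartiteRibbonGraph

open PathAlgebra BipartiteGraph

variable {W B E : Type*} {Γ : BipartiteRibbonGraph W B E}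

section

variable [DecidableEq (Dart E)]

/-- The loop composed of two closed walks, if they go out along the same oriented edge. -/
def sameHead (Γ : BipartiteRibbonGraph W B E) (r s : List (Dart E)) : Γ.L →₀ ℚ :=
  if r.head? = s.head? then Γ.toBipartiteGraph.loopTerm (s ++ r) else 0

/-- The loop composed of two closed walks, if they come in along the same oriented edge. -/
def sameLast (Γ : BipartiteRibbonGraph W B E) (r s : List (Dart E)) : Γ.L →₀ ℚ :=
  if r.getLast? = s.getLast? then Γ.toBipartiteGraph.loopTerm (s ++ r) else 0

/-- The loop composed of two closed walks, if the second goes out where the first comes in. -/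
def lastHead (Γ : BipartiteRibbonGraph W B E) (r s : List (Dart E)) : Γ.L →₀ ℚ :=
  if r.getLast?.map Dart.rev = s.head? then Γ.toBipartiteGraph.loopTerm (s ++ r) else 0

/-- The loop composed of two closed walks, if the first goes out where the second comes in. -/
def headLast (Γ : BipartiteRibbonGraph W B E) (r s : List (Dart E)) : Γ.L →₀ ℚ :=
  if s.getLast?.map Dart.rev = r.head? then Γ.toBipartiteGraph.loopTerm (s ++ r) else 0

theorem sameLast_rotate {r s : List (Dart E)} (hr : r ≠ []) (hs : s ≠ []) :
    Γ.sameLast (r.rotate 1) (s.rotate 1) = Γ.sameHead r s := by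
  cases r with
  | nil => exact absurd rfl hr
  | cons d r =>
    cases s with
    | nil => exact absurd rfl hs
    | cons d' s =>
      simp only [sameLast, sameHead, List.rotate_cons_succ, List.rotate_zero, List.getLast?_concat,
        List.head?_cons, Option.some.injEq]
      split_ifs with h
      · subst h
        rw [← List.append_assoc, loopTerm_comm _ [d]]
        simp
      · rfl

theorem lastHead_rotate {u v : W ⊕ B} {r s : List (Dart E)} (hr : r ≠ []) (hs : s ≠ [])
    (hu : Γ.toBipartiteGraph.IsWalk u u r) (hv : Γ.toBipartiteGraph.IsWalk v v s) :
    Γ.lastHead (r.rotate 1) s = Γ.headLast r (s.rotate 1) := by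
  cases r with
  | nil => exact absurd rfl hr
  | cons d r =>
    cases s with
    | nil => exact absurd rfl hs
    | cons d' s =>
      simp only [lastHead, headLast, List.rotate_cons_succ, List.rotate_zero, List.getLast?_concat,
        List.head?_cons, Option.some.injEq, Option.map_some]
      by_cases h : d.rev = d'
      · subst h
        rw [if_pos rfl, if_pos (rev_rev d)]
        obtain ⟨rfl, hu⟩ := hu
        obtain ⟨rfl, hv⟩ := hv
        rw [tgt_rev] at hv
        rw [src_rev] at hv
        have hd : Γ.toBipartiteGraph.IsWalk (Γ.toBipartiteGraph.src d) (Γ.toBipartiteGraph.tgt d) [d] :=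
          ⟨rfl, rfl⟩
        have hd' : Γ.toBipartiteGraph.IsWalk (Γ.toBipartiteGraph.tgt d) (Γ.toBipartiteGraph.src d)
            [d.rev] := ⟨rfl, tgt_rev d⟩
        rw [← trace_wd (u := Γ.toBipartiteGraph.tgt d) (by simp)
            (isWalk_append (l₁ := d.rev :: s).2 ⟨_, ⟨rfl, by rwa [tgt_rev]⟩, isWalk_append.2 ⟨_, hu, hd⟩⟩),
          ← trace_wd (u := Γ.toBipartiteGraph.src d) (by simp)
            (isWalk_append.2 ⟨_, isWalk_append.2 ⟨_, hv, hd'⟩, show Γ.toBipartiteGraph.IsWalk _ _ (d :: r) from ⟨rfl, hu⟩⟩)]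
        have h1 := wd_mul_rev d
        have h2 := wd_rev_mul d
        rw [List.cons_append, wd_cons, trace_mul_comm (wd_mem hd')]
        simp only [wd_append, wd_cons d r, mul_assoc, h1, mul_one]
        rw [← mul_assoc (wd [d.rev]), h2, one_mul]
      · rw [if_neg h, if_neg]
        rintro rfl
        exact h (rev_rev _)

/-- Modulo formal sums with integral coefficients, the contribution of two closed walks to their
bracket depends only on which of the four oriented edges at the common vertex coincide. -/
theorem bracketTerm_sub_mem [Finite E] {u v : W ⊕ B} {r s : List (Dart E)} (hr : r ≠ [])
    (hs : s ≠ []) (hu : Γ.toBipartiteGraph.IsWalk u u r) (hv : Γ.toBipartiteGraph.IsWalk v v s) :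
    Γ.bracketTerm r s - (1 / 2 : ℚ) • (Γ.lastHead r s + Γ.headLast r s - Γ.sameHead r s -
      Γ.sameLast r s) ∈ integralSums Γ.L := by
  obtain ⟨x, y, h1, h2, h3, h4⟩ := closedWalk_ends hr hu
  obtain ⟨z, t, k1, k2, k3, k4⟩ := closedWalk_ends hs hv
  by_cases huv : v = u
  · subst huv
    obtain ⟨o⟩ := VertexOrder.nonempty Γ
    obtain ⟨a1, e1⟩ := o.form_parity (h3.trans k3.symm)
    obtain ⟨a2, e2⟩ := o.form_parity (h4.trans k3.symm)
    obtain ⟨a3, e3⟩ := o.form_parity (h3.trans k4.symm)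
    obtain ⟨a4, e4⟩ := o.form_parity (h4.trans k4.symm)
    have hxz : x.rev = z.rev ↔ x = z :=
      ⟨fun h => by rw [← rev_rev x, h, rev_rev], fun h => by rw [h]⟩
    have hzy : z.rev = y ↔ y = z.rev := eq_comm
    have : Γ.bracketTerm r s - (1 / 2 : ℚ) • (Γ.lastHead r s + Γ.headLast r s - Γ.sameHead r s -
      Γ.sameLast r s) = ((a1 - a2 - a3 + a4 : ℤ) : ℚ) • Γ.toBipartiteGraph.loopTerm (s ++ r) := by
      simp only [bracketTerm, passageForm, lastHead, headLast, sameHead, sameLast, h1, h2, k1, k2,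
        Option.map_some, Option.some.injEq]
      rw [o.form_corner (h4.trans h3.symm) (k4.trans h3.symm) (k3.trans h3.symm), e1, e2, e3, e4]
      have hi : ∀ (p : Prop) [Decidable p] (f : Γ.L →₀ ℚ), (if p then f else 0) =
          (if p then (1 : ℚ) else 0) • f := by intros; split_ifs <;> simp
      simp only [hi _ (Γ.toBipartiteGraph.loopTerm (s ++ r)), ← add_smul, ← sub_smul, smul_smul, hxz,
        hzy]
      congr 1
      push_cast
      ring
    rw [this]
    exact int_smul_mem_integralSums (loopTerm_mem_integralSums _) _
  · have hc : Γ.toBipartiteGraph.loopTerm (s ++ r) = 0 := by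
      rw [loopTerm, dif_neg]
      rw [isClosedWalk_append hs hr hv hu]
      exact huv
    simp [bracketTerm, lastHead, headLast, sameHead, sameLast, hc]

end

variable (Γ)

/-- Modulo integers, the coefficient of a corner is half the number of coincidences between the ends of the
passages, and moving both walks by one edge pairs these coincidences. -/
theorem goldman_integral [Finite E] (a b : Γ.L) : Γ.goldman a b ∈ integralSums Γ.L := by
  classical
  induction a using Quot.ind with | _ x
  induction b using Quot.ind with | _ y
  obtain ⟨x, hx0, u, hu⟩ := x
  obtain ⟨y, hy0, v, hv⟩ := y
  change Γ.walkBracket x y ∈ _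
  have ne : ∀ {l : List (Dart E)}, l ≠ [] → ∀ i, l.rotate i ≠ [] := fun h i h' =>
    h (List.rotate_eq_nil_iff.1 h')
  -- A common edge is seen once from its beginning and once from its end.
  have h1 : ∑ i ∈ Finset.range x.length, ∑ j ∈ Finset.range y.length,
      Γ.sameLast (x.rotate i) (y.rotate j) = ∑ i ∈ Finset.range x.length,
        ∑ j ∈ Finset.range y.length, Γ.sameHead (x.rotate i) (y.rotate j) := by
    rw [sum_rotate_one (fun r => ∑ j ∈ Finset.range y.length, Γ.sameLast r (y.rotate j))]
    refine Finset.sum_congr rfl fun i _ => ?_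
    rw [sum_rotate_one (fun s => Γ.sameLast _ s)]
    exact Finset.sum_congr rfl fun j _ => sameLast_rotate (ne hx0 i) (ne hy0 j)
  have h2 : ∑ i ∈ Finset.range x.length, ∑ j ∈ Finset.range y.length,
      Γ.lastHead (x.rotate i) (y.rotate j) = ∑ i ∈ Finset.range x.length,
        ∑ j ∈ Finset.range y.length, Γ.headLast (x.rotate i) (y.rotate j) := by
    rw [sum_rotate_one (fun r => ∑ j ∈ Finset.range y.length, Γ.lastHead r (y.rotate j))]
    refine Finset.sum_congr rfl fun i _ => ?_
    rw [sum_rotate_one (fun s => Γ.headLast _ s)]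
    refine Finset.sum_congr rfl fun j _ => ?_
    obtain ⟨u', hu'⟩ := isWalk_rotate hu i
    obtain ⟨v', hv'⟩ := isWalk_rotate hv j
    exact lastHead_rotate (ne hx0 i) (ne hy0 j) hu' hv'
  have h3 : ∑ i ∈ Finset.range x.length, ∑ j ∈ Finset.range y.length,
      (Γ.bracketTerm (x.rotate i) (y.rotate j) - (1 / 2 : ℚ) • (Γ.lastHead (x.rotate i) (y.rotate j) +
        Γ.headLast (x.rotate i) (y.rotate j) - Γ.sameHead (x.rotate i) (y.rotate j) -
        Γ.sameLast (x.rotate i) (y.rotate j))) ∈ integralSums Γ.L := by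
    refine sum_mem fun i _ => sum_mem fun j _ => ?_
    obtain ⟨u', hu'⟩ := isWalk_rotate hu i
    obtain ⟨v', hv'⟩ := isWalk_rotate hv j
    exact bracketTerm_sub_mem (ne hx0 i) (ne hy0 j) hu' hv'
  simp only [Finset.sum_sub_distrib, ← Finset.smul_sum, Finset.sum_add_distrib, h1, h2] at h3
  have h4 : ∑ i ∈ Finset.range x.length, ∑ j ∈ Finset.range y.length,
      (Γ.headLast (x.rotate i) (y.rotate j) - Γ.sameHead (x.rotate i) (y.rotate j)) ∈
      integralSums Γ.L := by
    refine sum_mem fun i _ => sum_mem fun j _ => sub_mem ?_ ?_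
    · unfold headLast; split_ifs
      exacts [loopTerm_mem_integralSums _, zero_mem _]
    · unfold sameHead; split_ifs
      exacts [loopTerm_mem_integralSums _, zero_mem _]
  simp only [Finset.sum_sub_distrib] at h4
  have h5 := add_mem h3 h4
  rw [walkBracket]
  convert h5 using 1
  module

end BipartiteRibbonGraph

/-! ### Substitutions of paths for edges -/

/-- The path which is substituted for an oriented edge, if the path `f e` is substituted for the edge
`e`. -/
def subLetter {E E' : Type*} (f : E' → List (Dart E)) (d : Dart E') : List (Dart E) :=
  if d.2 then f d.1 else reversePath (f d.1)

/-- Substitution of paths for the edges in a path. -/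
def subWalk {E E' : Type*} (f : E' → List (Dart E)) (l : List (Dart E')) : List (Dart E) :=
  l.flatMap (subLetter f)

theorem reversePath_reversePath {E : Type*} (l : List (Dart E)) :
    reversePath (reversePath l) = l := by
  unfold reversePath
  rw [List.map_reverse, List.reverse_reverse, List.map_map]
  conv_rhs => rw [← List.map_id l]
  exact List.map_congr_left fun d _ => BipartiteGraph.rev_rev d

theorem reversePath_append {E : Type*} (l₁ l₂ : List (Dart E)) :
    reversePath (l₁ ++ l₂) = reversePath l₂ ++ reversePath l₁ := by
  simp [reversePath]

section Substitution

variable {E E' E'' : Type*} (f : E' → List (Dart E))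

theorem subLetter_rev (d : Dart E') : subLetter f d.rev = reversePath (subLetter f d) := by
  obtain ⟨e, b⟩ := d
  cases b
  · simp [subLetter, Dart.rev, reversePath_reversePath]
  · simp [subLetter, Dart.rev]

theorem subWalk_append (l₁ l₂ : List (Dart E')) :
    subWalk f (l₁ ++ l₂) = subWalk f l₁ ++ subWalk f l₂ := by
  simp [subWalk]

theorem subWalk_cons (d : Dart E') (l : List (Dart E')) :
    subWalk f (d :: l) = subLetter f d ++ subWalk f l := rfl

theorem subWalk_reversePath (l : List (Dart E')) :
    subWalk f (reversePath l) = reversePath (subWalk f l) := by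
  induction l with
  | nil => rfl
  | cons d l ih =>
    have : reversePath (d :: l) = reversePath l ++ [d.rev] := by simp [reversePath]
    rw [this, subWalk_append, ih, subWalk_cons, subWalk_cons, reversePath_append, subLetter_rev]
    simp [subWalk]

theorem subWalk_subWalk (g : E'' → List (Dart E')) (l : List (Dart E'')) :
    subWalk f (subWalk g l) = subWalk (fun e => subWalk f (g e)) l := by
  induction l with
  | nil => rfl
  | cons d l ih =>
    rw [subWalk_cons, subWalk_append, ih, subWalk_cons]
    congr 1
    obtain ⟨e, b⟩ := d
    cases b
    · exact subWalk_reversePath f (g e)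
    · rfl

theorem subWalk_single (l : List (Dart E)) : subWalk (fun e => [(e, true)]) l = l := by
  induction l with
  | nil => rfl
  | cons d l ih =>
    rw [subWalk_cons, ih]
    obtain ⟨e, b⟩ := d
    cases b <;> rfl

/-- The homomorphism of free groups given by a substitution. -/
def subHom : FreeGroup E' →* FreeGroup E := FreeGroup.lift fun e => FreeGroup.mk (f e)

theorem subHom_mk (l : List (Dart E')) : subHom f (FreeGroup.mk l) = FreeGroup.mk (subWalk f l) := by
  induction l with
  | nil => exact map_one _
  | cons d l ih =>
    have h : FreeGroup.mk (d :: l) = FreeGroup.mk [d] * FreeGroup.mk l := rfl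
    rw [h, map_mul, ih, subWalk_cons, ← FreeGroup.mul_mk]
    congr 1
    obtain ⟨e, b⟩ := d
    cases b
    · have h2 : FreeGroup.mk [(e, false)] = (FreeGroup.of e)⁻¹ := rfl
      rw [h2, map_inv, subHom, FreeGroup.lift_apply_of]
      simp [subLetter, PathAlgebra.wd_rev_eq]
    · exact FreeGroup.lift_apply_of

namespace PathAlgebra

/-- The homomorphism of path algebras given by a substitution. -/
def subAlg : PathAlgebra E' →ₐ[ℚ] PathAlgebra E := MonoidAlgebra.mapDomainAlgHom ℚ ℚ (subHom f)

theorem subAlg_wd (l : List (Dart E')) : subAlg f (wd l) = wd (subWalk f l) := by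
  rw [wd, wd, ← subHom_mk]
  simp [subAlg]

/-- A derivation along an algebra homomorphism given by a substitution is determined by its values on
the edges. -/
theorem der_subAlg {K : Dart E → PathAlgebra E} {K' : Dart E' → PathAlgebra E'}
    (h : ∀ e, der K (wd (f e)) = subAlg f (der K' (wd [(e, true)]))) (a : PathAlgebra E') :
    der K (subAlg f a) = subAlg f (der K' a) := by
  have h1 : ∀ d, der K (subAlg f (wd [d])) = subAlg f (der K' (wd [d])) := by
    intro d
    obtain ⟨e, b⟩ := d
    have ht : der K (subAlg f (wd [(e, true)])) = subAlg f (der K' (wd [(e, true)])) := by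
      rw [subAlg_wd, ← h]; simp [subWalk, subLetter]
    cases b
    · have e1 := wd_rev_mul (e, true)
      have e2 := wd_mul_rev (e, true)
      simp only [Dart.rev, Bool.not_true] at e1 e2
      have d1 := congrArg (der K) (congrArg (subAlg f) e1)
      have d2 := congrArg (subAlg f) (congrArg (der K') e1)
      have e3 := congrArg (subAlg f) e2
      rw [map_one, der_one, map_mul, der_mul] at d1
      rw [der_one, map_zero, der_mul, map_add, map_mul, map_mul, ← ht] at d2
      rw [map_mul, map_one] at e3
      have d3 := add_right_cancel (d1.trans d2.symm)
      have d4 := congrArg (· * subAlg f (wd [(e, false)])) d3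
      simpa only [mul_assoc, e3, mul_one] using d4
    · exact ht
  suffices der K ∘ₗ (subAlg f).toLinearMap = (subAlg f).toLinearMap ∘ₗ der K' from
    LinearMap.congr_fun this a
  refine hom_ext fun l => ?_
  change der K (subAlg f (wd l)) = subAlg f (der K' (wd l))
  induction l with
  | nil => simp [der_one]
  | cons d l ih => rw [wd_cons, map_mul, der_mul, ih, h1, der_mul, map_add, map_mul, map_mul]

end PathAlgebra

end Substitution

/-! ### Sliding an edge along two others -/

namespace PathAlgebra

variable {E : Type*}

section Slide

variable [DecidableEq E] (a b e : E)

/-- The substitution of `a b⁻¹ e` for the edge `e`. -/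
def slide (x : E) : List (Dart E) :=
  if x = e then [(a, true), (b, false), (e, true)] else [(x, true)]

/-- The cyclic derivative of a closed walk after sliding the edge `e`. -/
theorem cyc_slide (p : Dart E → ℚ) (l : List (Dart E)) :
    cyc p (subWalk (slide a b e) l) =
      subAlg (slide a b e) (cyc (Function.update p (e, true) (p (a, true))) l) +
      (p (e, true) - p (b, true)) • (wd [(b, true), (a, false)] *
        subAlg (slide a b e) (cycAt l (e, true)) * wd [(a, true), (b, false)]) +
      (p (b, false) - p (a, false)) • (wd [(a, false)] *
        subAlg (slide a b e) (cycAt l (e, true)) * wd [(a, true)]) := by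
  classical
  have ha1 : wd [(a, false)] * wd [(a, true)] = 1 := wd_rev_mul (a, true)
  have ha1' : ∀ z, wd [(a, false)] * (wd [(a, true)] * z) = z := fun z => by
    rw [← mul_assoc, ha1, one_mul]
  have hb1 : wd [(b, true)] * wd [(b, false)] = 1 := wd_mul_rev (b, true)
  have hb1' : ∀ z, wd [(b, true)] * (wd [(b, false)] * z) = z := fun z => by
    rw [← mul_assoc, hb1, one_mul]
  have key : ∀ (l : List (Dart E)) (c : PathAlgebra E),
      cycAux p (subWalk (slide a b e) l) (subAlg (slide a b e) c) =
      subAlg (slide a b e) (cycAux (Function.update p (e, true) (p (a, true))) l c) +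
      (p (e, true) - p (b, true)) • (wd [(b, true), (a, false)] *
        subAlg (slide a b e) (cycAux (Pi.single (e, true) 1) l c) * wd [(a, true), (b, false)]) +
      (p (b, false) - p (a, false)) • (wd [(a, false)] *
        subAlg (slide a b e) (cycAux (Pi.single (e, true) 1) l c) * wd [(a, true)]) := by
    intro l
    induction l with
    | nil => intro c; simp [cycAux, subWalk]
    | cons d l ih =>
      intro c
      have hd : wd (subLetter (slide a b e) d) = subAlg (slide a b e) (wd [d]) := by
        rw [subAlg_wd]; simp [subWalk]
      rw [subWalk_cons, cycAux_append, hd, ← map_mul, ih, cycAux, cycAux, ← subAlg_wd, ← map_mul]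
      have hmain : cycAux p (subLetter (slide a b e) d) (subAlg (slide a b e) (wd l * c)) =
        subAlg (slide a b e) (Function.update p (e, true) (p (a, true)) d • (wd [d] * wd l * c) -
          Function.update p (e, true) (p (a, true)) d.rev • (wd l * c * wd [d])) +
        (p (e, true) - p (b, true)) • (wd [(b, true), (a, false)] *
          subAlg (slide a b e) ((Pi.single (e, true) (1 : ℚ) : Dart E → ℚ) d • (wd [d] * wd l * c) -
          (Pi.single (e, true) (1 : ℚ) : Dart E → ℚ) d.rev • (wd l * c * wd [d])) *
            wd [(a, true), (b, false)]) +
        (p (b, false) - p (a, false)) • (wd [(a, false)] *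
          subAlg (slide a b e) ((Pi.single (e, true) (1 : ℚ) : Dart E → ℚ) d • (wd [d] * wd l * c) -
          (Pi.single (e, true) (1 : ℚ) : Dart E → ℚ) d.rev • (wd l * c * wd [d])) * wd [(a, true)]) := by
        rw [mul_assoc (wd [d])]
        generalize wd l * c = c
        simp only [map_sub, map_smul, map_mul, ← hd]
        generalize subAlg (slide a b e) c = c
        obtain ⟨x, o⟩ := d
        by_cases hx : x = e
        · subst hx
          cases o
          · simp only [subLetter, slide, Dart.rev, reversePath, if_true, Bool.not_false, Function.update_self,
              Pi.single_eq_same]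
            simp [cycAux, wd_cons _ (_ :: _), mul_assoc, ha1', ha1, hb1, Dart.rev]
            module
          · simp [subLetter, slide, Dart.rev, cycAux, wd_cons _ (_ :: _), mul_assoc, ha1', hb1']
            module
        · have h1 : ((x, o) : Dart E) ≠ (e, true) := fun h => hx (congrArg Prod.fst h)
          have h2 : Dart.rev (x, o) ≠ (e, true) := fun h => hx (congrArg Prod.fst h)
          have h3 : subLetter (slide a b e) (x, o) = [(x, o)] := by
            cases o <;> simp [subLetter, slide, hx, reversePath, Dart.rev]
          simp [h3, h1, h2, cycAux]
      rw [hmain]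
      simp only [map_add, mul_add, add_mul, smul_add]
      abel
  have := key l 1
  rw [map_one] at this
  have hc : cycAux (Pi.single (e, true) 1) l 1 = cycAt l (e, true) := by
    rw [cycAt, cyc]
    congr!
  rw [cyc, this, cyc, hc]

/-- The form after sliding the edge `e` from the place immediately after `b` to the place immediately
before `a`, at the `∘`-ends. -/
def slideForm (s : Dart E → Dart E → ℚ) (d d' : Dart E) : ℚ :=
  if d = (e, true) then
    if d' = (e, true) then 0 else if d' = (a, true) then 1 else s (a, true) d'
  else if d' = (e, true) then if d = (a, true) then -1 else s d (a, true)
  else s d d'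

/-- The form `s` compares edges at common ends; at the `∘`-ends, `e` follows immediately after `b`, and
at the `•`-ends, `b` follows immediately after `a`. -/
structure IsSlide (s : Dart E → Dart E → ℚ) : Prop where
  ne_ab : a ≠ b
  ne_ae : a ≠ e
  ne_be : b ≠ e
  skew : ∀ d d', s d' d = - s d d'
  color : ∀ d d', d.2 ≠ d'.2 → s d d' = 0
  eb : ∀ x, x ≠ b → x ≠ e → s (e, true) (x, true) = s (b, true) (x, true)
  be : s (b, true) (e, true) = 1
  ab : ∀ x, x ≠ a → x ≠ b → s (a, false) (x, false) = s (b, false) (x, false)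
  ab_one : s (a, false) (b, false) = 1

variable {a b e} {s : Dart E → Dart E → ℚ}

theorem IsSlide.self (h : IsSlide a b e s) (d : Dart E) : s d d = 0 := by
  have := h.skew d d
  linarith

theorem grad_slide (l : List (Dart E)) (d : Dart E) :
    grad s (subWalk (slide a b e) l) d = (1 / 2 : ℚ) • (
      subAlg (slide a b e) (cyc (Function.update (fun d' => s d' d) (e, true) (s (a, true) d)) l) +
      (s (e, true) d - s (b, true) d) • (wd [(b, true), (a, false)] *
        subAlg (slide a b e) (cycAt l (e, true)) * wd [(a, true), (b, false)]) +
      (s (b, false) d - s (a, false) d) • (wd [(a, false)] *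
        subAlg (slide a b e) (cycAt l (e, true)) * wd [(a, true)])) := by
  rw [grad, cyc_slide]

theorem cyc_add_single [DecidableEq (Dart E)] (p : Dart E → ℚ) (c : ℚ) (d : Dart E)
    (l : List (Dart E)) : cyc (p + Pi.single d c) l = cyc p l + c • cycAt l d := by
  have h : (Pi.single d c : Dart E → ℚ) = c • Pi.single d (1 : ℚ) := by
    rw [← Pi.single_smul, smul_eq_mul, mul_one]
  rw [cyc, cycAux_add_fun, h, cycAux_smul_fun, cycAt, cyc, cyc]
  congr!

namespace IsSlide

theorem grad_white (h : IsSlide a b e s) (l : List (Dart E)) {x : E} (ha : x ≠ a) (hb : x ≠ b)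
    (he : x ≠ e) : grad s (subWalk (slide a b e) l) (x, true) =
      subAlg (slide a b e) (grad (slideForm a e s) l (x, true)) := by
  have h1 : s (e, true) (x, true) - s (b, true) (x, true) = 0 := by rw [h.eb x hb he, sub_self]
  have h2 : ∀ y, s (y, false) (x, true) = 0 := fun y => h.color _ _ (by simp)
  rw [grad_slide, h1, h2, h2, grad, map_smul]
  simp only [zero_smul, add_zero, sub_zero]
  congr 4
  funext d
  by_cases hd : d = (e, true)
  · subst hd; simp [slideForm, he, ha]
  · simp [slideForm, hd, he]

theorem grad_white_a (h : IsSlide a b e s) (l : List (Dart E)) :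
    grad s (subWalk (slide a b e) l) (a, true) =
      subAlg (slide a b e) (grad (slideForm a e s) l (a, true)) -
      (1 / 2 : ℚ) • subAlg (slide a b e) (cycAt l (e, true)) := by
  have h1 : s (e, true) (a, true) - s (b, true) (a, true) = 0 := by
    rw [h.eb a h.ne_ab h.ne_ae, sub_self]
  have h2 : ∀ y, s (y, false) (a, true) = 0 := fun y => h.color _ _ (by simp)
  have h3 : (fun d' => slideForm a e s d' (a, true)) =
      Function.update (fun d' => s d' (a, true)) (e, true) (s (a, true) (a, true)) +
        Pi.single (e, true) 1 := by
    funext d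
    by_cases hd : d = (e, true)
    · subst hd; simp [slideForm, h.self, h.ne_ae]
    · simp [slideForm, hd, h.ne_ae]
  rw [grad_slide, h1, h2, h2, grad, h3, cyc_add_single, map_smul, map_add, map_smul]
  module

theorem grad_white_b (h : IsSlide a b e s) (l : List (Dart E)) :
    grad s (subWalk (slide a b e) l) (b, true) =
      subAlg (slide a b e) (grad (slideForm a e s) l (b, true)) -
      (1 / 2 : ℚ) • (wd [(b, true), (a, false)] * subAlg (slide a b e) (cycAt l (e, true)) *
        wd [(a, true), (b, false)]) := by
  have h1 : s (e, true) (b, true) - s (b, true) (b, true) = -1 := by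
    rw [h.self, h.skew, h.be, sub_zero]
  have h2 : ∀ y, s (y, false) (b, true) = 0 := fun y => h.color _ _ (by simp)
  have h3 : (fun d' => slideForm a e s d' (b, true)) =
      Function.update (fun d' => s d' (b, true)) (e, true) (s (a, true) (b, true)) := by
    funext d
    by_cases hd : d = (e, true)
    · subst hd; simp [slideForm, h.ne_be, h.ne_ab.symm]
    · simp [slideForm, hd, h.ne_be]
  rw [grad_slide, h1, h2, h2, grad, h3, map_smul]
  module

theorem grad_black (h : IsSlide a b e s) (l : List (Dart E)) (x : E) :
    grad s (subWalk (slide a b e) l) (x, false) =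
      subAlg (slide a b e) (grad (slideForm a e s) l (x, false)) +
      ((1 / 2 : ℚ) * (s (b, false) (x, false) - s (a, false) (x, false))) • (wd [(a, false)] *
        subAlg (slide a b e) (cycAt l (e, true)) * wd [(a, true)]) := by
  have h2 : ∀ y, s (y, true) (x, false) = 0 := fun y => h.color _ _ (by simp)
  have h3 : (fun d' => slideForm a e s d' (x, false)) =
      Function.update (fun d' => s d' (x, false)) (e, true) (s (a, true) (x, false)) := by
    funext d
    by_cases hd : d = (e, true)
    · subst hd; simp [slideForm, h2]
    · simp [slideForm, hd]
  rw [grad_slide, h2 e, h2 b, grad, h3, map_smul]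
  module

theorem grad_black_of_ne (h : IsSlide a b e s) (l : List (Dart E)) {x : E} (ha : x ≠ a)
    (hb : x ≠ b) : grad s (subWalk (slide a b e) l) (x, false) =
      subAlg (slide a b e) (grad (slideForm a e s) l (x, false)) := by
  rw [h.grad_black, h.ab x ha hb, sub_self, mul_zero, zero_smul, add_zero]

theorem grad_black_a (h : IsSlide a b e s) (l : List (Dart E)) :
    grad s (subWalk (slide a b e) l) (a, false) =
      subAlg (slide a b e) (grad (slideForm a e s) l (a, false)) - (1 / 2 : ℚ) • (wd [(a, false)] *
        subAlg (slide a b e) (cycAt l (e, true)) * wd [(a, true)]) := by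
  rw [h.grad_black, h.self, h.skew, h.ab_one]
  module

theorem grad_black_b (h : IsSlide a b e s) (l : List (Dart E)) :
    grad s (subWalk (slide a b e) l) (b, false) =
      subAlg (slide a b e) (grad (slideForm a e s) l (b, false)) - (1 / 2 : ℚ) • (wd [(a, false)] *
        subAlg (slide a b e) (cycAt l (e, true)) * wd [(a, true)]) := by
  rw [h.grad_black, h.self, h.ab_one]
  module

/-- Immediately after `b`, the gradient changes by the terms that pass through `b`. -/
theorem grad_e_sub_grad_b (h : IsSlide a b e s) (l : List (Dart E)) :
    grad s (subWalk (slide a b e) l) (e, true) = grad s (subWalk (slide a b e) l) (b, true) +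
      (1 / 2 : ℚ) • subAlg (slide a b e) (cycAt l (b, true)) := by
  have h0 : ∀ x y, s (x, false) (y, true) = 0 := fun x y => h.color _ _ (by simp)
  have h1 : s (a, true) (e, true) = s (a, true) (b, true) := by
    rw [h.skew, h.eb a h.ne_ab h.ne_ae, ← h.skew]
  have h3 : Function.update (fun d' => s d' (e, true)) (e, true) (s (a, true) (e, true)) =
      Function.update (fun d' => s d' (b, true)) (e, true) (s (a, true) (b, true)) +
        Pi.single (b, true) 1 := by
    funext d
    by_cases hd : d = (e, true)
    · subst hd; simp [h1, h.ne_be]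
    · obtain ⟨x, o⟩ := d
      cases o
      · simp [h0]
      · have hx : x ≠ e := fun hx => hd (by rw [hx])
        by_cases hb : x = b
        · subst hb; simp [hx, h.be, h.self]
        · have : s (x, true) (e, true) = s (x, true) (b, true) := by
            rw [h.skew, h.eb x hb hx, ← h.skew]
          simp [hx, hb, this]
  rw [grad_slide, grad_slide, h0, h0, h0, h0, h3, cyc_add_single, h.self, h.self, h.be,
    h.skew (b, true) (e, true), h.be, map_add, map_smul]
  module

theorem grad_e' (h : IsSlide a b e s) (l : List (Dart E)) :
    grad (slideForm a e s) l (e, true) = grad (slideForm a e s) l (a, true) -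
      (1 / 2 : ℚ) • (cycAt l (a, true) + cycAt l (e, true)) := by
  have h3 : (fun d' => slideForm a e s d' (e, true)) = (fun d' => slideForm a e s d' (a, true)) +
      Pi.single (a, true) (-1) + Pi.single (e, true) (-1) := by
    funext d
    by_cases hd : d = (e, true)
    · subst hd; simp [slideForm, h.ne_ae]
    · by_cases ha : d = (a, true)
      · subst ha; simp [slideForm, h.ne_ae, h.self]
      · simp [slideForm, hd, ha, h.ne_ae]
  rw [grad, h3, cyc_add_single, cyc_add_single, grad]
  module

theorem grad_a_sub_grad_b' (h : IsSlide a b e s) (l : List (Dart E)) :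
    grad (slideForm a e s) l (a, false) = grad (slideForm a e s) l (b, false) -
      (1 / 2 : ℚ) • (cycAt l (a, false) + cycAt l (b, false)) := by
  have h0 : ∀ x y, s (x, true) (y, false) = 0 := fun x y => h.color _ _ (by simp)
  have h3 : (fun d' => slideForm a e s d' (a, false)) =
      (fun d' => slideForm a e s d' (b, false)) + Pi.single (a, false) (-1) +
        Pi.single (b, false) (-1) := by
    funext d
    obtain ⟨x, o⟩ := d
    cases o
    · by_cases ha : x = a
      · subst ha; simp [slideForm, h.self, h.ab_one, h.ne_ab]
      · by_cases hb : x = b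
        · subst hb; simp [slideForm, h.self, h.skew (a, false), h.ab_one, ha]
        · have : s (x, false) (a, false) = s (x, false) (b, false) := by
            rw [h.skew, h.ab x ha hb, ← h.skew]
          simp [slideForm, this, ha, hb]
    · simp [slideForm, h0]
  rw [grad, h3, cyc_add_single, cyc_add_single, grad]
  module

/-- Sliding an edge is compatible with the derivations which define the bracket. -/
theorem der_grad (h : IsSlide a b e s) (l : List (Dart E)) (z : PathAlgebra E) :
    der (grad s (subWalk (slide a b e) l)) (subAlg (slide a b e) z) =
      subAlg (slide a b e) (der (grad (slideForm a e s) l) z) := by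
  have aa : wd [(a, true)] * wd [(a, false)] = 1 := wd_mul_rev (a, true)
  have aa' : ∀ z, wd [(a, true)] * (wd [(a, false)] * z) = z := fun z => by
    rw [← mul_assoc, aa, one_mul]
  have bb : wd [(b, false)] * wd [(b, true)] = 1 := wd_rev_mul (b, true)
  have bb' : ∀ z, wd [(b, false)] * (wd [(b, true)] * z) = z := fun z => by
    rw [← mul_assoc, bb, one_mul]
  have bb'' : ∀ z, wd [(b, true)] * (wd [(b, false)] * z) = z := fun z => by
    rw [← mul_assoc, show wd [(b, true)] * wd [(b, false)] = 1 from wd_mul_rev (b, true), one_mul]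
  have hs : ∀ x, x ≠ e → ∀ o, subAlg (slide a b e) (wd [(x, o)]) = wd [(x, o)] := by
    intro x hx o
    rw [subAlg_wd]
    cases o <;> simp [subWalk, subLetter, slide, hx, reversePath, Dart.rev]
  have hsa := hs a h.ne_ae
  have hsb := hs b h.ne_be
  have hse : subAlg (slide a b e) (wd [(e, true)]) =
      wd [(a, true)] * (wd [(b, false)] * wd [(e, true)]) := by
    rw [subAlg_wd, ← wd_append, ← wd_append]
    simp [subWalk, subLetter, slide]
  refine der_subAlg _ (fun x => ?_) z
  have ba : wd [(b, true), (a, false)] = wd [(b, true)] * wd [(a, false)] := wd_cons _ _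
  have ab : wd [(a, true), (b, false)] = wd [(a, true)] * wd [(b, false)] := wd_cons _ _
  have ra : Dart.rev (a, true) = (a, false) := rfl
  have rb : Dart.rev (b, true) = (b, false) := rfl
  by_cases he : x = e
  · subst he
    have e1 : wd (slide a b x x) = wd [(a, true)] * (wd [(b, false)] * wd [(x, true)]) := by
      rw [← wd_append, ← wd_append]; simp [slide]
    have c1 := cycAt_rev l (a, true)
    have c2 := cycAt_rev l (b, true)
    rw [ra] at c1
    rw [rb] at c2
    rw [e1, der_mul, der_mul, der_dart, der_dart, der_dart, der_dart]
    simp only [Dart.rev, Bool.not_true, Bool.not_false]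
    rw [h.grad_e_sub_grad_b, h.grad_white_a, h.grad_white_b, h.grad_black_a, h.grad_black_b,
      h.grad_black_of_ne l h.ne_ae.symm h.ne_be.symm, h.grad_e', h.grad_a_sub_grad_b', c1, c2]
    simp only [map_sub, map_add, map_mul, map_smul, map_neg, hsa, hsb, hse, ba, ab, sub_mul, mul_sub,
      add_mul, mul_add, smul_mul_assoc, mul_smul_comm, mul_assoc, aa', bb', bb'', mul_neg, neg_mul,
      mul_one, smul_add, smul_neg]
    module
  · have e1 : wd (slide a b e x) = wd [(x, true)] := by simp [slide, he]
    rw [e1, der_dart, der_dart, map_sub, map_mul, map_mul, hs x he]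
    simp only [Dart.rev, Bool.not_true]
    by_cases ha : x = a
    · subst ha
      rw [h.grad_white_a, h.grad_black_a, sub_mul, mul_sub, mul_smul_comm, smul_mul_assoc,
        mul_assoc (wd [(x, false)]), aa']
      abel
    · by_cases hb : x = b
      · subst hb
        rw [h.grad_white_b, h.grad_black_b, sub_mul, mul_sub, mul_smul_comm, smul_mul_assoc, ba, ab]
        simp only [mul_assoc, bb, mul_one]
        abel
      · rw [h.grad_white l ha hb he, h.grad_black_of_ne l ha hb]

end IsSlide

end Slide

end PathAlgebra

/-! ### Maps of loops induced by substitutions -/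

namespace BipartiteGraph

open PathAlgebra

variable {W B E W' B' E' : Type*} {G' : BipartiteGraph W' B' E'} {G : BipartiteGraph W B E}

theorem toLoop_eq_of_mk {u : W ⊕ B} {l l' : List (Dart E)} (hl : G.IsClosedWalk l)
    (hl' : G.IsClosedWalk l') (hu : G.IsWalk u u l) (hu' : G.IsWalk u u l')
    (h : FreeGroup.mk l = FreeGroup.mk l') :
    ClosedWalk.toLoop (⟨l, hl⟩ : G.ClosedWalk) = ClosedWalk.toLoop ⟨l', hl'⟩ := by
  have := loopTerm_eq_of_mk hl.1 hl'.1 hu hu' h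
  rw [loopTerm, loopTerm, dif_pos hl, dif_pos hl'] at this
  exact Finsupp.single_left_injective one_ne_zero this

/-- A map of graphs which sends every edge to a path. -/
structure PathMap (G' : BipartiteGraph W' B' E') (G : BipartiteGraph W B E) where
  edge : E' → List (Dart E)
  vert : W' ⊕ B' → W ⊕ B
  ne_nil : ∀ e, edge e ≠ []
  isWalk : ∀ e, G.IsWalk (vert (.inl (G'.white e))) (vert (.inr (G'.black e))) (edge e)

namespace PathMap

variable (F : PathMap G' G)

theorem isWalk_letter (d : Dart E') :
    G.IsWalk (F.vert (G'.src d)) (F.vert (G'.tgt d)) (subLetter F.edge d) := by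
  obtain ⟨e, b⟩ := d
  cases b
  · exact (F.isWalk e).reverse
  · exact F.isWalk e

theorem letter_ne_nil (d : Dart E') : subLetter F.edge d ≠ [] := by
  obtain ⟨e, b⟩ := d
  cases b <;> simp [subLetter, reversePath, F.ne_nil]

theorem isWalk_subWalk {u v : W' ⊕ B'} {l : List (Dart E')} (h : G'.IsWalk u v l) :
    G.IsWalk (F.vert u) (F.vert v) (subWalk F.edge l) := by
  induction l generalizing u with
  | nil => exact congrArg F.vert h
  | cons d l ih =>
    obtain ⟨rfl, h⟩ := h
    exact isWalk_append.2 ⟨_, F.isWalk_letter d, ih h⟩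

theorem subWalk_ne_nil {l : List (Dart E')} (h : l ≠ []) : subWalk F.edge l ≠ [] := by
  cases l with
  | nil => exact absurd rfl h
  | cons d l => simp [subWalk_cons, F.letter_ne_nil]

theorem isClosedWalk {l : List (Dart E')} (h : G'.IsClosedWalk l) :
    G.IsClosedWalk (subWalk F.edge l) := by
  obtain ⟨hne, v, hv⟩ := h
  exact ⟨F.subWalk_ne_nil hne, _, F.isWalk_subWalk hv⟩

/-- The map induced on free homotopy classes of loops. -/
def loopMap : G'.Loops → G.Loops :=
  Quot.lift (fun x => ClosedWalk.toLoop ⟨subWalk F.edge x.1, F.isClosedWalk x.2⟩) (by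
    intro x y h
    cases h with
    | rotate l₁ l₂ h h' =>
      have e := F.isClosedWalk h
      have e' := F.isClosedWalk h'
      simp only [subWalk_append] at e e' ⊢
      exact Quot.sound (ElemHomotopy.rotate _ _ e e')
    | spike l d h h' =>
      obtain ⟨hne, v, hv⟩ := h'
      obtain ⟨u, h1, h2⟩ := isWalk_append.1 hv
      obtain ⟨-, rfl⟩ := isWalk_spike.1 h2
      refine toLoop_eq_of_mk _ _ (F.isWalk_subWalk h1) (F.isWalk_subWalk hv) ?_
      rw [← subHom_mk, ← subHom_mk, ← FreeGroup.mul_mk, mk_spike, mul_one])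

theorem mapDomain_loopTerm {l : List (Dart E')} (h : G'.IsClosedWalk l) :
    (G'.loopTerm l).mapDomain F.loopMap = G.loopTerm (subWalk F.edge l) := by
  rw [loopTerm, loopTerm, dif_pos h, dif_pos (F.isClosedWalk h), Finsupp.mapDomain_single]
  rfl

theorem mapDomain_trace {v : W' ⊕ B'} (hv : ∃ d, G'.src d = v) {a : PathAlgebra E'}
    (ha : a ∈ G'.pathSpan v v) :
    (G'.trace v a).mapDomain F.loopMap = G.trace (F.vert v) (subAlg F.edge a) := by
  induction ha using Submodule.span_induction with
  | zero => simp
  | add y z _ _ hy hz => simp only [map_add, Finsupp.mapDomain_add, hy, hz]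
  | smul c y _ hy => simp only [map_smul, Finsupp.mapDomain_smul, hy]
  | mem y hy =>
    obtain ⟨l, hl, rfl⟩ := hy
    obtain ⟨l', h1, h2, h3⟩ := exists_isWalk_wd v hl hv
    rw [← h3, subAlg_wd, trace_wd h1 h2, trace_wd (F.subWalk_ne_nil h1) (F.isWalk_subWalk h2),
      F.mapDomain_loopTerm ⟨h1, v, h2⟩]

theorem walkWeight_reversePath {E : Type*} (w : E → ℤ) (l : List (Dart E)) :
    walkWeight w (reversePath l) = - walkWeight w l := by
  induction l with
  | nil => rfl
  | cons d l ih =>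
    have e : reversePath (d :: l) = reversePath l ++ [d.rev] := by simp [reversePath]
    rw [e, walkWeight_append, ih]
    obtain ⟨x, b⟩ := d
    cases b <;> simp [walkWeight, Dart.rev]

/-- A map of graphs preserves the weights of loops, if the weights of edges are preserved up to a
coboundary. -/
theorem loopWeight_loopMap {w' : E' → ℤ} {w : E → ℤ} (c : W' ⊕ B' → ℤ)
    (hc : ∀ e, w' e = walkWeight w (F.edge e) + c (.inr (G'.black e)) - c (.inl (G'.white e)))
    (ℓ : G'.Loops) : G.loopWeight w (F.loopMap ℓ) = G'.loopWeight w' ℓ := by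
  induction ℓ using Quot.ind with | _ x
  obtain ⟨l, hne, v, hv⟩ := x
  change walkWeight w (subWalk F.edge l) = walkWeight w' l
  suffices ∀ (l : List (Dart E')) (u v : W' ⊕ B'), G'.IsWalk u v l →
      walkWeight w' l = walkWeight w (subWalk F.edge l) + c v - c u by
    have := this l v v hv
    omega
  intro l
  induction l with
  | nil =>
    intro u v h
    obtain rfl : u = v := h
    simp [walkWeight, subWalk]
  | cons d l ih =>
    rintro u v ⟨rfl, h⟩
    have h1 := ih _ _ h
    have h2 : walkWeight w' (d :: l) = walkWeight w' [d] + walkWeight w' l :=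
      walkWeight_append w' [d] l
    rw [h2, h1, subWalk_cons, walkWeight_append]
    have h3 : walkWeight w' [d] =
        walkWeight w (subLetter F.edge d) + c (G'.tgt d) - c (G'.src d) := by
      obtain ⟨e, b⟩ := d
      have := hc e
      cases b
      · have h5 := walkWeight_reversePath w (F.edge e)
        simp only [subLetter, tgt, src, Dart.rev]
        simp [walkWeight] at this h5 ⊢
        omega
      · simp only [subLetter, tgt, src, Dart.rev]
        simp [walkWeight] at this ⊢
        omega
    omega

/-- Two maps of graphs induce inverse maps on loops, if they are inverse to each other up to
homotopy. -/
theorem loopMap_leftInverse (H : PathMap G G')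
    (hv : ∀ d, H.vert (F.vert (G'.src d)) = G'.src d)
    (h : ∀ e, FreeGroup.mk (subWalk H.edge (F.edge e)) = FreeGroup.mk [(e, true)]) :
    Function.LeftInverse H.loopMap F.loopMap := by
  intro ℓ
  induction ℓ using Quot.ind with | _ x
  obtain ⟨l, hl⟩ := x
  obtain ⟨hne, v, hw⟩ := id hl
  change ClosedWalk.toLoop (⟨subWalk H.edge (subWalk F.edge l), _⟩ : G'.ClosedWalk) =
    ClosedWalk.toLoop ⟨l, hl⟩
  have h2 : H.vert (F.vert v) = v := by
    cases l with
    | nil => exact absurd rfl hne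
    | cons d l => rw [← hw.1, hv]
  have h3 := H.isWalk_subWalk (F.isWalk_subWalk hw)
  rw [h2] at h3
  refine toLoop_eq_of_mk (u := v) _ _ h3 hw ?_
  rw [subWalk_subWalk, ← subHom_mk]
  have : subHom (fun e => subWalk H.edge (F.edge e)) = MonoidHom.id (FreeGroup E') := by
    refine FreeGroup.ext_hom _ _ fun e => ?_
    rw [subHom, FreeGroup.lift_apply_of, h]
    rfl
  rw [this]
  rfl

end PathMap

/-- A map of graphs which is compatible with the derivations defining the Goldman brackets is
compatible with these brackets. -/
theorem PathMap.goldman_loopMap [Finite E] [Finite E'] {Γ' : BipartiteRibbonGraph W' B' E'}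
    {Γ : BipartiteRibbonGraph W B E} (F : PathMap Γ'.toBipartiteGraph Γ.toBipartiteGraph)
    (o' : VertexOrder Γ') (o : VertexOrder Γ)
    (h : ∀ l a, der (grad o.form (subWalk F.edge l)) (subAlg F.edge a) =
      subAlg F.edge (der (grad o'.form l) a)) (ℓ₁ ℓ₂ : Γ'.L) :
    Γ.goldman (F.loopMap ℓ₁) (F.loopMap ℓ₂) = (Γ'.goldman ℓ₁ ℓ₂).mapDomain F.loopMap := by
  induction ℓ₁ using Quot.ind with | _ x
  induction ℓ₂ using Quot.ind with | _ y
  obtain ⟨x, hx⟩ := x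
  obtain ⟨y, hy⟩ := y
  obtain ⟨hx0, u, hu⟩ := id hx
  obtain ⟨hy0, v, hv⟩ := id hy
  change Γ.walkBracket (subWalk F.edge x) (subWalk F.edge y) =
    (Γ'.walkBracket x y).mapDomain F.loopMap
  have hv' : ∃ d, Γ'.toBipartiteGraph.src d = v := by
    cases y with
    | nil => exact absurd rfl hy0
    | cons d y => exact ⟨d, hv.1⟩
  rw [o.walkBracket_eq_trace (F.isWalk_subWalk hu) (F.isWalk_subWalk hv),
    o'.walkBracket_eq_trace hu hv,
    F.mapDomain_trace hv' (der_mem (o'.grad_mem hu) (wd_mem hv)), ← h, subAlg_wd]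

end BipartiteGraph

/-! ### The leading part of a two by two move -/

theorem exists_cut {E V : Type*} [Finite E] (σ : Equiv.Perm E) (f : E → V)
    (hσ : ∀ e e', σ.SameCycle e e' ↔ f e = f e') (good : E → Prop)
    (hg : ∀ e, ∃ e', good e' ∧ f e' = f e) : ∃ (first : E → E) (pos : E → ℤ),
      (∀ e, f (first e) = f e) ∧ (∀ e e', f e = f e' → first e = first e') ∧
      (∀ e, good (first e)) ∧ ∀ e, σ e = first e ∨ pos (σ e) = pos e + 1 := by
  classical
  have h1 : ∀ e, ∃ e', good e' ∧ f e' = f e := hg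
  let first : E → E := fun e => (h1 e).choose
  have hf : ∀ e e', f e = f e' → first e = first e' := by
    intro e e' h
    simp only [first, h]
  refine ⟨first, fun e => rotSteps σ (first e) e, fun e => (h1 e).choose_spec.2, hf,
    fun e => (h1 e).choose_spec.1, fun e => ?_⟩
  have h : first (σ e) = first e := hf _ _ ((hσ _ _).1 ⟨-1, by simp⟩)
  refine (rotSteps_rotate σ ((hσ _ _).2 (h1 e).choose_spec.2)).imp_right fun h' => ?_
  change (rotSteps σ (first (σ e)) (σ e) : ℤ) = rotSteps σ (first e) e + 1
  have h2 : rotSteps σ (first e) (σ e) = rotSteps σ (first e) e + 1 := h'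
  rw [h, h2]
  push_cast
  rfl

namespace PathAlgebra

variable {E E' E'' : Type*}

theorem subAlg_subAlg (f : E' → List (Dart E)) (g : E'' → List (Dart E')) (a : PathAlgebra E'') :
    subAlg f (subAlg g a) = subAlg (fun e => subWalk f (g e)) a := by
  suffices (subAlg f).toLinearMap ∘ₗ (subAlg g).toLinearMap =
      (subAlg fun e => subWalk f (g e)).toLinearMap from LinearMap.congr_fun this a
  refine hom_ext fun l => ?_
  simp only [LinearMap.comp_apply, AlgHom.toLinearMap_apply, subAlg_wd, subWalk_subWalk]

/-- Renaming edges is compatible with the derivations which define the bracket. -/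
theorem der_grad_rename (g : E' → E) (s : Dart E → Dart E → ℚ) (l : List (Dart E'))
    (a : PathAlgebra E') :
    der (grad s (subWalk (fun e => [(g e, true)]) l)) (subAlg (fun e => [(g e, true)]) a) =
      subAlg (fun e => [(g e, true)])
        (der (grad (fun d d' => s (g d.1, d.2) (g d'.1, d'.2)) l) a) := by
  have hletter : ∀ d : Dart E', subLetter (fun e => [(g e, true)]) d = [(g d.1, d.2)] := by
    rintro ⟨e, b⟩
    cases b <;> rfl
  have hwd : ∀ d : Dart E', subAlg (fun e => [(g e, true)]) (wd [d]) = wd [(g d.1, d.2)] := by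
    intro d
    rw [subAlg_wd]
    simp [subWalk, hletter]
  have hcyc : ∀ (p : Dart E → ℚ) (l : List (Dart E')) (c : PathAlgebra E'),
      cycAux p (subWalk (fun e => [(g e, true)]) l) (subAlg (fun e => [(g e, true)]) c) =
        subAlg (fun e => [(g e, true)]) (cycAux (fun d => p (g d.1, d.2)) l c) := by
    intro p l
    induction l with
    | nil => intro c; simp [cycAux, subWalk]
    | cons d l ih =>
      intro c
      rw [subWalk_cons, hletter, List.singleton_append, cycAux, cycAux, map_add, map_sub, map_smul,
        map_smul, map_mul, map_mul, map_mul, map_mul, ← ih, map_mul, hwd, subAlg_wd]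
      rfl
  have hgrad : ∀ d : Dart E', grad s (subWalk (fun e => [(g e, true)]) l) (g d.1, d.2) =
      subAlg (fun e => [(g e, true)]) (grad (fun d d' => s (g d.1, d.2) (g d'.1, d'.2)) l d) := by
    intro d
    have := hcyc (fun d' => s d' (g d.1, d.2)) l 1
    rw [map_one] at this
    rw [grad, grad, map_smul, cyc, this, cyc]
  refine der_subAlg _ (fun e => ?_) a
  rw [der_dart, der_dart, map_sub, map_mul, map_mul, ← hgrad, ← hgrad, hwd]
  rfl

variable [DecidableEq E]

theorem slideForm_color {a e : E} {s : Dart E → Dart E → ℚ} (h : ∀ d d', d.2 ≠ d'.2 → s d d' = 0)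
    (d d' : Dart E) (hd : d.2 ≠ d'.2) : slideForm a e s d d' = 0 := by
  simp only [slideForm]
  split_ifs with g1 g2 g3 g4 g5
  · rfl
  · subst g1; subst g3; simp at hd
  · subst g1; exact h _ _ hd
  · subst g4; subst g5; simp at hd
  · subst g4; exact h _ _ hd
  · exact h _ _ hd

/-- Sliding an edge does not change the hypotheses for sliding another one. -/
theorem IsSlide.slideForm {a b e a₂ b₂ e₂ : E} {s : Dart E → Dart E → ℚ} (h : IsSlide a b e s)
    (h₂ : IsSlide a₂ b₂ e₂ s) (h2 : a ≠ b₂) (h3 : a ≠ e₂) (h5 : e ≠ b₂)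
    (h6 : e ≠ e₂) : IsSlide a₂ b₂ e₂ (slideForm a e s) where
  ne_ab := h₂.ne_ab
  ne_ae := h₂.ne_ae
  ne_be := h₂.ne_be
  skew d d' := by
    have := h.skew
    simp only [PathAlgebra.slideForm]
    split_ifs <;> first | simp | exact this _ _
  color := slideForm_color h.color
  eb x hx hx' := by
    simp only [PathAlgebra.slideForm, Prod.mk.injEq, h6.symm, h5.symm, h2.symm, h3.symm, false_and,
      if_false]
    split_ifs
    · exact h₂.eb a h2 h3
    · exact h₂.eb x hx hx'
  be := by simp [PathAlgebra.slideForm, h6.symm, h5.symm, h₂.be]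
  ab x hx hx' := by simp [PathAlgebra.slideForm, h₂.ab x hx hx']
  ab_one := by simp [PathAlgebra.slideForm, h₂.ab_one]

end PathAlgebra

namespace VertexOrder

open PathAlgebra

variable {W B E : Type*} {Γ : BipartiteRibbonGraph W B E} (o : VertexOrder Γ)

theorem form_succ {d d' x : Dart E} (hs : Γ.toBipartiteGraph.src d = Γ.toBipartiteGraph.src d')
    (h : o.pos d' = o.pos d + 1) (hx : x ≠ d) (hx' : x ≠ d') : o.form d' x = o.form d x := by
  by_cases h1 : Γ.toBipartiteGraph.src d = Γ.toBipartiteGraph.src x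
  · rw [o.form_of_eq h1, o.form_of_eq (hs.symm.trans h1)]
    have n1 : o.pos x ≠ o.pos d := fun h' => hx (o.inj _ _ h1 h'.symm).symm
    have n2 : o.pos x ≠ o.pos d' := fun h' => hx' (o.inj _ _ (hs.symm.trans h1) h'.symm).symm
    rcases lt_or_gt_of_ne n1 with n | n
    · rw [Int.sign_eq_neg_one_of_neg, Int.sign_eq_neg_one_of_neg] <;> omega
    · rw [Int.sign_eq_one_of_pos, Int.sign_eq_one_of_pos] <;> omega
  · rw [o.form_of_ne h1, o.form_of_ne (hs ▸ h1)]

theorem isSlide [DecidableEq E] {a b e : E} (hab : a ≠ b) (hae : a ≠ e) (hbe : b ≠ e)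
    (hw : Γ.white b = Γ.white e) (hb : Γ.black a = Γ.black b)
    (hpw : o.pos (e, true) = o.pos (b, true) + 1)
    (hpb : o.pos (b, false) = o.pos (a, false) + 1) : IsSlide a b e o.form where
  ne_ab := hab
  ne_ae := hae
  ne_be := hbe
  skew := o.form_skew
  color := by
    rintro ⟨x, c⟩ ⟨y, c'⟩ h
    refine o.form_of_ne ?_
    cases c <;> cases c' <;> simp [BipartiteGraph.src] at h ⊢
  eb x hx hx' := o.form_succ (by simp [BipartiteGraph.src, hw]) hpw (by simp [hx]) (by simp [hx'])
  be := by
    rw [o.form_of_eq (by simp [BipartiteGraph.src, hw]), hpw]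
    simp
  ab x hx hx' := (o.form_succ (by simp [BipartiteGraph.src, hb]) hpb (by simp [hx])
    (by simp [hx'])).symm
  ab_one := by
    rw [o.form_of_eq (by simp [BipartiteGraph.src, hb]), hpb]
    simp

end VertexOrder

namespace TwoByTwoMove

open PathAlgebra BipartiteGraph

variable {W B B' E E' R : Type*} {Γ : BipartiteRibbonGraph W B E}
  {Γ' : BipartiteRibbonGraph W B' E'} (m : TwoByTwoMove R Γ Γ')

/-- The edges of `α'` correspond to the edges of `α` so that the cyclic orders at the `•`-vertices
are the same. -/
def label : AlphaEdge' ≃ AlphaEdge where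
  toFun
    | .ap => .ap | .bp => .bp | .cp => .dp | .aq => .bq | .cq => .cq | .dq => .dq
  invFun
    | .ap => .ap | .bp => .bp | .dp => .cp | .bq => .aq | .cq => .cq | .dq => .dq
  left_inv x := by cases x <;> rfl
  right_inv x := by cases x <;> rfl

/-- The bijection of edges which respects the cyclic orders at the `•`-vertices. -/
def edgeEquiv : E' ≃ E := m.edge'.symm.trans (((Equiv.refl R).sumCongr label).trans m.edge)

theorem edgeEquiv_inl (r : R) : m.edgeEquiv (m.edge' (.inl r)) = m.edge (.inl r) := by
  simp [edgeEquiv]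

theorem edgeEquiv_inr (x : AlphaEdge') :
    m.edgeEquiv (m.edge' (.inr x)) = m.edge (.inr (label x)) := by
  simp [edgeEquiv]

theorem rotB_alpha' (x : AlphaEdge') : ∃ y, Γ'.rotB (m.edge' (.inr x)) = m.edge' (.inr y) ∧
    Γ.rotB (m.edge (.inr (label x))) = m.edge (.inr (label y)) := by
  cases x
  exacts [⟨_, m.ap_cp', m.ap_dp⟩, ⟨_, m.bp_ap', m.bp_ap⟩, ⟨_, m.cp_bp', m.dp_bp⟩, ⟨_, m.aq_dq', m.bq_dq⟩,
    ⟨_, m.cq_aq', m.cq_bq⟩, ⟨_, m.dq_cq', m.dq_cq⟩]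

theorem rotB_alpha'_surj (y : AlphaEdge') : ∃ x, Γ'.rotB (m.edge' (.inr x)) = m.edge' (.inr y) := by
  cases y
  exacts [⟨_, m.bp_ap'⟩, ⟨_, m.cp_bp'⟩, ⟨_, m.ap_cp'⟩, ⟨_, m.cq_aq'⟩, ⟨_, m.dq_cq'⟩, ⟨_, m.aq_dq'⟩]

theorem rotB_inl' (r : R) : ∃ s, Γ'.rotB (m.edge' (.inl r)) = m.edge' (.inl s) := by
  obtain ⟨z, hz⟩ := m.edge'.surjective (Γ'.rotB (m.edge' (.inl r)))
  cases z with
  | inl s => exact ⟨s, hz.symm⟩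
  | inr y =>
    obtain ⟨x, hx⟩ := m.rotB_alpha'_surj y
    have := m.edge'.injective (Γ'.rotB.injective (hx.trans hz))
    simp at this

theorem edgeEquiv_rotB (e : E') : m.edgeEquiv (Γ'.rotB e) = Γ.rotB (m.edgeEquiv e) := by
  obtain ⟨z, rfl⟩ := m.edge'.surjective e
  cases z with
  | inl r =>
    obtain ⟨s, hs⟩ := m.rotB_inl' r
    rw [hs, edgeEquiv_inl, edgeEquiv_inl, (m.rotB_outer r s).2 hs]
  | inr x =>
    obtain ⟨y, h1, h2⟩ := m.rotB_alpha' x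
    rw [h1, edgeEquiv_inr, edgeEquiv_inr, h2]

theorem _root_.Equiv.Perm.SameCycle.apply_eq {X Y : Type*} {σ : Equiv.Perm X} {F : X → Y}
    (hF : ∀ x, F (σ x) = F x) {x y : X} (h : σ.SameCycle x y) : F x = F y := by
  obtain ⟨i, rfl⟩ := h
  have h1 : ∀ n : ℕ, ∀ x, F ((σ ^ n) x) = F x := by
    intro n
    induction n with
    | zero => intro x; rfl
    | succ n ih => intro x; rw [pow_succ, Equiv.Perm.mul_apply, ih, hF]
  cases i with
  | ofNat n => exact (h1 n x).symm
  | negSucc n =>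
    have := h1 (n + 1) ((σ ^ (Int.negSucc n)) x)
    rw [← this]
    simp [zpow_negSucc]

theorem black_edgeEquiv (e f : E') :
    Γ.black (m.edgeEquiv e) = Γ.black (m.edgeEquiv f) ↔ Γ'.black e = Γ'.black f := by
  constructor
  · intro h
    have h1 := (Γ.sameCycle_rotB _ _).2 h
    have h2 := Equiv.Perm.SameCycle.apply_eq (F := fun e => Γ'.black (m.edgeEquiv.symm e)) (fun e => by
      obtain ⟨e, rfl⟩ := m.edgeEquiv.surjective e
      rw [← edgeEquiv_rotB, Equiv.symm_apply_apply, Equiv.symm_apply_apply]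
      exact ((Γ'.sameCycle_rotB _ _).1 ⟨1, by simp⟩ : Γ'.black e = Γ'.black (Γ'.rotB e)).symm) h1
    simpa using h2
  · intro h
    have h1 := (Γ'.sameCycle_rotB _ _).2 h
    exact Equiv.Perm.SameCycle.apply_eq (F := fun e => Γ.black (m.edgeEquiv e)) (fun e => by
      rw [edgeEquiv_rotB]
      exact ((Γ.sameCycle_rotB _ _).1 ⟨1, by simp⟩ : Γ.black (m.edgeEquiv e) = _).symm) h1

/-- The edge of `α` which carries an edge of `α'` at its `∘`-end. -/
def carrier : R ⊕ AlphaEdge' → R ⊕ AlphaEdge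
  | .inl r => .inl r
  | .inr .ap => .inr .ap
  | .inr .aq => .inr .ap
  | .inr .bp => .inr .bp
  | .inr .cp => .inr .cq
  | .inr .cq => .inr .cq
  | .inr .dq => .inr .dq

/-- The position of an edge of `α'` among the edges with the same carrier. -/
def shift : R ⊕ AlphaEdge' → ℤ
  | .inr .ap => 1
  | .inr .cq => 1
  | _ => 0

theorem white_rotW (e : E) : Γ.white (Γ.rotW e) = Γ.white e :=
  ((Γ.sameCycle_rotW _ _).1 ⟨1, by simp⟩).symm

theorem white_b : Γ.white (m.edge (.inr .bp)) = Γ.white (m.edge (.inr .bq)) := by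
  rw [← m.bp_bq, white_rotW]

theorem white_d : Γ.white (m.edge (.inr .dq)) = Γ.white (m.edge (.inr .dp)) := by
  rw [← m.dq_dp, white_rotW]

theorem white_carrier (z : R ⊕ AlphaEdge') :
    Γ.white (m.edge (carrier z)) = Γ'.white (m.edge' z) := by
  rcases z with r | (_ | _ | _ | _ | _ | _)
  · exact (m.white_outer (.inl r)).symm
  · rw [← m.aq_ap', white_rotW]
    exact (m.white_outer (.inr .a)).symm
  · exact (m.white_outer (.inr .b)).symm
  · exact (m.white_outer (.inr .c)).symm
  · exact (m.white_outer (.inr .a)).symm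
  · rw [← m.cp_cq', white_rotW]
    exact (m.white_outer (.inr .c)).symm
  · exact (m.white_outer (.inr .d)).symm

/-- The first edge of `α'` at the corner of a first edge of `α`. -/
def uncarrier : R ⊕ AlphaEdge → R ⊕ AlphaEdge'
  | .inl r => .inl r
  | .inr .ap => .inr .aq
  | .inr .bp => .inr .bp
  | .inr .bq => .inr .bp
  | .inr .cq => .inr .cp
  | .inr .dq => .inr .dq
  | .inr .dp => .inr .dq

theorem black_rotB (e : E) : Γ.black (Γ.rotB e) = Γ.black e :=
  ((Γ.sameCycle_rotB _ _).1 ⟨1, by simp⟩).symm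

theorem white_uncarrier (z : R ⊕ AlphaEdge) :
    Γ'.white (m.edge' (uncarrier z)) = Γ.white (m.edge z) := by
  rw [← white_carrier]
  rcases z with r | (_ | _ | _ | _ | _ | _) <;> try rfl
  · exact m.white_d
  · exact m.white_b

/-- Linear orders at the vertices of `Γ` and of `Γ'` such that the form of `Γ'` comes from the one of `Γ` by
sliding `bq` to `a` and `dp` to `c`. No vertex may be cut between edges of `α` that have to be adjacent. -/
theorem exists_vertexOrders [Finite E] [Finite E'] [DecidableEq E] : ∃ (o : VertexOrder Γ.conj)
    (o' : VertexOrder Γ'.conj),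
    IsSlide (m.edge (.inr .ap)) (m.edge (.inr .bp)) (m.edge (.inr .bq)) o.form ∧
    IsSlide (m.edge (.inr .cq)) (m.edge (.inr .dq)) (m.edge (.inr .dp)) o.form ∧
    o'.form = fun d d' => slideForm (m.edge (.inr .cq)) (m.edge (.inr .dp))
      (slideForm (m.edge (.inr .ap)) (m.edge (.inr .bq)) o.form)
      (m.edgeEquiv d.1, d.2) (m.edgeEquiv d'.1, d'.2) := by
  have hinj : ∀ x y, m.edge x = m.edge y ↔ x = y := fun x y => m.edge.apply_eq_iff_eq
  have black1 : Γ.black (m.edge (.inr .ap)) = Γ.black (m.edge (.inr .bp)) := by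
    rw [← m.bp_ap, black_rotB]
  have black2 : Γ.black (m.edge (.inr .cq)) = Γ.black (m.edge (.inr .dq)) := by
    rw [← m.dq_cq, black_rotB]
  -- linear orders on `Γ` which do not cut the segments of edges of `α`
  obtain ⟨fW, pW, w1, w2, w3, w4⟩ := exists_cut Γ.rotW Γ.white Γ.sameCycle_rotW
    (fun e => e ≠ m.edge (.inr .bq) ∧ e ≠ m.edge (.inr .dp)) (fun e => by
      by_cases h1 : e = m.edge (.inr .bq)
      · exact ⟨m.edge (.inr .bp), by simp [hinj], by rw [h1, m.white_b]⟩
      by_cases h2 : e = m.edge (.inr .dp)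
      · exact ⟨m.edge (.inr .dq), by simp [hinj], by rw [h2, m.white_d]⟩
      exact ⟨e, ⟨h1, h2⟩, rfl⟩)
  obtain ⟨fB, pB, b1, b2, b3, b4⟩ := exists_cut Γ.conj.rotB Γ.black Γ.conj.sameCycle_rotB
    (fun e => e ≠ m.edge (.inr .bp) ∧ e ≠ m.edge (.inr .dq)) (fun e => by
      by_cases h1 : e = m.edge (.inr .bp)
      · exact ⟨m.edge (.inr .ap), by simp [hinj], by rw [h1, black1]⟩
      by_cases h2 : e = m.edge (.inr .dq)
      · exact ⟨m.edge (.inr .cq), by simp [hinj], by rw [h2, black2]⟩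
      exact ⟨e, ⟨h1, h2⟩, rfl⟩)
  let o : VertexOrder Γ.conj := VertexOrder.ofPos Γ.conj pW pB fW fB w1 w2 b1 b2
    (fun e => (w4 e).imp_right fun h => by rw [show Γ.conj.rotW = Γ.rotW from rfl, h]; omega)
    (fun e => (b4 e).imp_right fun h => by rw [h]; omega)
  have hb : pW (m.edge (.inr .bq)) = pW (m.edge (.inr .bp)) + 1 := by
    have := (w4 (m.edge (.inr .bp))).resolve_left (by rw [m.bp_bq]; exact (w3 _).1.symm)
    rwa [m.bp_bq] at this
  have hd : pW (m.edge (.inr .dp)) = pW (m.edge (.inr .dq)) + 1 := by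
    have := (w4 (m.edge (.inr .dq))).resolve_left (by rw [m.dq_dp]; exact (w3 _).2.symm)
    rwa [m.dq_dp] at this
  have hp : pB (m.edge (.inr .bp)) = pB (m.edge (.inr .ap)) + 1 := by
    have e : Γ.conj.rotB (m.edge (.inr .ap)) = m.edge (.inr .bp) := by
      change Γ.rotB⁻¹ _ = _
      rw [Equiv.Perm.inv_eq_iff_eq, m.bp_ap]
    have := (b4 (m.edge (.inr .ap))).resolve_left (by rw [e]; exact (b3 _).1.symm)
    rwa [e] at this
  have hq : pB (m.edge (.inr .dq)) = pB (m.edge (.inr .cq)) + 1 := by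
    have e : Γ.conj.rotB (m.edge (.inr .cq)) = m.edge (.inr .dq) := by
      change Γ.rotB⁻¹ _ = _
      rw [Equiv.Perm.inv_eq_iff_eq, m.dq_cq]
    have := (b4 (m.edge (.inr .cq))).resolve_left (by rw [e]; exact (b3 _).2.symm)
    rwa [e] at this
  -- the induced orders on `Γ'`
  -- The factor `2` makes room for the second edge of `α'` at `a` and at `c`.
  let pW' : E' → ℤ := fun e => 2 * pW (m.edge (carrier (m.edge'.symm e))) + shift (m.edge'.symm e)
  let fW' : E' → E' := fun e =>
    m.edge' (uncarrier (m.edge.symm (fW (m.edge (carrier (m.edge'.symm e))))))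
  have w4' : ∀ e, Γ'.rotW e = fW' e ∨ pW' e < pW' (Γ'.rotW e) := by
    intro e
    obtain ⟨z, rfl⟩ := m.edge'.surjective e
    by_cases h1 : z = .inr .aq
    · subst h1
      right
      rw [m.aq_ap']
      simp [pW', carrier, shift]
    by_cases h2 : z = .inr .cp
    · subst h2
      right
      rw [m.cp_cq']
      simp [pW', carrier, shift]
    obtain ⟨x, hx, hcW, hcp⟩ : ∃ x : R ⊕ Corner, z = x.map id Corner.last' ∧
        Γ.white (m.edge (carrier z)) = Γ.white (m.edge (x.map id Corner.last)) ∧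
        pW (m.edge (carrier z)) ≤ pW (m.edge (x.map id Corner.last)) := by
      rcases z with r | (_ | _ | _ | _ | _ | _)
      · exact ⟨.inl r, rfl, rfl, le_rfl⟩
      · exact ⟨.inr .a, rfl, rfl, le_rfl⟩
      · exact ⟨.inr .b, rfl, m.white_b, by simp [carrier, Corner.last, hb]⟩
      · exact absurd rfl h2
      · exact absurd rfl h1
      · exact ⟨.inr .c, rfl, rfl, le_rfl⟩
      · exact ⟨.inr .d, rfl, m.white_d, by simp [carrier, Corner.last, hd]⟩
    obtain ⟨z', hz'⟩ := m.edge'.surjective (Γ'.rotW (m.edge' z))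
    have h3 : z' ≠ .inr .ap := by
      rintro rfl
      exact h1 (m.edge'.injective (Γ'.rotW.injective (hz'.symm.trans m.aq_ap'.symm)))
    have h4 : z' ≠ .inr .cq := by
      rintro rfl
      exact h2 (m.edge'.injective (Γ'.rotW.injective (hz'.symm.trans m.cp_cq'.symm)))
    obtain ⟨y, hy, hy1, hy2, hy3⟩ : ∃ y : R ⊕ Corner, z' = y.map id Corner.first' ∧
        shift z' = 0 ∧ carrier z' = y.map id Corner.first ∧
        uncarrier (y.map id Corner.first) = z' := by
      rcases z' with r | (_ | _ | _ | _ | _ | _)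
      · exact ⟨.inl r, rfl, rfl, rfl, rfl⟩
      · exact absurd rfl h3
      · exact ⟨.inr .b, rfl, rfl, rfl, rfl⟩
      · exact ⟨.inr .c, rfl, rfl, rfl, rfl⟩
      · exact ⟨.inr .a, rfl, rfl, rfl, rfl⟩
      · exact absurd rfl h4
      · exact ⟨.inr .d, rfl, rfl, rfl, rfl⟩
    have hrot : Γ.rotW (m.edge (x.map id Corner.last)) = m.edge (y.map id Corner.first) := by
      rw [m.rotW_outer x y, ← hx, ← hy, hz']
    rw [← hz']
    rcases w4 (m.edge (x.map id Corner.last)) with h5 | h5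
    · left
      simp only [fW', Equiv.symm_apply_apply]
      rw [w2 _ _ hcW, ← h5, hrot, Equiv.symm_apply_apply, hy3]
    · right
      rw [hrot] at h5
      simp only [pW', Equiv.symm_apply_apply, hy1, hy2, h5]
      have : shift z ≤ 1 := by rcases z with r | (_ | _ | _ | _ | _ | _) <;> simp [shift]
      omega
  let o' : VertexOrder Γ'.conj := VertexOrder.ofPos Γ'.conj pW' (fun e => pB (m.edgeEquiv e)) fW'
    (fun e => m.edgeEquiv.symm (fB (m.edgeEquiv e)))
    (fun e => by
      obtain ⟨z, rfl⟩ := m.edge'.surjective e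
      change Γ'.white (m.edge' (uncarrier _)) = Γ'.white _
      rw [white_uncarrier, Equiv.apply_symm_apply, w1, Equiv.symm_apply_apply, white_carrier])
    (fun e f h => by
      obtain ⟨z, rfl⟩ := m.edge'.surjective e
      obtain ⟨y, rfl⟩ := m.edge'.surjective f
      change Γ'.white _ = Γ'.white _ at h
      rw [← white_carrier, ← white_carrier] at h
      simp only [fW', Equiv.symm_apply_apply]
      rw [w2 _ _ h])
    (fun e => by
      change Γ'.black _ = Γ'.black _
      rw [← black_edgeEquiv, Equiv.apply_symm_apply, b1])
    (fun e f h => by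
      change Γ'.black _ = Γ'.black _ at h
      rw [b2 _ _ ((m.black_edgeEquiv e f).2 h)])
    w4'
    (fun e => by
      have hr : m.edgeEquiv (Γ'.conj.rotB e) = Γ.conj.rotB (m.edgeEquiv e) := by
        change m.edgeEquiv (Γ'.rotB⁻¹ e) = Γ.rotB⁻¹ (m.edgeEquiv e)
        rw [Equiv.Perm.eq_inv_iff_eq, ← edgeEquiv_rotB]
        simp
      rcases b4 (m.edgeEquiv e) with h | h
      · left
        rw [← h, ← hr, Equiv.symm_apply_apply]
      · right
        rw [hr, h]
        omega)
  have s1 : IsSlide (m.edge (.inr .ap)) (m.edge (.inr .bp)) (m.edge (.inr .bq)) o.form :=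
    o.isSlide (by simp [hinj]) (by simp [hinj]) (by simp [hinj]) m.white_b black1 hb hp
  have s2 : IsSlide (m.edge (.inr .cq)) (m.edge (.inr .dq)) (m.edge (.inr .dp)) o.form :=
    o.isSlide (by simp [hinj]) (by simp [hinj]) (by simp [hinj]) m.white_d black2 hd hq
  refine ⟨o, o', s1, s2, ?_⟩
  have white_form : ∀ z z', o'.form (m.edge' z, true) (m.edge' z', true) =
      if m.edge (carrier z) = m.edge (carrier z') then ((shift z' - shift z).sign : ℚ) else
        o.form (m.edge (carrier z), true) (m.edge (carrier z'), true) := by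
    intro z z'
    have hp' : ∀ z, o'.pos (m.edge' z, true) = 2 * pW (m.edge (carrier z)) + shift z := by
      intro z
      change pW' (m.edge' z) = _
      simp [pW']
    have hpo : ∀ e, o.pos (e, true) = pW e := fun e => rfl
    have hiff : Γ'.conj.toBipartiteGraph.src (m.edge' z, true) =
        Γ'.conj.toBipartiteGraph.src (m.edge' z', true) ↔
        Γ.conj.toBipartiteGraph.src (m.edge (carrier z), true) =
          Γ.conj.toBipartiteGraph.src (m.edge (carrier z'), true) := by
      have h1 := m.white_carrier z
      have h2 := m.white_carrier z'
      simp [BipartiteGraph.src, BipartiteRibbonGraph.conj, h1, h2]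
    by_cases h : Γ.conj.toBipartiteGraph.src (m.edge (carrier z), true) =
          Γ.conj.toBipartiteGraph.src (m.edge (carrier z'), true)
    · rw [o'.form_of_eq (hiff.2 h), hp', hp']
      split_ifs with hc
      · rw [hc]; congr 2; ring
      · rw [o.form_of_eq h, hpo, hpo]
        have hne : pW (m.edge (carrier z)) ≠ pW (m.edge (carrier z')) := fun h' =>
          hc (congrArg Prod.fst (o.inj _ _ h h'))
        have r1 : 0 ≤ shift z ∧ shift z ≤ 1 := by
          rcases z with r | (_ | _ | _ | _ | _ | _) <;> simp [shift]
        have r2 : 0 ≤ shift z' ∧ shift z' ≤ 1 := by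
          rcases z' with r | (_ | _ | _ | _ | _ | _) <;> simp [shift]
        rcases lt_or_gt_of_ne hne with n | n
        · rw [Int.sign_eq_one_of_pos, Int.sign_eq_one_of_pos] <;> omega
        · rw [Int.sign_eq_neg_one_of_neg, Int.sign_eq_neg_one_of_neg] <;> omega
    · rw [o'.form_of_ne (fun h' => h (hiff.1 h')), o.form_of_ne h, if_neg]
      intro h'
      exact h (by rw [h'])
  funext d d'
  obtain ⟨e, c⟩ := d
  obtain ⟨e', c'⟩ := d'
  have ho' : ∀ (e e' : E') c c', c ≠ c' → o'.form (e, c) (e', c') = 0 := by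
    intro e e' c c' h
    refine o'.form_of_ne ?_
    cases c <;> cases c' <;> simp [BipartiteGraph.src] at h ⊢
  by_cases hcc : c = c'
  · subst hcc
    cases c
    · have : ∀ x y, o'.form (x, false) (y, false) =
          o.form (m.edgeEquiv x, false) (m.edgeEquiv y, false) := by
        intro x y
        have hb := m.black_edgeEquiv x y
        have hiff : Γ'.conj.toBipartiteGraph.src (x, false) = Γ'.conj.toBipartiteGraph.src (y, false) ↔
            Γ.conj.toBipartiteGraph.src (m.edgeEquiv x, false) =
              Γ.conj.toBipartiteGraph.src (m.edgeEquiv y, false) := by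
          simp [BipartiteGraph.src, BipartiteRibbonGraph.conj, hb]
        by_cases h : Γ'.conj.toBipartiteGraph.src (x, false) =
            Γ'.conj.toBipartiteGraph.src (y, false)
        · rw [o'.form_of_eq h, o.form_of_eq (hiff.1 h)]
          rfl
        · rw [o'.form_of_ne h, o.form_of_ne (fun h' => h (hiff.2 h'))]
      rw [this]
      simp [slideForm]
    · obtain ⟨z, rfl⟩ := m.edge'.surjective e
      obtain ⟨z', rfl⟩ := m.edge'.surjective e'
      rw [white_form]
      have hs := s1.self
      rcases z with r | (_ | _ | _ | _ | _ | _) <;> rcases z' with r' | (_ | _ | _ | _ | _ | _) <;>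
        simp [slideForm, edgeEquiv_inl, edgeEquiv_inr, label, carrier, shift, hinj, hs]
      by_cases h : m.edge (.inl r) = m.edge (.inl r')
      · refine (if_pos h).trans ?_
        rw [h, hs]
      · exact if_neg h
  · rw [ho' _ _ _ _ hcc]
    exact (slideForm_color (slideForm_color s1.color) _ _ hcc).symm

end TwoByTwoMove

namespace TwoByTwoMove

open PathAlgebra BipartiteGraph

variable {W B B' E E' R : Type*} {Γ : BipartiteRibbonGraph W B E}
  {Γ' : BipartiteRibbonGraph W B' E'} (m : TwoByTwoMove R Γ Γ')

open Classical in
/-- The path on `Γ` whose monodromy is, up to a sign, the leading term of the monodromy of the new line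
bundle along an edge of `Γ'`: the edges `b'q'` and `d'p'`, relabelled, slide along two others. -/
def leadingPath (e : E') : List (Dart E) :=
  subWalk (slide (m.edge (.inr .ap)) (m.edge (.inr .bp)) (m.edge (.inr .bq)))
    (slide (m.edge (.inr .cq)) (m.edge (.inr .dq)) (m.edge (.inr .dp)) (m.edgeEquiv e))

theorem leadingPath_edge' (z : R ⊕ AlphaEdge') : m.leadingPath (m.edge' z) = match z with
    | .inl r => [(m.edge (.inl r), true)]
    | .inr .ap => [m.fwd .ap]
    | .inr .bp => [m.fwd .bp]
    | .inr .cq => [m.fwd .cq]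
    | .inr .dq => [m.fwd .dq]
    | .inr .cp => [m.fwd .cq, m.bwd .dq, m.fwd .dp]
    | .inr .aq => [m.fwd .ap, m.bwd .bp, m.fwd .bq] := by
  have hinj : ∀ x y, m.edge x = m.edge y ↔ x = y := fun x y => m.edge.apply_eq_iff_eq
  rcases z with r | (_ | _ | _ | _ | _ | _) <;>
    simp [leadingPath, slide, edgeEquiv_inl, edgeEquiv_inr, label, hinj, subWalk, subLetter, fwd, bwd,
      reversePath, Dart.rev]

/-- The inverse of the leading part. -/
def leadingPathInv (e : E) : List (Dart E') := match m.edge.symm e with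
    | .inl r => [(m.edge' (.inl r), true)]
    | .inr .bq => [(m.edge' (.inr .bp), true), (m.edge' (.inr .ap), false), (m.edge' (.inr .aq), true)]
    | .inr .dp => [(m.edge' (.inr .dq), true), (m.edge' (.inr .cq), false), (m.edge' (.inr .cp), true)]
    | .inr .ap => [(m.edge' (.inr .ap), true)]
    | .inr .bp => [(m.edge' (.inr .bp), true)]
    | .inr .cq => [(m.edge' (.inr .cq), true)]
    | .inr .dq => [(m.edge' (.inr .dq), true)]

open Classical in
/-- The bijection of the `•`-vertices which carry edges. -/
def blackMap (b : B') : B :=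
  if h : ∃ e, Γ'.black e = b then Γ.black (m.edgeEquiv h.choose) else Γ.black (m.edge (.inr .ap))

theorem blackMap_black (e : E') : m.blackMap (Γ'.black e) = Γ.black (m.edgeEquiv e) := by
  have h : ∃ e', Γ'.black e' = Γ'.black e := ⟨e, rfl⟩
  rw [blackMap, dif_pos h, black_edgeEquiv]
  exact h.choose_spec

open Classical in
/-- The inverse bijection. -/
def blackMapInv (b : B) : B' :=
  if h : ∃ e, Γ.black e = b then Γ'.black (m.edgeEquiv.symm h.choose)
  else Γ'.black (m.edge' (.inr .ap))

theorem blackMapInv_black (e : E) : m.blackMapInv (Γ.black e) = Γ'.black (m.edgeEquiv.symm e) := by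
  have h : ∃ e', Γ.black e' = Γ.black e := ⟨e, rfl⟩
  rw [blackMapInv, dif_pos h, ← black_edgeEquiv, Equiv.apply_symm_apply, Equiv.apply_symm_apply]
  exact h.choose_spec

theorem black_p : Γ.black (m.edge (.inr .bp)) = Γ.black (m.edge (.inr .ap)) ∧
    Γ.black (m.edge (.inr .dp)) = Γ.black (m.edge (.inr .ap)) := by
  rw [← m.bp_ap, ← m.ap_dp, ← m.bp_ap]
  simp only [black_rotB, and_self]

theorem black_q : Γ.black (m.edge (.inr .bq)) = Γ.black (m.edge (.inr .cq)) ∧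
    Γ.black (m.edge (.inr .dq)) = Γ.black (m.edge (.inr .cq)) := by
  rw [← m.dq_cq, ← m.bq_dq]
  simp only [black_rotB, and_self]

/-- The leading part of the move, as a map of graphs. -/
def leading : PathMap Γ'.toBipartiteGraph Γ.toBipartiteGraph where
  edge := m.leadingPath
  vert := Sum.map id m.blackMap
  ne_nil e := by
    obtain ⟨z, rfl⟩ := m.edge'.surjective e
    rw [leadingPath_edge']
    rcases z with r | (_ | _ | _ | _ | _ | _) <;> simp
  isWalk e := by
    have hb := m.blackMap_black e
    obtain ⟨z, rfl⟩ := m.edge'.surjective e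
    rw [leadingPath_edge', ← white_carrier]
    simp only [Sum.map_inl, Sum.map_inr, hb, id]
    have h1 := m.black_p
    have h2 := m.black_q
    have h3 := m.white_b
    have h4 := m.white_d
    rcases z with r | (_ | _ | _ | _ | _ | _) <;>
      simp [IsWalk, src, tgt, Dart.rev, fwd, bwd, carrier, edgeEquiv_inl, edgeEquiv_inr, label, h1, h2,
        h3, h4]

/-- The inverse of the leading part, as a map of graphs. -/
def leadingInv : PathMap Γ.toBipartiteGraph Γ'.toBipartiteGraph where
  edge := m.leadingPathInv
  vert := Sum.map id m.blackMapInv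
  ne_nil e := by
    obtain ⟨z, rfl⟩ := m.edge.surjective e
    rw [leadingPathInv, Equiv.symm_apply_apply]
    rcases z with r | (_ | _ | _ | _ | _ | _) <;> simp
  isWalk e := by
    have hb := m.blackMapInv_black e
    have h3 := m.white_b
    have h4 := m.white_d
    have w := m.white_carrier
    have bl := m.black_edgeEquiv
    have q1 := m.black_p
    have q2 := m.black_q
    have p1 : Γ'.black (m.edge' (.inr .bp)) = Γ'.black (m.edge' (.inr .ap)) := by
      rw [← bl, edgeEquiv_inr, edgeEquiv_inr]; exact q1.1
    have p2 : Γ'.black (m.edge' (.inr .cp)) = Γ'.black (m.edge' (.inr .ap)) := by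
      rw [← bl, edgeEquiv_inr, edgeEquiv_inr]; exact q1.2
    have p3 : Γ'.black (m.edge' (.inr .dq)) = Γ'.black (m.edge' (.inr .cq)) := by
      rw [← bl, edgeEquiv_inr, edgeEquiv_inr]; exact q2.2
    obtain ⟨z, rfl⟩ := m.edge.surjective e
    have hz : ∀ x, m.edgeEquiv.symm (m.edge (.inr (label x))) = m.edge' (.inr x) := fun x => by
      rw [← edgeEquiv_inr, Equiv.symm_apply_apply]
    have hr : ∀ r, m.edgeEquiv.symm (m.edge (.inl r)) = m.edge' (.inl r) := fun x => by
      rw [← edgeEquiv_inl, Equiv.symm_apply_apply]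
    rw [leadingPathInv, Equiv.symm_apply_apply]
    simp only [Sum.map_inl, Sum.map_inr, hb, id]
    have wa := w (.inr .ap)
    have wa' := w (.inr .aq)
    have wb := w (.inr .bp)
    have wc := w (.inr .cp)
    have wc' := w (.inr .cq)
    have wd := w (.inr .dq)
    simp only [carrier] at wa wa' wb wc wc' wd
    rcases z with r | (_ | _ | _ | _ | _ | _)
    · rw [hr]
      simp [IsWalk, src, tgt, Dart.rev, ← w (.inl r), carrier]
    · rw [show m.edgeEquiv.symm (m.edge (.inr .ap)) = m.edge' (.inr .ap) from hz .ap]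
      simp [IsWalk, src, tgt, Dart.rev, ← wa]
    · rw [show m.edgeEquiv.symm (m.edge (.inr .bp)) = m.edge' (.inr .bp) from hz .bp]
      simp [IsWalk, src, tgt, Dart.rev, ← wb]
    · rw [show m.edgeEquiv.symm (m.edge (.inr .dp)) = m.edge' (.inr .cp) from hz .cp]
      simp [IsWalk, src, tgt, Dart.rev, ← wd, ← wc, ← wc', h4, p3]
    · rw [show m.edgeEquiv.symm (m.edge (.inr .bq)) = m.edge' (.inr .aq) from hz .aq]
      simp [IsWalk, src, tgt, Dart.rev, ← wb, ← wa, ← wa', h3, p1]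
    · rw [show m.edgeEquiv.symm (m.edge (.inr .cq)) = m.edge' (.inr .cq) from hz .cq]
      simp [IsWalk, src, tgt, Dart.rev, ← wc']
    · rw [show m.edgeEquiv.symm (m.edge (.inr .dq)) = m.edge' (.inr .dq) from hz .dq]
      simp [IsWalk, src, tgt, Dart.rev, ← wd]

theorem mk_spike_cons (x : E) (b : Bool) (l : List (Dart E)) :
    FreeGroup.mk ((x, b) :: (x, !b) :: l) = FreeGroup.mk l :=
  Quot.sound (FreeGroup.Red.Step.cons_not)

/-- The leading part of the move is a bijection of the sets of loops. -/
def leadingEquiv : Γ'.L ≃ Γ.L where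
  toFun := m.leading.loopMap
  invFun := m.leadingInv.loopMap
  left_inv := by
    refine PathMap.loopMap_leftInverse m.leading m.leadingInv ?_ ?_
    · rintro ⟨e, b⟩
      cases b
      · simp [src, leading, leadingInv, blackMap_black, blackMapInv_black]
      · simp [src, leading, leadingInv]
    · intro e
      obtain ⟨z, rfl⟩ := m.edge'.surjective e
      change FreeGroup.mk (subWalk m.leadingPathInv (m.leadingPath _)) = _
      rw [leadingPath_edge']
      rcases z with r | (_ | _ | _ | _ | _ | _) <;>
        simp only [subWalk, subLetter, fwd, bwd, leadingPathInv, Equiv.symm_apply_apply, reversePath,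
          Dart.rev, List.flatMap_cons, List.flatMap_nil, List.map_cons, List.map_nil,
          List.reverse_cons, List.reverse_nil, if_true, Bool.false_eq_true, if_false,
          List.nil_append, List.append_nil, List.cons_append, Bool.not_true]
      · exact (congrArg (FreeGroup.mk [(m.edge' (.inr .cq), true)] * ·)
          (mk_spike_cons (m.edge' (.inr .dq)) false _)).trans (mk_spike_cons _ true _)
      · exact (congrArg (FreeGroup.mk [(m.edge' (.inr .ap), true)] * ·)
          (mk_spike_cons (m.edge' (.inr .bp)) false _)).trans (mk_spike_cons _ true _)
  right_inv := by
    refine PathMap.loopMap_leftInverse m.leadingInv m.leading ?_ ?_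
    · rintro ⟨e, b⟩
      cases b
      · simp [src, leading, leadingInv, blackMap_black, blackMapInv_black]
      · simp [src, leading, leadingInv]
    · intro e
      obtain ⟨z, rfl⟩ := m.edge.surjective e
      change FreeGroup.mk (subWalk m.leadingPath (m.leadingPathInv _)) = _
      rw [leadingPathInv, Equiv.symm_apply_apply]
      rcases z with r | (_ | _ | _ | _ | _ | _) <;>
        simp only [subWalk, subLetter, fwd, bwd, leadingPath_edge', reversePath,
          Dart.rev, List.flatMap_cons, List.flatMap_nil, List.map_cons, List.map_nil,
          List.reverse_cons, List.reverse_nil, if_true, Bool.false_eq_true, if_false,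
          List.nil_append, List.append_nil, List.cons_append, Bool.not_true]
      · exact (congrArg (FreeGroup.mk [(m.edge (.inr .dq), true)] * ·)
          (mk_spike_cons (m.edge (.inr .cq)) false _)).trans (mk_spike_cons _ true _)
      · exact (congrArg (FreeGroup.mk [(m.edge (.inr .bp), true)] * ·)
          (mk_spike_cons (m.edge (.inr .ap)) false _)).trans (mk_spike_cons _ true _)

/-- The leading part respects the bracket: it is composed of a relabelling and of two slides, and each
of them carries the derivations which define the brackets to each other. -/
theorem bracket_leading [Finite E] [Finite E'] (a b : Γ'.L) :
    Γ.bracket (m.leadingEquiv a) (m.leadingEquiv b) = (Γ'.bracket a b).mapDomain m.leadingEquiv := by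
  classical
  obtain ⟨o, o', h1, h2, h3⟩ := m.exists_vertexOrders
  have hinj : ∀ x y, m.edge x = m.edge y ↔ x = y := fun x y => m.edge.apply_eq_iff_eq
  have h4 := h1.slideForm h2 (by simp [hinj]) (by simp [hinj]) (by simp [hinj]) (by simp [hinj])
  have hl : ∀ l, subWalk m.leadingPath l =
      subWalk (slide (m.edge (.inr .ap)) (m.edge (.inr .bp)) (m.edge (.inr .bq)))
        (subWalk (slide (m.edge (.inr .cq)) (m.edge (.inr .dq)) (m.edge (.inr .dp)))
          (subWalk (fun e => [(m.edgeEquiv e, true)]) l)) := by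
    intro l
    rw [subWalk_subWalk, subWalk_subWalk]
    congr 1
    funext e
    exact (List.append_nil _).symm
  have hA : ∀ a, subAlg m.leadingPath a =
      subAlg (slide (m.edge (.inr .ap)) (m.edge (.inr .bp)) (m.edge (.inr .bq)))
        (subAlg (slide (m.edge (.inr .cq)) (m.edge (.inr .dq)) (m.edge (.inr .dp)))
          (subAlg (fun e => [(m.edgeEquiv e, true)]) a)) := by
    intro a
    rw [subAlg_subAlg, subAlg_subAlg]
    congr 2
    funext e
    exact (List.append_nil _).symm
  refine PathMap.goldman_loopMap (Γ' := Γ'.conj) (Γ := Γ.conj) m.leading o' o (fun l a => ?_) a b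
  change der (grad o.form (subWalk m.leadingPath l)) (subAlg m.leadingPath a) =
    subAlg m.leadingPath (der (grad o'.form l) a)
  rw [hl, hA, hA, h1.der_grad, h4.der_grad, der_grad_rename, h3]

end TwoByTwoMove

namespace TwoByTwoMove

open PathAlgebra BipartiteGraph

variable {W B B' E E' R : Type*} {Γ : BipartiteRibbonGraph W B E}
  {Γ' : BipartiteRibbonGraph W B' E'} (m : TwoByTwoMove R Γ Γ')

/-! ### Weights and signs of the leading terms -/

theorem squareWeight_eq (w : E → ℤ) : m.squareWeight w = w (m.edge (.inr .dq)) -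
    w (m.edge (.inr .dp)) + w (m.edge (.inr .bp)) - w (m.edge (.inr .bq)) := by
  simp only [squareWeight, squareP, walkWeight, fwd, bwd, List.map_cons, List.map_nil, List.sum_cons,
    List.sum_nil, if_true, Bool.false_eq_true, if_false]
  ring

theorem walkWeight_leadingPath (w : E → ℤ) (z : R ⊕ AlphaEdge') :
    walkWeight w (m.leadingPath (m.edge' z)) = match z with
    | .inl r => w (m.edge (.inl r))
    | .inr .ap => w (m.edge (.inr .ap))
    | .inr .bp => w (m.edge (.inr .bp))
    | .inr .cq => w (m.edge (.inr .cq))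
    | .inr .dq => w (m.edge (.inr .dq))
    | .inr .cp => w (m.edge (.inr .cq)) - w (m.edge (.inr .dq)) + w (m.edge (.inr .dp))
    | .inr .aq => w (m.edge (.inr .ap)) - w (m.edge (.inr .bp)) + w (m.edge (.inr .bq)) := by
  rw [leadingPath_edge']
  rcases z with r | (_ | _ | _ | _ | _ | _) <;>
    simp [walkWeight, fwd, bwd, sub_eq_add_neg, add_assoc]

variable {m} in
/-- The weights of the edges of `Γ'` and of their leading terms differ by a coboundary. -/
theorem Compatible.exists_potential {w : E → ℤ} {w' : E' → ℤ} (h : m.Compatible w w') :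
    ∃ c : W ⊕ B' → ℤ, ∀ e, w' e =
      walkWeight w (m.leadingPath e) + c (.inr (Γ'.black e)) - c (.inl (Γ'.white e)) := by
  classical
  set f : E' → ℤ := fun e => w' e - walkWeight w (m.leadingPath e) with hf
  have h1 := h.outer
  have h2 := h.ba
  have h3 := h.cb
  have h4 := h.dc
  have h5 := h.ad
  rw [squareWeight_eq] at h3 h5
  have hinv : ∀ e, f (Γ'.rotB e) = f e := by
    intro e
    obtain ⟨z, rfl⟩ := m.edge'.surjective e
    rcases z with r | x
    · obtain ⟨s, hs⟩ := m.rotB_inl' r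
      simp only [hf, hs, walkWeight_leadingPath, h1, sub_self]
    · cases x
      · rw [m.ap_cp']; simp only [hf, walkWeight_leadingPath]; omega
      · rw [m.bp_ap']; simp only [hf, walkWeight_leadingPath]; omega
      · rw [m.cp_bp']; simp only [hf, walkWeight_leadingPath]; omega
      · rw [m.aq_dq']; simp only [hf, walkWeight_leadingPath]; omega
      · rw [m.cq_aq']; simp only [hf, walkWeight_leadingPath]; omega
      · rw [m.dq_cq']; simp only [hf, walkWeight_leadingPath]; omega
  refine ⟨Sum.elim 0 fun b => if hb : ∃ e, Γ'.black e = b then f hb.choose else 0, fun e => ?_⟩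
  have hb : ∃ e', Γ'.black e' = Γ'.black e := ⟨e, rfl⟩
  have := Equiv.Perm.SameCycle.apply_eq hinv ((Γ'.sameCycle_rotB _ _).2 hb.choose_spec)
  simp only [Sum.elim_inl, Sum.elim_inr, dif_pos hb, Pi.zero_apply]
  rw [this]
  simp only [hf]
  ring

variable {m} in
theorem Compatible.wt_leadingEquiv {w : E → ℤ} {w' : E' → ℤ} (h : m.Compatible w w') (ℓ : Γ'.L) :
    Γ.wt w (m.leadingEquiv ℓ) = Γ'.wt w' ℓ := by
  obtain ⟨c, hc⟩ := h.exists_potential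
  exact m.leading.loopWeight_loopMap c hc ℓ

/-- The edges of `Γ'` whose leading terms have the coefficient `-1`. -/
def IsNegative (e : E') : Prop := e = m.edge' (.inr .cp) ∨ e = m.edge' (.inr .aq)

open Classical in
/-- The number of passages along `c'p'` and `a'q'`, which gives the sign of the leading term. -/
def negCount (e : E') : ℤ := if m.IsNegative e then 1 else 0

/-- The coefficient of the leading term of the monodromy along a loop on `Γ'`. -/
def sign (ℓ : Γ'.L) : ℤ := (((-1) ^ Γ'.wt m.negCount ℓ : ℤˣ) : ℤ)

theorem sign_mul_self (ℓ : Γ'.L) : m.sign ℓ * m.sign ℓ = 1 := by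
  rw [sign, ← Units.val_mul, ← mul_zpow]
  simp

theorem sign_of_mem_bracket [Finite E'] {a b z : Γ'.L} (h : Γ'.bracket a b z ≠ 0) :
    m.sign z = m.sign a * m.sign b := by
  have := Γ'.conj.goldman_supported m.negCount a b (Finsupp.mem_support_iff.2 h)
  change Γ'.wt m.negCount z = Γ'.wt m.negCount a + Γ'.wt m.negCount b at this
  rw [sign, this, zpow_add, Units.val_mul]
  rfl

end TwoByTwoMove

/-! ### The Hamiltonian flows of the powers of the square -/

namespace PathAlgebra

open BipartiteGraph

variable {E : Type*}

theorem der_ext {K K' : Dart E → PathAlgebra E}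
    (h : ∀ e, der K (wd [(e, true)]) = der K' (wd [(e, true)])) : der K = der K' := by
  have h1 : subAlg (fun e : E => [(e, true)]) = AlgHom.id ℚ (PathAlgebra E) := by
    have : (subAlg (fun e : E => [(e, true)])).toLinearMap = LinearMap.id :=
      hom_ext fun l => by simp [subAlg_wd, subWalk_single]
    exact AlgHom.toLinearMap_injective this
  refine LinearMap.ext fun a => ?_
  have h2 := der_subAlg (K := K) (K' := K') (f := fun e : E => [(e, true)])
    (fun e => by rw [h1]; exact h e) a
  rwa [h1] at h2

theorem wd_replicate_flatten (l : List (Dart E)) (k : ℕ) :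
    wd (List.replicate k l).flatten = wd l ^ k := by
  induction k with
  | zero => simp
  | succ k ih => rw [List.replicate_succ, List.flatten_cons, wd_append, ih, pow_succ']

/-- The cyclic derivative of a power. -/
theorem cyc_replicate (a : Dart E → ℚ) (l : List (Dart E)) (k : ℕ) :
    cyc a (List.replicate (k + 1) l).flatten = ((k : ℚ) + 1) • cycAux a l (wd l ^ k) := by
  have h : ∀ j i, cycAux a (List.replicate j l).flatten (wd l ^ i) =
      (j : ℚ) • cycAux a l (wd l ^ (j + i - 1)) := by
    intro j
    induction j with
    | zero => intro i; simp [cycAux]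
    | succ j ih =>
      intro i
      rw [List.replicate_succ, List.flatten_cons, cycAux_append, wd_replicate_flatten, ← pow_add,
        ← pow_succ, ih, show j + (i + 1) - 1 = j + i by omega, show j + 1 + i - 1 = j + i by omega]
      push_cast
      rw [add_smul, one_smul, add_comm]
  have := h (k + 1) 0
  rw [pow_zero] at this
  rw [cyc, this]
  simp

/-- Inner derivations that come from loops at the vertices do not change the class of a closed walk. -/
theorem trace_der_inner {W B : Type*} {G : BipartiteGraph W B E} {H : W ⊕ B → PathAlgebra E}
    (hH : ∀ v, H v ∈ G.pathSpan v v) {v : W ⊕ B} {a : PathAlgebra E} (ha : a ∈ G.pathSpan v v) :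
    G.trace v (der (fun d => H (G.src d)) a) = 0 := by
  have h : ∀ (l : List (Dart E)) u v, G.IsWalk u v l →
      der (fun d => H (G.src d)) (wd l) = H u * wd l - wd l * H v := by
    intro l
    induction l with
    | nil =>
      rintro u v rfl
      rw [wd_nil, der_one, mul_one, one_mul, sub_self]
    | cons d l ih =>
      rintro u v ⟨rfl, hl⟩
      rw [wd_cons, der_mul, der_dart, ih _ _ hl, src_rev]
      noncomm_ring
  induction ha using Submodule.span_induction with
  | zero => simp
  | add y z _ _ hy hz => rw [map_add, map_add, hy, hz, add_zero]
  | smul c y _ hy => rw [map_smul, map_smul, hy, smul_zero]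
  | mem y hy =>
    obtain ⟨l, hl, rfl⟩ := hy
    rw [h l v v hl, map_sub, trace_mul_comm (hH v), sub_self]

end PathAlgebra

namespace TwoByTwoMove

open PathAlgebra BipartiteGraph

variable {W B B' E E' R : Type*} {Γ : BipartiteRibbonGraph W B E}
  {Γ' : BipartiteRibbonGraph W B' E'} (m : TwoByTwoMove R Γ Γ')

/-- The vertex `p`. -/
def vertexP : W ⊕ B := .inr (Γ.black (m.edge (.inr .ap)))

/-- The vertex `q`. -/
def vertexQ : W ⊕ B := .inr (Γ.black (m.edge (.inr .cq)))

theorem isWalk_squareP : Γ.toBipartiteGraph.IsWalk m.vertexP m.vertexP m.squareP := by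
  have h1 := m.black_p
  have h2 := m.black_q
  have h3 := m.white_b
  have h4 := m.white_d
  simp [squareP, vertexP, IsWalk, src, tgt, Dart.rev, fwd, bwd, h1, h2, h3, h4]

theorem isWalk_squareQ : Γ.toBipartiteGraph.IsWalk m.vertexQ m.vertexQ m.squareQ := by
  have h1 := m.black_p
  have h2 := m.black_q
  have h3 := m.white_b
  have h4 := m.white_d
  simp [squareQ, vertexQ, IsWalk, src, tgt, Dart.rev, fwd, bwd, h1, h2, h3, h4]

/-- The edges of `α` at `p`. -/
def AtP (e : E) : Prop := e = m.edge (.inr .ap) ∨ e = m.edge (.inr .bp) ∨ e = m.edge (.inr .dp)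

/-- The edges of `α` at `q`. -/
def AtQ (e : E) : Prop := e = m.edge (.inr .cq) ∨ e = m.edge (.inr .bq) ∨ e = m.edge (.inr .dq)

theorem black_eq_p (e : E) : Γ.black e = Γ.black (m.edge (.inr .ap)) ↔ m.AtP e := by
  have h1 := m.black_p
  constructor
  · intro h
    have hinv : ∀ e, m.AtP (Γ.rotB e) = m.AtP e := by
      intro e
      have hr : ∀ x y, Γ.rotB x = y → (Γ.rotB e = y ↔ e = x) := fun x y hxy => by
        rw [← hxy, Γ.rotB.apply_eq_iff_eq]
      simp only [AtP, hr _ _ m.bp_ap, hr _ _ m.ap_dp, hr _ _ m.dp_bp, eq_iff_iff]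
      tauto
    rw [Equiv.Perm.SameCycle.apply_eq hinv ((Γ.sameCycle_rotB _ _).2 h)]
    exact Or.inl rfl
  · rintro (rfl | rfl | rfl)
    exacts [rfl, h1.1, h1.2]

theorem black_eq_q (e : E) : Γ.black e = Γ.black (m.edge (.inr .cq)) ↔ m.AtQ e := by
  have h1 := m.black_q
  constructor
  · intro h
    have hinv : ∀ e, m.AtQ (Γ.rotB e) = m.AtQ e := by
      intro e
      have hr : ∀ x y, Γ.rotB x = y → (Γ.rotB e = y ↔ e = x) := fun x y hxy => by
        rw [← hxy, Γ.rotB.apply_eq_iff_eq]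
      simp only [AtQ, hr _ _ m.dq_cq, hr _ _ m.cq_bq, hr _ _ m.bq_dq, eq_iff_iff]
      tauto
    rw [Equiv.Perm.SameCycle.apply_eq hinv ((Γ.sameCycle_rotB _ _).2 h)]
    exact Or.inl rfl
  · rintro (rfl | rfl | rfl)
    exacts [rfl, h1.1, h1.2]

open Classical in
/-- The coefficients of the derivation with `a•p ↦ a•p Sᵏ` and `c•q ↦ c•q Sᵏ`, where `S` is the square,
and which is zero on the other edges. -/
def flowCoeff (k : ℕ) (d : Dart E) : PathAlgebra E :=
  if d = m.bwd .ap then - wd m.squareP ^ k else if d = m.bwd .cq then - wd m.squareQ ^ k else 0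

/-- The `k`-th power of the square, as a closed walk at `p`. -/
def squarePow (k : ℕ) : List (Dart E) := (List.replicate k m.squareP).flatten

theorem isWalk_squarePow (k : ℕ) : Γ.toBipartiteGraph.IsWalk m.vertexP m.vertexP (m.squarePow k) := by
  induction k with
  | zero => rfl
  | succ k ih =>
    rw [squarePow, List.replicate_succ, List.flatten_cons]
    exact isWalk_append.2 ⟨_, m.isWalk_squareP, ih⟩

theorem der_flowCoeff (k : ℕ) (z : R ⊕ AlphaEdge) :
    der (m.flowCoeff k) (wd [(m.edge z, true)]) = match z with
    | .inr .ap => wd [m.fwd .ap] * wd m.squareP ^ k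
    | .inr .cq => wd [m.fwd .cq] * wd m.squareQ ^ k
    | _ => 0 := by
  have hinj : ∀ x y, m.edge x = m.edge y ↔ x = y := fun x y => m.edge.apply_eq_iff_eq
  rw [der_dart]
  rcases z with r | (_ | _ | _ | _ | _ | _) <;>
    simp [flowCoeff, bwd, fwd, Dart.rev, hinj]

theorem squareP_eq : wd m.squareP =
    wd [m.bwd .dp] * wd [m.fwd .dq] * wd [m.bwd .bq] * wd [m.fwd .bp] := by
  simp only [← wd_append]; rfl

theorem squareQ_eq : wd m.squareQ =
    wd [m.bwd .bq] * wd [m.fwd .bp] * wd [m.bwd .dp] * wd [m.fwd .dq] := by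
  simp only [← wd_append]; rfl

theorem fwd_mul_bwd (x : AlphaEdge) : wd [m.fwd x] * wd [m.bwd x] = 1 := wd_mul_rev (m.fwd x)

theorem bwd_mul_fwd (x : AlphaEdge) : wd [m.bwd x] * wd [m.fwd x] = 1 := wd_rev_mul (m.fwd x)

theorem fwd_mul_bwd_assoc (x : AlphaEdge) (a : PathAlgebra E) :
    wd [m.fwd x] * (wd [m.bwd x] * a) = a := by rw [← mul_assoc, fwd_mul_bwd, one_mul]

theorem bwd_mul_fwd_assoc (x : AlphaEdge) (a : PathAlgebra E) :
    wd [m.bwd x] * (wd [m.fwd x] * a) = a := by rw [← mul_assoc, bwd_mul_fwd, one_mul]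

/-- The path `p d q` conjugates the square at `q` into the square at `p`. -/
theorem semiconj_d : SemiconjBy (wd [m.bwd .dp] * wd [m.fwd .dq]) (wd m.squareQ) (wd m.squareP) := by
  rw [SemiconjBy, squareP_eq, squareQ_eq]
  simp only [mul_assoc]

/-- The path `p b q` conjugates the square at `q` into the square at `p`. -/
theorem semiconj_b : SemiconjBy (wd [m.bwd .bp] * wd [m.fwd .bq]) (wd m.squareQ) (wd m.squareP) := by
  rw [SemiconjBy, squareP_eq, squareQ_eq]
  simp only [mul_assoc, fwd_mul_bwd_assoc, bwd_mul_fwd_assoc, bwd_mul_fwd, mul_one]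

theorem grad_squarePow (s : Dart E → Dart E → ℚ) (k : ℕ) (d : Dart E) :
    grad s (m.squarePow (k + 1)) d = (((k : ℚ) + 1) / 2) • (
      (s (m.bwd .dp) d - s (m.bwd .bp) d) • wd m.squareP ^ (k + 1) +
      (s (m.fwd .dq) d - s (m.fwd .dp) d) •
        (wd [m.fwd .dp] * wd m.squareP ^ (k + 1) * wd [m.bwd .dp]) +
      (s (m.bwd .bq) d - s (m.bwd .dq) d) • wd m.squareQ ^ (k + 1) +
      (s (m.fwd .bp) d - s (m.fwd .bq) d) •
        (wd [m.fwd .bp] * wd m.squareP ^ (k + 1) * wd [m.bwd .bp])) := by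
  have hQ : wd m.squareQ ^ (k + 1) = wd [m.bwd .bq] * wd [m.fwd .bp] * wd m.squareP ^ k *
      (wd [m.bwd .dp] * wd [m.fwd .dq]) := by
    have h := (m.semiconj_d.pow_right k).eq
    rw [mul_assoc, ← h, pow_succ', squareQ_eq]
    simp only [mul_assoc]
  have h1 : (m.bwd .dp).rev = m.fwd .dp := rfl
  have h2 : (m.fwd .dq).rev = m.bwd .dq := rfl
  have h3 : (m.bwd .bq).rev = m.fwd .bq := rfl
  have h4 : (m.fwd .bp).rev = m.bwd .bp := rfl
  have e1 : wd m.squareP ^ (k + 1) = wd [m.bwd .dp] * (wd [m.fwd .dq] * (wd [m.bwd .bq] *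
      (wd [m.fwd .bp] * wd m.squareP ^ k))) := by
    rw [pow_succ', m.squareP_eq]; simp only [mul_assoc]
  have e2 : wd [m.fwd .bp] * wd m.squareP ^ (k + 1) * wd [m.bwd .bp] =
      wd [m.fwd .bp] * (wd m.squareP ^ k * (wd [m.bwd .dp] * (wd [m.fwd .dq] * wd [m.bwd .bq]))) := by
    rw [pow_succ]; nth_rw 2 [m.squareP_eq]; simp only [mul_assoc, fwd_mul_bwd, mul_one]
  have e3 : wd m.squareP ^ (k + 1) = wd m.squareP ^ k * (wd [m.bwd .dp] * (wd [m.fwd .dq] *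
      (wd [m.bwd .bq] * wd [m.fwd .bp]))) := by
    rw [pow_succ]; nth_rw 2 [m.squareP_eq]; simp only [mul_assoc]
  have e4 : wd [m.fwd .dp] * wd m.squareP ^ (k + 1) * wd [m.bwd .dp] =
      wd [m.fwd .dq] * (wd [m.bwd .bq] * (wd [m.fwd .bp] * (wd m.squareP ^ k * wd [m.bwd .dp]))) := by
    rw [e1]; simp only [mul_assoc, fwd_mul_bwd_assoc]
  rw [grad, squarePow, cyc_replicate, e2, e4, hQ]
  simp only [squareP, cycAux]
  rw [← squareP]
  simp only [h1, h2, h3, h4, wd_nil, one_mul, mul_one, wd_cons _ (_ :: _), mul_assoc]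
  simp only [← e1, ← e3]
  module

/-- The gradient of a power of the square at the `∘`-ends: it is supported on the two adjacent edges at `b`
and at `d` between which the square turns. -/
theorem grad_squarePow_white (o : VertexOrder Γ.conj)
    (h1 : IsSlide (m.edge (.inr .ap)) (m.edge (.inr .bp)) (m.edge (.inr .bq)) o.form)
    (h2 : IsSlide (m.edge (.inr .cq)) (m.edge (.inr .dq)) (m.edge (.inr .dp)) o.form) (k : ℕ)
    (z : R ⊕ AlphaEdge) :
    grad o.form (m.squarePow (k + 1)) (m.edge z, true) = match z with
      | .inr .bp | .inr .bq => (((k : ℚ) + 1) / 2) •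
          (wd [m.fwd .bp] * wd m.squareP ^ (k + 1) * wd [m.bwd .bp])
      | .inr .dp | .inr .dq => (((k : ℚ) + 1) / 2) •
          (wd [m.fwd .dp] * wd m.squareP ^ (k + 1) * wd [m.bwd .dp])
      | _ => 0 := by
  classical
  have hinj : ∀ x y, m.edge x = m.edge y ↔ x = y := fun x y => m.edge.apply_eq_iff_eq
  have ft : ∀ a b, o.form (m.bwd a) (b, true) = 0 := fun a b => h1.color _ _ (by simp [bwd])
  have hself : ∀ d, o.form d d = 0 := h1.self
  have hD : ∀ z, o.form (m.fwd .dq) (m.edge z, true) - o.form (m.fwd .dp) (m.edge z, true) =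
      if z = .inr .dq ∨ z = .inr .dp then 1 else 0 := by
    intro z
    by_cases z1 : z = .inr .dq
    · subst z1
      rw [if_pos (Or.inl rfl), fwd, fwd, hself, h2.skew, h2.be]; norm_num
    by_cases z2 : z = .inr .dp
    · subst z2
      rw [if_pos (Or.inr rfl), fwd, fwd, h2.be, hself, sub_zero]
    rw [if_neg (by tauto), fwd, fwd, h2.eb _ (by rwa [ne_eq, hinj]) (by rwa [ne_eq, hinj]), sub_self]
  have hBq : ∀ z, o.form (m.fwd .bp) (m.edge z, true) - o.form (m.fwd .bq) (m.edge z, true) =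
      if z = .inr .bp ∨ z = .inr .bq then 1 else 0 := by
    intro z
    by_cases z1 : z = .inr .bp
    · subst z1
      rw [if_pos (Or.inl rfl), fwd, fwd, hself, h1.skew, h1.be]; norm_num
    by_cases z2 : z = .inr .bq
    · subst z2
      rw [if_pos (Or.inr rfl), fwd, fwd, h1.be, hself, sub_zero]
    rw [if_neg (by tauto), fwd, fwd, h1.eb _ (by rwa [ne_eq, hinj]) (by rwa [ne_eq, hinj]), sub_self]
  rw [grad_squarePow, hD, hBq, ft, ft, ft, ft]
  rcases z with r | (_ | _ | _ | _ | _ | _) <;> simp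

/-- The gradient of a power of the square at the `•`-ends; its values depend on where the cyclic orders at
`p` and at `q` are cut. -/
theorem grad_squarePow_black (o : VertexOrder Γ.conj)
    (h1 : IsSlide (m.edge (.inr .ap)) (m.edge (.inr .bp)) (m.edge (.inr .bq)) o.form)
    (h2 : IsSlide (m.edge (.inr .cq)) (m.edge (.inr .dq)) (m.edge (.inr .dp)) o.form) (k : ℕ)
    (z : R ⊕ AlphaEdge) :
    grad o.form (m.squarePow (k + 1)) (m.edge z, false) = match z with
      | .inr .bp | .inr .dp => (((k : ℚ) + 1) / 2 * - o.form (m.bwd .bp) (m.bwd .dp)) •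
          wd m.squareP ^ (k + 1)
      | .inr .ap => (((k : ℚ) + 1) / 2 * (1 - o.form (m.bwd .bp) (m.bwd .dp))) •
          wd m.squareP ^ (k + 1)
      | .inr .bq | .inr .dq => (((k : ℚ) + 1) / 2 * - o.form (m.bwd .dq) (m.bwd .bq)) •
          wd m.squareQ ^ (k + 1)
      | .inr .cq => (((k : ℚ) + 1) / 2 * (1 - o.form (m.bwd .dq) (m.bwd .bq))) •
          wd m.squareQ ^ (k + 1)
      | _ => 0 := by
  classical
  have hinj : ∀ x y, m.edge x = m.edge y ↔ x = y := fun x y => m.edge.apply_eq_iff_eq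
  have tf : ∀ a b, o.form (m.fwd a) (b, false) = 0 := fun a b => h1.color _ _ (by simp [fwd])
  have hself : ∀ d, o.form d d = 0 := h1.self
  set x := o.form (m.bwd .bp) (m.bwd .dp) with hx
  set y := o.form (m.bwd .dq) (m.bwd .bq) with hy
  have hP0 : ∀ z x, Γ.black (m.edge z) ≠ Γ.black (m.edge (.inr .ap)) → m.AtP (m.edge (.inr x)) →
      o.form (m.bwd x) (m.edge z, false) = 0 := fun z x hz hx => by
    refine o.form_of_ne fun h => hz ?_
    rw [← (m.black_eq_p _).2 hx]
    exact (Sum.inr_injective h).symm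
  have hQ0 : ∀ z x, Γ.black (m.edge z) ≠ Γ.black (m.edge (.inr .cq)) → m.AtQ (m.edge (.inr x)) →
      o.form (m.bwd x) (m.edge z, false) = 0 := fun z x hz hx => by
    refine o.form_of_ne fun h => hz ?_
    rw [← (m.black_eq_q _).2 hx]
    exact (Sum.inr_injective h).symm
  have hx2 : o.form (m.bwd .ap) (m.bwd .dp) = x := h1.ab _ (by simp [hinj]) (by simp [hinj])
  have hy2 : o.form (m.bwd .cq) (m.bwd .bq) = y := h2.ab _ (by simp [hinj]) (by simp [hinj])
  have hDP : ∀ z, o.form (m.bwd .dp) (m.edge z, false) - o.form (m.bwd .bp) (m.edge z, false) =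
      match z with
      | .inr .bp | .inr .dp => - x
      | .inr .ap => 1 - x
      | _ => 0 := by
    intro z
    by_cases hz : m.AtP (m.edge z)
    · simp only [AtP, hinj] at hz
      rcases hz with rfl | rfl | rfl
      · change o.form (m.bwd .dp) (m.bwd .ap) - o.form (m.bwd .bp) (m.bwd .ap) = 1 - x
        rw [h1.skew, hx2, h1.skew (m.bwd .ap), bwd, bwd, h1.ab_one]
        ring
      · change o.form (m.bwd .dp) (m.bwd .bp) - o.form (m.bwd .bp) (m.bwd .bp) = - x
        rw [h1.skew, hself, sub_zero]
      · change o.form (m.bwd .dp) (m.bwd .dp) - o.form (m.bwd .bp) (m.bwd .dp) = - x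
        rw [hself, zero_sub]
    · have hz' : Γ.black (m.edge z) ≠ Γ.black (m.edge (.inr .ap)) := fun h => hz ((m.black_eq_p _).1 h)
      rw [hP0 _ _ hz' (by simp [AtP]), hP0 _ _ hz' (by simp [AtP]), sub_self]
      simp only [AtP, hinj] at hz
      rcases z with r | (_ | _ | _ | _ | _ | _) <;> simp_all
  have hBQ : ∀ z, o.form (m.bwd .bq) (m.edge z, false) - o.form (m.bwd .dq) (m.edge z, false) =
      match z with
      | .inr .bq | .inr .dq => - y
      | .inr .cq => 1 - y
      | _ => 0 := by
    intro z
    by_cases hz : m.AtQ (m.edge z)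
    · simp only [AtQ, hinj] at hz
      rcases hz with rfl | rfl | rfl
      · change o.form (m.bwd .bq) (m.bwd .cq) - o.form (m.bwd .dq) (m.bwd .cq) = 1 - y
        rw [h1.skew, hy2, h1.skew (m.bwd .cq), bwd, bwd, h2.ab_one]
        ring
      · change o.form (m.bwd .bq) (m.bwd .bq) - o.form (m.bwd .dq) (m.bwd .bq) = - y
        rw [hself, zero_sub]
      · change o.form (m.bwd .bq) (m.bwd .dq) - o.form (m.bwd .dq) (m.bwd .dq) = - y
        rw [h1.skew, hself, sub_zero]
    · have hz' : Γ.black (m.edge z) ≠ Γ.black (m.edge (.inr .cq)) := fun h => hz ((m.black_eq_q _).1 h)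
      rw [hQ0 _ _ hz' (by simp [AtQ]), hQ0 _ _ hz' (by simp [AtQ]), sub_self]
      simp only [AtQ, hinj] at hz
      rcases z with r | (_ | _ | _ | _ | _ | _) <;> simp_all
  rw [grad_squarePow, hDP, hBQ, tf, tf, tf, tf]
  simp only [sub_self, zero_smul, add_zero]
  rcases z with r | (_ | _ | _ | _ | _ | _) <;>
    simp only [zero_smul, add_zero, zero_add, smul_zero, smul_smul]

/-- The derivation of a power of the square, up to an inner derivation. -/
theorem exists_der_squarePow (o : VertexOrder Γ.conj)
    (h1 : IsSlide (m.edge (.inr .ap)) (m.edge (.inr .bp)) (m.edge (.inr .bq)) o.form)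
    (h2 : IsSlide (m.edge (.inr .cq)) (m.edge (.inr .dq)) (m.edge (.inr .dp)) o.form) (k : ℕ) :
    ∃ H : W ⊕ B → PathAlgebra E, (∀ v, H v ∈ Γ.toBipartiteGraph.pathSpan v v) ∧
      der (grad o.form (m.squarePow (k + 1))) = - ((k : ℚ) + 1) • der (m.flowCoeff (k + 1)) +
        der (fun d => H (Γ.toBipartiteGraph.src d)) := by
  classical
  have hinj : ∀ x y, m.edge x = m.edge y ↔ x = y := fun x y => m.edge.apply_eq_iff_eq
  set c : ℚ := ((k : ℚ) + 1) / 2 with hc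
  set x := o.form (m.bwd .bp) (m.bwd .dp) with hx
  set y := o.form (m.bwd .dq) (m.bwd .bq) with hy
  -- The constants at `p` and at `q` are determined by the condition that `bp` and `dp`, respectively
  -- `bq` and `dq`, are killed.
  set H : W ⊕ B → PathAlgebra E := fun v =>
    if v = m.vertexP then (- c * (1 + x)) • wd m.squareP ^ (k + 1)
    else if v = m.vertexQ then (- c * (1 + y)) • wd m.squareQ ^ (k + 1) else 0 with hH
  have hpq : m.vertexQ ≠ m.vertexP := by
    intro h
    have := (m.black_eq_p _).1 (Sum.inr_injective h)
    simp [AtP, hinj] at this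
  have hpowP : ∀ n, wd m.squareP ^ n ∈ Γ.toBipartiteGraph.pathSpan m.vertexP m.vertexP := fun n => by
    rw [← wd_replicate_flatten]; exact wd_mem (m.isWalk_squarePow n)
  have hpowQ : ∀ n, wd m.squareQ ^ n ∈ Γ.toBipartiteGraph.pathSpan m.vertexQ m.vertexQ := fun n => by
    induction n with
    | zero => exact one_mem_pathSpan _
    | succ n ih => rw [pow_succ]; exact mul_mem_pathSpan ih (wd_mem m.isWalk_squareQ)
  refine ⟨H, fun v => ?_, ?_⟩
  · simp only [hH]
    split_ifs with hv hv
    · rw [hv]; exact Submodule.smul_mem _ _ (hpowP _)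
    · rw [hv]; exact Submodule.smul_mem _ _ (hpowQ _)
    · exact Submodule.zero_mem _
  have hHw : ∀ w, H (.inl w) = 0 := fun w => by simp [hH, vertexP, vertexQ]
  have hHb : ∀ z, H (.inr (Γ.black (m.edge z))) = match z with
      | .inr .ap | .inr .bp | .inr .dp => (- c * (1 + x)) • wd m.squareP ^ (k + 1)
      | .inr .cq | .inr .bq | .inr .dq => (- c * (1 + y)) • wd m.squareQ ^ (k + 1)
      | _ => 0 := by
    intro z
    simp only [hH, vertexP, vertexQ, Sum.inr.injEq, black_eq_p, black_eq_q, AtP, AtQ]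
    rcases z with r | (_ | _ | _ | _ | _ | _) <;> simp [hinj]
  have hd : wd [m.fwd .dp] * wd m.squareP ^ (k + 1) * wd [m.bwd .dp] * wd [m.fwd .dq] =
      wd [m.fwd .dq] * wd m.squareQ ^ (k + 1) := by
    have h := (m.semiconj_d.pow_right (k + 1)).eq
    rw [mul_assoc, mul_assoc, ← h, mul_assoc, fwd_mul_bwd_assoc]
  have hb : wd [m.fwd .bp] * wd m.squareP ^ (k + 1) * wd [m.bwd .bp] * wd [m.fwd .bq] =
      wd [m.fwd .bq] * wd m.squareQ ^ (k + 1) := by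
    have h := (m.semiconj_b.pow_right (k + 1)).eq
    rw [mul_assoc, mul_assoc, ← h, mul_assoc, fwd_mul_bwd_assoc]
  rw [← der_smul_left, ← der_add_left]
  refine der_ext fun e => ?_
  obtain ⟨z, rfl⟩ := m.edge.surjective e
  rw [der_add_left, der_smul_left, LinearMap.add_apply, LinearMap.smul_apply, der_flowCoeff,
    der_dart, der_dart]
  have hrev : Dart.rev (m.edge z, true) = (m.edge z, false) := rfl
  have s1 : Γ.toBipartiteGraph.src (m.edge z, true) = .inl (Γ.white (m.edge z)) := rfl
  have s2 : Γ.toBipartiteGraph.src (m.edge z, false) = .inr (Γ.black (m.edge z)) := rfl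
  rw [hrev, s1, s2, hHw, hHb, m.grad_squarePow_white o h1 h2, m.grad_squarePow_black o h1 h2, ← hx, ← hy, ← hc]
  have hc2 : (k : ℚ) + 1 = 2 * c := by rw [hc]; ring
  rw [hc2]
  have hd' : wd [m.fwd .dp] * wd m.squareP ^ (k + 1) * wd [m.bwd .dp] * wd [m.fwd .dp] =
      wd [m.fwd .dp] * wd m.squareP ^ (k + 1) := by rw [mul_assoc, bwd_mul_fwd, mul_one]
  have hb' : wd [m.fwd .bp] * wd m.squareP ^ (k + 1) * wd [m.bwd .bp] * wd [m.fwd .bp] =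
      wd [m.fwd .bp] * wd m.squareP ^ (k + 1) := by rw [mul_assoc, bwd_mul_fwd, mul_one]
  have hf : ∀ x, wd [(m.edge (.inr x), true)] = wd [m.fwd x] := fun _ => rfl
  rcases z with r | (_ | _ | _ | _ | _ | _)
  · simp
  · simp only [hf, zero_mul, mul_smul_comm]; module
  · simp only [hf, smul_mul_assoc, hb', mul_smul_comm, zero_mul]; module
  · simp only [hf, smul_mul_assoc, hd', mul_smul_comm, zero_mul]; module
  · simp only [hf, smul_mul_assoc, hb, mul_smul_comm, zero_mul]; module
  · simp only [hf, zero_mul, mul_smul_comm]; module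
  · simp only [hf, smul_mul_assoc, hd, mul_smul_comm, zero_mul]; module

end TwoByTwoMove

/-! ### Exponentials of derivations -/

section ExpFlow

variable {V : Type*} [AddCommGroup V] [Module ℚ V]

/-- The coefficients of the solution `A(t) = ∑ Aₙ tⁿ` of `A' = - D(t) A`, `A(0) = 1`, where
`D(t) = ∑ Dₖ tᵏ`. -/
def expFlow (D : ℕ → V →ₗ[ℚ] V) : ℕ → V →ₗ[ℚ] V
  | 0 => LinearMap.id
  | N + 1 => (-(1 / ((N : ℚ) + 1))) • ∑ j : Fin (N + 1), D (N - j) ∘ₗ expFlow D j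

theorem expFlow_zero (D : ℕ → V →ₗ[ℚ] V) : expFlow D 0 = LinearMap.id := by rw [expFlow]

theorem expFlow_succ (D : ℕ → V →ₗ[ℚ] V) (N : ℕ) (x : V) :
    ((N : ℚ) + 1) • expFlow D (N + 1) x =
      - ∑ p ∈ Finset.HasAntidiagonal.antidiagonal N, D p.1 (expFlow D p.2 x) := by
  have h : (N : ℚ) + 1 ≠ 0 := by positivity
  rw [expFlow, LinearMap.smul_apply, smul_smul, ← Finset.Nat.sum_antidiagonal_swap,
    Finset.Nat.sum_antidiagonal_eq_sum_range_succ_mk, Finset.sum_range, mul_neg,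
    mul_one_div_cancel h, neg_smul, one_smul, LinearMap.sum_apply]
  rfl

/-- The equation `A' = - D A` determines a sequence by its first term. -/
theorem eq_expFlow (D : ℕ → V →ₗ[ℚ] V) (f : ℕ → V)
    (h : ∀ N : ℕ, ((N : ℚ) + 1) • f (N + 1) = - ∑ p ∈ Finset.HasAntidiagonal.antidiagonal N, D p.1 (f p.2)) (N : ℕ) :
    f N = expFlow D N (f 0) := by
  induction N using Nat.strong_induction_on with
  | _ N ih =>
    cases N with
    | zero => rw [expFlow_zero]; rfl
    | succ N =>
      have h0 : (N : ℚ) + 1 ≠ 0 := by positivity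
      refine smul_right_injective V h0 ?_
      simp only
      rw [h, expFlow_succ]
      congr 1
      refine Finset.sum_congr rfl fun p hp => ?_
      rw [ih p.2 (by have := Finset.HasAntidiagonal.mem_antidiagonal.1 hp; omega)]

theorem sum_antidiagonal_assoc {M : Type*} [AddCommMonoid M] (f : ℕ → ℕ → ℕ → M) (N : ℕ) :
    ∑ p ∈ Finset.HasAntidiagonal.antidiagonal N, ∑ q ∈ Finset.HasAntidiagonal.antidiagonal p.1, f q.1 q.2 p.2 =
      ∑ p ∈ Finset.HasAntidiagonal.antidiagonal N, ∑ q ∈ Finset.HasAntidiagonal.antidiagonal p.2, f p.1 q.1 q.2 := by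
  rw [Finset.sum_sigma', Finset.sum_sigma']
  refine Finset.sum_nbij' (fun x => ⟨(x.2.1, x.2.2 + x.1.2), (x.2.2, x.1.2)⟩)
    (fun x => ⟨(x.1.1 + x.2.1, x.2.2), (x.1.1, x.2.1)⟩) ?_ ?_ ?_ ?_ ?_ <;>
  · rintro ⟨⟨a, b⟩, ⟨c, d⟩⟩ h
    simp only [Finset.mem_sigma, Finset.HasAntidiagonal.mem_antidiagonal] at h
    obtain ⟨rfl, rfl⟩ := h
    simp [add_assoc]

/-- The exponential of derivations of a bilinear operation is an automorphism. -/
theorem sum_expFlow (β : V →ₗ[ℚ] V →ₗ[ℚ] V) (D : ℕ → V →ₗ[ℚ] V)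
    (hD : ∀ k x y, D k (β x y) = β (D k x) y + β x (D k y)) (x y : V) (N : ℕ) :
    ∑ p ∈ Finset.HasAntidiagonal.antidiagonal N, β (expFlow D p.1 x) (expFlow D p.2 y) = expFlow D N (β x y) := by
  have h0 : ∑ p ∈ Finset.HasAntidiagonal.antidiagonal 0, β (expFlow D p.1 x) (expFlow D p.2 y) =
      β x y := by simp [expFlow_zero]
  rw [← h0]
  refine eq_expFlow D (fun N => ∑ p ∈ Finset.HasAntidiagonal.antidiagonal N,
    β (expFlow D p.1 x) (expFlow D p.2 y)) (fun N => ?_) N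
  have h1 : ((N : ℚ) + 1) • ∑ p ∈ Finset.HasAntidiagonal.antidiagonal (N + 1), β (expFlow D p.1 x) (expFlow D p.2 y) =
      ∑ p ∈ Finset.HasAntidiagonal.antidiagonal (N + 1), (p.1 : ℚ) • β (expFlow D p.1 x) (expFlow D p.2 y) +
      ∑ p ∈ Finset.HasAntidiagonal.antidiagonal (N + 1), (p.2 : ℚ) • β (expFlow D p.1 x) (expFlow D p.2 y) := by
    rw [Finset.smul_sum, ← Finset.sum_add_distrib]
    refine Finset.sum_congr rfl fun p hp => ?_
    rw [← add_smul, ← Nat.cast_add, Finset.HasAntidiagonal.mem_antidiagonal.1 hp]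
    push_cast
    rfl
  rw [h1, Finset.Nat.sum_antidiagonal_succ, Finset.Nat.sum_antidiagonal_succ']
  simp only [Nat.cast_zero, zero_smul, zero_add, Nat.cast_add, Nat.cast_one]
  have h2 : ∀ p : ℕ × ℕ, ((p.1 : ℚ) + 1) • β (expFlow D (p.1 + 1) x) (expFlow D p.2 y) =
      - ∑ q ∈ Finset.HasAntidiagonal.antidiagonal p.1, β (D q.1 (expFlow D q.2 x)) (expFlow D p.2 y) := by
    intro p
    rw [← LinearMap.smul_apply, ← map_smul, expFlow_succ, map_neg, LinearMap.neg_apply, map_sum,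
      LinearMap.sum_apply]
  have h3 : ∀ p : ℕ × ℕ, ((p.2 : ℚ) + 1) • β (expFlow D p.1 x) (expFlow D (p.2 + 1) y) =
      - ∑ q ∈ Finset.HasAntidiagonal.antidiagonal p.2, β (expFlow D p.1 x) (D q.1 (expFlow D q.2 y)) := by
    intro p
    rw [← map_smul, expFlow_succ, map_neg, map_sum]
  simp only [h2, h3, Finset.sum_neg_distrib, map_sum, hD, Finset.sum_add_distrib]
  rw [sum_antidiagonal_assoc (fun a b c => β (D a (expFlow D b x)) (expFlow D c y)),
    ← sum_antidiagonal_assoc (fun b a c => β (expFlow D b x) (D a (expFlow D c y))), neg_add]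
  congr 2
  rw [← sum_antidiagonal_assoc (fun a b c => β (expFlow D b x) (D a (expFlow D c y)))]
  refine Finset.sum_congr rfl fun p _ => ?_
  rw [← Finset.Nat.sum_antidiagonal_swap]
  rfl

end ExpFlow

section BilinearExt

variable {X : Type*} {c : X → X → (X →₀ ℚ)}

theorem bilinearExt_skew (h : ∀ a b, c b a = - c a b) (u v : X →₀ ℚ) :
    bilinearExt c v u = - bilinearExt c u v := by
  induction u using Finsupp.induction_linear with
  | zero => simp
  | add u u' hu hu' => rw [map_add, map_add, LinearMap.add_apply, hu, hu', neg_add]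
  | single a r =>
    induction v using Finsupp.induction_linear with
    | zero => simp
    | add u u' hu hu' => rw [map_add, map_add, LinearMap.add_apply, hu, hu', neg_add]
    | single b s => simp [bilinearExt, h a b, smul_comm r s]

/-- The Jacobi identity extends from the index set to finite sums. -/
theorem bilinearExt_jacobi (h : ∀ x y z, bilinearExt c (Finsupp.single x 1) (c y z) +
    bilinearExt c (Finsupp.single y 1) (c z x) + bilinearExt c (Finsupp.single z 1) (c x y) = 0)
    (u v w : X →₀ ℚ) : bilinearExt c u (bilinearExt c v w) + bilinearExt c v (bilinearExt c w u) +
      bilinearExt c w (bilinearExt c u v) = 0 := by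
  have hs : ∀ (x : X) (r : ℚ), Finsupp.single x r = r • Finsupp.single x 1 := fun x r => by simp
  induction u using Finsupp.induction_linear with
  | zero => simp
  | add u u' hu hu' =>
    rw [← add_zero (0 : X →₀ ℚ)]
    nth_rw 1 [← hu]
    rw [← hu']
    simp only [map_add, LinearMap.add_apply]
    abel
  | single x r =>
    induction v using Finsupp.induction_linear with
    | zero => simp
    | add u u' hu hu' =>
      rw [← add_zero (0 : X →₀ ℚ)]
      nth_rw 1 [← hu]
      rw [← hu']
      simp only [map_add, LinearMap.add_apply]
      abel
    | single y s =>
      induction w using Finsupp.induction_linear with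
      | zero => simp
      | add u u' hu hu' =>
        rw [← add_zero (0 : X →₀ ℚ)]
        nth_rw 1 [← hu]
        rw [← hu']
        simp only [map_add, LinearMap.add_apply]
        abel
      | single z t =>
        rw [hs x r, hs y s, hs z t]
        simp only [map_smul, LinearMap.smul_apply, bilinearExt_single]
        have := congrArg (fun p => (r * s * t) • p) (h x y z)
        simp only [smul_add, smul_zero] at this
        rw [← this]
        module

end BilinearExt

namespace BipartiteRibbonGraph

variable {W B E : Type*} [Finite E] (Γ : BipartiteRibbonGraph W B E)

/-- The Goldman bracket of the conjugate graph on finite linear combinations of loops. -/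
def linBracket : (Γ.L →₀ ℚ) →ₗ[ℚ] (Γ.L →₀ ℚ) →ₗ[ℚ] (Γ.L →₀ ℚ) := bilinearExt Γ.bracket

theorem linBracket_skew (u v : Γ.L →₀ ℚ) : Γ.linBracket v u = - Γ.linBracket u v :=
  bilinearExt_skew (fun a b => Γ.conj.goldman_skew a b) u v

theorem linBracket_jacobi (u v w : Γ.L →₀ ℚ) : Γ.linBracket u (Γ.linBracket v w) +
    Γ.linBracket v (Γ.linBracket w u) + Γ.linBracket w (Γ.linBracket u v) = 0 :=
  bilinearExt_jacobi (fun x y z => Γ.conj.goldman_jacobi x y z) u v w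

end BipartiteRibbonGraph

namespace TwoByTwoMove

open PathAlgebra BipartiteGraph

variable {W B B' E E' R : Type*} {Γ : BipartiteRibbonGraph W B E}
  {Γ' : BipartiteRibbonGraph W B' E'} (m : TwoByTwoMove R Γ Γ')

theorem squarePow_ne_nil (k : ℕ) : m.squarePow (k + 1) ≠ [] := by
  simp [squarePow, List.replicate_succ, squareP]

/-- The bracket with the `(k + 1)`-st power of the square, divided by `k + 1`. -/
def flow [Finite E] (k : ℕ) : (Γ.L →₀ ℚ) →ₗ[ℚ] (Γ.L →₀ ℚ) :=
  (1 / ((k : ℚ) + 1)) • Γ.linBracket.flip (Γ.toBipartiteGraph.loopTerm (m.squarePow (k + 1)))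

/-- The flow consists of derivations of the bracket, by the Jacobi identity. -/
theorem flow_linBracket [Finite E] (k : ℕ) (x y : Γ.L →₀ ℚ) :
    m.flow k (Γ.linBracket x y) = Γ.linBracket (m.flow k x) y + Γ.linBracket x (m.flow k y) := by
  simp only [flow, LinearMap.smul_apply, LinearMap.flip_apply, map_smul]
  rw [← smul_add]
  congr 1
  generalize Γ.toBipartiteGraph.loopTerm (m.squarePow (k + 1)) = s
  have h := Γ.linBracket_jacobi x y s
  rw [Γ.linBracket_skew x s, map_neg] at h
  rw [Γ.linBracket_skew s (Γ.linBracket x y), Γ.linBracket_skew y (Γ.linBracket x s)]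
  rw [eq_comm, ← sub_eq_zero, ← h]
  abel

/-- On closed walks the flow is given by a derivation of the path algebra. -/
theorem trace_flow [Finite E] [Finite E'] (k : ℕ) {v : W ⊕ B} {a : PathAlgebra E}
    (ha : a ∈ Γ.toBipartiteGraph.pathSpan v v) :
    Γ.toBipartiteGraph.trace v (der (m.flowCoeff (k + 1)) a) =
      m.flow k (Γ.toBipartiteGraph.trace v a) := by
  classical
  obtain ⟨o, -, h1, h2, -⟩ := m.exists_vertexOrders
  obtain ⟨H, hH, h⟩ := m.exists_der_squarePow o h1 h2 k
  have hb : Γ.linBracket (Γ.toBipartiteGraph.trace m.vertexP (wd (m.squarePow (k + 1))))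
      (Γ.toBipartiteGraph.trace v a) =
      Γ.toBipartiteGraph.trace v (der (grad o.form (m.squarePow (k + 1))) a) :=
    o.bilinearExt_trace (m.squarePow_ne_nil k) (m.isWalk_squarePow _) ha
  rw [trace_wd (m.squarePow_ne_nil k) (m.isWalk_squarePow _), h, LinearMap.add_apply, map_add,
    trace_der_inner hH ha, add_zero, LinearMap.smul_apply, map_smul] at hb
  have hk : (k : ℚ) + 1 ≠ 0 := by positivity
  rw [flow, LinearMap.smul_apply, LinearMap.flip_apply, Γ.linBracket_skew, hb, neg_smul, neg_neg,
    smul_smul, one_div_mul_cancel hk, one_smul]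

end TwoByTwoMove

section ExpFlowAlgebra

variable {A : Type*} [Ring A] [Algebra ℚ A] {D : ℕ → A →ₗ[ℚ] A}

theorem expFlow_of_const {x : A} (hx : ∀ k, D k x = 0) (n : ℕ) :
    expFlow D n x = if n = 0 then x else 0 := by
  refine (eq_expFlow D (fun n => if n = 0 then x else 0) (fun N => ?_) n).symm
  rw [if_neg (Nat.succ_ne_zero N), smul_zero, eq_comm, neg_eq_zero]
  refine Finset.sum_eq_zero fun p _ => ?_
  split_ifs
  · exact hx _
  · exact map_zero _

/-- The case `A(t) x = x (1 - t s)`. -/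
theorem expFlow_of_mul_pow (hD : ∀ k x y, D k (x * y) = D k x * y + x * D k y) {x s : A}
    (hs : ∀ k, D k s = 0) (hx : ∀ k, D k x = x * s ^ (k + 1)) (n : ℕ) :
    expFlow D n x = if n = 0 then x else if n = 1 then - (x * s) else 0 := by
  set f : ℕ → A := fun n => if n = 0 then x else if n = 1 then - (x * s) else 0 with hf
  have h1 : ∀ k, D k (f 1) = - (x * s ^ (k + 2)) := fun k => by
    simp only [hf, one_ne_zero, if_false, if_true, map_neg, hD, hs, hx, mul_zero, add_zero]
    rw [mul_assoc, ← pow_succ]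
  refine (eq_expFlow D f (fun N => ?_) n).symm
  cases N with
  | zero => simp [hf, hx]
  | succ N =>
    rw [Finset.Nat.sum_antidiagonal_succ']
    have h0 : f (N + 1 + 1) = 0 := by simp [hf]
    have h2 : ∑ p ∈ Finset.HasAntidiagonal.antidiagonal N, D p.1 (f (p.2 + 1)) = D N (f 1) := by
      cases N with
      | zero => simp
      | succ N =>
        rw [Finset.Nat.sum_antidiagonal_succ', Finset.sum_eq_zero, add_zero]
        intro p _
        simp [hf]
    rw [h2, h0, h1, smul_zero]
    simp [hf, hx]

/-- The case `A(t) y = (1 - t s)⁻¹ y`. -/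
theorem expFlow_of_pow_mul (hD : ∀ k x y, D k (x * y) = D k x * y + x * D k y) {y s : A}
    (hs : ∀ k, D k s = 0) (hy : ∀ k, D k y = - (s ^ (k + 1) * y)) (n : ℕ) :
    expFlow D n y = s ^ n * y := by
  have hpow : ∀ k j, D k (s ^ j) = 0 := by
    intro k j
    induction j with
    | zero =>
      have := hD k 1 1
      simp only [mul_one, one_mul] at this
      rw [pow_zero]
      exact left_eq_add.1 this
    | succ j ih => rw [pow_succ, hD, ih, hs, zero_mul, mul_zero, add_zero]
  have := (eq_expFlow D (fun n => s ^ n * y) (fun N => ?_) n).symm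
  · simpa using this
  · have h : ∀ p ∈ Finset.HasAntidiagonal.antidiagonal N, D p.1 (s ^ p.2 * y) = - (s ^ (N + 1) * y) := by
      intro p hp
      have := Finset.HasAntidiagonal.mem_antidiagonal.1 hp
      rw [hD, hpow, zero_mul, zero_add, hy, mul_neg, ← mul_assoc, ← pow_add, ← this]
      congr 3
      omega
    rw [Finset.sum_congr rfl h, Finset.sum_const, Finset.Nat.card_antidiagonal, smul_neg, neg_neg,
      ← Nat.cast_smul_eq_nsmul ℚ]
    push_cast
    rfl

end ExpFlowAlgebra

namespace TwoByTwoMove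

open PathAlgebra BipartiteGraph

variable {W B B' E E' R : Type*} {Γ : BipartiteRibbonGraph W B E}
  {Γ' : BipartiteRibbonGraph W B' E'} (m : TwoByTwoMove R Γ Γ')

/-! ### The transports of the new line bundle -/

/-- The derivations of the path algebra of which the new line bundle is the exponential. -/
def pathFlow (k : ℕ) : PathAlgebra E →ₗ[ℚ] PathAlgebra E := der (m.flowCoeff (k + 1))

theorem pathFlow_mul (k : ℕ) (x y : PathAlgebra E) :
    m.pathFlow k (x * y) = m.pathFlow k x * y + x * m.pathFlow k y := der_mul _ _ _

theorem pathFlow_fwd (k : ℕ) (z : R ⊕ AlphaEdge) :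
    m.pathFlow k (wd [(m.edge z, true)]) = match z with
    | .inr .ap => wd [m.fwd .ap] * wd m.squareP ^ (k + 1)
    | .inr .cq => wd [m.fwd .cq] * wd m.squareQ ^ (k + 1)
    | _ => 0 := m.der_flowCoeff (k + 1) z

theorem pathFlow_bwd (k : ℕ) (z : R ⊕ AlphaEdge) :
    m.pathFlow k (wd [(m.edge z, false)]) = match z with
    | .inr .ap => - (wd m.squareP ^ (k + 1) * wd [m.bwd .ap])
    | .inr .cq => - (wd m.squareQ ^ (k + 1) * wd [m.bwd .cq])
    | _ => 0 := by
  have hinj : ∀ x y, m.edge x = m.edge y ↔ x = y := fun x y => m.edge.apply_eq_iff_eq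
  rw [pathFlow, der_dart]
  rcases z with r | (_ | _ | _ | _ | _ | _) <;>
    simp [flowCoeff, bwd, Dart.rev, hinj]

theorem pathFlow_square (k : ℕ) :
    m.pathFlow k (wd m.squareP) = 0 ∧ m.pathFlow k (wd m.squareQ) = 0 := by
  have h1 := m.pathFlow_fwd k (.inr .bp)
  have h2 := m.pathFlow_fwd k (.inr .dq)
  have h3 := m.pathFlow_bwd k (.inr .bq)
  have h4 := m.pathFlow_bwd k (.inr .dp)
  rw [squareP_eq, squareQ_eq]
  simp only [pathFlow_mul]
  simp only [fwd, bwd, h1, h2, h3, h4, mul_zero, zero_mul, add_zero, and_self]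

open Classical in
/-- The order of the terms of the transports according to their weights: for `c'p'` and `a'q'` the first
two terms have to be exchanged. -/
def reorder (d : Dart E') : Equiv.Perm ℕ :=
  if d.2 = true ∧ m.IsNegative d.1 then Equiv.swap 0 1 else 1

/-- The terms of the transport along an oriented edge of `Γ'`, ordered according to their weights. -/
def orderedTransport (d : Dart E') : PathSeries E := fun n =>
  m.transport (m.edge'.symm d.1) d.2 (m.reorder d n)

theorem isNegative_edge' (z : R ⊕ AlphaEdge') :
    m.IsNegative (m.edge' z) ↔ z = .inr .cp ∨ z = .inr .aq := by
  simp [IsNegative]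

open PathSeries in
theorem orderedTransport_true (z : R ⊕ AlphaEdge') :
    m.orderedTransport (m.edge' z, true) = match z with
    | .inl r => ofPath [(m.edge (.inl r), true)]
    | .inr .bp => ofPath [m.fwd .bp]
    | .inr .dq => ofPath [m.fwd .dq]
    | .inr .ap => prepend [m.fwd .ap] (onePlus m.squareP)
    | .inr .cq => prepend [m.fwd .cq] (onePlus m.squareQ)
    | .inr .cp => fun n => prepend [m.fwd .cq, m.bwd .bq, m.fwd .bp]
        (onePlus (reversePath m.squareP)) (Equiv.swap 0 1 n)
    | .inr .aq => fun n => prepend [m.fwd .ap, m.bwd .dp, m.fwd .dq]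
        (onePlus (reversePath m.squareQ)) (Equiv.swap 0 1 n) := by
  funext n
  rw [orderedTransport, reorder, Equiv.symm_apply_apply, isNegative_edge']
  rcases z with r | (_ | _ | _ | _ | _ | _) <;> simp [transport]

open PathSeries in
theorem orderedTransport_false (z : R ⊕ AlphaEdge') :
    m.orderedTransport (m.edge' z, false) = m.transport z false := by
  funext n
  rw [orderedTransport, reorder, Equiv.symm_apply_apply]
  simp

/-- The sign of the leading term along an oriented edge. -/
def dartSign (d : Dart E') : ℤ := (((-1) ^ walkWeight m.negCount [d] : ℤˣ) : ℤ)

theorem dartSign_edge' (z : R ⊕ AlphaEdge') (o : Bool) :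
    m.dartSign (m.edge' z, o) = match z with
    | .inr .cp => -1
    | .inr .aq => -1
    | _ => 1 := by
  rw [dartSign]
  rcases z with r | (_ | _ | _ | _ | _ | _) <;> cases o <;>
    simp [walkWeight, negCount, isNegative_edge']

theorem swap_zero_one_add_two (n : ℕ) : Equiv.swap 0 1 (n + 2) = n + 2 :=
  Equiv.swap_apply_of_ne_of_ne (by omega) (by omega)

/-- The flow multiplies the leading term of the transport along `c'p'` by powers of the square; the factors
of `cq` are moved across the path from `q` to `p`. -/
theorem pathFlow_cp (k : ℕ) : m.pathFlow k (wd [m.fwd .cq, m.bwd .dq, m.fwd .dp]) =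
    wd [m.fwd .cq, m.bwd .dq, m.fwd .dp] * wd m.squareP ^ (k + 1) := by
  have h1 := m.pathFlow_fwd k (.inr .cq)
  have h2 := m.pathFlow_bwd k (.inr .dq)
  have h3 := m.pathFlow_fwd k (.inr .dp)
  have h : SemiconjBy (wd [m.bwd .dq] * wd [m.fwd .dp]) (wd m.squareP) (wd m.squareQ) := by
    rw [SemiconjBy, squareP_eq, squareQ_eq]
    simp only [mul_assoc, fwd_mul_bwd_assoc, bwd_mul_fwd_assoc, bwd_mul_fwd, mul_one]
  have h4 := (h.pow_right (k + 1)).eq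
  rw [wd_cons, wd_cons (m.bwd .dq), mul_assoc, h4, pathFlow_mul, pathFlow_mul]
  rw [fwd, fwd, bwd, h1, h2, h3]
  simp only [zero_mul, mul_zero, add_zero, mul_assoc]
  rfl

theorem pathFlow_aq (k : ℕ) : m.pathFlow k (wd [m.fwd .ap, m.bwd .bp, m.fwd .bq]) =
    wd [m.fwd .ap, m.bwd .bp, m.fwd .bq] * wd m.squareQ ^ (k + 1) := by
  have h1 := m.pathFlow_fwd k (.inr .ap)
  have h2 := m.pathFlow_bwd k (.inr .bp)
  have h3 := m.pathFlow_fwd k (.inr .bq)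
  have h4 := (m.semiconj_b.pow_right (k + 1)).eq
  rw [wd_cons, wd_cons (m.bwd .bp), mul_assoc, h4, pathFlow_mul, pathFlow_mul]
  rw [fwd, fwd, bwd, h1, h2, h3]
  simp only [zero_mul, mul_zero, add_zero, mul_assoc]
  rfl

theorem pathFlow_cp_inv (k : ℕ) : m.pathFlow k (wd [m.bwd .dp, m.fwd .dq, m.bwd .cq]) =
    - (wd m.squareP ^ (k + 1) * wd [m.bwd .dp, m.fwd .dq, m.bwd .cq]) := by
  have h1 := m.pathFlow_bwd k (.inr .dp)
  have h2 := m.pathFlow_fwd k (.inr .dq)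
  have h3 := m.pathFlow_bwd k (.inr .cq)
  have h4 := (m.semiconj_d.pow_right (k + 1)).eq
  rw [wd_cons, wd_cons (m.fwd .dq), ← mul_assoc, ← mul_assoc, ← h4, pathFlow_mul, pathFlow_mul]
  rw [fwd, bwd, bwd, h1, h2, h3]
  simp only [zero_mul, mul_zero, zero_add, mul_assoc, mul_neg]
  rfl

theorem pathFlow_aq_inv (k : ℕ) : m.pathFlow k (wd [m.bwd .bq, m.fwd .bp, m.bwd .ap]) =
    - (wd m.squareQ ^ (k + 1) * wd [m.bwd .bq, m.fwd .bp, m.bwd .ap]) := by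
  have h1 := m.pathFlow_bwd k (.inr .bq)
  have h2 := m.pathFlow_fwd k (.inr .bp)
  have h3 := m.pathFlow_bwd k (.inr .ap)
  have h : SemiconjBy (wd [m.bwd .bq] * wd [m.fwd .bp]) (wd m.squareP) (wd m.squareQ) := by
    rw [SemiconjBy, squareP_eq, squareQ_eq]
    simp only [mul_assoc]
  have h4 := (h.pow_right (k + 1)).eq
  rw [wd_cons, wd_cons (m.fwd .bp), ← mul_assoc, ← mul_assoc, ← h4, pathFlow_mul, pathFlow_mul]
  rw [fwd, bwd, bwd, h1, h2, h3]
  simp only [zero_mul, mul_zero, zero_add, mul_assoc, mul_neg]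
  rfl

open PathSeries in
/-- The transports are the exponentials of their leading terms. -/
theorem wd_orderedTransport (d : Dart E') (n : ℕ) :
    ((m.orderedTransport d n).1 : ℚ) • wd (m.orderedTransport d n).2 =
      (m.dartSign d : ℚ) • expFlow m.pathFlow n (wd (subLetter m.leadingPath d)) := by
  obtain ⟨e, o⟩ := d
  obtain ⟨z, rfl⟩ := m.edge'.surjective e
  rw [dartSign_edge']
  have hsP := fun k => (m.pathFlow_square k).1
  have hsQ := fun k => (m.pathFlow_square k).2
  have hmul := m.pathFlow_mul
  -- The five types of transports: edges that the flow fixes, `x (1 - S)`, its inverse, and the same two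
  -- with `S⁻¹` in place of `S`, where the leading term absorbs a factor `-S⁻¹` or `-S`.
  have hofPath : ∀ (d : Dart E) (n : ℕ), (∀ k, m.pathFlow k (wd [d]) = 0) →
      ((ofPath [d] n).1 : ℚ) • wd (ofPath [d] n).2 = expFlow m.pathFlow n (wd [d]) := by
    intro d n h
    rw [expFlow_of_const h]
    cases n <;> simp [ofPath]
  have hplus : ∀ (x : List (Dart E)) (s : List (Dart E)), (∀ k, m.pathFlow k (wd s) = 0) →
      (∀ k, m.pathFlow k (wd x) = wd x * wd s ^ (k + 1)) → ∀ n,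
      ((prepend x (onePlus s) n).1 : ℚ) • wd (prepend x (onePlus s) n).2 =
        expFlow m.pathFlow n (wd x) := by
    intro x s hs hx n
    rw [expFlow_of_mul_pow hmul hs hx]
    rcases n with _ | _ | n <;> simp [prepend, onePlus, wd_append]
  have hinv : ∀ (y : List (Dart E)) (s : List (Dart E)), (∀ k, m.pathFlow k (wd s) = 0) →
      (∀ k, m.pathFlow k (wd y) = - (wd s ^ (k + 1) * wd y)) → ∀ n,
      ((append (onePlusInv s) y n).1 : ℚ) • wd (append (onePlusInv s) y n).2 =
        expFlow m.pathFlow n (wd y) := by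
    intro y s hs hy n
    rw [expFlow_of_pow_mul hmul hs hy]
    simp [append, onePlusInv, wd_append, wd_replicate_flatten]
  have hinv' : ∀ (y y' : List (Dart E)) (s : List (Dart E)), (∀ k, m.pathFlow k (wd s) = 0) →
      (∀ k, m.pathFlow k (wd y) = - (wd s ^ (k + 1) * wd y)) → wd s * wd y' = wd y → ∀ n,
      ((append (onePlusInvInv s) y' n).1 : ℚ) • wd (append (onePlusInvInv s) y' n).2 =
        (-1 : ℚ) • expFlow m.pathFlow n (wd y) := by
    intro y y' s hs hy hyy n
    rw [expFlow_of_pow_mul hmul hs hy, ← hyy]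
    simp [append, onePlusInvInv, wd_append, wd_replicate_flatten, pow_succ, mul_assoc]
  have hplus' : ∀ (x x' : List (Dart E)) (s s' : List (Dart E)), (∀ k, m.pathFlow k (wd s) = 0) →
      (∀ k, m.pathFlow k (wd x) = wd x * wd s ^ (k + 1)) → wd x' = wd x * wd s →
      wd x' * wd s' = wd x → ∀ n,
      ((prepend x' (onePlus s') (Equiv.swap 0 1 n)).1 : ℚ) •
        wd (prepend x' (onePlus s') (Equiv.swap 0 1 n)).2 =
        (-1 : ℚ) • expFlow m.pathFlow n (wd x) := by
    intro x x' s s' hs hx h1 h2 n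
    rw [expFlow_of_mul_pow hmul hs hx]
    rcases n with _ | _ | n
    · simp [prepend, onePlus, wd_append, h2]
    · simp [prepend, onePlus, h1]
    · rw [swap_zero_one_add_two]; simp [prepend, onePlus]
  cases o
  · rw [orderedTransport_false, subLetter, leadingPath_edge']
    rcases z with r | (_ | _ | _ | _ | _ | _) <;>
      simp only [Int.cast_one, Int.cast_neg, one_smul, Bool.false_eq_true, if_false, transport]
    · exact hofPath (m.edge (.inl r), false) n fun k => m.pathFlow_bwd k (.inl r)
    · exact hinv [m.bwd .ap] _ hsP (fun k => m.pathFlow_bwd k (.inr .ap)) n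
    · exact hofPath (m.bwd .bp) n fun k => m.pathFlow_bwd k (.inr .bp)
    · refine hinv' [m.bwd .dp, m.fwd .dq, m.bwd .cq] _ _ hsP m.pathFlow_cp_inv ?_ n
      rw [squareP_eq]
      simp only [wd_cons _ (_ :: _), mul_assoc, fwd_mul_bwd_assoc, bwd_mul_fwd_assoc]
    · refine hinv' [m.bwd .bq, m.fwd .bp, m.bwd .ap] _ _ hsQ m.pathFlow_aq_inv ?_ n
      rw [squareQ_eq]
      simp only [wd_cons _ (_ :: _), mul_assoc, fwd_mul_bwd_assoc, bwd_mul_fwd_assoc]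
    · exact hinv [m.bwd .cq] _ hsQ (fun k => m.pathFlow_bwd k (.inr .cq)) n
    · exact hofPath (m.bwd .dq) n fun k => m.pathFlow_bwd k (.inr .dq)
  · have hrP : wd (reversePath m.squareP) = wd [m.bwd .bp] * (wd [m.fwd .bq] * (wd [m.bwd .dq] *
        wd [m.fwd .dp])) := by
      simp only [← wd_append]; rfl
    have hrQ : wd (reversePath m.squareQ) = wd [m.bwd .dq] * (wd [m.fwd .dp] * (wd [m.bwd .bp] *
        wd [m.fwd .bq])) := by
      simp only [← wd_append]; rfl
    rw [orderedTransport_true, subLetter, leadingPath_edge']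
    rcases z with r | (_ | _ | _ | _ | _ | _) <;>
      simp only [Int.cast_one, Int.cast_neg, one_smul, if_true]
    · exact hofPath (m.edge (.inl r), true) n fun k => m.pathFlow_fwd k (.inl r)
    · exact hplus [m.fwd .ap] _ hsP (fun k => m.pathFlow_fwd k (.inr .ap)) n
    · exact hofPath (m.fwd .bp) n fun k => m.pathFlow_fwd k (.inr .bp)
    · refine hplus' _ _ _ _ hsP m.pathFlow_cp ?_ ?_ n
      · rw [squareP_eq]
        simp only [wd_cons _ (_ :: _), mul_assoc, fwd_mul_bwd_assoc, bwd_mul_fwd_assoc]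
      · rw [hrP]
        simp only [wd_cons _ (_ :: _), mul_assoc, fwd_mul_bwd_assoc, bwd_mul_fwd_assoc]
    · refine hplus' _ _ _ _ hsQ m.pathFlow_aq ?_ ?_ n
      · rw [squareQ_eq]
        simp only [wd_cons _ (_ :: _), mul_assoc, fwd_mul_bwd_assoc, bwd_mul_fwd_assoc]
      · rw [hrQ]
        simp only [wd_cons _ (_ :: _), mul_assoc, fwd_mul_bwd_assoc, bwd_mul_fwd_assoc]
    · exact hplus [m.fwd .cq] _ hsQ (fun k => m.pathFlow_fwd k (.inr .cq)) n
    · exact hofPath (m.fwd .dq) n fun k => m.pathFlow_fwd k (.inr .dq)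

theorem walkWeight_squareQ (w : E → ℤ) : walkWeight w m.squareQ = m.squareWeight w := by
  simp only [squareWeight, squareP, squareQ, walkWeight, List.map_cons, List.map_nil, List.sum_cons,
    List.sum_nil]
  ring

theorem walkWeight_replicate (w : E → ℤ) (l : List (Dart E)) (n : ℕ) :
    walkWeight w (List.replicate n l).flatten = n * walkWeight w l := by
  induction n with
  | zero => simp [walkWeight]
  | succ n ih =>
    rw [List.replicate_succ, List.flatten_cons, walkWeight_append, ih]
    push_cast
    ring

/-- The terms of the transports are paths with the same ends, and their weights form an arithmetic
progression. -/
theorem orderedTransport_spec (w : E → ℤ) (d : Dart E') (n : ℕ) (h : (m.orderedTransport d n).1 ≠ 0) :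
    Γ.toBipartiteGraph.IsWalk (m.leading.vert (Γ'.toBipartiteGraph.src d))
      (m.leading.vert (Γ'.toBipartiteGraph.tgt d)) (m.orderedTransport d n).2 ∧
    (m.orderedTransport d n).2 ≠ [] ∧
    walkWeight w (m.orderedTransport d n).2 =
      walkWeight w (subLetter m.leadingPath d) + n * m.squareWeight w := by
  have hG := m.leading.isWalk_letter d
  change Γ.toBipartiteGraph.IsWalk _ _ (subLetter m.leadingPath d) at hG
  obtain ⟨e, o⟩ := d
  obtain ⟨z, rfl⟩ := m.edge'.surjective e
  generalize m.leading.vert (Γ'.toBipartiteGraph.src (m.edge' z, o)) = x at hG ⊢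
  generalize m.leading.vert (Γ'.toBipartiteGraph.tgt (m.edge' z, o)) = y at hG ⊢
  have hP := m.isWalk_squareP
  have hQ := m.isWalk_squareQ
  have hwP : walkWeight w m.squareP = m.squareWeight w := rfl
  have hwQ := m.walkWeight_squareQ w
  have b1 := m.black_p
  have b2 := m.black_q
  have b3 := m.white_b
  have b4 := m.white_d
  have hrep : ∀ x s n, Γ.toBipartiteGraph.IsWalk x x s →
      Γ.toBipartiteGraph.IsWalk x x (List.replicate n s).flatten := by
    intro x s n hs
    induction n with
    | zero => rfl
    | succ n ih =>
      rw [List.replicate_succ, List.flatten_cons]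
      exact isWalk_append.2 ⟨_, hs, ih⟩
  have hofPath : ∀ (d : Dart E) (n : ℕ), (PathSeries.ofPath [d] n).1 ≠ 0 →
      Γ.toBipartiteGraph.IsWalk x y [d] → Γ.toBipartiteGraph.IsWalk x y (PathSeries.ofPath [d] n).2 ∧
      (PathSeries.ofPath [d] n).2 ≠ [] ∧
      walkWeight w (PathSeries.ofPath [d] n).2 = walkWeight w [d] + n * m.squareWeight w := by
    intro d n h hd
    cases n with
    | zero => simpa [PathSeries.ofPath] using hd
    | succ n => exact absurd rfl h
  have hplus : ∀ (l s : List (Dart E)) (n : ℕ), (PathSeries.prepend l (PathSeries.onePlus s) n).1 ≠ 0 →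
      l ≠ [] → Γ.toBipartiteGraph.IsWalk x y l → Γ.toBipartiteGraph.IsWalk y y s →
      Γ.toBipartiteGraph.IsWalk x y (PathSeries.prepend l (PathSeries.onePlus s) n).2 ∧
      (PathSeries.prepend l (PathSeries.onePlus s) n).2 ≠ [] ∧
      walkWeight w (PathSeries.prepend l (PathSeries.onePlus s) n).2 =
        walkWeight w l + n * walkWeight w s := by
    intro l s n h hne hl hs
    rcases n with _ | _ | n
    · simpa [PathSeries.prepend, PathSeries.onePlus] using ⟨hl, hne⟩
    · refine ⟨isWalk_append.2 ⟨y, hl, hs⟩, by simp [PathSeries.prepend, hne], ?_⟩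
      simp [PathSeries.prepend, PathSeries.onePlus, walkWeight_append]
    · exact absurd rfl h
  have hinv : ∀ (l s : List (Dart E)) (n : ℕ), l ≠ [] → Γ.toBipartiteGraph.IsWalk x y l →
      Γ.toBipartiteGraph.IsWalk x x s →
      Γ.toBipartiteGraph.IsWalk x y ((List.replicate n s).flatten ++ l) ∧
      (List.replicate n s).flatten ++ l ≠ [] ∧
      walkWeight w ((List.replicate n s).flatten ++ l) = walkWeight w l + n * walkWeight w s := by
    intro l s n hne hl hs
    refine ⟨isWalk_append.2 ⟨x, hrep _ _ _ hs, hl⟩, by simp [hne], ?_⟩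
    rw [walkWeight_append, walkWeight_replicate, add_comm]
  have hswap : ∀ (l s : List (Dart E)) (n : ℕ),
      (PathSeries.prepend l (PathSeries.onePlus s) (Equiv.swap 0 1 n)).1 ≠ 0 →
      ((Equiv.swap 0 1 n : ℕ) : ℤ) = 1 - n := by
    intro l s n h
    rcases n with _ | _ | n
    · simp
    · simp
    · rw [swap_zero_one_add_two] at h; exact absurd rfl h
  cases o
  · rw [orderedTransport_false] at h ⊢
    rw [subLetter, leadingPath_edge'] at hG ⊢
    rcases z with r | (_ | _ | _ | _ | _ | _) <;>
      simp only [Bool.false_eq_true, if_false, transport] at h hG ⊢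
    · exact hofPath _ n h hG
    · obtain rfl : m.vertexP = x := hG.1
      exact hinv _ _ n (by simp) hG hP
    · exact hofPath _ n h hG
    · obtain rfl : m.vertexP = x := by simpa [vertexP, src, b1, Dart.rev, fwd] using hG.1
      obtain rfl : _ = y := hG.2.2.2
      have := hinv [m.bwd .bp, m.fwd .bq, m.bwd .cq] _ (n + 1) (by simp)
        (by simp [IsWalk, src, tgt, Dart.rev, fwd, bwd, vertexP, b1, b2, b3]) hP
      refine ⟨this.1, this.2.1, this.2.2.trans ?_⟩
      rw [hwP, squareWeight_eq]
      simp [walkWeight, fwd, bwd, reversePath, Dart.rev]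
      ring
    · obtain rfl : m.vertexQ = x := by simpa [vertexQ, src, b2, Dart.rev, fwd] using hG.1
      obtain rfl : _ = y := hG.2.2.2
      have := hinv [m.bwd .dq, m.fwd .dp, m.bwd .ap] _ (n + 1) (by simp)
        (by simp [IsWalk, src, tgt, Dart.rev, fwd, bwd, vertexQ, b1, b2, b4]) hQ
      refine ⟨this.1, this.2.1, this.2.2.trans ?_⟩
      rw [hwQ, squareWeight_eq]
      simp [walkWeight, fwd, bwd, reversePath, Dart.rev]
      ring
    · obtain rfl : m.vertexQ = x := hG.1
      have := hinv [m.bwd .cq] _ n (by simp) hG hQ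
      rwa [hwQ] at this
    · exact hofPath _ n h hG
  · have hrP : walkWeight w (reversePath m.squareP) = - m.squareWeight w := by
      rw [PathMap.walkWeight_reversePath, hwP]
    have hrQ : walkWeight w (reversePath m.squareQ) = - m.squareWeight w := by
      rw [PathMap.walkWeight_reversePath, hwQ]
    rw [orderedTransport_true] at h ⊢
    rw [subLetter, leadingPath_edge'] at hG ⊢
    rcases z with r | (_ | _ | _ | _ | _ | _) <;> simp only [if_true] at h hG ⊢
    · exact hofPath _ n h hG
    · obtain rfl : m.vertexP = y := hG.2
      exact hplus _ _ n h (by simp) hG hP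
    · exact hofPath _ n h hG
    · obtain rfl : _ = x := hG.1
      obtain rfl : m.vertexP = y := by
        simpa [vertexP, IsWalk, tgt, src, b1, Dart.rev, fwd] using hG.2.2.2
      have := hplus _ _ _ h (by simp)
        (by simp [IsWalk, src, tgt, Dart.rev, fwd, bwd, vertexP, b1, b2, b3]) hP.reverse
      refine ⟨this.1, this.2.1, this.2.2.trans ?_⟩
      rw [hrP, hswap _ _ _ h, squareWeight_eq]
      simp [walkWeight, fwd, bwd]
      ring
    · obtain rfl : _ = x := hG.1
      obtain rfl : m.vertexQ = y := by
        simpa [vertexQ, IsWalk, tgt, src, b2, Dart.rev, fwd] using hG.2.2.2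
      have := hplus _ _ _ h (by simp)
        (by simp [IsWalk, src, tgt, Dart.rev, fwd, bwd, vertexQ, b1, b2, b4]) hQ.reverse
      refine ⟨this.1, this.2.1, this.2.2.trans ?_⟩
      rw [hrQ, hswap _ _ _ h, squareWeight_eq]
      simp [walkWeight, fwd, bwd]
      ring
    · obtain rfl : m.vertexQ = y := hG.2
      have := hplus _ _ n h (by simp) hG hQ
      rwa [hwQ] at this
    · exact hofPath _ n h hG

end TwoByTwoMove

/-! ### The monodromy of the new line bundle -/

theorem sum_antidiagonalTuple_succ {M : Type*} [AddCommMonoid M] (k N : ℕ) (F : (Fin (k + 1) → ℕ) → M) :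
    ∑ n ∈ Finset.Nat.antidiagonalTuple (k + 1) N, F n =
      ∑ p ∈ Finset.HasAntidiagonal.antidiagonal N,
        ∑ n ∈ Finset.Nat.antidiagonalTuple k p.2, F (Fin.cons p.1 n) := by
  rw [Finset.sum_sigma']
  refine Finset.sum_nbij' (fun n => ⟨(n 0, ∑ i, Fin.tail n i), Fin.tail n⟩)
    (fun x => Fin.cons x.1.1 x.2) ?_ ?_ ?_ ?_ ?_
  · intro n hn
    rw [Finset.Nat.mem_antidiagonalTuple, Fin.sum_univ_succ] at hn
    simp only [Finset.mem_sigma, Finset.HasAntidiagonal.mem_antidiagonal,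
      Finset.Nat.mem_antidiagonalTuple, and_true]
    exact hn
  · rintro ⟨⟨a, b⟩, n⟩ hn
    simp only [Finset.mem_sigma, Finset.HasAntidiagonal.mem_antidiagonal,
      Finset.Nat.mem_antidiagonalTuple] at hn
    rw [Finset.Nat.mem_antidiagonalTuple, Fin.sum_univ_succ]
    simp [hn.1, hn.2]
  · intro n _
    exact Fin.cons_self_tail n
  · rintro ⟨⟨a, b⟩, n⟩ hn
    simp only [Finset.mem_sigma, Finset.Nat.mem_antidiagonalTuple] at hn
    simp [hn.2]
  · intro n _
    rw [Fin.cons_self_tail]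

namespace TwoByTwoMove

open PathAlgebra BipartiteGraph

variable {W B B' E E' R : Type*} {Γ : BipartiteRibbonGraph W B E}
  {Γ' : BipartiteRibbonGraph W B' E'} (m : TwoByTwoMove R Γ Γ')

/-- The path composed of the chosen terms of the transports along the edges of a path on `Γ'`. -/
def termWalk (γ : List (Dart E')) (n : Fin γ.length → ℕ) : List (Dart E) :=
  (List.ofFn fun i => (m.orderedTransport (γ.get i) (n i)).2).flatten

/-- The coefficient of the chosen terms. -/
def termCoeff (γ : List (Dart E')) (n : Fin γ.length → ℕ) : ℤ :=
  ∏ i, (m.orderedTransport (γ.get i) (n i)).1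

/-- The sign of the leading term along a path. -/
def walkSign (γ : List (Dart E')) : ℤ := (((-1) ^ walkWeight m.negCount γ : ℤˣ) : ℤ)

theorem walkSign_cons (d : Dart E') (γ : List (Dart E')) :
    m.walkSign (d :: γ) = m.dartSign d * m.walkSign γ := by
  rw [walkSign, dartSign, walkSign, ← Units.val_mul, ← zpow_add, ← walkWeight_append]
  rfl

theorem termWalk_cons (d : Dart E') (γ : List (Dart E')) (a : ℕ) (n : Fin γ.length → ℕ) :
    m.termWalk (d :: γ) (Fin.cons a n) = (m.orderedTransport d a).2 ++ m.termWalk γ n := by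
  rw [termWalk]
  change (List.ofFn (n := γ.length + 1) _).flatten = _
  rw [List.ofFn_succ, List.flatten_cons]
  rfl

theorem termCoeff_cons (d : Dart E') (γ : List (Dart E')) (a : ℕ) (n : Fin γ.length → ℕ) :
    m.termCoeff (d :: γ) (Fin.cons a n) = (m.orderedTransport d a).1 * m.termCoeff γ n := by
  rw [termCoeff]
  change ∏ i : Fin (γ.length + 1), _ = _
  rw [Fin.prod_univ_succ]
  rfl

/-- The sum of the terms of a given weight is a coefficient of the exponential flow. -/
theorem sum_terms (γ : List (Dart E')) (N : ℕ) :
    ∑ n ∈ Finset.Nat.antidiagonalTuple γ.length N, (m.termCoeff γ n : ℚ) • wd (m.termWalk γ n) =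
      (m.walkSign γ : ℚ) • expFlow m.pathFlow N (wd (subWalk m.leadingPath γ)) := by
  induction γ generalizing N with
  | nil =>
    have h1 : ∀ k, m.pathFlow k 1 = 0 := fun k => der_one _
    change _ = _ • expFlow m.pathFlow N (wd [])
    rw [wd_nil, expFlow_of_const h1]
    cases N <;> simp [termCoeff, termWalk, walkSign, walkWeight]
  | cons d γ ih =>
    change ∑ n ∈ Finset.Nat.antidiagonalTuple (γ.length + 1) N, _ = _
    rw [sum_antidiagonalTuple_succ, subWalk_cons, wd_append]
    have hprod := sum_expFlow (LinearMap.mul ℚ (PathAlgebra E)) m.pathFlow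
      (fun k x y => m.pathFlow_mul k x y) (wd (subLetter m.leadingPath d))
      (wd (subWalk m.leadingPath γ)) N
    simp only [LinearMap.mul_apply'] at hprod
    rw [← hprod, Finset.smul_sum]
    refine Finset.sum_congr rfl fun p _ => ?_
    rw [walkSign_cons, Int.cast_mul, ← smul_mul_smul_comm, ← ih,
      ← wd_orderedTransport, Finset.mul_sum]
    refine Finset.sum_congr rfl fun n _ => ?_
    rw [termCoeff_cons, termWalk_cons, wd_append, Int.cast_mul, smul_mul_smul_comm]

/-- The chosen terms compose to a path, and the sum of their indices determines its weight. -/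
theorem termWalk_spec (w : E → ℤ) {u v : W ⊕ B'} {γ : List (Dart E')}
    (hγ : Γ'.toBipartiteGraph.IsWalk u v γ) (n : Fin γ.length → ℕ) (h : m.termCoeff γ n ≠ 0) :
    Γ.toBipartiteGraph.IsWalk (m.leading.vert u) (m.leading.vert v) (m.termWalk γ n) ∧
    (γ ≠ [] → m.termWalk γ n ≠ []) ∧
    walkWeight w (m.termWalk γ n) =
      walkWeight w (subWalk m.leadingPath γ) + (∑ i, n i : ℕ) * m.squareWeight w := by
  induction γ generalizing u with
  | nil =>
    refine ⟨congrArg m.leading.vert hγ, fun h => absurd rfl h, ?_⟩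
    simp [termWalk, walkWeight, subWalk]
  | cons d γ ih =>
    obtain ⟨rfl, hγ⟩ := hγ
    obtain ⟨a, n, rfl⟩ : ∃ a n', n = Fin.cons a n' := ⟨n 0, Fin.tail n, (Fin.cons_self_tail n).symm⟩
    rw [termCoeff_cons] at h
    obtain ⟨h1, h2, h3⟩ := m.orderedTransport_spec w d a (left_ne_zero_of_mul h)
    obtain ⟨k1, k2, k3⟩ := ih hγ n (right_ne_zero_of_mul h)
    rw [termWalk_cons]
    refine ⟨isWalk_append.2 ⟨_, h1, k1⟩, fun _ => by simp [h2], ?_⟩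
    have hs : ∑ i, (Fin.cons a n : Fin (γ.length + 1) → ℕ) i = a + ∑ i, n i := by
      rw [Fin.sum_univ_succ]; simp
    change _ = _ + ((∑ i, (Fin.cons a n : Fin (γ.length + 1) → ℕ) i : ℕ) : ℤ) * _
    rw [hs, walkWeight_append, h3, k3, subWalk_cons, walkWeight_append]
    push_cast
    ring

theorem flowCoeff_mem (k : ℕ) (d : Dart E) : m.flowCoeff k d ∈
    Γ.toBipartiteGraph.pathSpan (Γ.toBipartiteGraph.src d) (Γ.toBipartiteGraph.src d) := by
  unfold flowCoeff
  have hpow : ∀ (v : W ⊕ B) l n, Γ.toBipartiteGraph.IsWalk v v l →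
      wd l ^ n ∈ Γ.toBipartiteGraph.pathSpan v v := fun v l n hl => by
    induction n with
    | zero => exact one_mem_pathSpan _
    | succ n ih => rw [pow_succ]; exact mul_mem_pathSpan ih (wd_mem hl)
  split_ifs with h1 h2
  · subst h1
    exact neg_mem (hpow m.vertexP _ _ m.isWalk_squareP)
  · subst h2
    exact neg_mem (hpow m.vertexQ _ _ m.isWalk_squareQ)
  · exact zero_mem _

theorem expFlow_pathFlow_mem {u v : W ⊕ B} {a : PathAlgebra E}
    (ha : a ∈ Γ.toBipartiteGraph.pathSpan u v) (N : ℕ) :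
    expFlow m.pathFlow N a ∈ Γ.toBipartiteGraph.pathSpan u v := by
  induction N using Nat.strong_induction_on with
  | _ N ih =>
    cases N with
    | zero => rwa [expFlow_zero]
    | succ N =>
      have h0 : (N : ℚ) + 1 ≠ 0 := by positivity
      rw [← Submodule.smul_mem_iff _ h0, expFlow_succ]
      refine neg_mem (Submodule.sum_mem _ fun p hp => ?_)
      exact der_mem (m.flowCoeff_mem _)
        (ih p.2 (by have := Finset.HasAntidiagonal.mem_antidiagonal.1 hp; omega))

/-- On closed walks the exponentials of the flows on the path algebra and on loops agree. -/
theorem trace_expFlow [Finite E] [Finite E'] {v : W ⊕ B} {a : PathAlgebra E}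
    (ha : a ∈ Γ.toBipartiteGraph.pathSpan v v) (N : ℕ) :
    Γ.toBipartiteGraph.trace v (expFlow m.pathFlow N a) =
      expFlow m.flow N (Γ.toBipartiteGraph.trace v a) := by
  have h := eq_expFlow m.flow (fun N => Γ.toBipartiteGraph.trace v (expFlow m.pathFlow N a))
    (fun N => ?_) N
  · rwa [expFlow_zero] at h
  · rw [← map_smul, expFlow_succ, map_neg, map_sum]
    congr 1
    exact Finset.sum_congr rfl fun p _ => m.trace_flow p.1 (m.expFlow_pathFlow_mem ha _)

/-- The index of the coefficient of the flow of a loop `ℓ` in which the loop `z` can occur. -/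
def flowIndex (w : E → ℤ) (ℓ z : Γ.L) : ℕ := ((Γ.wt w z - Γ.wt w ℓ) / m.squareWeight w).toNat

theorem flowIndex_eq {w : E → ℤ} (hw : 0 < m.squareWeight w) {ℓ z : Γ.L} {N : ℕ}
    (h : Γ.wt w z = Γ.wt w ℓ + N * m.squareWeight w) : m.flowIndex w ℓ z = N := by
  rw [flowIndex, h, add_sub_cancel_left, Int.mul_ediv_cancel _ hw.ne']
  rfl

/-- The sum of the coefficients of the exponential flow of a loop, as a formal sum of loops. -/
def flowSum [Finite E] (w : E → ℤ) (ℓ : Γ.L) : Γ.L → ℚ := fun z =>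
  expFlow m.flow (m.flowIndex w ℓ z) (Finsupp.single ℓ 1) z

/-- The monodromy of the new line bundle along a loop is, up to a sign, the exponential flow of the leading
term. -/
theorem pull_eq [Finite E] [Finite E'] {w : E → ℤ} (hw : 0 < m.squareWeight w)
    (γ : Γ'.toBipartiteGraph.ClosedWalk) :
    m.pull γ.1 = fun z => (m.sign γ.toLoop : ℚ) * m.flowSum w (m.leadingEquiv γ.toLoop) z := by
  obtain ⟨γ, hγ⟩ := γ
  obtain ⟨hne, u, hu⟩ := id hγ
  funext z
  set ℓ : Γ.L := m.leadingEquiv (ClosedWalk.toLoop ⟨γ, hγ⟩) with hℓ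
  have hwℓ : Γ.wt w ℓ = walkWeight w (subWalk m.leadingPath γ) := rfl
  set G : (Fin γ.length → ℕ) → ℚ := fun n =>
    (m.termCoeff γ n : ℚ) * Γ.toBipartiteGraph.loopTerm (m.termWalk γ n) z with hG
  have h1 : m.pull γ z = ∑ᶠ n, G n := by
    rw [pull, ← finsum_comp_equiv (Equiv.piCongrRight fun i => m.reorder (γ.get i))]
    refine finsum_congr fun n => ?_
    simp only [hG, termCoeff, termWalk, Int.cast_prod]
    rfl
  -- The weights determine the coefficient of the flow in which a given loop occurs.
  have h2 : ∀ n, G n ≠ 0 → ∑ i, n i = m.flowIndex w ℓ z := by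
    intro n hn
    have hc : m.termCoeff γ n ≠ 0 := by exact_mod_cast left_ne_zero_of_mul hn
    obtain ⟨k1, k2, k3⟩ := m.termWalk_spec w hu n hc
    have hz := right_ne_zero_of_mul hn
    have hcl : Γ.toBipartiteGraph.IsClosedWalk (m.termWalk γ n) := ⟨k2 hne, _, k1⟩
    rw [loopTerm, dif_pos hcl, Finsupp.single_apply_ne_zero] at hz
    refine (m.flowIndex_eq hw ?_).symm
    rw [hwℓ, ← k3, hz.1]
    rfl
  have h3 : ∑ᶠ n, G n = ∑ n ∈ Finset.Nat.antidiagonalTuple γ.length (m.flowIndex w ℓ z), G n := by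
    refine finsum_eq_sum_of_support_subset _ fun n hn => ?_
    exact Finset.mem_coe.2 (Finset.Nat.mem_antidiagonalTuple.2 (h2 n hn))
  change m.pull γ z = _
  rw [h1, h3, flowSum]
  generalize m.flowIndex w ℓ z = N
  have hwalk := m.leading.isWalk_subWalk hu
  have hcl := m.leading.isClosedWalk hγ
  change Γ.toBipartiteGraph.IsWalk _ _ (subWalk m.leadingPath γ) at hwalk
  change Γ.toBipartiteGraph.IsClosedWalk (subWalk m.leadingPath γ) at hcl
  have h4 := congrArg (Γ.toBipartiteGraph.trace (m.leading.vert u)) (m.sum_terms γ N)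
  rw [map_smul, m.trace_expFlow (wd_mem hwalk), trace_wd hcl.1 hwalk, loopTerm, dif_pos hcl,
    map_sum] at h4
  have h5 := DFunLike.congr_fun h4 z
  rw [Finsupp.finsetSum_apply] at h5
  refine Eq.trans (Finset.sum_congr rfl fun n _ => ?_) h5
  rw [map_smul, Finsupp.smul_apply, smul_eq_mul]
  by_cases hc : m.termCoeff γ n = 0
  · simp [hG, hc]
  · obtain ⟨k1, k2, -⟩ := m.termWalk_spec w hu n hc
    rw [trace_wd (k2 hne) k1]

/-- The coefficients of the exponential flow are homogeneous, since the bracket adds weights. -/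
theorem expFlow_supported [Finite E] (w : E → ℤ) (ℓ : Γ.L) (N : ℕ) :
    expFlow m.flow N (Finsupp.single ℓ 1) ∈
      Finsupp.supported ℚ ℚ {z | Γ.wt w z = Γ.wt w ℓ + N * m.squareWeight w} := by
  have hflow : ∀ (k : ℕ) (c : ℤ) (u : Γ.L →₀ ℚ), u ∈ Finsupp.supported ℚ ℚ {z | Γ.wt w z = c} →
      m.flow k u ∈ Finsupp.supported ℚ ℚ {z | Γ.wt w z = c + (k + 1) * m.squareWeight w} := by
    intro k c u hu
    rw [Finsupp.supported_eq_span_single] at hu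
    induction hu using Submodule.span_induction with
    | zero => rw [map_zero]; exact Submodule.zero_mem _
    | add x y _ _ hx hy => rw [map_add]; exact Submodule.add_mem _ hx hy
    | smul r x _ hx => rw [map_smul]; exact Submodule.smul_mem _ _ hx
    | mem x hx =>
      obtain ⟨x, hx, rfl⟩ := hx
      have hcl : Γ.toBipartiteGraph.IsClosedWalk (m.squarePow (k + 1)) :=
        ⟨m.squarePow_ne_nil k, _, m.isWalk_squarePow _⟩
      rw [flow, LinearMap.smul_apply, LinearMap.flip_apply, loopTerm, dif_pos hcl,
        BipartiteRibbonGraph.linBracket, bilinearExt_single]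
      refine Submodule.smul_mem _ _ ?_
      have h := Γ.conj.goldman_supported w x (ClosedWalk.toLoop ⟨m.squarePow (k + 1), hcl⟩)
      have h2 : Γ.wt w (ClosedWalk.toLoop ⟨m.squarePow (k + 1), hcl⟩) =
          (k + 1) * m.squareWeight w := by
        change walkWeight w (m.squarePow (k + 1)) = _
        rw [squarePow, walkWeight_replicate]
        push_cast
        rfl
      refine (Finsupp.mem_supported _ _).2 fun z hz => ?_
      have hz' : Γ.wt w z = Γ.wt w x + Γ.wt w (ClosedWalk.toLoop ⟨m.squarePow (k + 1), hcl⟩) := h hz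
      rw [h2, show Γ.wt w x = c from hx] at hz'
      exact hz'
  induction N using Nat.strong_induction_on with
  | _ N ih =>
    cases N with
    | zero =>
      rw [expFlow_zero]
      exact Finsupp.single_mem_supported ℚ _ (by simp)
    | succ N =>
      have h0 : (N : ℚ) + 1 ≠ 0 := by positivity
      rw [← Submodule.smul_mem_iff _ h0, expFlow_succ]
      refine neg_mem (Submodule.sum_mem _ fun p hp => ?_)
      have hp' := Finset.HasAntidiagonal.mem_antidiagonal.1 hp
      have := hflow p.1 _ _ (ih p.2 (by omega))
      convert this using 5
      rw [← hp']
      push_cast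
      ring

end TwoByTwoMove

/-! ### Formal sums that are finite below every weight -/

section Novikov

variable {X Y : Type*} {ω : X → ℤ} {ω' : Y → ℤ}

theorem SupportedFrom.mono {M N : ℤ} {f : X → ℚ} (h : SupportedFrom ω N f) (hMN : M ≤ N) :
    SupportedFrom ω M f := fun x hx => hMN.trans (h x hx)

theorem SupportedFrom.zero (N : ℤ) : SupportedFrom ω N (0 : X → ℚ) := fun _ h => absurd rfl h

theorem SupportedFrom.add {N : ℤ} {f g : X → ℚ} (hf : SupportedFrom ω N f)
    (hg : SupportedFrom ω N g) : SupportedFrom ω N (f + g) := fun x hx => by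
  by_cases h : f x = 0
  · exact hg x fun h' => hx (by rw [Pi.add_apply, h, h', add_zero])
  · exact hf x h

theorem SupportedFrom.neg {N : ℤ} {f : X → ℚ} (hf : SupportedFrom ω N f) :
    SupportedFrom ω N (-f) := fun x hx => hf x fun h => hx (by rw [Pi.neg_apply, h, neg_zero])

theorem SupportedFrom.sub {N : ℤ} {f g : X → ℚ} (hf : SupportedFrom ω N f)
    (hg : SupportedFrom ω N g) : SupportedFrom ω N (f - g) := by
  rw [sub_eq_add_neg]; exact hf.add hg.neg

theorem SupportedFrom.sum {ι : Type*} {s : Finset ι} {N : ℤ} {f : ι → X → ℚ}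
    (h : ∀ i ∈ s, SupportedFrom ω N (f i)) : SupportedFrom ω N (∑ i ∈ s, f i) :=
  Finset.sum_induction _ _ (fun _ _ => SupportedFrom.add) (SupportedFrom.zero N) h

theorem eq_zero_of_supportedFrom {f : X → ℚ} (h : ∀ N, SupportedFrom ω N f) : f = 0 := by
  funext x
  by_contra hx
  have := h (ω x + 1) x hx
  omega

theorem HasIntegralCoeffs.add {f g : X → ℚ} (hf : HasIntegralCoeffs f) (hg : HasIntegralCoeffs g) :
    HasIntegralCoeffs (f + g) := fun x => by
  obtain ⟨a, ha⟩ := hf x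
  obtain ⟨b, hb⟩ := hg x
  exact ⟨a + b, by rw [Pi.add_apply, ha, hb]; push_cast; rfl⟩

theorem HasIntegralCoeffs.sub {f g : X → ℚ} (hf : HasIntegralCoeffs f) (hg : HasIntegralCoeffs g) :
    HasIntegralCoeffs (f - g) := fun x => by
  obtain ⟨a, ha⟩ := hf x
  obtain ⟨b, hb⟩ := hg x
  exact ⟨a - b, by rw [Pi.sub_apply, ha, hb]; push_cast; rfl⟩

theorem exists_int_finsum {ι : Type*} {f : ι → ℚ} (h : ∀ i, ∃ n : ℤ, f i = n) :
    ∃ n : ℤ, ∑ᶠ i, f i = n := by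
  refine finsum_induction (p := fun q : ℚ => ∃ n : ℤ, q = n) ⟨0, by simp⟩ ?_ h
  rintro _ _ ⟨a, rfl⟩ ⟨b, rfl⟩
  exact ⟨a + b, by push_cast; rfl⟩

theorem exists_ne_zero_of_finsum_ne_zero' {ι : Type*} {f : ι → ℚ} (h : ∑ᶠ i, f i ≠ 0) :
    ∃ i, f i ≠ 0 := by
  by_contra! h'
  exact h (by rw [finsum_congr h', finsum_zero])

variable (ω) in
/-- The space of formal sums with finitely many terms of weight at most `N`, for every `N`. -/
def Nov : Submodule ℚ (X → ℚ) where
  carrier := {x | IsNovikov ω x}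
  add_mem' := IsNovikov.add
  zero_mem' := IsNovikov.of_finite (by simp)
  smul_mem' c _ h := h.smul c

namespace Nov

open Classical in
variable (ω) in
/-- An element of the index set as a formal sum. -/
def single (x : X) : Nov ω :=
  ⟨Pi.single x 1, IsNovikov.of_finite ((Set.finite_singleton x).subset fun y hy => by
    by_contra h
    exact hy (Pi.single_eq_of_ne h 1))⟩

theorem single_apply (x y : X) [Decidable (y = x)] :
    (single ω x).1 y = if y = x then 1 else 0 := by
  classical
  split_ifs with h
  · rw [h]
    simp [single]
  · simp [single, h]

variable (ω) in
/-- A finite sum as a formal sum. -/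
def ofFinsupp : (X →₀ ℚ) →ₗ[ℚ] Nov ω where
  toFun f := ⟨f, IsNovikov.of_finite (f.support.finite_toSet.subset fun x hx => by simpa using hx)⟩
  map_add' f g := Subtype.ext (Finsupp.coe_add f g)
  map_smul' r f := Subtype.ext (Finsupp.coe_smul r f)

theorem ofFinsupp_single (x : X) : ofFinsupp ω (Finsupp.single x 1) = single ω x := by
  classical
  refine Subtype.ext (funext fun y => ?_)
  change Finsupp.single x (1 : ℚ) y = (Pi.single x 1 : X → ℚ) y
  rw [Finsupp.single_apply, Pi.single_apply]
  simp only [eq_comm]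

theorem single_supportedFrom (x : X) : SupportedFrom ω (ω x) (single ω x).1 := fun y hy => by
  classical
  by_cases h : y = x
  · rw [h]
  · exact absurd (Pi.single_eq_of_ne h 1) hy

theorem single_integral (x : X) : HasIntegralCoeffs (single ω x).1 := fun y => by
  classical
  by_cases h : y = x
  · subst h; exact ⟨1, by simp [single]⟩
  · exact ⟨0, by simp [single, h]⟩

/-- A formal sum is a finite sum up to terms of large weight. -/
theorem exists_finsupp (f : Nov ω) (N : ℤ) : ∃ u : X →₀ ℚ, SupportedFrom ω N (f - ofFinsupp ω u).1 := by
  classical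
  refine ⟨Finsupp.onFinset (f.2 N).toFinset (fun x => if ω x ≤ N then f.1 x else 0) fun x hx => ?_,
    fun x hx => ?_⟩
  · rw [ne_eq, ite_eq_right_iff, not_forall] at hx
    simpa using ⟨hx.2, hx.1⟩
  · by_contra h
    refine hx ?_
    change f.1 x - (if ω x ≤ N then f.1 x else 0) = 0
    rw [if_pos (by omega), sub_self]

/-- The density of the finite sums: a linear map that respects the weights, up to a constant, is determined
by its values on the index set. -/
theorem eq_zero_of_single {V : Type*} [AddCommGroup V] [Module ℚ V] {P : ℤ → V → Prop}
    (hP : ∀ v, (∀ N, P N v) → v = 0) (T : Nov ω →ₗ[ℚ] V) (c : ℤ)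
    (hT : ∀ N f, SupportedFrom ω N f.1 → P (N + c) (T f)) (h : ∀ x, T (single ω x) = 0) (f : Nov ω) :
    T f = 0 := by
  have h0 : ∀ u, T (ofFinsupp ω u) = 0 := fun u => by
    induction u using Finsupp.induction_linear with
    | zero => rw [map_zero, map_zero]
    | single x r =>
      have : Finsupp.single x r = r • Finsupp.single x 1 := by simp
      rw [this, map_smul, map_smul, ofFinsupp_single, h, smul_zero]
    | add u v hu hv => rw [map_add, map_add, hu, hv, add_zero]
  refine hP _ fun N => ?_
  obtain ⟨u, hu⟩ := exists_finsupp f (N - c)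
  have := hT _ _ hu
  rwa [map_sub, h0 u, sub_zero, sub_add_cancel] at this

/-- The linear extension of a map from the index set to formal sums which does not decrease weights. -/
def extend (c : X → Nov ω') (hc : ∀ x, SupportedFrom ω' (ω x) (c x).1) : Nov ω →ₗ[ℚ] Nov ω' :=
  have hfin : ∀ (f : Nov ω) (y : Y), (Function.support fun x => f.1 x * (c x).1 y).Finite := fun f y =>
    (f.2 (ω' y)).subset fun x hx => ⟨left_ne_zero_of_mul hx, hc x y (right_ne_zero_of_mul hx)⟩
  { toFun f := ⟨fun y => ∑ᶠ x, f.1 x * (c x).1 y, fun N => by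
      refine ((f.2 N).biUnion fun x _ => (c x).2 N).subset ?_
      rintro y ⟨hy, hN⟩
      obtain ⟨x, hx⟩ := exists_ne_zero_of_finsum_ne_zero' hy
      have h1 := right_ne_zero_of_mul hx
      simp only [Set.mem_iUnion]
      exact ⟨x, ⟨left_ne_zero_of_mul hx, (hc x y h1).trans hN⟩, h1, hN⟩⟩
    map_add' f g := Subtype.ext <| funext fun y => by
      change ∑ᶠ x, (f.1 x + g.1 x) * (c x).1 y =
        ∑ᶠ x, f.1 x * (c x).1 y + ∑ᶠ x, g.1 x * (c x).1 y
      rw [← finsum_add_distrib (hfin f y) (hfin g y)]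
      exact finsum_congr fun x => add_mul _ _ _
    map_smul' r f := Subtype.ext <| funext fun y => by
      change ∑ᶠ x, (r * f.1 x) * (c x).1 y = r * ∑ᶠ x, f.1 x * (c x).1 y
      rw [mul_finsum]
      exact finsum_congr fun x => mul_assoc _ _ _ }

variable {c : X → Nov ω'} {hc : ∀ x, SupportedFrom ω' (ω x) (c x).1}

theorem extend_single (x : X) : extend c hc (single ω x) = c x := by
  classical
  refine Subtype.ext (funext fun y => ?_)
  change ∑ᶠ x', (Pi.single x 1 : X → ℚ) x' * (c x').1 y = _
  rw [finsum_eq_single _ x fun x' h => by rw [Pi.single_eq_of_ne h, zero_mul], Pi.single_eq_same,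
    one_mul]

theorem extend_supportedFrom {N : ℤ} {f : Nov ω} (hf : SupportedFrom ω N f.1) :
    SupportedFrom ω' N (extend c hc f).1 := fun y hy => by
  obtain ⟨x, hx⟩ := exists_ne_zero_of_finsum_ne_zero' hy
  exact (hf x (left_ne_zero_of_mul hx)).trans (hc x y (right_ne_zero_of_mul hx))

theorem extend_integral (hi : ∀ x, HasIntegralCoeffs (c x).1) {f : Nov ω} (hf : HasIntegralCoeffs f.1) :
    HasIntegralCoeffs (extend c hc f).1 := fun y => exists_int_finsum fun x => by
  obtain ⟨a, ha⟩ := hf x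
  obtain ⟨b, hb⟩ := hi x y
  exact ⟨a * b, by rw [ha, hb]; push_cast; rfl⟩

/-- A linear map is surjective if its difference from the identity increases the weights. -/
theorem exists_preimage {U : Nov ω →ₗ[ℚ] Nov ω}
    (hU : ∀ N f, SupportedFrom ω N f.1 → SupportedFrom ω (N + 1) (U f - f).1)
    (hi : ∀ f, HasIntegralCoeffs f.1 → HasIntegralCoeffs (U f).1) {A : ℤ} {g : Nov ω}
    (hg : SupportedFrom ω A g.1) :
    ∃ f, U f = g ∧ SupportedFrom ω A f.1 ∧ (HasIntegralCoeffs g.1 → HasIntegralCoeffs f.1) := by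
  set V : Module.End ℚ (Nov ω) := 1 - U with hV
  have hVN : ∀ N f, SupportedFrom ω N f.1 → SupportedFrom ω (N + 1) (V f).1 := fun N f hf => by
    have : V f = - (U f - f) := by simp [hV]
    rw [this]
    exact (hU N f hf).neg
  have hVk : ∀ k : ℕ, SupportedFrom ω (A + k) ((V ^ k) g).1 := by
    intro k
    induction k with
    | zero => simpa using hg
    | succ k ih =>
      rw [pow_succ', Module.End.mul_apply]
      have := hVN _ _ ih
      rwa [add_assoc] at this
  -- Partial sums of the geometric series for `(1 - V)⁻¹ = U⁻¹`; they stabilise below every weight.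
  set F : ℕ → Nov ω := fun K => ∑ k ∈ Finset.range K, (V ^ k) g with hF
  have hFF : ∀ K₀ K : ℕ, K₀ ≤ K → SupportedFrom ω (A + K₀) (F K - F K₀).1 := by
    intro K₀ K h
    have : F K - F K₀ = ∑ k ∈ Finset.Ico K₀ K, (V ^ k) g := (Finset.sum_Ico_eq_sub _ h).symm
    rw [this, AddSubmonoidClass.coe_finsetSum]
    refine SupportedFrom.sum fun k hk => (hVk k).mono ?_
    have := (Finset.mem_Ico.1 hk).1
    omega
  set f : X → ℚ := fun y => (F (ω y - A + 1).toNat).1 y with hf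
  have hfF : ∀ K : ℕ, ∀ y, ω y < A + K → f y = (F K).1 y := by
    intro K y hy
    by_contra h
    have := hFF (ω y - A + 1).toNat K (by omega) y fun h0 => h (sub_eq_zero.1 h0).symm
    omega
  have hfn : IsNovikov ω f := by
    intro N
    refine ((F (N - A + 1).toNat).2 N).subset ?_
    rintro y ⟨hy, hN⟩
    rw [hfF (N - A + 1).toNat y (by omega)] at hy
    exact ⟨hy, hN⟩
  have hfs : ∀ K : ℕ, SupportedFrom ω (A + K) ((⟨f, hfn⟩ : Nov ω) - F K).1 := by
    intro K y hy
    by_contra h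
    exact hy (sub_eq_zero.2 (hfF K y (by omega)))
  have hUs : ∀ N f, SupportedFrom ω N f.1 → SupportedFrom ω N (U f).1 := fun N f hf => by
    have : U f = (U f - f) + f := by abel
    rw [this]
    exact ((hU N f hf).mono (by omega)).add hf
  refine ⟨⟨f, hfn⟩, ?_, ?_, ?_⟩
  · rw [← sub_eq_zero]
    refine Subtype.ext (eq_zero_of_supportedFrom (ω := ω) fun N => ?_)
    have hUF : ∀ K, U (F K) = g - (V ^ K) g := by
      intro K
      have h1 := mul_neg_geom_sum V K
      have h2 : 1 - V = U := sub_sub_self 1 U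
      rw [h2] at h1
      have h3 := LinearMap.congr_fun h1 g
      rw [Module.End.mul_apply, LinearMap.sum_apply] at h3
      exact h3
    set K := (N - A).toNat
    have h3 : U ⟨f, hfn⟩ - g = U (⟨f, hfn⟩ - F K) - (V ^ K) g := by rw [map_sub, hUF]; abel
    rw [h3]
    exact ((hUs _ _ (hfs K)).sub (hVk K)).mono (by omega)
  · have := hfs 0
    simpa [hF] using this
  · intro hgi y
    have hVi : ∀ k : ℕ, HasIntegralCoeffs ((V ^ k) g).1 := by
      intro k
      induction k with
      | zero => simpa using hgi
      | succ k ih =>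
        rw [pow_succ', Module.End.mul_apply]
        exact ih.sub (hi _ ih)
    have : ∀ K, HasIntegralCoeffs (F K).1 := by
      intro K
      rw [hF, AddSubmonoidClass.coe_finsetSum]
      exact Finset.sum_induction _ _ (fun _ _ => HasIntegralCoeffs.add) (fun _ => ⟨0, by simp⟩)
        fun k _ => hVi k
    exact this _ y

theorem injective_of_unipotent {U : Nov ω →ₗ[ℚ] Nov ω}
    (hU : ∀ N f, SupportedFrom ω N f.1 → SupportedFrom ω (N + 1) (U f - f).1) :
    Function.Injective U := by
  rw [injective_iff_map_eq_zero]
  intro f hf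
  obtain ⟨A, hA⟩ := f.2.exists_le
  have h : ∀ k : ℕ, SupportedFrom ω (A + k) f.1 := by
    intro k
    induction k with
    | zero => simpa using hA
    | succ k ih =>
      have h1 := hU _ _ ih
      rw [hf, zero_sub] at h1
      have h2 := h1.neg
      have h3 : - ((-f : Nov ω) : X → ℚ) = f.1 := neg_neg f.1
      rw [h3, add_assoc] at h2
      exact_mod_cast h2
  exact Subtype.ext (eq_zero_of_supportedFrom (ω := ω) fun N => (h (N - A).toNat).mono (by omega))

/-- The bilinear extension to formal sums of an operation on the index set that is additive on
weights. -/
def bilin (c : X → X → (X →₀ ℚ)) (hc : ∀ a b, c a b ∈ Finsupp.supported ℚ ℚ {z | ω z = ω a + ω b}) :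
    Nov ω →ₗ[ℚ] Nov ω →ₗ[ℚ] Nov ω :=
  have hfin : ∀ (f g : Nov ω) (z : X),
      (Function.support fun p : X × X => f.1 p.1 * g.1 p.2 * c p.1 p.2 z).Finite := fun f g z => by
    obtain ⟨A, hA⟩ := f.2.exists_le
    obtain ⟨C, hC⟩ := g.2.exists_le
    refine ((f.2 (ω z - C)).prod (g.2 (ω z - A))).subset ?_
    rintro ⟨a, b⟩ hp
    have h1 := left_ne_zero_of_mul hp
    have ha := left_ne_zero_of_mul h1
    have hb := right_ne_zero_of_mul h1
    have hz : ω z = ω a + ω b := hc a b (by simpa using right_ne_zero_of_mul hp)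
    have h2 := hA a ha
    have h3 := hC b hb
    exact ⟨⟨ha, show ω a ≤ _ by omega⟩, ⟨hb, show ω b ≤ _ by omega⟩⟩
  LinearMap.mk₂ ℚ (fun f g => ⟨formalExtend c f.1 g.1, f.2.formalExtend hc g.2⟩)
    (fun f f' g => Subtype.ext <| funext fun z => by
      change (∑ᶠ p : X × X, (f.1 p.1 + f'.1 p.1) * g.1 p.2 * c p.1 p.2 z) =
        (∑ᶠ p : X × X, f.1 p.1 * g.1 p.2 * c p.1 p.2 z) +
          (∑ᶠ p : X × X, f'.1 p.1 * g.1 p.2 * c p.1 p.2 z)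
      rw [← finsum_add_distrib (hfin f g z) (hfin f' g z)]
      exact finsum_congr fun p => by ring)
    (fun r f g => Subtype.ext <| funext fun z => by
      change (∑ᶠ p : X × X, (r * f.1 p.1) * g.1 p.2 * c p.1 p.2 z) =
        r * (∑ᶠ p : X × X, f.1 p.1 * g.1 p.2 * c p.1 p.2 z)
      rw [mul_finsum]
      exact finsum_congr fun p => by ring)
    (fun f g g' => Subtype.ext <| funext fun z => by
      change (∑ᶠ p : X × X, f.1 p.1 * (g.1 p.2 + g'.1 p.2) * c p.1 p.2 z) =
        (∑ᶠ p : X × X, f.1 p.1 * g.1 p.2 * c p.1 p.2 z) +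
          (∑ᶠ p : X × X, f.1 p.1 * g'.1 p.2 * c p.1 p.2 z)
      rw [← finsum_add_distrib (hfin f g z) (hfin f g' z)]
      exact finsum_congr fun p => by ring)
    (fun r f g => Subtype.ext <| funext fun z => by
      change (∑ᶠ p : X × X, f.1 p.1 * (r * g.1 p.2) * c p.1 p.2 z) =
        r * (∑ᶠ p : X × X, f.1 p.1 * g.1 p.2 * c p.1 p.2 z)
      rw [mul_finsum]
      exact finsum_congr fun p => by ring)

variable {b : X → X → (X →₀ ℚ)} {hb : ∀ x y, b x y ∈ Finsupp.supported ℚ ℚ {z | ω z = ω x + ω y}}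

theorem bilin_single (x y : X) : bilin b hb (single ω x) (single ω y) = ofFinsupp ω (b x y) := by
  classical
  refine Subtype.ext (funext fun z => ?_)
  change ∑ᶠ p : X × X, (Pi.single x 1 : X → ℚ) p.1 * (Pi.single y 1 : X → ℚ) p.2 * b p.1 p.2 z = b x y z
  rw [finsum_eq_single _ (x, y)]
  · simp
  · rintro ⟨x', y'⟩ h
    by_cases hx : x' = x
    · have : y' ≠ y := fun hy => h (by rw [hx, hy])
      simp [this]
    · simp [hx]

theorem bilin_supportedFrom {M N : ℤ} {f g : Nov ω} (hf : SupportedFrom ω M f.1)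
    (hg : SupportedFrom ω N g.1) : SupportedFrom ω (M + N) (bilin b hb f g).1 := fun z hz => by
  obtain ⟨⟨x, y⟩, hp⟩ := exists_ne_zero_of_finsum_ne_zero' hz
  have h1 := left_ne_zero_of_mul hp
  have h2 := hf x (left_ne_zero_of_mul h1)
  have h3 := hg y (right_ne_zero_of_mul h1)
  have hz : ω z = ω x + ω y := hb x y (by simpa using right_ne_zero_of_mul hp)
  omega

theorem bilin_integral (hi : ∀ x y, HasIntegralCoeffs (b x y)) {f g : Nov ω}
    (hf : HasIntegralCoeffs f.1) (hg : HasIntegralCoeffs g.1) :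
    HasIntegralCoeffs (bilin b hb f g).1 := fun z => exists_int_finsum fun p => by
  obtain ⟨x, hx⟩ := hf p.1
  obtain ⟨y, hy⟩ := hg p.2
  obtain ⟨t, ht⟩ := hi p.1 p.2 z
  exact ⟨x * y * t, by rw [hx, hy, ht]; push_cast; rfl⟩

end Nov

end Novikov

/-! ### Continuity and density -/

section Novikov

variable {X Y Z : Type*} {ω : X → ℤ} {ω' : Y → ℤ} {ω'' : Z → ℤ}

namespace Nov

/-- A linear map between spaces of formal sums that decreases weights at most by a constant. -/
def Bounded (T : Nov ω →ₗ[ℚ] Nov ω') : Prop :=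
  ∃ c : ℤ, ∀ N f, SupportedFrom ω N f.1 → SupportedFrom ω' (N + c) (T f).1

theorem Bounded.of_filtered {T : Nov ω →ₗ[ℚ] Nov ω'}
    (h : ∀ N f, SupportedFrom ω N f.1 → SupportedFrom ω' N (T f).1) : Bounded T :=
  ⟨0, fun N f hf => by rw [add_zero]; exact h N f hf⟩

theorem Bounded.id : Bounded (LinearMap.id : Nov ω →ₗ[ℚ] Nov ω) := .of_filtered fun _ _ h => h

theorem Bounded.comp {S : Nov ω' →ₗ[ℚ] Nov ω''} {T : Nov ω →ₗ[ℚ] Nov ω'} (hS : Bounded S)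
    (hT : Bounded T) : Bounded (S ∘ₗ T) := by
  obtain ⟨c, hc⟩ := hS
  obtain ⟨d, hd⟩ := hT
  refine ⟨d + c, fun N f hf => ?_⟩
  rw [← add_assoc]
  exact hc _ _ (hd _ _ hf)

theorem Bounded.add {S T : Nov ω →ₗ[ℚ] Nov ω'} (hS : Bounded S) (hT : Bounded T) :
    Bounded (S + T) := by
  obtain ⟨c, hc⟩ := hS
  obtain ⟨d, hd⟩ := hT
  refine ⟨min c d, fun N f hf => ?_⟩
  exact ((hc _ _ hf).mono (by have := min_le_left c d; omega)).add
    ((hd _ _ hf).mono (by have := min_le_right c d; omega))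

theorem Bounded.neg {T : Nov ω →ₗ[ℚ] Nov ω'} (hT : Bounded T) : Bounded (-T) := by
  obtain ⟨d, hd⟩ := hT
  exact ⟨d, fun N f hf => (hd _ _ hf).neg⟩

theorem Bounded.zero : Bounded (0 : Nov ω →ₗ[ℚ] Nov ω') :=
  .of_filtered fun N _ _ => SupportedFrom.zero N

/-- Two bounded linear maps are equal if they agree on the index set. -/
theorem Bounded.ext {S T : Nov ω →ₗ[ℚ] Nov ω'} (hS : Bounded S) (hT : Bounded T)
    (h : ∀ x, S (single ω x) = T (single ω x)) : S = T := by
  obtain ⟨c, hc⟩ := hS.add hT.neg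
  refine LinearMap.ext fun f => sub_eq_zero.1 ?_
  have := eq_zero_of_single (V := Nov ω') (P := fun N v => SupportedFrom ω' N v.1)
    (fun v hv => Subtype.ext (eq_zero_of_supportedFrom (ω := ω') hv)) (S + -T) c hc
    (fun x => by rw [LinearMap.add_apply, LinearMap.neg_apply, h, add_neg_cancel]) f
  rwa [LinearMap.add_apply, LinearMap.neg_apply, ← sub_eq_add_neg] at this

theorem Bounded.extend {c : X → Nov ω'} {hc : ∀ x, SupportedFrom ω' (ω x) (c x).1} :
    Bounded (Nov.extend c hc) := .of_filtered fun _ _ => extend_supportedFrom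

variable {b : X → X → (X →₀ ℚ)} {hb : ∀ x y, b x y ∈ Finsupp.supported ℚ ℚ {z | ω z = ω x + ω y}}

theorem Bounded.bilin_left (f : Nov ω) : Bounded (bilin b hb f) := by
  obtain ⟨A, hA⟩ := f.2.exists_le
  exact ⟨A, fun N g hg => by rw [add_comm]; exact bilin_supportedFrom hA hg⟩

theorem Bounded.bilin_right (g : Nov ω) : Bounded ((bilin b hb).flip g) := by
  obtain ⟨A, hA⟩ := g.2.exists_le
  exact ⟨A, fun N f hf => bilin_supportedFrom (hb := hb) hf hA⟩

theorem bilin_ofFinsupp (u v : X →₀ ℚ) :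
    bilin b hb (ofFinsupp ω u) (ofFinsupp ω v) = ofFinsupp ω (bilinearExt b u v) := by
  induction u using Finsupp.induction_linear with
  | zero => simp
  | add u u' h h' => simp only [map_add, LinearMap.add_apply, h, h']
  | single x r =>
    have hx : Finsupp.single x r = r • Finsupp.single x 1 := by simp
    induction v using Finsupp.induction_linear with
    | zero => simp
    | add u u' h h' => simp only [map_add, h, h']
    | single y s =>
      have hy : Finsupp.single y s = s • Finsupp.single y 1 := by simp
      simp only [hx, hy, map_smul, LinearMap.smul_apply, ofFinsupp_single, bilin_single,
        bilinearExt_single]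

theorem bilin_skew (h : ∀ x y, b y x = - b x y) (f g : Nov ω) :
    bilin b hb g f = - bilin b hb f g := by
  have h1 : ∀ x, (bilin b hb).flip (single ω x) = - bilin b hb (single ω x) := fun x =>
    Bounded.ext (.bilin_right _) (.neg (.bilin_left _)) fun y => by
      rw [LinearMap.flip_apply, LinearMap.neg_apply, bilin_single, bilin_single, h, map_neg]
  have h2 : bilin b hb g = - (bilin b hb).flip g :=
    Bounded.ext (.bilin_left _) (.neg (.bilin_right _)) fun x => by
      rw [LinearMap.neg_apply, LinearMap.flip_apply]
      exact LinearMap.congr_fun (h1 x) g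
  rw [h2, LinearMap.neg_apply, LinearMap.flip_apply]

theorem bilin_jacobi (h : ∀ u v w, bilinearExt b u (bilinearExt b v w) +
    bilinearExt b v (bilinearExt b w u) + bilinearExt b w (bilinearExt b u v) = 0) (f g k : Nov ω) :
    bilin b hb f (bilin b hb g k) + bilin b hb g (bilin b hb k f) +
      bilin b hb k (bilin b hb f g) = 0 := by
  set β := bilin b hb
  have key : ∀ f g, (∀ x, β f (β g (single ω x)) + β g (β (single ω x) f) +
      β (single ω x) (β f g) = 0) → ∀ k, β f (β g k) + β g (β k f) + β k (β f g) = 0 := by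
    intro f g h k
    have : β f ∘ₗ β g + β g ∘ₗ β.flip f + β.flip (β f g) = 0 :=
      Bounded.ext (((Bounded.bilin_left _).comp (.bilin_left _)).add
        ((Bounded.bilin_left _).comp (.bilin_right _)) |>.add (.bilin_right _)) .zero h
    exact LinearMap.congr_fun this k
  have h3 : ∀ x y z, β (single ω x) (β (single ω y) (single ω z)) +
      β (single ω y) (β (single ω z) (single ω x)) +
      β (single ω z) (β (single ω x) (single ω y)) = 0 := fun x y z => by
    simp only [β, ← ofFinsupp_single, bilin_ofFinsupp, ← map_add, h, map_zero]
  have cyc : ∀ {a b c : Nov ω}, a + b + c = 0 → b + c + a = 0 := fun h => by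
    rw [← h]; abel
  exact key f g (fun x => cyc (key _ f (fun y => cyc (key _ _ (fun z => h3 y x z) f)) g)) k

end Nov

end Novikov

/-! ### The Lie algebra of formal sums of loops -/

namespace BipartiteRibbonGraph

variable {W B E : Type*} [Finite E] (Γ : BipartiteRibbonGraph W B E) (w : E → ℤ)

/-- The bracket on formal sums of loops as a bilinear map. -/
def hatBilin : Nov (Γ.wt w) →ₗ[ℚ] Nov (Γ.wt w) →ₗ[ℚ] Nov (Γ.wt w) :=
  Nov.bilin Γ.bracket (Γ.conj.goldman_supported w)

theorem isLieBracket_of_bilinear {V : Type*} [AddCommGroup V] [Module ℚ V] (β : V →ₗ[ℚ] V →ₗ[ℚ] V)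
    (skew : ∀ x y, β y x = - β x y)
    (jacobi : ∀ x y z, β x (β y z) + β y (β z x) + β z (β x y) = 0) :
    IsLieBracket fun x y => β x y where
  add_left x y z := by rw [map_add, LinearMap.add_apply]
  smul_left c x y := by rw [map_smul, LinearMap.smul_apply]
  add_right x y z := map_add _ _ _
  smul_right c x y := map_smul _ _ _
  self x := by
    have h : (2 : ℚ) • β x x = 0 := by
      rw [two_smul]
      nth_rewrite 1 [skew x x]
      exact neg_add_cancel _
    exact (smul_eq_zero.1 h).resolve_left two_ne_zero
  jacobi := jacobi

theorem isLieBracket_hatBracket : IsLieBracket (Γ.hatBracket w) :=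
  isLieBracket_of_bilinear (Γ.hatBilin w)
    (Nov.bilin_skew fun a b => Γ.conj.goldman_skew a b) (Nov.bilin_jacobi Γ.linBracket_jacobi)

theorem hatBracket_integral {x y : Γ.LHat w} (hx : HasIntegralCoeffs x.1)
    (hy : HasIntegralCoeffs y.1) : HasIntegralCoeffs (Γ.hatBracket w x y).1 :=
  Nov.bilin_integral (ω := Γ.wt w) (hb := Γ.conj.goldman_supported w)
    (fun a b => Γ.conj.goldman_integral a b) hx hy

end BipartiteRibbonGraph

/-! ### Automorphisms given by graded families -/

section Novikov

variable {X Y : Type*} {ω : X → ℤ} {ω' : Y → ℤ}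

namespace Nov

/-- Relabelling the index set by a bijection that preserves weights, with signs. -/
def relabel (τ : Y ≃ X) (hτ : ∀ y, ω (τ y) = ω' y) (s : Y → ℤ) (hs : ∀ y, s y * s y = 1) :
    Nov ω' ≃ₗ[ℚ] Nov ω where
  toFun f := ⟨fun x => s (τ.symm x) * f.1 (τ.symm x), fun N =>
    ((f.2 N).image τ).subset fun x ⟨h, hx⟩ => ⟨τ.symm x, ⟨right_ne_zero_of_mul h, by
      rwa [← hτ, τ.apply_symm_apply]⟩, τ.apply_symm_apply x⟩⟩
  invFun g := ⟨fun y => s y * g.1 (τ y), fun N =>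
    ((g.2 N).image τ.symm).subset fun y ⟨h, hy⟩ => ⟨τ y, ⟨right_ne_zero_of_mul h, by
      rwa [hτ]⟩, τ.symm_apply_apply y⟩⟩
  map_add' f g := Subtype.ext (funext fun x => mul_add _ (f.1 (τ.symm x)) (g.1 (τ.symm x)))
  map_smul' r f := Subtype.ext (funext fun x => mul_left_comm _ r (f.1 (τ.symm x)))
  left_inv f := Subtype.ext (funext fun y => by
    change (s y : ℚ) * (s (τ.symm (τ y)) * f.1 (τ.symm (τ y))) = f.1 y
    rw [τ.symm_apply_apply, ← mul_assoc, ← Int.cast_mul, hs, Int.cast_one, one_mul])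
  right_inv g := Subtype.ext (funext fun x => by
    change (s (τ.symm x) : ℚ) * (s (τ.symm x) * g.1 (τ (τ.symm x))) = g.1 x
    rw [τ.apply_symm_apply, ← mul_assoc, ← Int.cast_mul, hs, Int.cast_one, one_mul])

variable {τ : Y ≃ X} {hτ : ∀ y, ω (τ y) = ω' y} {s : Y → ℤ} {hs : ∀ y, s y * s y = 1}

theorem relabel_supportedFrom {N : ℤ} {f : Nov ω'} :
    SupportedFrom ω' N f.1 ↔ SupportedFrom ω N (relabel τ hτ s hs f).1 := by
  have hs0 : ∀ y, (s y : ℚ) ≠ 0 := fun y h => by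
    have := hs y
    rw [Int.cast_eq_zero.1 h] at this
    simp at this
  constructor
  · intro h x hx
    have := h _ (right_ne_zero_of_mul hx)
    rwa [← hτ, τ.apply_symm_apply] at this
  · intro h y hy
    rw [← hτ]
    refine h (τ y) ?_
    change (s (τ.symm (τ y)) : ℚ) * f.1 (τ.symm (τ y)) ≠ 0
    rw [τ.symm_apply_apply]
    exact mul_ne_zero (hs0 y) hy

theorem relabel_integral {f : Nov ω'} :
    HasIntegralCoeffs f.1 ↔ HasIntegralCoeffs (relabel τ hτ s hs f).1 := by
  constructor
  · intro h x
    obtain ⟨n, hn⟩ := h (τ.symm x)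
    exact ⟨s (τ.symm x) * n, by rw [Int.cast_mul, ← hn]; rfl⟩
  · intro h y
    obtain ⟨n, hn⟩ := h (τ y)
    refine ⟨s y * n, ?_⟩
    rw [Int.cast_mul, ← hn]
    change f.1 y = (s y : ℚ) * (s (τ.symm (τ y)) * f.1 (τ.symm (τ y)))
    rw [τ.symm_apply_apply, ← mul_assoc, ← Int.cast_mul, hs, Int.cast_one, one_mul]

theorem relabel_ofFinsupp {u : Y →₀ ℚ} {c : ℤ} (hu : ∀ y, u y ≠ 0 → s y = c) :
    relabel τ hτ s hs (ofFinsupp ω' u) = (c : ℚ) • ofFinsupp ω (u.mapDomain τ) := by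
  refine Subtype.ext (funext fun x => ?_)
  change (s (τ.symm x) : ℚ) * u (τ.symm x) = c * u.mapDomain τ x
  rw [Finsupp.mapDomain_equiv_apply]
  by_cases h : u (τ.symm x) = 0
  · rw [h, mul_zero, mul_zero]
  · rw [hu _ h]

theorem relabel_single (y : Y) :
    relabel τ hτ s hs (single ω' y) = (s y : ℚ) • single ω (τ y) := by
  rw [← ofFinsupp_single, relabel_ofFinsupp (c := s y), Finsupp.mapDomain_single, ofFinsupp_single]
  intro y' h
  rw [(Finsupp.single_apply_ne_zero.1 h).1]

/-- Two bilinear operations that correspond to each other on the index sets are exchanged by the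
relabelling. -/
theorem relabel_bilin {b : X → X → (X →₀ ℚ)}
    {hb : ∀ x y, b x y ∈ Finsupp.supported ℚ ℚ {z | ω z = ω x + ω y}} {b' : Y → Y → (Y →₀ ℚ)}
    {hb' : ∀ x y, b' x y ∈ Finsupp.supported ℚ ℚ {z | ω' z = ω' x + ω' y}}
    (h : ∀ x y, b (τ x) (τ y) = (b' x y).mapDomain τ)
    (hsign : ∀ x y z, b' x y z ≠ 0 → s z = s x * s y) (f g : Nov ω') :
    relabel τ hτ s hs (bilin b' hb' f g) =
      bilin b hb (relabel τ hτ s hs f) (relabel τ hτ s hs g) := by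
  set T : Nov ω' →ₗ[ℚ] Nov ω := (relabel τ hτ s hs).toLinearMap
  have hT : Bounded T := .of_filtered fun N f => relabel_supportedFrom.1
  have h1 : ∀ x, T ∘ₗ bilin b' hb' (single ω' x) = bilin b hb (T (single ω' x)) ∘ₗ T := fun x =>
    Bounded.ext (hT.comp (.bilin_left _)) (.comp (.bilin_left _) hT) fun y => by
      change relabel τ hτ s hs (bilin b' hb' (single ω' x) (single ω' y)) =
        bilin b hb (relabel τ hτ s hs (single ω' x)) (relabel τ hτ s hs (single ω' y))
      rw [bilin_single, relabel_ofFinsupp (hsign x y), relabel_single, relabel_single, map_smul,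
        map_smul, LinearMap.smul_apply, smul_smul, bilin_single, h, Int.cast_mul, mul_comm]
  have h2 : T ∘ₗ (bilin b' hb').flip g = (bilin b hb).flip (T g) ∘ₗ T :=
    Bounded.ext (hT.comp (.bilin_right _)) (.comp (.bilin_right _) hT) fun x =>
      LinearMap.congr_fun (h1 x) g
  exact LinearMap.congr_fun h2 f

theorem ofFinsupp_supportedFrom {u : X →₀ ℚ} {c : ℤ} (hu : u ∈ Finsupp.supported ℚ ℚ {z | ω z = c}) :
    SupportedFrom ω c (ofFinsupp ω u).1 := fun _ hx =>
  le_of_eq (Eq.symm (hu (Finsupp.mem_support_iff.2 hx)))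

/-- The pairs with sum less than `K`, sorted by their sums. -/
theorem sum_range_antidiagonal {M : Type*} [AddCommMonoid M] (f : ℕ × ℕ → M) (K : ℕ) :
    ∑ N ∈ Finset.range K, ∑ p ∈ Finset.HasAntidiagonal.antidiagonal N, f p =
      ∑ p ∈ Finset.range K ×ˢ Finset.range K with p.1 + p.2 < K, f p := by
  rw [Finset.sum_sigma']
  refine Finset.sum_nbij' (fun x => x.2) (fun p => ⟨p.1 + p.2, p⟩) ?_ ?_ ?_ ?_ ?_
  · rintro ⟨N, p⟩ h
    simp only [Finset.mem_sigma, Finset.mem_range, Finset.HasAntidiagonal.mem_antidiagonal] at h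
    simp only [Finset.mem_filter, Finset.mem_product, Finset.mem_range]
    omega
  · rintro p h
    simp only [Finset.mem_filter, Finset.mem_product, Finset.mem_range] at h
    simp only [Finset.mem_sigma, Finset.mem_range, Finset.HasAntidiagonal.mem_antidiagonal, and_true]
    exact h.2
  · rintro ⟨N, p⟩ h
    simp only [Finset.mem_sigma, Finset.mem_range, Finset.HasAntidiagonal.mem_antidiagonal] at h
    obtain ⟨-, rfl⟩ := h
    rfl
  · intros; rfl
  · intros; rfl

/-- Suppose that `a x` is the sum of the series with terms `A N x`, where `A N` increases weights by
`N m`. If the family `A` respects a bilinear operation, then so does the extension of `a`. -/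
theorem extend_bilin_of_graded {a : X → Nov ω} {ha : ∀ x, SupportedFrom ω (ω x) (a x).1}
    {A : ℕ → (X →₀ ℚ) →ₗ[ℚ] (X →₀ ℚ)} {m : ℤ} (hm : 0 < m)
    (hA : ∀ x (N : ℕ), A N (Finsupp.single x 1) ∈ Finsupp.supported ℚ ℚ {z | ω z = ω x + N * m})
    (haA : ∀ x (K : ℕ), SupportedFrom ω (ω x + K * m)
      (a x - ofFinsupp ω (∑ N ∈ Finset.range K, A N (Finsupp.single x 1))).1)
    {b : X → X → (X →₀ ℚ)} {hb : ∀ x y, b x y ∈ Finsupp.supported ℚ ℚ {z | ω z = ω x + ω y}}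
    (hAb : ∀ x y N, ∑ p ∈ Finset.HasAntidiagonal.antidiagonal N,
      bilinearExt b (A p.1 x) (A p.2 y) = A N (bilinearExt b x y)) (f g : Nov ω) :
    extend a ha (bilin b hb f g) = bilin b hb (extend a ha f) (extend a ha g) := by
  classical
  set T := extend a ha
  have hT : Bounded T := .extend
  have hext : ∀ (c : ℤ) (K : ℕ) (u : X →₀ ℚ), u ∈ Finsupp.supported ℚ ℚ {z | ω z = c} →
      SupportedFrom ω (c + K * m)
        (T (ofFinsupp ω u) - ofFinsupp ω (∑ N ∈ Finset.range K, A N u)).1 := by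
    intro c K u hu
    rw [Finsupp.supported_eq_span_single] at hu
    induction hu using Submodule.span_induction with
    | zero => simpa using SupportedFrom.zero _
    | add x y _ _ hx hy =>
      convert hx.add hy using 1
      simp only [map_add, Finset.sum_add_distrib, Submodule.coe_sub, Submodule.coe_add]
      abel
    | smul r x _ hx =>
      have h : T (ofFinsupp ω (r • x)) - ofFinsupp ω (∑ N ∈ Finset.range K, A N (r • x)) =
          r • (T (ofFinsupp ω x) - ofFinsupp ω (∑ N ∈ Finset.range K, A N x)) := by
        simp only [map_smul, ← Finset.smul_sum, smul_sub]
      rw [h]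
      exact fun z hz => hx z (right_ne_zero_of_mul hz)
    | mem x hx =>
      obtain ⟨x, hx, rfl⟩ := hx
      rw [ofFinsupp_single, extend_single]
      exact hx ▸ haA x K
  -- On the index set, both sides agree up to terms of weight at least `ω x + ω y + K * m`, for every `K`.
  have key : ∀ x y, T (bilin b hb (single ω x) (single ω y)) =
      bilin b hb (T (single ω x)) (T (single ω y)) := by
    intro x y
    rw [← sub_eq_zero]
    refine Subtype.ext (eq_zero_of_supportedFrom (ω := ω) fun N => ?_)
    obtain ⟨K, hK⟩ : ∃ K : ℕ, N ≤ ω x + ω y + K * m := by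
      refine ⟨(N - ω x - ω y).toNat, ?_⟩
      have h1 : N - ω x - ω y ≤ ((N - ω x - ω y).toNat : ℤ) := Int.self_le_toNat _
      have h2 : ((N - ω x - ω y).toNat : ℤ) * 1 ≤ (N - ω x - ω y).toNat * m :=
        mul_le_mul_of_nonneg_left hm (Int.natCast_nonneg _)
      linarith
    refine SupportedFrom.mono ?_ hK
    rw [bilin_single, extend_single, extend_single]
    set α : ℕ → X → Nov ω := fun N x => ofFinsupp ω (A N (Finsupp.single x 1))
    set S : X → Nov ω := fun x => ∑ N ∈ Finset.range K, α N x with hS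
    have hα : ∀ (N : ℕ) x, SupportedFrom ω (ω x + N * m) (α N x).1 := fun N x =>
      ofFinsupp_supportedFrom (hA x N)
    have haS : ∀ x, SupportedFrom ω (ω x + K * m) (a x - S x).1 := fun x => by
      have := haA x K
      rwa [map_sum] at this
    have hSx : ∀ x, SupportedFrom ω (ω x) (S x).1 := fun x => by
      have h : S x = a x - (a x - S x) := by abel
      rw [h]
      refine (ha x).sub ((haS x).mono ?_)
      have : 0 ≤ (K : ℤ) * m := by positivity
      omega
    have h1 := hext _ K _ (hb x y)
    have h2 : SupportedFrom ω (ω x + ω y + K * m)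
        (bilin b hb (a x) (a y) - bilin b hb (S x) (S y)).1 := by
      have h : bilin b hb (a x) (a y) - bilin b hb (S x) (S y) =
          bilin b hb (a x) (a y - S y) + bilin b hb (a x - S x) (S y) := by
        simp only [map_sub, LinearMap.sub_apply]
        abel
      rw [h]
      refine SupportedFrom.add ?_ ?_
      · exact (bilin_supportedFrom (ha x) (haS y)).mono (by omega)
      · exact (bilin_supportedFrom (haS x) (hSx y)).mono (by omega)
    have h3 : SupportedFrom ω (ω x + ω y + K * m) (bilin b hb (S x) (S y) -
        ofFinsupp ω (∑ N ∈ Finset.range K, A N (b x y))).1 := by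
      have e1 : bilin b hb (S x) (S y) =
          ∑ p ∈ Finset.range K ×ˢ Finset.range K, bilin b hb (α p.1 x) (α p.2 y) := by
        simp only [hS, map_sum, LinearMap.sum_apply, Finset.sum_product]
        exact Finset.sum_comm
      have e2 : ofFinsupp ω (∑ N ∈ Finset.range K, A N (b x y)) =
          ∑ p ∈ Finset.range K ×ˢ Finset.range K with p.1 + p.2 < K,
            bilin b hb (α p.1 x) (α p.2 y) := by
        rw [← sum_range_antidiagonal, map_sum]
        refine Finset.sum_congr rfl fun N _ => ?_
        rw [← bilinearExt_single b x y, ← hAb, map_sum]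
        exact Finset.sum_congr rfl fun p _ => (bilin_ofFinsupp _ _).symm
      rw [e1, e2, ← Finset.sum_filter_add_sum_filter_not _ (fun p : ℕ × ℕ => p.1 + p.2 < K),
        add_sub_cancel_left, AddSubmonoidClass.coe_finsetSum]
      refine SupportedFrom.sum fun p hp => ?_
      have hp' := (Finset.mem_filter.1 hp).2
      refine (bilin_supportedFrom (hα p.1 x) (hα p.2 y)).mono ?_
      have : (K : ℤ) * m ≤ (p.1 + p.2) * m :=
        mul_le_mul_of_nonneg_right (by push Not at hp'; exact_mod_cast hp') hm.le
      linarith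
    have h4 := (h1.sub h2).sub h3
    convert h4 using 1
    simp only [Submodule.coe_sub]
    abel
  have h1 : ∀ x, T ∘ₗ bilin b hb (single ω x) = bilin b hb (T (single ω x)) ∘ₗ T := fun x =>
    Bounded.ext (hT.comp (.bilin_left _)) (.comp (.bilin_left _) hT) (key x)
  have h2 : T ∘ₗ (bilin b hb).flip g = (bilin b hb).flip (T g) ∘ₗ T :=
    Bounded.ext (hT.comp (.bilin_right _)) (.comp (.bilin_right _) hT) fun x =>
      LinearMap.congr_fun (h1 x) g
  exact LinearMap.congr_fun h2 f

end Nov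

end Novikov

/-! ### The isomorphism of Lie algebras -/

namespace TwoByTwoMove

open BipartiteGraph

variable {W B B' E E' R : Type*} {Γ : BipartiteRibbonGraph W B E}
  {Γ' : BipartiteRibbonGraph W B' E'} (m : TwoByTwoMove R Γ Γ')

theorem flowSum_sub_supported [Finite E] {w : E → ℤ} (hw : 0 < m.squareWeight w) (ℓ : Γ.L) (K : ℕ) :
    SupportedFrom (Γ.wt w) (Γ.wt w ℓ + K * m.squareWeight w) (m.flowSum w ℓ -
      ((∑ N ∈ Finset.range K, expFlow m.flow N (Finsupp.single ℓ 1) : Γ.L →₀ ℚ) : Γ.L → ℚ)) := by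
  intro z hz
  by_contra hlt
  refine hz ?_
  have hne : ∀ N : ℕ, expFlow m.flow N (Finsupp.single ℓ 1) z ≠ 0 →
      Γ.wt w z = Γ.wt w ℓ + N * m.squareWeight w := fun N h =>
    m.expFlow_supported w ℓ N (Finsupp.mem_support_iff.2 h)
  rw [Pi.sub_apply, sub_eq_zero, Finsupp.finsetSum_apply, flowSum]
  by_cases hK : m.flowIndex w ℓ z < K
  · refine (Finset.sum_eq_single_of_mem (f := fun N => expFlow m.flow N (Finsupp.single ℓ 1) z) _
      (Finset.mem_range.2 hK) fun N _ hN => ?_).symm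
    by_contra h
    exact hN (m.flowIndex_eq hw (hne N h)).symm
  · have h0 : ∑ N ∈ Finset.range K, expFlow m.flow N (Finsupp.single ℓ 1) z = 0 := by
      refine Finset.sum_eq_zero fun N hN => ?_
      by_contra h
      have := m.flowIndex_eq hw (hne N h)
      have := Finset.mem_range.1 hN
      omega
    rw [h0]
    by_contra h
    have h1 := hne _ h
    have h2 : (K : ℤ) * m.squareWeight w ≤ m.flowIndex w ℓ z * m.squareWeight w :=
      mul_le_mul_of_nonneg_right (by exact_mod_cast not_lt.1 hK) hw.le
    omega

theorem flowSum_supportedFrom [Finite E] {w : E → ℤ} (hw : 0 < m.squareWeight w) (ℓ : Γ.L) :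
    SupportedFrom (Γ.wt w) (Γ.wt w ℓ) (m.flowSum w ℓ) := by
  simpa using m.flowSum_sub_supported hw ℓ 0

theorem isNovikov_flowSum [Finite E] {w : E → ℤ} (hw : 0 < m.squareWeight w) (ℓ : Γ.L) :
    IsNovikov (Γ.wt w) (m.flowSum w ℓ) := by
  intro N
  set K := (N + 1 - Γ.wt w ℓ).toNat
  refine (Finsupp.hasFiniteSupport
    (∑ N ∈ Finset.range K, expFlow m.flow N (Finsupp.single ℓ 1))).subset ?_
  rintro z ⟨hz, hN⟩
  by_contra h
  have h1 := m.flowSum_sub_supported hw ℓ K z (by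
    rw [Pi.sub_apply, Function.notMem_support.1 h, sub_zero]
    exact hz)
  have h2 : (K : ℤ) * 1 ≤ K * m.squareWeight w :=
    mul_le_mul_of_nonneg_left hw (Int.natCast_nonneg _)
  omega

theorem pull_integral [Finite E] (γ : List (Dart E')) : HasIntegralCoeffs (m.pull γ) := fun ℓ =>
  exists_int_finsum fun n => by
    have : ∀ l : List (Dart E), ∃ k : ℤ, Γ.toBipartiteGraph.loopTerm l ℓ = k := by
      classical
      intro l
      unfold loopTerm
      split_ifs
      · rw [Finsupp.single_apply]
        split_ifs
        · exact ⟨1, by simp⟩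
        · exact ⟨0, by simp⟩
      · exact ⟨0, by simp⟩
    obtain ⟨k, hk⟩ := this (List.ofFn fun i =>
      (m.transport (m.edge'.symm (γ.get i).1) (γ.get i).2 (n i)).2).flatten
    exact ⟨(∏ i, (m.transport (m.edge'.symm (γ.get i).1) (γ.get i).2 (n i)).1) * k, by
      rw [hk]; push_cast; rfl⟩

theorem flowSum_integral [Finite E] [Finite E'] {w : E → ℤ} (hw : 0 < m.squareWeight w) (ℓ : Γ.L) :
    HasIntegralCoeffs (m.flowSum w ℓ) := by
  intro z
  obtain ⟨ℓ', rfl⟩ := m.leadingEquiv.surjective ℓ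
  induction ℓ' using Quot.ind with | _ γ
  obtain ⟨n, hn⟩ := m.pull_integral γ.1 z
  refine ⟨m.sign γ.toLoop * n, ?_⟩
  rw [Int.cast_mul, ← hn, m.pull_eq hw γ, ← mul_assoc, ← Int.cast_mul, sign_mul_self, Int.cast_one,
    one_mul]
  rfl

/-- The automorphism of the space of formal sums given by the exponential of the Hamiltonian flow. -/
def flowMap [Finite E] {w : E → ℤ} (hw : 0 < m.squareWeight w) :
    Nov (Γ.wt w) →ₗ[ℚ] Nov (Γ.wt w) :=
  Nov.extend (fun ℓ => ⟨m.flowSum w ℓ, m.isNovikov_flowSum hw ℓ⟩) (m.flowSum_supportedFrom hw)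

theorem flowMap_unipotent [Finite E] {w : E → ℤ} (hw : 0 < m.squareWeight w) (N : ℤ)
    (f : Nov (Γ.wt w)) (hf : SupportedFrom (Γ.wt w) N f.1) :
    SupportedFrom (Γ.wt w) (N + 1) (m.flowMap hw f - f).1 := by
  have hd : ∀ ℓ, SupportedFrom (Γ.wt w) (Γ.wt w ℓ + 1)
      ((⟨m.flowSum w ℓ, m.isNovikov_flowSum hw ℓ⟩ : Nov (Γ.wt w)) - Nov.single _ ℓ).1 := fun ℓ => by
    have := m.flowSum_sub_supported hw ℓ 1
    rw [Finset.sum_range_one, expFlow_zero] at this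
    rw [← Nov.ofFinsupp_single]
    exact this.mono (by push_cast; omega)
  have h1 : m.flowMap hw = LinearMap.id + Nov.extend (ω := Γ.wt w) (fun ℓ =>
      (⟨m.flowSum w ℓ, m.isNovikov_flowSum hw ℓ⟩ : Nov (Γ.wt w)) - Nov.single _ ℓ)
      (fun ℓ => (hd ℓ).mono (by omega)) :=
    Nov.Bounded.ext .extend (.add .id .extend) fun ℓ => by
      rw [LinearMap.add_apply, Nov.extend_single, flowMap, Nov.extend_single, LinearMap.id_apply]
      abel
  have h2 : m.flowMap hw f - f = Nov.extend (ω := Γ.wt w) (fun ℓ =>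
      (⟨m.flowSum w ℓ, m.isNovikov_flowSum hw ℓ⟩ : Nov (Γ.wt w)) - Nov.single _ ℓ)
      (fun ℓ => (hd ℓ).mono (by omega)) f := by
    rw [h1, LinearMap.add_apply, LinearMap.id_apply, add_sub_cancel_left]
  rw [h2]
  intro z hz
  obtain ⟨x, hx⟩ := exists_ne_zero_of_finsum_ne_zero' hz
  have h3 := hf x (left_ne_zero_of_mul hx)
  have h4 := hd x z (right_ne_zero_of_mul hx)
  omega

theorem flowMap_supportedFrom [Finite E] {w : E → ℤ} (hw : 0 < m.squareWeight w) {N : ℤ}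
    {f : Nov (Γ.wt w)} (hf : SupportedFrom (Γ.wt w) N f.1) :
    SupportedFrom (Γ.wt w) N (m.flowMap hw f).1 := Nov.extend_supportedFrom hf

theorem flowMap_integral [Finite E] [Finite E'] (m : TwoByTwoMove R Γ Γ') {w : E → ℤ}
    (hw : 0 < m.squareWeight w) {f : Nov (Γ.wt w)} (hf : HasIntegralCoeffs f.1) :
    HasIntegralCoeffs (m.flowMap hw f).1 := Nov.extend_integral (m.flowSum_integral hw) hf

theorem flowMap_hatBilin [Finite E] {w : E → ℤ} (hw : 0 < m.squareWeight w) (f g : Nov (Γ.wt w)) :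
    m.flowMap hw (Γ.hatBilin w f g) = Γ.hatBilin w (m.flowMap hw f) (m.flowMap hw g) :=
  Nov.extend_bilin_of_graded (A := expFlow m.flow) hw (m.expFlow_supported w)
    (m.flowSum_sub_supported hw) (sum_expFlow Γ.linBracket m.flow m.flow_linBracket) f g

/-- The isomorphism `L̂(Γ') → L̂(Γ)` inverse to `μ`: the leading part of the transport, followed by
the exponential of the Hamiltonian flow. -/
def pullEquiv [Finite E] [Finite E'] {w : E → ℤ} {w' : E' → ℤ} (hw : 0 < m.squareWeight w)
    (h : m.Compatible w w') : Nov (Γ'.wt w') ≃ₗ[ℚ] Nov (Γ.wt w) :=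
  (Nov.relabel m.leadingEquiv (h.wt_leadingEquiv) m.sign m.sign_mul_self).trans
    (LinearEquiv.ofBijective (m.flowMap hw)
      ⟨Nov.injective_of_unipotent (m.flowMap_unipotent hw), fun g => by
        obtain ⟨A, hA⟩ := g.2.exists_le
        obtain ⟨f, hf, -⟩ := Nov.exists_preimage (m.flowMap_unipotent hw)
          (fun _ => m.flowMap_integral hw) hA
        exact ⟨f, hf⟩⟩)

variable [Finite E] [Finite E'] {w : E → ℤ} {w' : E' → ℤ} (hw : 0 < m.squareWeight w)
    (h : m.Compatible w w')

theorem pullEquiv_apply (f : Nov (Γ'.wt w')) : m.pullEquiv hw h f = m.flowMap hw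
    (Nov.relabel m.leadingEquiv (h.wt_leadingEquiv) m.sign m.sign_mul_self f) := rfl

theorem pullEquiv_supportedFrom (N : ℤ) (f : Nov (Γ'.wt w')) :
    SupportedFrom (Γ.wt w) N (m.pullEquiv hw h f).1 ↔ SupportedFrom (Γ'.wt w') N f.1 := by
  rw [Nov.relabel_supportedFrom (hτ := h.wt_leadingEquiv) (hs := m.sign_mul_self), pullEquiv_apply]
  refine ⟨fun hf => ?_, m.flowMap_supportedFrom hw⟩
  obtain ⟨g, hg, hgs, -⟩ := Nov.exists_preimage (m.flowMap_unipotent hw)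
    (fun _ => m.flowMap_integral hw) hf
  rwa [Nov.injective_of_unipotent (m.flowMap_unipotent hw) hg] at hgs

theorem pullEquiv_integral (f : Nov (Γ'.wt w')) :
    HasIntegralCoeffs (m.pullEquiv hw h f).1 ↔ HasIntegralCoeffs f.1 := by
  rw [Nov.relabel_integral (hτ := h.wt_leadingEquiv) (hs := m.sign_mul_self), pullEquiv_apply]
  refine ⟨fun hf => ?_, m.flowMap_integral hw⟩
  obtain ⟨A, hA⟩ := (m.flowMap hw (Nov.relabel m.leadingEquiv (h.wt_leadingEquiv) m.sign
    m.sign_mul_self f)).2.exists_le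
  obtain ⟨g, hg, -, hgi⟩ := Nov.exists_preimage (m.flowMap_unipotent hw)
    (fun _ => m.flowMap_integral hw) hA
  have := hgi hf
  rwa [Nov.injective_of_unipotent (m.flowMap_unipotent hw) hg] at this

theorem pullEquiv_hatBilin (f g : Nov (Γ'.wt w')) : m.pullEquiv hw h (Γ'.hatBilin w' f g) =
    Γ.hatBilin w (m.pullEquiv hw h f) (m.pullEquiv hw h g) := by
  have := Nov.relabel_bilin (hτ := h.wt_leadingEquiv) (hs := m.sign_mul_self)
    (hb := Γ.conj.goldman_supported w) (hb' := Γ'.conj.goldman_supported w') m.bracket_leading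
    (fun x y z => m.sign_of_mem_bracket) f g
  exact (congrArg (m.flowMap hw) this).trans (m.flowMap_hatBilin hw _ _)

theorem pullEquiv_single (γ : Γ'.toBipartiteGraph.ClosedWalk) :
    (m.pullEquiv hw h (Nov.single _ γ.toLoop)).1 = m.pull γ.1 := by
  rw [pullEquiv_apply, Nov.relabel_single, map_smul, flowMap, Nov.extend_single, m.pull_eq hw γ]
  rfl

end TwoByTwoMove

/-! ### The Poisson algebra of polynomials in loops -/

namespace BipartiteRibbonGraph

open BipartiteGraph MvPolynomial

section Polynomials

variable {W B E : Type*} [Finite E] (Γ : BipartiteRibbonGraph W B E)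

/-- The Poisson bracket on polynomials in loops: the biderivation which extends the bracket on
loops. -/
def polyBracket : MvPolynomial Γ.L ℚ →ₗ[ℚ] MvPolynomial Γ.L ℚ →ₗ[ℚ] MvPolynomial Γ.L ℚ :=
  LinearMap.mk₂ ℚ (fun p q => mkDerivation ℚ (fun a =>
      mkDerivation ℚ (fun b => Finsupp.linearCombination ℚ X (Γ.bracket a b)) q) p)
    (fun _ _ _ => map_add _ _ _) (fun r p _ => Derivation.map_smul _ r p)
    (fun p q q' => by
      rw [← Derivation.add_apply]
      refine congrArg (fun D : Derivation ℚ (MvPolynomial Γ.L ℚ) (MvPolynomial Γ.L ℚ) => D p)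
        (derivation_ext fun a => ?_)
      rw [Derivation.add_apply, mkDerivation_X, mkDerivation_X, mkDerivation_X, map_add])
    (fun r p q => by
      rw [← Derivation.smul_apply]
      refine congrArg (fun D : Derivation ℚ (MvPolynomial Γ.L ℚ) (MvPolynomial Γ.L ℚ) => D p)
        (derivation_ext fun a => ?_)
      rw [Derivation.smul_apply, mkDerivation_X, mkDerivation_X, Derivation.map_smul])

theorem polyBracket_apply (p q : MvPolynomial Γ.L ℚ) : Γ.polyBracket p q = mkDerivation ℚ (fun a =>
      mkDerivation ℚ (fun b => Finsupp.linearCombination ℚ X (Γ.bracket a b)) q) p := rfl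

theorem polyBracket_X_X (a b : Γ.L) :
    Γ.polyBracket (X a) (X b) = Finsupp.linearCombination ℚ X (Γ.bracket a b) := by
  rw [polyBracket_apply, mkDerivation_X, mkDerivation_X]

theorem polyBracket_mul_left (p p' q : MvPolynomial Γ.L ℚ) :
    Γ.polyBracket (p * p') q = p * Γ.polyBracket p' q + p' * Γ.polyBracket p q :=
  by simp only [polyBracket_apply, Derivation.leibniz, smul_eq_mul]

theorem polyBracket_C_left (r : ℚ) (q : MvPolynomial Γ.L ℚ) : Γ.polyBracket (C r) q = 0 := by
  rw [polyBracket_apply, derivation_C]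

theorem polyBracket_mul_right (p q q' : MvPolynomial Γ.L ℚ) :
    Γ.polyBracket p (q * q') = q * Γ.polyBracket p q' + q' * Γ.polyBracket p q := by
  have h : mkDerivation ℚ (fun a => mkDerivation ℚ (fun b =>
      Finsupp.linearCombination ℚ X (Γ.bracket a b)) (q * q')) =
      q • mkDerivation ℚ (fun a => mkDerivation ℚ (fun b =>
        Finsupp.linearCombination ℚ X (Γ.bracket a b)) q') +
      q' • mkDerivation ℚ (fun a => mkDerivation ℚ (fun b =>
        Finsupp.linearCombination ℚ (X : Γ.L → MvPolynomial Γ.L ℚ) (Γ.bracket a b)) q) :=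
    derivation_ext fun a => by
      rw [Derivation.add_apply, Derivation.smul_apply, Derivation.smul_apply, mkDerivation_X,
        mkDerivation_X, mkDerivation_X, Derivation.leibniz]
  exact congrArg (fun D : Derivation ℚ (MvPolynomial Γ.L ℚ) (MvPolynomial Γ.L ℚ) => D p) h

theorem polyBracket_C_right (p : MvPolynomial Γ.L ℚ) (r : ℚ) : Γ.polyBracket p (C r) = 0 := by
  rw [polyBracket_apply]
  have h : mkDerivation ℚ (fun a => mkDerivation ℚ (fun b =>
      Finsupp.linearCombination ℚ (X : Γ.L → MvPolynomial Γ.L ℚ) (Γ.bracket a b)) (C r)) = 0 :=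
    derivation_ext fun a => by rw [mkDerivation_X, derivation_C, Derivation.zero_apply]
  rw [h, Derivation.zero_apply]

theorem polyBracket_skew (p q : MvPolynomial Γ.L ℚ) : Γ.polyBracket q p = - Γ.polyBracket p q := by
  have hX : ∀ a, Γ.polyBracket q (X a) = - Γ.polyBracket (X a) q := by
    intro a
    induction q using MvPolynomial.induction_on with
    | C r => rw [polyBracket_C_left, polyBracket_C_right, neg_zero]
    | add p p' h h' => rw [map_add, map_add, LinearMap.add_apply, h, h', neg_add]
    | mul_X q b h =>
      have hb : Γ.polyBracket (X b) (X a) = - Γ.polyBracket (X a) (X b) := by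
        rw [polyBracket_X_X, polyBracket_X_X, ← map_neg]
        exact congrArg _ (Γ.conj.goldman_skew a b)
      rw [polyBracket_mul_left, polyBracket_mul_right, h, hb]
      ring
  induction p using MvPolynomial.induction_on with
  | C r => rw [polyBracket_C_left, polyBracket_C_right, neg_zero]
  | add p p' h h' => rw [map_add, map_add, LinearMap.add_apply, h, h', neg_add]
  | mul_X p a h =>
    rw [polyBracket_mul_left, polyBracket_mul_right, h, hX]
    ring

theorem polyBracket_linear (u v : Γ.L →₀ ℚ) :
    Γ.polyBracket (Finsupp.linearCombination ℚ X u) (Finsupp.linearCombination ℚ X v) =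
      Finsupp.linearCombination ℚ X (Γ.linBracket u v) := by
  induction u using Finsupp.induction_linear with
  | zero => simp
  | add u u' h h' => simp only [map_add, LinearMap.add_apply, h, h']
  | single x r =>
    have hx : Finsupp.single x r = r • Finsupp.single x 1 := by simp
    induction v using Finsupp.induction_linear with
    | zero => simp
    | add u u' h h' => simp only [map_add, h, h']
    | single y s =>
      have hy : Finsupp.single y s = s • Finsupp.single y 1 := by simp
      simp only [hx, hy, map_smul, LinearMap.smul_apply, linBracket, bilinearExt_single]
      rw [Finsupp.linearCombination_single, Finsupp.linearCombination_single, one_smul, one_smul,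
        polyBracket_X_X]

/-- The Jacobi identity on generators implies the identity for all polynomials, as the left-hand side
is a derivation in each argument. -/
theorem polyBracket_jacobi (p q r : MvPolynomial Γ.L ℚ) :
    Γ.polyBracket p (Γ.polyBracket q r) + Γ.polyBracket q (Γ.polyBracket r p) +
      Γ.polyBracket r (Γ.polyBracket p q) = 0 := by
  have key : ∀ q r, (∀ a, Γ.polyBracket (X a) (Γ.polyBracket q r) +
      Γ.polyBracket q (Γ.polyBracket r (X a)) + Γ.polyBracket r (Γ.polyBracket (X a) q) = 0) →
      ∀ p, Γ.polyBracket p (Γ.polyBracket q r) + Γ.polyBracket q (Γ.polyBracket r p) +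
        Γ.polyBracket r (Γ.polyBracket p q) = 0 := by
    intro q r h p
    induction p using MvPolynomial.induction_on with
    | C c => simp [polyBracket_C_left, polyBracket_C_right]
    | add p p' hp hp' =>
      simp only [map_add, LinearMap.add_apply]
      linear_combination hp + hp'
    | mul_X p a hp =>
      simp only [polyBracket_mul_left, polyBracket_mul_right, map_add]
      linear_combination p * h a + X a * hp +
        Γ.polyBracket r (X a) * Γ.polyBracket_skew p q + Γ.polyBracket r p * Γ.polyBracket_skew (X a) q
  have cyc : ∀ {a b c : MvPolynomial Γ.L ℚ}, a + b + c = 0 → b + c + a = 0 := fun h => by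
    rw [← h]; abel
  have h3 : ∀ a b c : Γ.L, Γ.polyBracket (X a) (Γ.polyBracket (X b) (X c)) +
      Γ.polyBracket (X b) (Γ.polyBracket (X c) (X a)) +
      Γ.polyBracket (X c) (Γ.polyBracket (X a) (X b)) = 0 := by
    intro a b c
    have hX : ∀ a : Γ.L, (X a : MvPolynomial Γ.L ℚ) =
        Finsupp.linearCombination ℚ X (Finsupp.single a (1 : ℚ)) := fun a => by
      rw [Finsupp.linearCombination_single, one_smul]
    rw [hX a, hX b, hX c]
    simp only [polyBracket_linear, ← map_add, linBracket_jacobi, map_zero]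
  exact key q r (fun a => cyc (cyc (key _ _ (fun b => cyc (cyc (key _ _ (fun c => h3 c a b) r))) q))) p

end Polynomials

end BipartiteRibbonGraph

/-! ### The completed Poisson algebra -/

namespace BipartiteRibbonGraph

open BipartiteGraph

section Completed

variable {W B E : Type*} (Γ : BipartiteRibbonGraph W B E) (w : E → ℤ)

/-- An element of the completed algebra as a formal sum of monomials. -/
def coeffs : Γ.OHat w ≃ₗ[ℚ] Nov (Γ.mwt w) where
  toFun f := ⟨fun m => MvPowerSeries.coeff m f.1, f.2⟩
  invFun g := ⟨fun m => g.1 m, g.2⟩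
  map_add' _ _ := rfl
  map_smul' _ _ := rfl
  left_inv _ := rfl
  right_inv _ := rfl

theorem monomial_mul_supported (m n : Γ.L →₀ ℕ) : Finsupp.single (m + n) (1 : ℚ) ∈
    Finsupp.supported ℚ ℚ {z | Γ.mwt w z = Γ.mwt w m + Γ.mwt w n} :=
  Finsupp.single_mem_supported ℚ _ (monWeight_add _ w m n)

theorem coeffs_mul (f g : Γ.OHat w) : Γ.coeffs w (f * g) =
    Nov.bilin (fun m n => Finsupp.single (m + n) 1) (Γ.monomial_mul_supported w)
      (Γ.coeffs w f) (Γ.coeffs w g) := by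
  classical
  refine Subtype.ext (funext fun k => ?_)
  change MvPowerSeries.coeff k (f.1 * g.1) = ∑ᶠ p : (Γ.L →₀ ℕ) × (Γ.L →₀ ℕ),
    MvPowerSeries.coeff p.1 f.1 * MvPowerSeries.coeff p.2 g.1 * Finsupp.single (p.1 + p.2) (1 : ℚ) k
  rw [MvPowerSeries.coeff_mul,
    finsum_eq_sum_of_support_subset (s := Finset.HasAntidiagonal.antidiagonal k)]
  · refine Finset.sum_congr rfl fun p hp => ?_
    rw [Finset.HasAntidiagonal.mem_antidiagonal.1 hp, Finsupp.single_eq_same, mul_one]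
  · intro p hp
    have h := (Finsupp.single_apply_ne_zero.1 (right_ne_zero_of_mul hp)).1
    exact Finset.mem_coe.2 (Finset.HasAntidiagonal.mem_antidiagonal.2 h.symm)

theorem mul_supportedFrom {M N : ℤ} {f g : Γ.OHat w}
    (hf : SupportedFrom (Γ.mwt w) M (Γ.coeffs w f).1)
    (hg : SupportedFrom (Γ.mwt w) N (Γ.coeffs w g).1) :
    SupportedFrom (Γ.mwt w) (M + N) (Γ.coeffs w (f * g)).1 := by
  rw [coeffs_mul]
  exact Nov.bilin_supportedFrom hf hg

theorem mul_integral {f g : Γ.OHat w} (hf : HasIntegralCoeffs (Γ.coeffs w f).1)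
    (hg : HasIntegralCoeffs (Γ.coeffs w g).1) : HasIntegralCoeffs (Γ.coeffs w (f * g)).1 := by
  classical
  rw [coeffs_mul]
  refine Nov.bilin_integral (fun m n k => ?_) hf hg
  rw [Finsupp.single_apply]
  split_ifs
  · exact ⟨1, by simp⟩
  · exact ⟨0, by simp⟩

/-- Polynomials in loops as elements of the completed algebra. -/
def ofPoly : MvPolynomial Γ.L ℚ →ₐ[ℚ] Γ.OHat w :=
  (MvPolynomial.coeToMvPowerSeries.algHom ℚ).codRestrict (Γ.OHat w) fun p =>
    IsNovikov.of_finite (p.support.finite_toSet.subset fun m hm => by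
      simpa [MvPolynomial.coeToMvPowerSeries.algHom_apply] using hm)

theorem coeffs_ofPoly_apply (p : MvPolynomial Γ.L ℚ) (m : Γ.L →₀ ℕ) :
    (Γ.coeffs w (Γ.ofPoly w p)).1 m = p.coeff m := by
  change MvPowerSeries.coeff m (MvPolynomial.coeToMvPowerSeries.algHom ℚ p) = _
  simp [MvPolynomial.coeToMvPowerSeries.algHom_apply]

theorem coeffs_ofPoly_monomial (m : Γ.L →₀ ℕ) :
    Γ.coeffs w (Γ.ofPoly w (MvPolynomial.monomial m 1)) = Nov.single _ m := by
  classical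
  refine Subtype.ext (funext fun n => ?_)
  rw [coeffs_ofPoly_apply, MvPolynomial.coeff_monomial, Nov.single_apply]
  simp only [eq_comm]

/-- The inclusion of the formal sums of loops as a linear map. -/
def linearIncl : Nov (Γ.wt w) →ₗ[ℚ] Γ.OHat w where
  toFun := Γ.linearPart w
  map_add' x y := by
    classical
    refine Subtype.ext (funext fun m => ?_)
    change (∑ ℓ ∈ m.support, if m = Finsupp.single ℓ 1 then x.1 ℓ + y.1 ℓ else 0) =
      (∑ ℓ ∈ m.support, if m = Finsupp.single ℓ 1 then x.1 ℓ else 0) +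
        ∑ ℓ ∈ m.support, if m = Finsupp.single ℓ 1 then y.1 ℓ else 0
    rw [← Finset.sum_add_distrib]
    refine Finset.sum_congr rfl fun ℓ _ => ?_
    split_ifs
    · rfl
    · rw [add_zero]
  map_smul' r x := by
    classical
    refine Subtype.ext (funext fun m => ?_)
    change (∑ ℓ ∈ m.support, if m = Finsupp.single ℓ 1 then r * x.1 ℓ else 0) =
      r * ∑ ℓ ∈ m.support, if m = Finsupp.single ℓ 1 then x.1 ℓ else 0
    rw [Finset.mul_sum]
    refine Finset.sum_congr rfl fun ℓ _ => ?_
    split_ifs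
    · rfl
    · rw [mul_zero]

theorem exists_of_coeff_linearIncl {x : Nov (Γ.wt w)} {m : Γ.L →₀ ℕ}
    (h : (Γ.coeffs w (Γ.linearIncl w x)).1 m ≠ 0) : ∃ ℓ, m = Finsupp.single ℓ 1 := by
  classical
  obtain ⟨ℓ, -, h⟩ := Finset.exists_ne_zero_of_sum_ne_zero h
  split_ifs at h with hm
  · exact ⟨ℓ, hm⟩
  · exact absurd rfl h

theorem coeff_linearIncl_single (x : Nov (Γ.wt w)) (ℓ : Γ.L) :
    (Γ.coeffs w (Γ.linearIncl w x)).1 (Finsupp.single ℓ 1) = x.1 ℓ := by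
  classical
  change (∑ ℓ' ∈ (Finsupp.single ℓ 1 : Γ.L →₀ ℕ).support,
    if (Finsupp.single ℓ 1 : Γ.L →₀ ℕ) = Finsupp.single ℓ' 1 then x.1 ℓ' else 0) = x.1 ℓ
  rw [show (Finsupp.single ℓ 1 : Γ.L →₀ ℕ).support = {ℓ} from Finsupp.support_single _ one_ne_zero,
    Finset.sum_singleton, if_pos rfl]

theorem linearIncl_supportedFrom {N : ℤ} {x : Nov (Γ.wt w)} (hx : SupportedFrom (Γ.wt w) N x.1) :
    SupportedFrom (Γ.mwt w) N (Γ.coeffs w (Γ.linearIncl w x)).1 := by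
  intro m hm
  obtain ⟨ℓ, rfl⟩ := Γ.exists_of_coeff_linearIncl w hm
  rw [coeff_linearIncl_single] at hm
  rw [mwt, monWeight_single]
  exact hx ℓ hm

theorem linearIncl_integral {x : Nov (Γ.wt w)} (hx : HasIntegralCoeffs x.1) :
    HasIntegralCoeffs (Γ.coeffs w (Γ.linearIncl w x)).1 := by
  intro m
  by_cases hm : (Γ.coeffs w (Γ.linearIncl w x)).1 m = 0
  · exact ⟨0, by rw [hm, Int.cast_zero]⟩
  · obtain ⟨ℓ, rfl⟩ := Γ.exists_of_coeff_linearIncl w hm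
    rw [coeff_linearIncl_single]
    exact hx ℓ

theorem linearIncl_ofFinsupp (u : Γ.L →₀ ℚ) : Γ.linearIncl w (Nov.ofFinsupp _ u) =
    Γ.ofPoly w (Finsupp.linearCombination ℚ MvPolynomial.X u) := by
  have : Γ.linearIncl w ∘ₗ Nov.ofFinsupp _ =
      (Γ.ofPoly w).toLinearMap ∘ₗ Finsupp.linearCombination ℚ MvPolynomial.X := by
    refine Finsupp.lhom_ext' fun ℓ => LinearMap.ext_ring ?_
    change Γ.linearIncl w (Nov.ofFinsupp _ (Finsupp.single ℓ 1)) =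
      Γ.ofPoly w (Finsupp.linearCombination ℚ MvPolynomial.X (Finsupp.single ℓ (1 : ℚ)))
    rw [Finsupp.linearCombination_single, one_smul, Nov.ofFinsupp_single]
    refine (Γ.coeffs w).injective ?_
    rw [MvPolynomial.X, coeffs_ofPoly_monomial]
    refine Subtype.ext (funext fun m => ?_)
    by_cases hm : ∃ ℓ', m = Finsupp.single ℓ' 1
    · obtain ⟨ℓ', rfl⟩ := hm
      classical
      rw [coeff_linearIncl_single, Nov.single_apply, Nov.single_apply]
      simp only [Finsupp.single_left_inj one_ne_zero]
    · classical
      have h0 : (Γ.coeffs w (Γ.linearIncl w (Nov.single _ ℓ))).1 m = 0 := by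
        by_contra h
        exact hm (Γ.exists_of_coeff_linearIncl w h)
      rw [h0, Nov.single_apply, if_neg fun h => hm ⟨ℓ, h⟩]
  exact LinearMap.congr_fun this u

theorem linearIncl_single (ℓ : Γ.L) :
    Γ.linearIncl w (Nov.single _ ℓ) = Γ.ofPoly w (MvPolynomial.X ℓ) := by
  rw [← Nov.ofFinsupp_single, linearIncl_ofFinsupp, Finsupp.linearCombination_single, one_smul]

end Completed

section Continuity

variable {W B E W' B' E' W'' B'' E'' : Type*} {Γ : BipartiteRibbonGraph W B E} {w : E → ℤ}
  {Γ' : BipartiteRibbonGraph W' B' E'} {w' : E' → ℤ} {Γ'' : BipartiteRibbonGraph W'' B'' E''}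
  {w'' : E'' → ℤ}

variable (Γ w) in
/-- A linear map between completed algebras that decreases weights at most by a constant. -/
def IsBounded (T : Γ.OHat w →ₗ[ℚ] Γ'.OHat w') : Prop :=
  Nov.Bounded ((Γ'.coeffs w').toLinearMap ∘ₗ T ∘ₗ (Γ.coeffs w).symm.toLinearMap)

theorem IsBounded.add {S T : Γ.OHat w →ₗ[ℚ] Γ'.OHat w'} (hS : IsBounded Γ w S)
    (hT : IsBounded Γ w T) : IsBounded Γ w (S + T) := by
  have := Nov.Bounded.add hS hT
  rwa [← LinearMap.comp_add, ← LinearMap.add_comp] at this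

theorem IsBounded.neg {T : Γ.OHat w →ₗ[ℚ] Γ'.OHat w'} (hT : IsBounded Γ w T) :
    IsBounded Γ w (-T) := by
  have := Nov.Bounded.neg hT
  rwa [← LinearMap.comp_neg, ← LinearMap.neg_comp] at this

theorem IsBounded.zero : IsBounded Γ w (0 : Γ.OHat w →ₗ[ℚ] Γ'.OHat w') :=
  Nov.Bounded.of_filtered fun N _ _ => SupportedFrom.zero N

theorem IsBounded.id : IsBounded Γ w (LinearMap.id : Γ.OHat w →ₗ[ℚ] Γ.OHat w) :=
  Nov.Bounded.of_filtered fun _ _ h => h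

theorem IsBounded.comp {S : Γ'.OHat w' →ₗ[ℚ] Γ''.OHat w''} {T : Γ.OHat w →ₗ[ℚ] Γ'.OHat w'}
    (hS : IsBounded Γ' w' S) (hT : IsBounded Γ w T) : IsBounded Γ w (S ∘ₗ T) :=
  Nov.Bounded.comp (S := (Γ''.coeffs w'').toLinearMap ∘ₗ S ∘ₗ (Γ'.coeffs w').symm.toLinearMap)
    (T := (Γ'.coeffs w').toLinearMap ∘ₗ T ∘ₗ (Γ.coeffs w).symm.toLinearMap) hS hT

/-- The density of the polynomials in loops. -/
theorem IsBounded.eq_of_poly {S T : Γ.OHat w →ₗ[ℚ] Γ'.OHat w'} (hS : IsBounded Γ w S)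
    (hT : IsBounded Γ w T) (h : ∀ p, S (Γ.ofPoly w p) = T (Γ.ofPoly w p)) : S = T := by
  have := Nov.Bounded.ext hS hT fun m => by
    rw [← coeffs_ofPoly_monomial]
    exact congrArg (Γ'.coeffs w') (h _)
  refine LinearMap.ext fun f => (Γ'.coeffs w').injective ?_
  exact LinearMap.congr_fun this (Γ.coeffs w f)

theorem isBounded_mulLeft (f : Γ.OHat w) : IsBounded Γ w (LinearMap.mulLeft ℚ f) := by
  obtain ⟨A, hA⟩ := (Γ.coeffs w f).2.exists_le
  refine ⟨A, fun N g hg => ?_⟩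
  rw [add_comm]
  exact Γ.mul_supportedFrom w (g := (Γ.coeffs w).symm g) hA hg

theorem isBounded_mulRight (f : Γ.OHat w) : IsBounded Γ w (LinearMap.mulRight ℚ f) := by
  obtain ⟨A, hA⟩ := (Γ.coeffs w f).2.exists_le
  exact ⟨A, fun N g hg => Γ.mul_supportedFrom w (f := (Γ.coeffs w).symm g) hg hA⟩

variable [Finite E]

variable (Γ w) in
/-- The Poisson bracket as a bilinear map. -/
def poissonMap : Γ.OHat w →ₗ[ℚ] Γ.OHat w →ₗ[ℚ] Γ.OHat w :=
  ((Nov.bilin Γ.monBracket (Γ.monBracket_supported w)).compl₁₂ (Γ.coeffs w).toLinearMap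
    (Γ.coeffs w).toLinearMap).compr₂ (Γ.coeffs w).symm.toLinearMap

theorem isBounded_poisson_left (f : Γ.OHat w) : IsBounded Γ w (Γ.poissonMap w f) :=
  Nov.Bounded.bilin_left (hb := Γ.monBracket_supported w) (Γ.coeffs w f)

theorem isBounded_poisson_right (f : Γ.OHat w) : IsBounded Γ w ((Γ.poissonMap w).flip f) :=
  Nov.Bounded.bilin_right (hb := Γ.monBracket_supported w) (Γ.coeffs w f)

theorem poissonMap_ofPoly (p q : MvPolynomial Γ.L ℚ) :
    Γ.poissonMap w (Γ.ofPoly w p) (Γ.ofPoly w q) = Γ.ofPoly w (Γ.polyBracket p q) := by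
  classical
  have hmon : ∀ m n : Γ.L →₀ ℕ, Γ.poissonMap w (Γ.ofPoly w (MvPolynomial.monomial m 1))
      (Γ.ofPoly w (MvPolynomial.monomial n 1)) =
      Γ.ofPoly w (Γ.polyBracket (MvPolynomial.monomial m 1) (MvPolynomial.monomial n 1)) := by
    intro m n
    have hmap : ∀ (k : Γ.L →₀ ℕ) (u : Γ.L →₀ ℚ),
        Nov.ofFinsupp (Γ.mwt w) (u.mapDomain fun ℓ => k + Finsupp.single ℓ 1) =
          Γ.coeffs w (Γ.ofPoly w (MvPolynomial.monomial k 1 *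
            Finsupp.linearCombination ℚ MvPolynomial.X u)) := by
      intro k u
      induction u using Finsupp.induction_linear with
      | zero => simp
      | add u v hu hv => rw [Finsupp.mapDomain_add, map_add, hu, hv, map_add, mul_add, map_add, map_add]
      | single ℓ r =>
        have hr : Finsupp.single ℓ r = r • Finsupp.single ℓ 1 := by simp
        rw [hr, Finsupp.mapDomain_smul, map_smul, map_smul, mul_smul_comm, map_smul, map_smul,
          Finsupp.mapDomain_single, Nov.ofFinsupp_single, Finsupp.linearCombination_single, one_smul,
          MvPolynomial.X, MvPolynomial.monomial_mul, one_mul, coeffs_ofPoly_monomial]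
    refine (Γ.coeffs w).injective ?_
    change Nov.bilin Γ.monBracket (Γ.monBracket_supported w)
      (Γ.coeffs w (Γ.ofPoly w (MvPolynomial.monomial m 1)))
      (Γ.coeffs w (Γ.ofPoly w (MvPolynomial.monomial n 1))) = _
    rw [coeffs_ofPoly_monomial, coeffs_ofPoly_monomial, Nov.bilin_single, monBracket, map_sum,
      polyBracket_apply, MvPolynomial.mkDerivation_monomial, one_smul, Finsupp.sum, map_sum, map_sum]
    refine Finset.sum_congr rfl fun a _ => ?_
    rw [map_sum, MvPolynomial.mkDerivation_monomial, one_smul, Finsupp.sum, Finset.smul_sum, map_sum,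
      map_sum]
    refine Finset.sum_congr rfl fun b _ => ?_
    rw [map_smul, hmap, ← map_smul, ← map_smul]
    congr 2
    rw [smul_eq_mul, smul_eq_mul, ← mul_assoc, MvPolynomial.monomial_mul, ← smul_mul_assoc,
      MvPolynomial.smul_monomial, smul_eq_mul, mul_one]
  induction p using MvPolynomial.induction_on' with
  | add p p' h h' => simp only [map_add, LinearMap.add_apply, h, h']
  | monomial m r =>
    induction q using MvPolynomial.induction_on' with
    | add p p' h h' => simp only [map_add, h, h']
    | monomial n s =>
      have hs : ∀ (m : Γ.L →₀ ℕ) (r : ℚ), MvPolynomial.monomial m r =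
          r • MvPolynomial.monomial m (1 : ℚ) := fun m r => by
        rw [MvPolynomial.smul_monomial, smul_eq_mul, mul_one]
      rw [hs m, hs n]
      simp only [map_smul, LinearMap.smul_apply, hmon]

theorem poissonMap_skew (f g : Γ.OHat w) : Γ.poissonMap w g f = - Γ.poissonMap w f g := by
  have h1 : ∀ p, (Γ.poissonMap w).flip (Γ.ofPoly w p) = - Γ.poissonMap w (Γ.ofPoly w p) := fun p =>
    (isBounded_poisson_right _).eq_of_poly (isBounded_poisson_left _).neg fun q => by
      rw [LinearMap.flip_apply, LinearMap.neg_apply, poissonMap_ofPoly, poissonMap_ofPoly,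
        polyBracket_skew, map_neg]
  have h2 : Γ.poissonMap w g = - (Γ.poissonMap w).flip g :=
    (isBounded_poisson_left _).eq_of_poly (isBounded_poisson_right _).neg fun p => by
      rw [LinearMap.neg_apply, LinearMap.flip_apply]
      exact LinearMap.congr_fun (h1 p) g
  rw [h2, LinearMap.neg_apply, LinearMap.flip_apply]

theorem poissonMap_leibniz (f g h : Γ.OHat w) :
    Γ.poissonMap w f (g * h) = Γ.poissonMap w f g * h + g * Γ.poissonMap w f h := by
  have h1 : ∀ p q, Γ.poissonMap w (Γ.ofPoly w p) ∘ₗ LinearMap.mulLeft ℚ (Γ.ofPoly w q) =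
      LinearMap.mulLeft ℚ (Γ.poissonMap w (Γ.ofPoly w p) (Γ.ofPoly w q)) +
        LinearMap.mulLeft ℚ (Γ.ofPoly w q) ∘ₗ Γ.poissonMap w (Γ.ofPoly w p) := fun p q =>
    ((isBounded_poisson_left _).comp (isBounded_mulLeft _)).eq_of_poly
      ((isBounded_mulLeft _).add ((isBounded_mulLeft _).comp (isBounded_poisson_left _))) fun r => by
      simp only [LinearMap.comp_apply, LinearMap.add_apply, LinearMap.mulLeft_apply]
      rw [← map_mul, poissonMap_ofPoly, poissonMap_ofPoly, poissonMap_ofPoly, polyBracket_mul_right,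
        map_add, map_mul, map_mul]
      ring
  have h2 : ∀ p, Γ.poissonMap w (Γ.ofPoly w p) ∘ₗ LinearMap.mulRight ℚ h =
      LinearMap.mulRight ℚ h ∘ₗ Γ.poissonMap w (Γ.ofPoly w p) +
        LinearMap.mulRight ℚ (Γ.poissonMap w (Γ.ofPoly w p) h) := fun p =>
    ((isBounded_poisson_left _).comp (isBounded_mulRight _)).eq_of_poly
      (((isBounded_mulRight _).comp (isBounded_poisson_left _)).add (isBounded_mulRight _)) fun q =>
      LinearMap.congr_fun (h1 p q) h
  have h3 : (Γ.poissonMap w).flip (g * h) = LinearMap.mulRight ℚ h ∘ₗ (Γ.poissonMap w).flip g +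
      LinearMap.mulLeft ℚ g ∘ₗ (Γ.poissonMap w).flip h :=
    (isBounded_poisson_right _).eq_of_poly
      (((isBounded_mulRight _).comp (isBounded_poisson_right _)).add
        ((isBounded_mulLeft _).comp (isBounded_poisson_right _))) fun p =>
      LinearMap.congr_fun (h2 p) g
  exact LinearMap.congr_fun h3 f

theorem poissonMap_jacobi (f g h : Γ.OHat w) :
    Γ.poissonMap w f (Γ.poissonMap w g h) + Γ.poissonMap w g (Γ.poissonMap w h f) +
      Γ.poissonMap w h (Γ.poissonMap w f g) = 0 := by
  set β := Γ.poissonMap w with hβ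
  have key : ∀ f g, (∀ p, β f (β g (Γ.ofPoly w p)) + β g (β (Γ.ofPoly w p) f) +
      β (Γ.ofPoly w p) (β f g) = 0) → ∀ k, β f (β g k) + β g (β k f) + β k (β f g) = 0 := by
    intro f g h k
    have : β f ∘ₗ β g + β g ∘ₗ β.flip f + β.flip (β f g) = 0 :=
      ((((isBounded_poisson_left _).comp (isBounded_poisson_left _)).add
        ((isBounded_poisson_left _).comp (isBounded_poisson_right _))).add
        (isBounded_poisson_right _)).eq_of_poly .zero h
    exact LinearMap.congr_fun this k
  have cyc : ∀ {a b c : Γ.OHat w}, a + b + c = 0 → b + c + a = 0 := fun h => by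
    rw [← h]; abel
  refine key f g (fun x => cyc (key _ f (fun y => cyc (key _ _ (fun z => ?_) f)) g)) h
  simp only [hβ, poissonMap_ofPoly, ← map_add, polyBracket_jacobi, map_zero]

variable (Γ w) in
theorem isPoissonBracket_poisson : IsPoissonBracket (Γ.poisson w) :=
  { isLieBracket_of_bilinear (Γ.poissonMap w) poissonMap_skew poissonMap_jacobi with
    leibniz := poissonMap_leibniz }

theorem poissonMap_linearIncl (x y : Nov (Γ.wt w)) :
    Γ.poissonMap w (Γ.linearIncl w x) (Γ.linearIncl w y) = Γ.linearIncl w (Γ.hatBilin w x y) := by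
  set e := (Γ.coeffs w).toLinearMap
  set i := e ∘ₗ Γ.linearIncl w
  set P := Nov.bilin Γ.monBracket (Γ.monBracket_supported w)
  have hi : Nov.Bounded i := .of_filtered fun _ _ => Γ.linearIncl_supportedFrom w
  have h1 : ∀ a, P (i (Nov.single _ a)) ∘ₗ i = i ∘ₗ Γ.hatBilin w (Nov.single _ a) := fun a =>
    Nov.Bounded.ext (.comp (.bilin_left _) hi) (hi.comp (.bilin_left _)) fun b => by
      have h : Γ.poissonMap w (Γ.linearIncl w (Nov.single _ a)) (Γ.linearIncl w (Nov.single _ b)) =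
          Γ.linearIncl w (Γ.hatBilin w (Nov.single _ a) (Nov.single _ b)) := by
        have hb : Γ.hatBilin w (Nov.single _ a) (Nov.single _ b) =
            Nov.ofFinsupp _ (Γ.bracket a b) :=
          Nov.bilin_single (hb := Γ.conj.goldman_supported w) a b
        rw [hb, linearIncl_single, linearIncl_single, poissonMap_ofPoly, polyBracket_X_X,
          linearIncl_ofFinsupp]
      exact congrArg e h
  have h2 : P.flip (i y) ∘ₗ i = i ∘ₗ (Γ.hatBilin w).flip y :=
    Nov.Bounded.ext (.comp (.bilin_right _) hi) (hi.comp (.bilin_right _)) fun a =>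
      LinearMap.congr_fun (h1 a) y
  exact (Γ.coeffs w).injective (LinearMap.congr_fun h2 x)

end Continuity

end BipartiteRibbonGraph

/-! ### Functoriality of the completed algebra -/

namespace BipartiteRibbonGraph

open BipartiteGraph

variable {W B E W' B' E' : Type*} {Γ : BipartiteRibbonGraph W B E} {w : E → ℤ}
  {Γ' : BipartiteRibbonGraph W' B' E'} {w' : E' → ℤ}

/-- The homomorphism from polynomials in loops which is given on loops by a linear map. -/
def polyHom (μ : Nov (Γ.wt w) →ₗ[ℚ] Nov (Γ'.wt w')) : MvPolynomial Γ.L ℚ →ₐ[ℚ] Γ'.OHat w' :=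
  MvPolynomial.aeval fun ℓ => Γ'.linearIncl w' (μ (Nov.single _ ℓ))

variable {μ : Nov (Γ.wt w) →ₗ[ℚ] Nov (Γ'.wt w')}

/-- A property of elements that is inherited by products holds for the images of monomials if it holds
for the images of loops. -/
theorem polyHom_monomial_induction {P : (Γ.L →₀ ℕ) → Γ'.OHat w' → Prop} (h1 : P 0 1)
    (hmul : ∀ m n f g, P m f → P n g → P (m + n) (f * g))
    (hX : ∀ ℓ, P (Finsupp.single ℓ 1) (Γ'.linearIncl w' (μ (Nov.single _ ℓ)))) (m : Γ.L →₀ ℕ) :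
    P m (polyHom μ (MvPolynomial.monomial m 1)) := by
  have hadd : ∀ m n : Γ.L →₀ ℕ, MvPolynomial.monomial (m + n) (1 : ℚ) =
      MvPolynomial.monomial m 1 * MvPolynomial.monomial n 1 := fun m n => by
    rw [MvPolynomial.monomial_mul, one_mul]
  have h0 : P 0 (polyHom μ (MvPolynomial.monomial 0 1)) := by
    rw [MvPolynomial.monomial_zero', map_one, map_one]
    exact h1
  induction m using Finsupp.induction_linear with
  | zero => exact h0
  | add m n hm hn => rw [hadd, map_mul]; exact hmul _ _ _ _ hm hn
  | single ℓ k =>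
    induction k with
    | zero => rw [Finsupp.single_zero]; exact h0
    | succ k ih =>
      rw [Finsupp.single_add, hadd, map_mul]
      refine hmul _ _ _ _ ih ?_
      have : polyHom μ (MvPolynomial.monomial (Finsupp.single ℓ 1) 1) =
          Γ'.linearIncl w' (μ (Nov.single _ ℓ)) := MvPolynomial.aeval_X _ ℓ
      rw [this]
      exact hX ℓ

theorem one_supportedFrom : SupportedFrom (Γ.mwt w) 0 (Γ.coeffs w 1).1 := by
  rw [← map_one (Γ.ofPoly w), ← MvPolynomial.C_1, MvPolynomial.C_apply, coeffs_ofPoly_monomial]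
  have := Nov.single_supportedFrom (ω := Γ.mwt w) 0
  rwa [show Γ.mwt w 0 = 0 from Finsupp.sum_zero_index] at this

theorem one_integral : HasIntegralCoeffs (Γ.coeffs w 1).1 := by
  rw [← map_one (Γ.ofPoly w), ← MvPolynomial.C_1, MvPolynomial.C_apply, coeffs_ofPoly_monomial]
  exact Nov.single_integral 0

theorem polyHom_monomial_supportedFrom
    (hμ : ∀ N x, SupportedFrom (Γ.wt w) N x.1 → SupportedFrom (Γ'.wt w') N (μ x).1) (m : Γ.L →₀ ℕ) :
    SupportedFrom (Γ'.mwt w') (Γ.mwt w m)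
      (Γ'.coeffs w' (polyHom μ (MvPolynomial.monomial m 1))).1 := by
  refine polyHom_monomial_induction
    (P := fun m f => SupportedFrom (Γ'.mwt w') (Γ.mwt w m) (Γ'.coeffs w' f).1) ?_ ?_ ?_ m
  · rw [show Γ.mwt w 0 = 0 from Finsupp.sum_zero_index]
    exact one_supportedFrom
  · intro m n f g hf hg
    rw [show Γ.mwt w (m + n) = Γ.mwt w m + Γ.mwt w n from monWeight_add _ w m n]
    exact Γ'.mul_supportedFrom w' hf hg
  · intro ℓ
    rw [show Γ.mwt w (Finsupp.single ℓ 1) = Γ.wt w ℓ from monWeight_single _ w ℓ]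
    exact Γ'.linearIncl_supportedFrom w' (hμ _ _ (Nov.single_supportedFrom ℓ))

/-- The continuous homomorphism of completed algebras which is given on loops by a linear map that
does not decrease weights. -/
def completedMap (μ : Nov (Γ.wt w) →ₗ[ℚ] Nov (Γ'.wt w'))
    (hμ : ∀ N x, SupportedFrom (Γ.wt w) N x.1 → SupportedFrom (Γ'.wt w') N (μ x).1) :
    Γ.OHat w →ₗ[ℚ] Γ'.OHat w' :=
  (Γ'.coeffs w').symm.toLinearMap ∘ₗ
    Nov.extend (fun m => Γ'.coeffs w' (polyHom μ (MvPolynomial.monomial m 1)))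
      (polyHom_monomial_supportedFrom hμ) ∘ₗ (Γ.coeffs w).toLinearMap

variable (hμ : ∀ N x, SupportedFrom (Γ.wt w) N x.1 → SupportedFrom (Γ'.wt w') N (μ x).1)

theorem completedMap_supportedFrom {N : ℤ} {f : Γ.OHat w}
    (hf : SupportedFrom (Γ.mwt w) N (Γ.coeffs w f).1) :
    SupportedFrom (Γ'.mwt w') N (Γ'.coeffs w' (completedMap μ hμ f)).1 :=
  Nov.extend_supportedFrom (hc := polyHom_monomial_supportedFrom hμ) hf

theorem completedMap_integral (hi : ∀ x, HasIntegralCoeffs x.1 → HasIntegralCoeffs (μ x).1)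
    {f : Γ.OHat w} (hf : HasIntegralCoeffs (Γ.coeffs w f).1) :
    HasIntegralCoeffs (Γ'.coeffs w' (completedMap μ hμ f)).1 :=
  Nov.extend_integral (hc := polyHom_monomial_supportedFrom hμ) (fun m => polyHom_monomial_induction
    (P := fun _ f => HasIntegralCoeffs (Γ'.coeffs w' f).1) one_integral
    (fun _ _ _ _ => Γ'.mul_integral w')
    (fun ℓ => Γ'.linearIncl_integral w' (hi _ (Nov.single_integral ℓ))) m) hf

theorem isBounded_completedMap : IsBounded Γ w (completedMap μ hμ) :=
  Nov.Bounded.of_filtered fun _ _ hf => Nov.extend_supportedFrom (hc := polyHom_monomial_supportedFrom hμ) hf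

theorem completedMap_ofPoly (p : MvPolynomial Γ.L ℚ) :
    completedMap μ hμ (Γ.ofPoly w p) = polyHom μ p := by
  induction p using MvPolynomial.induction_on' with
  | add p q hp hq => rw [map_add, map_add, map_add, hp, hq]
  | monomial m r =>
    have hr : MvPolynomial.monomial m r = r • MvPolynomial.monomial m (1 : ℚ) := by
      rw [MvPolynomial.smul_monomial, smul_eq_mul, mul_one]
    rw [hr, map_smul, map_smul, map_smul]
    congr 1
    refine (Γ'.coeffs w').injective ?_
    change Nov.extend _ (polyHom_monomial_supportedFrom hμ) (Γ.coeffs w _) = _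
    rw [coeffs_ofPoly_monomial, Nov.extend_single]

theorem completedMap_mul (f g : Γ.OHat w) :
    completedMap μ hμ (f * g) = completedMap μ hμ f * completedMap μ hμ g := by
  have hΦ := isBounded_completedMap hμ
  set Φ := completedMap μ hμ with hΦdef
  have h1 : ∀ p, Φ ∘ₗ LinearMap.mulLeft ℚ (Γ.ofPoly w p) =
      LinearMap.mulLeft ℚ (Φ (Γ.ofPoly w p)) ∘ₗ Φ := fun p =>
    (hΦ.comp (isBounded_mulLeft _)).eq_of_poly ((isBounded_mulLeft _).comp hΦ) fun q => by
      simp only [LinearMap.comp_apply, LinearMap.mulLeft_apply]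
      rw [← map_mul, hΦdef, completedMap_ofPoly, completedMap_ofPoly, completedMap_ofPoly, map_mul]
  have h2 : Φ ∘ₗ LinearMap.mulRight ℚ g = LinearMap.mulRight ℚ (Φ g) ∘ₗ Φ :=
    (hΦ.comp (isBounded_mulRight _)).eq_of_poly ((isBounded_mulRight _).comp hΦ) fun p =>
      LinearMap.congr_fun (h1 p) g
  exact LinearMap.congr_fun h2 f

/-- The map of completed algebras as a homomorphism of algebras. -/
def completedHom : Γ.OHat w →ₐ[ℚ] Γ'.OHat w' :=
  AlgHom.ofLinearMap (completedMap μ hμ)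
    (by rw [← map_one (Γ.ofPoly w), completedMap_ofPoly, map_one]) (completedMap_mul hμ)

theorem completedHom_apply (f : Γ.OHat w) : completedHom hμ f = completedMap μ hμ f := rfl

theorem completedHom_linearIncl (x : Nov (Γ.wt w)) :
    completedHom hμ (Γ.linearIncl w x) = Γ'.linearIncl w' (μ x) := by
  have h : (Γ'.coeffs w').toLinearMap ∘ₗ completedMap μ hμ ∘ₗ Γ.linearIncl w =
      ((Γ'.coeffs w').toLinearMap ∘ₗ Γ'.linearIncl w') ∘ₗ μ :=
    Nov.Bounded.ext (.of_filtered fun N x hx => completedMap_supportedFrom hμ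
        (Γ.linearIncl_supportedFrom w hx))
      (.of_filtered fun N x hx => Γ'.linearIncl_supportedFrom w' (hμ N x hx)) fun ℓ => by
      change Γ'.coeffs w' (completedMap μ hμ (Γ.linearIncl w (Nov.single _ ℓ))) =
        Γ'.coeffs w' (Γ'.linearIncl w' (μ (Nov.single _ ℓ)))
      rw [linearIncl_single, completedMap_ofPoly, polyHom, MvPolynomial.aeval_X]
  exact (Γ'.coeffs w').injective (LinearMap.congr_fun h x)

theorem completedHom_comp {ν : Nov (Γ'.wt w') →ₗ[ℚ] Nov (Γ.wt w)}
    (hν : ∀ N x, SupportedFrom (Γ'.wt w') N x.1 → SupportedFrom (Γ.wt w) N (ν x).1)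
    (h : ν ∘ₗ μ = LinearMap.id) : (completedHom hν).comp (completedHom hμ) = AlgHom.id ℚ _ := by
  have hpoly : ((completedHom hν).comp (completedHom hμ)).comp (Γ.ofPoly w) = Γ.ofPoly w := by
    refine MvPolynomial.algHom_ext fun ℓ => ?_
    rw [AlgHom.comp_apply, AlgHom.comp_apply, ← linearIncl_single, completedHom_linearIncl,
      completedHom_linearIncl]
    exact congrArg _ (LinearMap.congr_fun h _)
  have := ((isBounded_completedMap hν).comp (isBounded_completedMap hμ)).eq_of_poly .id
    fun p => DFunLike.congr_fun hpoly p
  exact AlgHom.ext fun f => LinearMap.congr_fun this f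

/-- A map of formal sums of loops that respects the brackets induces a homomorphism of Poisson algebras: by the
Leibniz rule it is enough to check this on loops, and by density on polynomials. -/
theorem completedHom_poisson [Finite E] [Finite E']
    (h : ∀ x y, μ (Γ.hatBilin w x y) = Γ'.hatBilin w' (μ x) (μ y)) (f g : Γ.OHat w) :
    completedHom hμ (Γ.poissonMap w f g) =
      Γ'.poissonMap w' (completedHom hμ f) (completedHom hμ g) := by
  have hΦ := isBounded_completedMap hμ
  set Φ := completedMap μ hμ with hΦdef
  -- Constants are central, by the Leibniz rule for `1 = 1 * 1`.
  have hC : ∀ r : ℚ, ∀ f : Γ'.OHat w', Γ'.poissonMap w' f (algebraMap ℚ _ r) = 0 := by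
    intro r f
    have h1 := poissonMap_leibniz f (1 : Γ'.OHat w') 1
    rw [mul_one, mul_one, one_mul, left_eq_add] at h1
    rw [Algebra.algebraMap_eq_smul_one, map_smul, h1, smul_zero]
  have hX : ∀ f a, (∀ b, Φ (Γ.poissonMap w (Γ.ofPoly w f) (Γ.ofPoly w (MvPolynomial.X b))) =
      Γ'.poissonMap w' (Φ (Γ.ofPoly w f)) (Φ (Γ.ofPoly w (MvPolynomial.X b)))) →
      Φ (Γ.poissonMap w (Γ.ofPoly w f) (Γ.ofPoly w a)) =
        Γ'.poissonMap w' (Φ (Γ.ofPoly w f)) (Φ (Γ.ofPoly w a)) := by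
    intro f a hb
    induction a using MvPolynomial.induction_on with
    | C r =>
      have : Φ (Γ.ofPoly w (MvPolynomial.C r)) = algebraMap ℚ _ r := by
        rw [hΦdef, completedMap_ofPoly]
        exact AlgHom.commutes _ r
      rw [poissonMap_ofPoly, polyBracket_C_right, map_zero, map_zero, this, hC]
    | add p q hp hq => simp only [map_add, hp, hq]
    | mul_X p b hp =>
      rw [map_mul, poissonMap_leibniz, map_add, hΦdef, completedMap_mul, completedMap_mul,
        completedMap_mul, poissonMap_leibniz, ← hΦdef, hp, hb]
  have hXX : ∀ a b, Φ (Γ.poissonMap w (Γ.ofPoly w (MvPolynomial.X a))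
      (Γ.ofPoly w (MvPolynomial.X b))) = Γ'.poissonMap w' (Φ (Γ.ofPoly w (MvPolynomial.X a)))
        (Φ (Γ.ofPoly w (MvPolynomial.X b))) := by
    intro a b
    have hl := completedHom_linearIncl hμ
    simp only [completedHom_apply] at hl
    rw [← linearIncl_single, ← linearIncl_single, poissonMap_linearIncl, hΦdef, hl, hl, hl, h,
      poissonMap_linearIncl]
  have hpoly : ∀ p q, Φ (Γ.poissonMap w (Γ.ofPoly w p) (Γ.ofPoly w q)) =
      Γ'.poissonMap w' (Φ (Γ.ofPoly w p)) (Φ (Γ.ofPoly w q)) := by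
    intro p q
    refine hX p q fun b => ?_
    rw [← neg_inj, ← map_neg, ← poissonMap_skew, ← poissonMap_skew]
    exact hX _ p fun a => hXX b a
  have h1 : ∀ p, Φ ∘ₗ Γ.poissonMap w (Γ.ofPoly w p) =
      Γ'.poissonMap w' (Φ (Γ.ofPoly w p)) ∘ₗ Φ := fun p =>
    (hΦ.comp (isBounded_poisson_left _)).eq_of_poly ((isBounded_poisson_left _).comp hΦ) (hpoly p)
  have h2 : Φ ∘ₗ (Γ.poissonMap w).flip g = (Γ'.poissonMap w').flip (Φ g) ∘ₗ Φ :=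
    (hΦ.comp (isBounded_poisson_right _)).eq_of_poly ((isBounded_poisson_right _).comp hΦ)
      fun p => LinearMap.congr_fun (h1 p) g
  exact LinearMap.congr_fun h2 f

end BipartiteRibbonGraph

theorem mainTheorem9 {W B B' E E' R : Type*} [Finite E] [Finite E']
    (Γ : BipartiteRibbonGraph W B E) (Γ' : BipartiteRibbonGraph W B' E')
    (m : TwoByTwoMove R Γ Γ') (w : E → ℤ) (w' : E' → ℤ)
    (hw : 0 < m.squareWeight w) (hww' : m.Compatible w w') :
    IsLieBracket (Γ.hatBracket w) ∧ IsLieBracket (Γ'.hatBracket w') ∧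
    IsPoissonBracket (Γ.poisson w) ∧ IsPoissonBracket (Γ'.poisson w') ∧
    (∀ x y : Γ.LHat w, HasIntegralCoeffs x.1 → HasIntegralCoeffs y.1 → HasIntegralCoeffs (Γ.hatBracket w x y).1) ∧
    (∀ x y : Γ'.LHat w', HasIntegralCoeffs x.1 → HasIntegralCoeffs y.1 →
      HasIntegralCoeffs (Γ'.hatBracket w' x y).1) ∧
    ∃ μ : Γ.LHat w ≃ₗ[ℚ] Γ'.LHat w',
      (∀ γ' : Γ'.toBipartiteGraph.ClosedWalk,
        (μ.symm (Γ'.ofLoop w' γ'.toLoop)).1 = m.pull γ'.1) ∧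
      (∀ N x, SupportedFrom (Γ.wt w) N x.1 ↔ SupportedFrom (Γ'.wt w') N (μ x).1) ∧
      (∀ x, HasIntegralCoeffs x.1 ↔ HasIntegralCoeffs (μ x).1) ∧
      (∀ x y, μ (Γ.hatBracket w x y) = Γ'.hatBracket w' (μ x) (μ y)) ∧
      ∃ Φ : Γ.OHat w ≃ₐ[ℚ] Γ'.OHat w',
        (∀ x, Φ (Γ.linearPart w x) = Γ'.linearPart w' (μ x)) ∧
        (∀ N f, SupportedFrom (Γ.mwt w) N (fun k => MvPowerSeries.coeff k f.1) ↔
          SupportedFrom (Γ'.mwt w') N (fun k => MvPowerSeries.coeff k (Φ f).1)) ∧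
        (∀ f, HasIntegralCoeffs (fun k => MvPowerSeries.coeff k f.1) ↔
          HasIntegralCoeffs (fun k => MvPowerSeries.coeff k (Φ f).1)) ∧
        (∀ f g, Φ (Γ.poisson w f g) = Γ'.poisson w' (Φ f) (Φ g)) := by
  refine ⟨Γ.isLieBracket_hatBracket w, Γ'.isLieBracket_hatBracket w', Γ.isPoissonBracket_poisson w,
    Γ'.isPoissonBracket_poisson w', fun _ _ => Γ.hatBracket_integral w,
    fun _ _ => Γ'.hatBracket_integral w', ?_⟩
  set ν : Nov (Γ'.wt w') ≃ₗ[ℚ] Nov (Γ.wt w) := m.pullEquiv hw hww'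
  have hs : ∀ N x, SupportedFrom (Γ.wt w) N x.1 ↔ SupportedFrom (Γ'.wt w') N (ν.symm x).1 := by
    intro N x
    rw [← m.pullEquiv_supportedFrom hw hww']
    change _ ↔ SupportedFrom _ N (ν (ν.symm x)).1
    rw [ν.apply_symm_apply]
  have hi : ∀ x, HasIntegralCoeffs x.1 ↔ HasIntegralCoeffs (ν.symm x).1 := by
    intro x
    rw [← m.pullEquiv_integral hw hww']
    change _ ↔ HasIntegralCoeffs (ν (ν.symm x)).1
    rw [ν.apply_symm_apply]
  have hb : ∀ x y, ν.symm (Γ.hatBilin w x y) = Γ'.hatBilin w' (ν.symm x) (ν.symm y) := by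
    intro x y
    rw [LinearEquiv.symm_apply_eq]
    refine Eq.trans ?_ (m.pullEquiv_hatBilin hw hww' _ _).symm
    change _ = Γ.hatBilin w (ν (ν.symm x)) (ν (ν.symm y))
    rw [ν.apply_symm_apply, ν.apply_symm_apply]
  have hμ : ∀ N x, SupportedFrom (Γ.wt w) N x.1 →
      SupportedFrom (Γ'.wt w') N (ν.symm.toLinearMap x).1 := fun N x => (hs N x).1
  have hν : ∀ N x, SupportedFrom (Γ'.wt w') N x.1 → SupportedFrom (Γ.wt w) N (ν.toLinearMap x).1 :=
    fun N x => (m.pullEquiv_supportedFrom hw hww' N x).2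
  set Φ : Γ.OHat w ≃ₐ[ℚ] Γ'.OHat w' := AlgEquiv.ofAlgHom
    (BipartiteRibbonGraph.completedHom hμ) (BipartiteRibbonGraph.completedHom hν)
    (BipartiteRibbonGraph.completedHom_comp hν hμ (LinearMap.ext ν.symm_apply_apply))
    (BipartiteRibbonGraph.completedHom_comp hμ hν (LinearMap.ext ν.apply_symm_apply)) with hΦ
  refine ⟨ν.symm, m.pullEquiv_single hw hww', hs, hi, hb, Φ,
    BipartiteRibbonGraph.completedHom_linearIncl hμ, fun N f => ⟨fun hf => ?_, fun hf => ?_⟩,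
    fun f => ⟨fun hf => ?_, fun hf => ?_⟩, BipartiteRibbonGraph.completedHom_poisson hμ hb⟩
  · exact BipartiteRibbonGraph.completedMap_supportedFrom hμ (f := f) hf
  · have := BipartiteRibbonGraph.completedMap_supportedFrom hν (f := Φ f) hf
    rwa [show BipartiteRibbonGraph.completedMap ν.toLinearMap hν (Φ f) = f from
      Φ.symm_apply_apply f] at this
  · exact BipartiteRibbonGraph.completedMap_integral hμ (fun x => (hi x).1) (f := f) hf
  · have := BipartiteRibbonGraph.completedMap_integral hν
      (fun x => (m.pullEquiv_integral hw hww' x).2) (f := Φ f) hf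
    rwa [show BipartiteRibbonGraph.completedMap ν.toLinearMap hν (Φ f) = f from
      Φ.symm_apply_apply f] at this

end
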